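/- Let $p$ be a prime, $k$ a finite field of characteristic $p$ with $f=[k:\mathbb F_p]$, $\mathcal O_L=W(k)$, and let $\mathbb F$ be a finite field of characteristic $p$ into which $k$ embeds; put $\mathcal O=W(\mathbb F)$ and let $\mathcal J=\mathrm{Hom}(k,\mathbb F)$ (a set with $f$ elements; we also write $\tau:\mathcal O_L\to\mathcal O$ for the lift of $\tau\in\mathcal J$). Let $K=\mathrm{GL}_2(\mathcal O_L)$, $K_1=1+p\,\mathrm M_2(\mathcal O_L)$, $Z_1=Z(K)\cap K_1$, and let $\mathfrak m_{K_1}$ be the augmentation ideal of the completed group algebra $\mathbb F[[K_1]]$. Let $\lambda=(\lambda_{\tau,1},\lambda_{\tau,2})_\tau\in(\mathbb Z^2)^{\mathcal J}$ be $2$-deep in the lowest alcove, i.e. $2<\lambda_{\tau,1}-\lambda_{\tau,2}+1<p-2$ for all $\tau\in\mathcal J$, and let $\sigma=F(\lambda)=\bigotimes_{\tau}\big(\mathrm{Sym}^{\lambda_{\tau,1}-\lambda_{\tau,2}}(\mathbb F^2)\otimes\det^{\lambda_{\tau,2}}\big)^{(\tau)}$, where $(\tau)$ means that $\mathrm{GL}_2(k)$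 acts through $\tau$. Let $\widetilde P_\sigma$ be a finitely generated projective $\mathcal O[\mathrm{GL}_2(k)]$-module such that $P_\sigma=\widetilde P_\sigma/p$ is a projective cover of $\sigma$ over $\mathbb F[\mathrm{GL}_2(k)]$; it is viewed as a $K$-representation by inflation. For $\tau\in\mathcal J$ let $R_{2,\tau}=\mathfrak{sl}_{2,\mathcal O_L}\otimes_{\mathcal O_L,\tau}\widetilde P_\sigma$, where $K$ acts on $\mathfrak{sl}_{2,\mathcal O_L}$ by the adjoint action; thus $\bigoplus_\tau R_{2,\tau}=\mathfrak{sl}_{2,\mathcal O_L}\otimes_{\mathbb Z_p}\widetilde P_\sigma$. There exist $K$-equivariant $\mathbb F$-linear injections $\iota_\tau:P_\sigma\hookrightarrow R_{2,\tau}/pR_{2,\tau}$ $(\tau\in\mathcal J)$. For every choice of such injections, the $K$-stable lattice $$R=\Big\{(x,(x_\tau)_\tau)\in\widetilde P_\sigma\oplus\bigoplus_{\tau\in\mathcal J}R_{2,\tau}\ :\ (x_\tau \bmod p)=\iota_\tau(x\bmod p)\ \text{ for all }\tau\Big\}$$ in $\widetilde P_\sigma[1/p]\oplus\bigoplus_\tau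 R_{2,\tau}[1/p]$ has the following properties: 1. the $K$-cosocle (largest semisimple quotient) of $R/pR$ is isomorphic to $\sigma$; 2. there is an isomorphism of $K$-representations over $\mathbb F$ $$R/pR\;\cong\;(\mathrm{Proj}_{K/Z_1}\sigma)/\mathfrak m_{K_1}^2(\mathrm{Proj}_{K/Z_1}\sigma),$$ where $\mathrm{Proj}_{K/Z_1}\sigma$ is the algebraic dual of an injective envelope of $\sigma^\vee$ in the category of smooth representations of $K/Z_1$ over $\mathbb F$. -/

import Mathlib

open scoped TensorProduct

universe u

namespace LatticeGL2

noncomputable section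

/-! ### General representation theory -/

section General

/-- The scalar extension `A ⊗_O V` of a representation on an `O`-module `V`. -/
def baseChangeRep {O : Type*} (A : Type*) {G V : Type*} [CommSemiring O] [CommSemiring A]
    [Algebra O A] [Monoid G] [AddCommMonoid V] [Module O V] (ρ : Representation O G V) :
    Representation A G (A ⊗[O] V) :=
  ((Module.End.baseChangeHom O A V : Module.End O V →ₐ[O] Module.End A (A ⊗[O] V)) :
    Module.End O V →* Module.End A (A ⊗[O] V)).comp ρ

/-- The direct sum of a finite family of representations, realised on the product. -/
def piRep {O G ι : Type*} [CommSemiring O] [Monoid G] {V : ι → Type*}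
    [∀ i, AddCommMonoid (V i)] [∀ i, Module O (V i)] (ρ : ∀ i, Representation O G (V i)) :
    Representation O G (∀ i, V i) where
  toFun g := LinearMap.pi fun i => (ρ i g).comp (LinearMap.proj i)
  map_one' := by ext; simp
  map_mul' g h := by ext; simp

/-- `π : ρ → τ` exhibits `ρ` as a projective cover of `τ` among `F[G]`-modules: `ρ` is projective
and `π` is surjective with superfluous kernel. -/
structure IsProjectiveCover {F G V W : Type*} [Field F] [Monoid G] [AddCommMonoid V] [Module F V]
    [AddCommMonoid W] [Module F W] {ρ : Representation F G V} {τ : Representation F G W}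
    (π : Representation.IntertwiningMap ρ τ) : Prop where
  projective : Module.Projective (MonoidAlgebra F G) ρ.asModule
  surjective : Function.Surjective π
  superfluous : ∀ N : Subrepresentation ρ, N ⊔ π.ker = ⊤ → N = ⊤

/-- The radical of a representation: the intersection of its maximal subrepresentations. -/
abbrev radical {F G V : Type*} [Field F] [Group G] [AddCommGroup V] [Module F V]
    (ρ : Representation F G V) : Submodule (MonoidAlgebra F G) ρ.asModule :=
  Module.jacobson (MonoidAlgebra F G) ρ.asModule

/-- The cosocle of a representation of finite length (its largest semisimple quotient),
as a module over the group algebra. -/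
abbrev Cosocle {F G V : Type*} [Field F] [Group G] [AddCommGroup V] [Module F V]
    (ρ : Representation F G V) : Type _ :=
  ρ.asModule ⧸ radical ρ

end General

/-! ### Smooth representations and completed group algebras

The topology of a profinite group `G` is given by a decreasing sequence `U` of normal subgroups
which form a basis of open neighbourhoods of `1`. -/

section Smooth

variable {F G : Type*} [Field F] [Group G]

/-- Every vector is fixed by an open subgroup. -/
def IsSmooth (U : ℕ → Subgroup G) {V : Type*} [AddCommGroup V] [Module F V]
    (ρ : Representation F G V) : Prop :=
  ∀ v : V, ∃ n : ℕ, ∀ g ∈ U n, ρ g v = v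

/-- The representation factors through `G ⧸ Z`. -/
def IsTrivialOn (Z : Subgroup G) {V : Type*} [AddCommGroup V] [Module F V]
    (ρ : Representation F G V) : Prop :=
  ∀ g ∈ Z, ∀ v : V, ρ g v = v

/-- `i : τ → ρ` exhibits `ρ` as an injective envelope of `τ` in the category of smooth
`F`-representations of `G ⧸ Z`. -/
structure IsInjectiveEnvelope {F : Type u} [Field F] (U : ℕ → Subgroup G) (Z : Subgroup G)
    {J : Type u} {W : Type*} [AddCommGroup J] [Module F J] [AddCommGroup W] [Module F W]
    {τ : Representation F G W} {ρ : Representation F G J}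
    (i : Representation.IntertwiningMap τ ρ) : Prop where
  smooth : IsSmooth U ρ
  trivialOn : IsTrivialOn Z ρ
  extend : ∀ {A B : Type u} [AddCommGroup A] [Module F A] [AddCommGroup B] [Module F B]
    (ρA : Representation F G A) (ρB : Representation F G B),
    IsSmooth U ρA → IsTrivialOn Z ρA → IsSmooth U ρB → IsTrivialOn Z ρB →
    ∀ (f : Representation.IntertwiningMap ρA ρB) (g : Representation.IntertwiningMap ρA ρ),
      Function.Injective f → ∃ h : Representation.IntertwiningMap ρB ρ, ∀ a : A, h (f a) = g a
  injective : Function.Injective i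
  essential : ∀ N : Subrepresentation ρ, N ⊓ i.range = ⊥ → N = ⊥

variable (F) in
/-- The completed group algebra `F[[G]] = lim_n F[G ⧸ U n]`. -/
def completedGroupAlgebra (U : ℕ → Subgroup G) [∀ n, (U n).Normal] :
    Subalgebra F (∀ n, MonoidAlgebra F (G ⧸ U n)) where
  carrier := {ξ | ∀ (m n : ℕ) (h : U n ≤ (U m).comap (MonoidHom.id G)),
    MonoidAlgebra.mapDomainAlgHom F F (QuotientGroup.map (U n) (U m) (MonoidHom.id G) h) (ξ n)
      = ξ m}
  mul_mem' ha hb m n h := by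
    simp only [Pi.mul_apply, map_mul]
    rw [ha m n h, hb m n h]
  add_mem' ha hb m n h := by
    simp only [Pi.add_apply, map_add]
    rw [ha m n h, hb m n h]
  algebraMap_mem' r m n h := by
    simp only [Pi.algebraMap_apply, AlgHom.commutes]

/-- The augmentation `F[[G]] → F`. -/
def augmentation (U : ℕ → Subgroup G) [∀ n, (U n).Normal] :
    completedGroupAlgebra F U →ₐ[F] F :=
  (MonoidAlgebra.lift F F (G ⧸ U 0) 1).comp
    ((Pi.evalAlgHom F (fun n => MonoidAlgebra F (G ⧸ U n)) 0).comp
      (completedGroupAlgebra F U).val)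

/-- The augmentation ideal `𝔪_G` of `F[[G]]`. -/
def augmentationIdeal (U : ℕ → Subgroup G) [∀ n, (U n).Normal] :
    Ideal (completedGroupAlgebra F U) :=
  RingHom.ker (augmentation (F := F) U)

end Smooth

/-! ### The action of `F[[H]]` on the dual of a smooth representation of `G ⊇ H` -/

section DualAction

variable {F G J : Type*} [Field F] [Group G] [AddCommGroup J] [Module F J]

/-- The induced sequence of open normal subgroups of a subgroup `H`. -/
abbrev levels (U : ℕ → Subgroup G) (H : Subgroup G) (n : ℕ) : Subgroup H := (U n).subgroupOf H

variable {U : ℕ → Subgroup G} [∀ n, (U n).Normal] {H : Subgroup G}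
  {ρ : Representation F G J}

/-- For `v` fixed by `U n`, the value at `v` of `ξ • φ`, where `ξ = ∑ a_x [x]` modulo `U n` and
`[x] • φ = φ ∘ ρ x⁻¹`. -/
def levelSum (ρ : Representation F G J) (n : ℕ) (ξ : MonoidAlgebra F (H ⧸ levels U H n))
    (φ : Module.Dual F J) (v : J) : F :=
  ξ.coeff.sum fun x a => a * φ (ρ ((Quotient.out x : H) : G)⁻¹ v)

theorem out_apply {n : ℕ} {v : J} (hv : ∀ g ∈ U n, ρ g v = v) (h : H) :
    ρ ((Quotient.out (h : H ⧸ levels U H n) : H) : G)⁻¹ v = ρ (h : G)⁻¹ v := by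
  obtain ⟨u, hu⟩ := QuotientGroup.mk_out_eq_mul (levels U H n) h
  rw [hu]
  have h1 : ((u : H) : G)⁻¹ ∈ U n := (U n).inv_mem u.2
  have h2 : (h : G) * (((u : H) : G)⁻¹) * (h : G)⁻¹ ∈ U n :=
    Subgroup.Normal.conj_mem inferInstance _ h1 _
  have h3 : ((h * (u : H) : H) : G)⁻¹
      = (h : G)⁻¹ * ((h : G) * (((u : H) : G)⁻¹) * (h : G)⁻¹) := by
    push_cast; group
  rw [h3, map_mul, Module.End.mul_apply, hv _ h2]

theorem levelSum_mapDomain {m n : ℕ} (hmn : U n ≤ U m) (ξ : completedGroupAlgebra F (levels U H))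
    (φ : Module.Dual F J) {v : J} (hm : ∀ g ∈ U m, ρ g v = v) :
    levelSum ρ m (ξ.1 m) φ v = levelSum ρ n (ξ.1 n) φ v := by
  have hle : levels U H n ≤ (levels U H m).comap (MonoidHom.id H) := fun x hx => hmn hx
  rw [← ξ.2 m n hle]
  unfold levelSum
  simp only [MonoidAlgebra.mapDomainAlgHom_apply, MonoidAlgebra.mapDomain]
  rw [Finsupp.sum_mapDomain_index (by simp) (by intros; ring)]
  refine Finsupp.sum_congr fun x _ => ?_
  obtain ⟨h, rfl⟩ := QuotientGroup.mk_surjective x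
  simp only [QuotientGroup.map_mk, MonoidHom.id_apply]
  rw [out_apply hm, out_apply fun g hg => hm g (hmn hg)]

/-- `ξ • φ` for `ξ ∈ F[[H]]` and `φ` in the algebraic dual of a smooth representation. -/
def dualActionFun (hρ : IsSmooth U ρ) (ξ : completedGroupAlgebra F (levels U H))
    (φ : Module.Dual F J) (v : J) : F :=
  levelSum ρ (hρ v).choose (ξ.1 (hρ v).choose) φ v

theorem dualActionFun_eq (hU : Antitone U) (hρ : IsSmooth U ρ)
    (ξ : completedGroupAlgebra F (levels U H)) (φ : Module.Dual F J) {v : J} {n : ℕ}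
    (hv : ∀ g ∈ U n, ρ g v = v) : dualActionFun hρ ξ φ v = levelSum ρ n (ξ.1 n) φ v := by
  have hc := (hρ v).choose_spec
  rcases le_total (hρ v).choose n with h | h
  · exact levelSum_mapDomain (hU h) ξ φ hc
  · exact (levelSum_mapDomain (hU h) ξ φ hv).symm

/-- `ξ • φ` for `ξ ∈ F[[H]]` and `φ` in the algebraic dual of a smooth representation, as a
linear form. -/
def dualAction (hU : Antitone U) (hρ : IsSmooth U ρ) (ξ : completedGroupAlgebra F (levels U H))
    (φ : Module.Dual F J) : Module.Dual F J where
  toFun := dualActionFun hρ ξ φ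
  map_add' v w := by
    obtain ⟨m, hm⟩ := hρ v
    obtain ⟨n, hn⟩ := hρ w
    have hm' : ∀ g ∈ U (max m n), ρ g v = v := fun g hg => hm g (hU (le_max_left m n) hg)
    have hn' : ∀ g ∈ U (max m n), ρ g w = w := fun g hg => hn g (hU (le_max_right m n) hg)
    rw [dualActionFun_eq hU hρ ξ φ hm', dualActionFun_eq hU hρ ξ φ hn',
      dualActionFun_eq hU hρ ξ φ (n := max m n)
        (fun g hg => by rw [map_add, hm' g hg, hn' g hg])]
    simp only [levelSum, map_add, mul_add]
    exact Finsupp.sum_add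
  map_smul' c v := by
    obtain ⟨m, hm⟩ := hρ v
    rw [dualActionFun_eq hU hρ ξ φ hm,
      dualActionFun_eq hU hρ ξ φ (n := m) (fun g hg => by rw [map_smul, hm g hg])]
    simp only [levelSum, map_smul, smul_eq_mul, RingHom.id_apply, Finsupp.sum, Finset.mul_sum]
    exact Finset.sum_congr rfl fun x _ => by ring

/-- `𝔪_H · N`, for a subspace `N` of the dual of a smooth representation of `G`, where `𝔪_H` is
the augmentation ideal of `F[[H]]`. -/
def augmentationMul (hU : Antitone U) (H : Subgroup G) (hρ : IsSmooth U ρ)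
    (N : Submodule F (Module.Dual F J)) : Submodule F (Module.Dual F J) :=
  Submodule.span F {ψ | ∃ ξ ∈ augmentationIdeal (F := F) (levels U H), ∃ φ ∈ N,
    ψ = dualAction hU hρ ξ φ}

/-- Conjugation by `g` on `H ⧸ (U n ∩ H)` for a normal subgroup `H`. -/
def conjQuot (U : ℕ → Subgroup G) [∀ n, (U n).Normal] (H : Subgroup G) [H.Normal] (g : G)
    (n : ℕ) : H ⧸ levels U H n →* H ⧸ levels U H n :=
  QuotientGroup.map _ _ (MulAut.conjNormal g : H ≃* H).toMonoidHom (by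
    intro x hx
    change ((MulAut.conjNormal g x : H) : G) ∈ U n
    rw [MulAut.conjNormal_apply]
    exact (inferInstance : (U n).Normal).conj_mem (x : G) hx g)

/-- Conjugation by `g` on `F[[H]]` for a normal subgroup `H`. -/
def conjCompleted [H.Normal] (g : G) (ξ : completedGroupAlgebra F (levels U H)) :
    completedGroupAlgebra F (levels U H) :=
  ⟨fun n => MonoidAlgebra.mapDomainAlgHom F F (conjQuot U H g n) (ξ.1 n), by
    intro m n h
    change MonoidAlgebra.mapDomainAlgHom F F _ (MonoidAlgebra.mapDomainAlgHom F F
      (conjQuot U H g n) (ξ.1 n)) = MonoidAlgebra.mapDomainAlgHom F F (conjQuot U H g m) (ξ.1 m)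
    rw [← ξ.2 m n h, ← AlgHom.comp_apply, ← AlgHom.comp_apply,
      ← MonoidAlgebra.mapDomainAlgHom_comp, ← MonoidAlgebra.mapDomainAlgHom_comp]
    congr 2
    ext x
    rfl⟩

theorem conjCompleted_mem [H.Normal] (g : G) {ξ : completedGroupAlgebra F (levels U H)}
    (hξ : ξ ∈ augmentationIdeal (F := F) (levels U H)) :
    conjCompleted g ξ ∈ augmentationIdeal (F := F) (levels U H) := by
  have key : (MonoidAlgebra.lift F F (H ⧸ levels U H 0) 1).comp
      (MonoidAlgebra.mapDomainAlgHom F F (conjQuot U H g 0))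
      = MonoidAlgebra.lift F F (H ⧸ levels U H 0) 1 := by
    ext x; simp
  change (MonoidAlgebra.lift F F (H ⧸ levels U H 0) 1)
    (MonoidAlgebra.mapDomainAlgHom F F (conjQuot U H g 0) (ξ.1 0)) = 0
  rw [← AlgHom.comp_apply, key]
  exact hξ

theorem dual_dualAction [H.Normal] (hU : Antitone U) (hρ : IsSmooth U ρ) (g : G)
    (ξ : completedGroupAlgebra F (levels U H)) (φ : Module.Dual F J) :
    ρ.dual g (dualAction hU hρ ξ φ) = dualAction hU hρ (conjCompleted g ξ) (ρ.dual g φ) := by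
  ext v
  obtain ⟨n, hn⟩ := hρ v
  have hn' : ∀ u ∈ U n, ρ u (ρ g⁻¹ v) = ρ g⁻¹ v := by
    intro u hu
    have h2 : g * u * g⁻¹ ∈ U n := Subgroup.Normal.conj_mem inferInstance _ hu _
    have h3 : u * g⁻¹ = g⁻¹ * (g * u * g⁻¹) := by group
    rw [← Module.End.mul_apply, ← map_mul, h3, map_mul, Module.End.mul_apply, hn _ h2]
  change dualActionFun hρ ξ φ (ρ g⁻¹ v) = dualActionFun hρ (conjCompleted g ξ) (ρ.dual g φ) v
  rw [dualActionFun_eq hU hρ _ _ hn', dualActionFun_eq hU hρ _ _ hn]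
  unfold levelSum conjCompleted
  simp only [MonoidAlgebra.mapDomainAlgHom_apply, MonoidAlgebra.mapDomain]
  rw [Finsupp.sum_mapDomain_index (by simp) (by intros; ring)]
  refine Finsupp.sum_congr fun x _ => ?_
  obtain ⟨h, rfl⟩ := QuotientGroup.mk_surjective x
  have hc : conjQuot U H g n (h : H ⧸ levels U H n)
      = ((MulAut.conjNormal g h : H) : H ⧸ levels U H n) := rfl
  rw [hc, out_apply hn', out_apply hn]
  change _ = _ * φ (ρ g⁻¹ (ρ _ v))
  rw [MulAut.conjNormal_apply, ← Module.End.mul_apply, ← Module.End.mul_apply, ← map_mul,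
    ← map_mul]
  congr 4
  group

theorem augmentationMul_stable [H.Normal] (hU : Antitone U) (hρ : IsSmooth U ρ)
    {N : Submodule F (Module.Dual F J)} (hN : ∀ g, N ≤ N.comap (ρ.dual g)) (g : G) :
    augmentationMul hU H hρ N ≤ (augmentationMul hU H hρ N).comap (ρ.dual g) := by
  refine Submodule.span_le.2 ?_
  rintro _ ⟨ξ, hξ, φ, hφ, rfl⟩
  refine Submodule.subset_span ⟨conjCompleted g ξ, conjCompleted_mem g hξ, ρ.dual g φ, hN g hφ, ?_⟩
  exact dual_dualAction hU hρ g ξ φ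

/-- The representation `J^∨ ⧸ 𝔪_H² J^∨` of `G`, where `J^∨` is the algebraic dual of the smooth
representation `J`. -/
def dualModSq (hU : Antitone U) (H : Subgroup G) [H.Normal] (hρ : IsSmooth U ρ) :
    Representation F G
      (Module.Dual F J ⧸ augmentationMul hU H hρ (augmentationMul hU H hρ ⊤)) :=
  ρ.dual.quotient _ (augmentationMul_stable hU hρ
    (augmentationMul_stable hU hρ fun _ _ _ => Submodule.mem_top))

end DualAction

/-! ### The group `K = GL₂(𝒪_L)`, with `𝒪_L = W(k)` -/

section Group

variable (p : ℕ) [Fact p.Prime] (k : Type*) [Field k]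

/-- `K = GL₂(𝒪_L)`, where `𝒪_L = W(k)` is the ring of integers of the unramified extension `L` of
`ℚ_p` with residue field `k`. -/
abbrev K : Type _ := GL (Fin 2) (WittVector p k)

/-- The congruence subgroup `K_n = 1 + pⁿ M₂(𝒪_L)` (and `K_0 = K`); these form a basis of open
neighbourhoods of `1`. -/
def congruenceSubgroup (n : ℕ) : Subgroup (K p k) :=
  (Matrix.GeneralLinearGroup.map
    (Ideal.Quotient.mk (Ideal.span {(p : WittVector p k) ^ n}))).ker

instance (n : ℕ) : (congruenceSubgroup p k n).Normal := MonoidHom.normal_ker _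

theorem congruenceSubgroup_antitone : Antitone (congruenceSubgroup p k) := by
  intro m n hmn g hg
  have hle : Ideal.span {(p : WittVector p k) ^ n} ≤ Ideal.span {(p : WittVector p k) ^ m} :=
    Ideal.span_singleton_le_span_singleton.2 (pow_dvd_pow _ hmn)
  have h2 := congrArg (Matrix.GeneralLinearGroup.map (n := Fin 2) (Ideal.Quotient.factor hle))
    (MonoidHom.mem_ker.1 hg)
  rw [map_one, ← MonoidHom.comp_apply, ← Matrix.GeneralLinearGroup.map_comp,
    Ideal.Quotient.factor_comp_mk] at h2
  exact MonoidHom.mem_ker.2 h2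

/-- `Z_1`, the intersection of the centre of `K` with `K_1`. -/
def Z₁ : Subgroup (K p k) := Subgroup.center (K p k) ⊓ congruenceSubgroup p k 1

/-- The reduction map `K → GL₂(k)`. -/
def reduction : K p k →* GL (Fin 2) k :=
  Matrix.GeneralLinearGroup.map (WittVector.constantCoeff (p := p) (R := k))

end Group

/-! ### Serre weights -/

section SerreWeight

variable {k F : Type*} [Field k] [Field F]

/-- The substitution `X_j ↦ ∑_i g_{ij} X_i` on polynomials in two variables. -/
def substitution (g : Matrix (Fin 2) (Fin 2) F) :
    MvPolynomial (Fin 2) F →ₐ[F] MvPolynomial (Fin 2) F :=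
  MvPolynomial.aeval fun j => ∑ i, MvPolynomial.C (g i j) * MvPolynomial.X i

/-- `Sym^r(F²)`, realised on homogeneous polynomials of degree `r`. -/
abbrev SymPow (F : Type*) [Field F] (r : ℕ) : Type _ :=
  MvPolynomial.homogeneousSubmodule (Fin 2) F r

theorem substitution_mem (g : Matrix (Fin 2) (Fin 2) F) {r : ℕ} {P : MvPolynomial (Fin 2) F}
    (hP : P ∈ MvPolynomial.homogeneousSubmodule (Fin 2) F r) :
    substitution g P ∈ MvPolynomial.homogeneousSubmodule (Fin 2) F r := by
  rw [MvPolynomial.mem_homogeneousSubmodule] at hP ⊢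
  have := hP.aeval (n := 1) (fun j => ∑ i, MvPolynomial.C (g i j) * MvPolynomial.X (R := F) i)
    (fun j => MvPolynomial.IsHomogeneous.sum _ _ _ fun i _ => by
      simpa using (MvPolynomial.isHomogeneous_C (Fin 2) (g i j)).mul
        (MvPolynomial.isHomogeneous_X F i))
  simpa [substitution] using this

theorem substitution_one : substitution (1 : Matrix (Fin 2) (Fin 2) F) = AlgHom.id F _ := by
  ext j : 1
  fin_cases j <;> simp [substitution]

theorem substitution_mul (g h : Matrix (Fin 2) (Fin 2) F) :
    substitution (g * h) = (substitution g).comp (substitution h) := by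
  ext j : 1
  simp only [substitution, MvPolynomial.aeval_X, AlgHom.comp_apply, Matrix.mul_apply,
    Fin.sum_univ_two, map_add, map_mul, MvPolynomial.algHom_C, MvPolynomial.algebraMap_eq]
  ring

/-- The representation `Sym^r(F²)` of `GL₂(F)`. -/
def symRep (F : Type*) [Field F] (r : ℕ) : Representation F (GL (Fin 2) F) (SymPow F r) where
  toFun g := (substitution (g : Matrix (Fin 2) (Fin 2) F)).toLinearMap.restrict
    fun _ hP => substitution_mem _ hP
  map_one' := by
    ext x
    simp [substitution_one]
  map_mul' g h := by
    ext x
    simp only [Units.val_mul, substitution_mul]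
    rfl

/-- For `a = (a₁, a₂)` with `0 ≤ a₁ - a₂ ≤ p - 1`, the irreducible algebraic representation
`L(a) = Sym^{a₁ - a₂}(F²) ⊗ det^{a₂}` of `GL₂` of highest weight `a`. -/
def algRep (F : Type*) [Field F] (a : ℤ × ℤ) :
    Representation F (GL (Fin 2) F) (SymPow F (a.1 - a.2).toNat) where
  toFun g := ((Matrix.GeneralLinearGroup.det g ^ a.2 : Fˣ) : F) • symRep F (a.1 - a.2).toNat g
  map_one' := by simp
  map_mul' g h := by
    rw [map_mul, map_mul, mul_zpow, Units.val_mul, smul_mul_smul_comm]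

/-- The underlying space of `F(λ)`. -/
abbrev SerreWeightSpace (lam : (k →+* F) → ℤ × ℤ) : Type _ :=
  PiTensorProduct F fun τ : k →+* F => SymPow F ((lam τ).1 - (lam τ).2).toNat

/-- The Serre weight `F(λ) = ⊗_τ L(λ_τ)^{(τ)}`, a representation of `GL₂(k)` over `F`, for a
`p`-restricted weight `λ` indexed by the embeddings `τ : k → F`. -/
def serreWeight (lam : (k →+* F) → ℤ × ℤ) :
    Representation F (GL (Fin 2) k) (SerreWeightSpace lam) :=
  PiTensorProduct.mapMonoidHom.comp
    { toFun := fun g τ => algRep F (lam τ) (Matrix.GeneralLinearGroup.map τ g)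
      map_one' := by funext τ; simp only [map_one]; rfl
      map_mul' := fun g h => by funext τ; simp only [map_mul]; rfl }

/-- `λ` is `N`-deep in the lowest alcove: `N < ⟨λ + η, α_τ^∨⟩ < p - N` for all `τ`, where
`η = (1, 0)` at every embedding. -/
def IsDeep (p N : ℕ) (lam : (k →+* F) → ℤ × ℤ) : Prop :=
  ∀ τ, (N : ℤ) < (lam τ).1 - (lam τ).2 + 1 ∧ (lam τ).1 - (lam τ).2 + 1 < (p : ℤ) - N

end SerreWeight

/-- The inflation of `F(λ)` to `K`. -/
def serreWeightK (p : ℕ) [Fact p.Prime] {k F : Type*} [Field k] [Field F]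
    (lam : (k →+* F) → ℤ × ℤ) : Representation F (K p k) (SerreWeightSpace lam) :=
  (serreWeight lam).comp (reduction p k)

/-! ### The lattice -/

section Lattice

variable {p : ℕ} [Fact p.Prime] {k F : Type*} [Field k] [Field F] [CharP F p]

/-- `F` as an algebra over `W(F)`, through `W(F) → W(F) ⧸ p = F`. -/
instance wittAlgebra : Algebra (WittVector p F) F :=
  (WittVector.constantCoeff (p := p) (R := F)).toAlgebra

/-- The trace zero matrices over `O`. -/
abbrev sl₂ (O : Type*) [CommRing O] : Type _ := LinearMap.ker (Matrix.traceLinearMap (Fin 2) O O)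

/-- The adjoint action of `GL₂(O)` on `sl₂(O)`, `X ↦ g X g⁻¹`. -/
def adjointRep (O : Type*) [CommRing O] : Representation O (GL (Fin 2) O) (sl₂ O) where
  toFun g := ((LinearMap.mulLeft O (g : Matrix (Fin 2) (Fin 2) O)).comp
    (LinearMap.mulRight O ((g⁻¹ : GL (Fin 2) O) : Matrix (Fin 2) (Fin 2) O))).restrict (by
      intro X hX
      have hX' : Matrix.trace X = 0 := hX
      change Matrix.trace ((g : Matrix (Fin 2) (Fin 2) O) *
        (X * ((g⁻¹ : GL (Fin 2) O) : Matrix (Fin 2) (Fin 2) O))) = 0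
      rw [← mul_assoc, Matrix.trace_units_conj, hX'])
  map_one' := by
    ext X
    simp
  map_mul' g h := by
    ext X : 2
    simp [mul_assoc]

variable {P : Type*} [AddCommGroup P] [Module (WittVector p F) P]

/-- The module underlying `sl_{2,𝒪_L} ⊗_{𝒪_L,τ} P = sl₂(𝒪) ⊗_𝒪 P`, where `𝒪 = W(F)`. -/
abbrev R₂Space (p : ℕ) [Fact p.Prime] (F : Type*) [Field F] [CharP F p] (P : Type*)
    [AddCommGroup P] [Module (WittVector p F) P] : Type _ :=
  sl₂ (WittVector p F) ⊗[WittVector p F] P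

/-- `R_1 = P`, a representation of `GL₂(k)` over `𝒪`, inflated to `K`. -/
def R₁ (ρ : Representation (WittVector p F) (GL (Fin 2) k) P) :
    Representation (WittVector p F) (K p k) P :=
  ρ.comp (reduction p k)

/-- `R_{2,τ} = sl_{2,𝒪_L} ⊗_{𝒪_L,τ} P`, with `K` acting on `sl₂(𝒪)` by the adjoint action through
`τ : 𝒪_L = W(k) → W(F) = 𝒪` and on `P` through `GL₂(k)`. -/
def R₂ (ρ : Representation (WittVector p F) (GL (Fin 2) k) P) (τ : k →+* F) :
    Representation (WittVector p F) (K p k) (R₂Space p F P) :=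
  Representation.tprod
    ((adjointRep (WittVector p F)).comp (Matrix.GeneralLinearGroup.map (WittVector.map τ)))
    (R₁ ρ)

/-- `R_1 ⊕ R_2`, where `R_2 = sl_{2,𝒪_L} ⊗_{ℤ_p} P = ⊕_τ R_{2,τ}`. -/
def ambient (ρ : Representation (WittVector p F) (GL (Fin 2) k) P) :
    Representation (WittVector p F) (K p k) (P × ((k →+* F) → R₂Space p F P)) :=
  (R₁ ρ).prod (piRep fun τ => R₂ ρ τ)

/-- A choice of `K`-equivariant maps `ι_τ : P/p → R_{2,τ}/p`. -/
abbrev GluingMaps (ρ : Representation (WittVector p F) (GL (Fin 2) k) P) : Type _ :=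
  ∀ τ : k →+* F,
    Representation.IntertwiningMap (baseChangeRep F (R₁ ρ)) (baseChangeRep F (R₂ ρ τ))

/-- The glued lattice
`R = {(x, (x_τ)_τ) ∈ R_1 ⊕ ⊕_τ R_{2,τ} : x_τ mod p = ι_τ (x mod p) for all τ}`.
Here `V/p = F ⊗_𝒪 V`, and the class of `v` modulo `p` is `1 ⊗ v`. It contains `p (R_1 ⊕ R_2)`, so it is a
lattice in `R_1[1/p] ⊕ R_2[1/p]`. -/
def lattice {ρ : Representation (WittVector p F) (GL (Fin 2) k) P} (ι : GluingMaps ρ) :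
    Submodule (WittVector p F) (P × ((k →+* F) → R₂Space p F P)) where
  carrier := {x | ∀ τ, (1 : F) ⊗ₜ[WittVector p F] x.2 τ = ι τ ((1 : F) ⊗ₜ x.1)}
  zero_mem' τ := by simp
  add_mem' hx hy τ := by
    simp only [Prod.fst_add, Prod.snd_add, Pi.add_apply, TensorProduct.tmul_add, map_add]
    rw [hx τ, hy τ]
  smul_mem' c x hx τ := by
    have h := hx τ
    simp only [Prod.smul_fst, Prod.smul_snd, Pi.smul_apply]
    rw [TensorProduct.tmul_smul, TensorProduct.tmul_smul, h,
      ← algebraMap_smul F c ((1 : F) ⊗ₜ[WittVector p F] x.1), map_smul, algebraMap_smul]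

theorem lattice_stable {ρ : Representation (WittVector p F) (GL (Fin 2) k) P} (ι : GluingMaps ρ)
    (g : K p k) : lattice ι ≤ (lattice ι).comap (ambient ρ g) := by
  intro x hx τ
  have h1 : (1 : F) ⊗ₜ[WittVector p F] (R₂ ρ τ g (x.2 τ))
      = baseChangeRep F (R₂ ρ τ) g ((1 : F) ⊗ₜ x.2 τ) := rfl
  have h2 : (1 : F) ⊗ₜ[WittVector p F] (R₁ ρ g x.1)
      = baseChangeRep F (R₁ ρ) g ((1 : F) ⊗ₜ x.1) := rfl
  change (1 : F) ⊗ₜ[WittVector p F] (R₂ ρ τ g (x.2 τ)) = ι τ ((1 : F) ⊗ₜ (R₁ ρ g x.1))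
  rw [h1, h2, hx τ, (ι τ).isIntertwining]

/-- The `K`-representation `R` over `𝒪`. -/
def latticeRep {ρ : Representation (WittVector p F) (GL (Fin 2) k) P} (ι : GluingMaps ρ) :
    Representation (WittVector p F) (K p k) (lattice ι) :=
  (ambient ρ).subrepresentation (lattice ι) (lattice_stable ι)

/-- The `K`-representation `R/pR` over `F`. -/
def latticeModP {ρ : Representation (WittVector p F) (GL (Fin 2) k) P} (ι : GluingMaps ρ) :
    Representation F (K p k) (F ⊗[WittVector p F] lattice ι) :=
  baseChangeRep F (latticeRep ι)

end Lattice

end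

end LatticeGL2

/-!
Write `V = P / p` for the projective cover of the Serre weight `σ`, and `f` for the number of
embeddings `τ : k → F`.

**Gluing maps as operators.** Through the trace pairing, an equivariant map `ι_τ : V → 𝔰𝔩₂ ⊗ V` is
the same as an equivariant family of operators `A_Y` on `V`, for `Y ∈ 𝔰𝔩₂`, where the group acts on
`𝔰𝔩₂` through `τ` (`IsAdTriple`). It is injective if and only if the `A_Y` have no common kernel.
Such a family induces one on `σ`, which is a multiple of the natural action of `𝔰𝔩₂` on `σ` by
`IsAdTriple.exists_eq_smul`. Conversely the natural action lifts to `V` by projectivity. The Casimir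
operator of the lift is invertible, being a nonzero scalar on `σ`, so that the `A_Y` have no common
kernel; hence injective gluing maps exist (`exists_adTriple_projectiveCover`).

**The structure of the projective cover.** The point that needs an explicit model of `V` is that
equivariant families of operators respect the radical filtration of `V`. This holds because
`Hom(𝔰𝔩₂, S)` is semisimple for every simple subquotient `S` of `V` (`niceOn_projectiveCover`).
To see this, `V` is written as a quotient of a space of polynomials in two pairs of variables for
each `τ`, of degrees `p - 1` and `p - 1 - r_τ`. This space is projective, because it is a tensor
product with the Steinberg representation, the polynomials of degree `p - 1`
(`exists_sum_unip_conj`). It suffices to take the polynomials in the generalised kernel of the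
operators `Δ ∂`, where `Δ` is the determinant of the two pairs and `∂` is Cayley's operator
(`exists_surjection`). They have an explicit filtration, with three steps for every `τ`, whose
graded pieces are tensor products of symmetric powers and Frobenius twists in degrees so small that
the Clebsch–Gordan rule makes the tensor products with `𝔰𝔩₂` semisimple (`niceOn_thetaSub`).

**The cosocle.** An element `1 + p X` of `K_1` acts on `R / p` by adding to `n` the commutators of
`X` with the gluing maps, applied to the image of `n` in `V`; they lie in the kernel
`⊕_τ 𝔰𝔩₂ ⊗ V` of `R / p → V` (`latticeModP_apply_eq`). Let `N` be a stable subspace of `R / p`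
which surjects onto `V`. As distinct embeddings are linearly independent, `N` contains the
commutators for every `τ` separately, which says that the coordinates `b_Y : V → (R / p) / N` of the
inclusion of `𝔰𝔩₂ ⊗ V` satisfy `b_Y A_Z = b_Z A_Y`. An argument with the Casimir operator and the
radical filtration shows that such `b_Y` vanish (`eq_zero_of_symmetric`). So `N` is everything, and
together with the definition of a projective cover this shows that every stable subspace of `R / p`
which surjects onto `σ` is everything (`eq_top_of_serreWeight`). The cosocle is therefore `σ`.

**The comparison.** Let `J` be an injective envelope of `σ^∨`. By injectivity and the result on the
cosocle, the dual of `R / p` embeds into `J`, and in fact into the vectors killed by the square of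
the augmentation ideal `𝔪` of `K_1`, as `K_1` acts trivially on both steps of `R / p`. Since `K_1` is
topologically generated by `3 f` elements modulo `Z_1` (`exists_generators`), these vectors form a
space of dimension at most `(1 + 3 f) dim J^{K_1}` (`finrank_fixedSq_le`), and `J^{K_1}` embeds into
the dual of `V` because it is an essential extension of `σ^∨` (`exists_injective_fixedBy_ker`). The
dimension of `R / p` is exactly `(1 + 3 f) dim V`, so that the embedding is onto. Finally
`𝔪² J^∨` is the annihilator of the vectors of `J` killed by `𝔪²`
(`augmentationMul_augmentationMul_top`), and dualising gives the isomorphism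
(`nonempty_latticeModP_equiv`).
-/

namespace LatticeGL2

noncomputable section

set_option linter.unusedSectionVars false

/-! ### Stable subspaces and relative complements -/

section Stable

variable {F G V V' ι : Type*} [Field F] [AddCommGroup V] [Module F V] [AddCommGroup V'] [Module F V']

/-- The subspace `W` is stable under all operators `ρ g`. -/
def Stable (ρ : G → Module.End F V) (W : Submodule F V) : Prop :=
  ∀ g, ∀ v ∈ W, ρ g v ∈ W

/-- `f` intertwines `ρ` and `ρ'` up to nonzero scalars. -/
def SemiEquivariant (ρ : G → Module.End F V) (ρ' : G → Module.End F V') (f : V →ₗ[F] V') : Prop :=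
  ∃ χ : G → F, (∀ g, χ g ≠ 0) ∧ ∀ g v, f (ρ g v) = χ g • ρ' g (f v)

/-- The interval `[N, M]` in the lattice of stable subspaces is complemented. For `N ≤ M` this says
that `M ⧸ N` is semisimple. -/
def RelCompl (ρ : G → Module.End F V) (N M : Submodule F V) : Prop :=
  ∀ K, Stable ρ K → N ≤ K → K ≤ M → ∃ L, Stable ρ L ∧ K ⊓ L = N ∧ K ⊔ L = M

/-- `N < M` are stable with nothing stable in between, i.e. `M ⧸ N` is simple or zero. -/
def StepPair (ρ : G → Module.End F V) (N M : Submodule F V) : Prop :=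
  Stable ρ N ∧ Stable ρ M ∧ N ≤ M ∧ ∀ K, Stable ρ K → N ≤ K → K ≤ M → K = N ∨ K = M

/-- The action on `V^ι` deduced from `ρ` and from matrices `c g`; for suitable `c` this is the
representation on `Hom(S, V)`, for a representation `S` with a basis indexed by `ι`. -/
def powRep [Fintype ι] (c : G → Matrix ι ι F) (ρ : G → Module.End F V) (g : G) :
    Module.End F (ι → V) :=
  LinearMap.pi fun i => ∑ j, c g i j • (ρ g).comp (LinearMap.proj j)

theorem powRep_apply [Fintype ι] (c : G → Matrix ι ι F) (ρ : G → Module.End F V) (g : G)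
    (v : ι → V) (i : ι) : powRep c ρ g v i = ∑ j, c g i j • ρ g (v j) := by
  simp [powRep, LinearMap.sum_apply]

/-- `N^ι` as a subspace of `V^ι`. -/
def powSub (ι : Type*) (N : Submodule F V) : Submodule F (ι → V) := Submodule.pi Set.univ fun _ => N

theorem mem_powSub {N : Submodule F V} {v : ι → V} : v ∈ powSub ι N ↔ ∀ i, v i ∈ N := by
  simp [powSub, Submodule.mem_pi]

/-- Every simple subquotient `S` of `W` has `S^ι` (with the action `powRep c`) semisimple. In the
application `S^ι` is `Hom(𝔰𝔩₂, S)`, and the property makes equivariant families of operators indexed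
by `𝔰𝔩₂` respect the radical filtration. -/
def NiceOn [Fintype ι] (c : G → Matrix ι ι F) (ρ : G → Module.End F V) (W : Submodule F V) : Prop :=
  ∀ N M, StepPair ρ N M → M ≤ W → RelCompl (powRep c ρ) (powSub ι N) (powSub ι M)

/-- `W` is simple or zero. -/
def IrrOn (ρ : G → Module.End F V) (W : Submodule F V) : Prop :=
  ∀ K, Stable ρ K → K ≤ W → K = ⊥ ∨ K = W

variable {ρ : G → Module.End F V} {ρ' : G → Module.End F V'} {f : V →ₗ[F] V'}
  {N M K L W : Submodule F V} {N' M' K' L' W' : Submodule F V'}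

theorem Stable.inf (h : Stable ρ N) (h' : Stable ρ M) : Stable ρ (N ⊓ M) :=
  fun g v hv => ⟨h g v hv.1, h' g v hv.2⟩

theorem Stable.sup (h : Stable ρ N) (h' : Stable ρ M) : Stable ρ (N ⊔ M) := by
  intro g v hv
  obtain ⟨a, ha, b, hb, rfl⟩ := Submodule.mem_sup.1 hv
  rw [map_add]
  exact Submodule.add_mem_sup (h g a ha) (h' g b hb)

theorem Stable.bot : Stable ρ ⊥ := by
  intro g v hv
  rw [Submodule.mem_bot] at hv ⊢
  rw [hv, map_zero]

theorem Stable.top : Stable ρ ⊤ := fun _ _ _ => Submodule.mem_top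

theorem Stable.iInf {κ : Sort*} {N : κ → Submodule F V} (h : ∀ i, Stable ρ (N i)) :
    Stable ρ (⨅ i, N i) := by
  intro g v hv
  rw [Submodule.mem_iInf] at hv ⊢
  exact fun i => h i g v (hv i)

theorem Stable.comap (hf : SemiEquivariant ρ ρ' f) (h : Stable ρ' K') : Stable ρ (K'.comap f) := by
  obtain ⟨χ, -, hχ⟩ := hf
  intro g v hv
  rw [Submodule.mem_comap, hχ]
  exact K'.smul_mem _ (h g _ hv)

theorem Stable.map (hf : SemiEquivariant ρ ρ' f) (h : Stable ρ K) : Stable ρ' (K.map f) := by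
  obtain ⟨χ, h0, hχ⟩ := hf
  rintro g _ ⟨v, hv, rfl⟩
  refine ⟨(χ g)⁻¹ • ρ g v, K.smul_mem _ (h g v hv), ?_⟩
  rw [map_smul, hχ, smul_smul, inv_mul_cancel₀ (h0 g), one_smul]

theorem Stable.ker (hf : SemiEquivariant ρ ρ' f) : Stable ρ (LinearMap.ker f) :=
  Stable.comap hf Stable.bot

theorem Stable.powSub [Fintype ι] (c : G → Matrix ι ι F) (h : Stable ρ N) :
    Stable (powRep c ρ) (powSub ι N) := by
  intro g v hv
  rw [mem_powSub] at hv ⊢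
  intro i
  rw [powRep_apply]
  exact N.sum_mem fun j _ => N.smul_mem _ (h g _ (hv j))

theorem SemiEquivariant.comp {V'' : Type*} [AddCommGroup V''] [Module F V'']
    {ρ'' : G → Module.End F V''} {f' : V' →ₗ[F] V''} (hf' : SemiEquivariant ρ' ρ'' f')
    (hf : SemiEquivariant ρ ρ' f) : SemiEquivariant ρ ρ'' (f'.comp f) := by
  obtain ⟨χ, h0, hχ⟩ := hf
  obtain ⟨χ', h0', hχ'⟩ := hf'
  refine ⟨fun g => χ g * χ' g, fun g => mul_ne_zero (h0 g) (h0' g), fun g v => ?_⟩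
  rw [LinearMap.comp_apply, hχ, map_smul, hχ', smul_smul, LinearMap.comp_apply]

theorem SemiEquivariant.pow {f : Module.End F V} (hf : SemiEquivariant ρ ρ f) (n : ℕ) :
    SemiEquivariant ρ ρ (f ^ n) := by
  induction n with
  | zero => exact ⟨fun _ => 1, fun _ => one_ne_zero, fun g v => by simp⟩
  | succ n ih => rw [pow_succ]; exact ih.comp hf

theorem SemiEquivariant.powMap [Fintype ι] (c : G → Matrix ι ι F) (hf : SemiEquivariant ρ ρ' f) :
    SemiEquivariant (powRep c ρ) (powRep c ρ') (f.compLeft ι) := by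
  obtain ⟨χ, h0, hχ⟩ := hf
  refine ⟨χ, h0, fun g v => ?_⟩
  ext i
  simp only [LinearMap.compLeft_apply, Function.comp_apply, powRep_apply, map_sum, map_smul, hχ,
    Pi.smul_apply, Finset.smul_sum]
  exact Finset.sum_congr rfl fun j _ => smul_comm _ _ _

theorem powSub_map : powSub ι (K.map f) = (powSub ι K).map (f.compLeft ι) := by
  ext v
  simp only [mem_powSub, Submodule.mem_map]
  constructor
  · intro h
    choose w hw hw' using h
    exact ⟨w, hw, funext hw'⟩
  · rintro ⟨w, hw, rfl⟩ i
    exact ⟨w i, hw i, rfl⟩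

theorem powSub_inf : powSub ι (N ⊓ M) = powSub ι N ⊓ powSub ι M := by
  ext v; simp [mem_powSub, forall_and]

theorem powSub_sup : powSub ι (N ⊔ M) = powSub ι N ⊔ powSub ι M := by
  ext v
  simp only [mem_powSub, Submodule.mem_sup]
  constructor
  · intro h
    choose a ha b hb hab using h
    exact ⟨a, ha, b, hb, funext hab⟩
  · rintro ⟨a, ha, b, hb, rfl⟩ i
    exact ⟨a i, ha i, b i, hb i, rfl⟩

theorem powSub_mono (h : N ≤ M) : powSub ι N ≤ powSub ι M :=
  fun _ hv => mem_powSub.2 fun i => h (mem_powSub.1 hv i)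

/-- Subquotients of semisimple representations are semisimple. -/
theorem RelCompl.of_bot (h : RelCompl ρ ⊥ W) (hN : Stable ρ N) (hM : Stable ρ M)
    (hMW : M ≤ W) : RelCompl ρ N M := by
  intro K hK hNK hKM
  obtain ⟨L, hL, h1, h2⟩ := h K hK bot_le (hKM.trans hMW)
  refine ⟨N ⊔ L ⊓ M, hN.sup (hL.inf hM), ?_, ?_⟩
  · rw [inf_comm, sup_inf_assoc_of_le _ hNK, inf_right_comm, inf_comm L K, h1]
    simp
  · rw [← sup_assoc, sup_eq_left.2 hNK, ← sup_inf_assoc_of_le _ hKM, h2, inf_eq_right.2 hMW]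

/-- Transport of relative complements along a transposition of intervals. -/
theorem RelCompl.of_inf (hM : M = N ⊔ W ⊓ M) (hN : Stable ρ N) (hW : Stable ρ W)
    (h : RelCompl ρ (W ⊓ N) (W ⊓ M)) : RelCompl ρ N M := by
  intro K hK hNK hKM
  obtain ⟨L, hL, h1, h2⟩ := h (W ⊓ K) (hW.inf hK) (inf_le_inf_left _ hNK) (inf_le_inf_left _ hKM)
  have hLM : L ≤ W ⊓ M := h2 ▸ le_sup_right
  refine ⟨N ⊔ L, hN.sup hL, ?_, ?_⟩
  · have : K ⊓ L ≤ N := by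
      calc K ⊓ L ≤ W ⊓ K ⊓ L :=
            le_inf (le_inf ((inf_le_right.trans hLM).trans inf_le_left) inf_le_left) inf_le_right
        _ ≤ N := h1.trans_le inf_le_right
    rw [inf_comm, sup_inf_assoc_of_le _ hNK, inf_comm L K, sup_eq_left.2 this]
  · refine le_antisymm (sup_le hKM (sup_le (hNK.trans hKM) (hLM.trans inf_le_right))) ?_
    rw [hM, ← h2]
    exact sup_le (le_sup_left.trans le_sup_right)
      (sup_le (inf_le_right.trans le_sup_left) (le_sup_right.trans le_sup_right))

/-- If `f` is injective modulo `N` on `M`, then `M ⧸ N` is isomorphic to its image under `f`, and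
semisimplicity is inherited from there. -/
theorem RelCompl.of_map (hf : SemiEquivariant ρ ρ' f) (hM : Stable ρ M)
    (hker : M ⊓ LinearMap.ker f ≤ N) (hNM : N ≤ M) (h : RelCompl ρ' (N.map f) (M.map f)) :
    RelCompl ρ N M := by
  intro K hK hNK hKM
  obtain ⟨L, hL, h1, h2⟩ := h (K.map f) (hK.map hf) (Submodule.map_mono hNK)
    (Submodule.map_mono hKM)
  refine ⟨M ⊓ L.comap f, hM.inf (hL.comap hf), le_antisymm ?_ ?_, le_antisymm ?_ ?_⟩
  · rintro v ⟨hvK, hvM, hvL⟩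
    have : f v ∈ N.map f := h1 ▸ ⟨⟨v, hvK, rfl⟩, hvL⟩
    obtain ⟨n, hn, hnv⟩ := this
    have : v - n ∈ N := hker ⟨M.sub_mem hvM (hNM hn), by simp [hnv]⟩
    simpa using N.add_mem this hn
  · intro v hv
    refine ⟨hNK hv, hNM hv, ?_⟩
    have : f v ∈ N.map f := ⟨v, hv, rfl⟩
    rw [← h1] at this
    exact this.2
  · exact sup_le hKM inf_le_left
  · intro v hv
    have : f v ∈ M.map f := ⟨v, hv, rfl⟩
    rw [← h2] at this
    obtain ⟨_, ⟨a, ha, rfl⟩, b, hb, hab⟩ := Submodule.mem_sup.1 this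
    rw [Submodule.mem_sup]
    refine ⟨a, ha, v - a, ⟨M.sub_mem hv (hKM ha), ?_⟩, by abel⟩
    change f (v - a) ∈ L
    rw [map_sub, ← hab]
    simpa using hb

theorem RelCompl.map (hf : SemiEquivariant ρ ρ' f) (h : RelCompl ρ N M)
    (hM : Stable ρ M) (hNM : N ≤ M) :
    RelCompl ρ' (N.map f) (M.map f) := by
  intro K hK hNK hKM
  obtain ⟨L, hL, h1, h2⟩ := h (M ⊓ K.comap f) (hM.inf (hK.comap hf))
    (le_inf hNM (Submodule.map_le_iff_le_comap.1 hNK)) inf_le_left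
  have hK' : (M ⊓ K.comap f).map f = K := by
    refine le_antisymm (Submodule.map_le_iff_le_comap.2 inf_le_right) fun v hv => ?_
    obtain ⟨m, hm, rfl⟩ := hKM hv
    exact ⟨m, ⟨hm, hv⟩, rfl⟩
  refine ⟨L.map f, hL.map hf, le_antisymm ?_ (le_inf hNK ?_), ?_⟩
  · rintro _ ⟨hv, l, hl, rfl⟩
    have hlM : l ∈ M := h2 ▸ Submodule.mem_sup_right hl
    have : l ∈ N := h1 ▸ ⟨⟨hlM, hv⟩, hl⟩
    exact ⟨l, this, rfl⟩
  · exact Submodule.map_mono (h1 ▸ inf_le_right)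
  · rw [← h2, Submodule.map_sup, hK']

theorem StepPair.inf (h : StepPair ρ N M) (hW : Stable ρ W) : StepPair ρ (W ⊓ N) (W ⊓ M) := by
  obtain ⟨hN, hM, hNM, h⟩ := h
  refine ⟨hW.inf hN, hW.inf hM, inf_le_inf_left _ hNM, fun K hK h1 h2 => ?_⟩
  have hKW : K ≤ W := h2.trans inf_le_left
  have e : W ⊓ (N ⊔ K) = W ⊓ N ⊔ K := (inf_sup_assoc_of_le _ hKW).symm
  rw [sup_eq_right.2 h1] at e
  rcases h (N ⊔ K) (hN.sup hK) le_sup_left (sup_le hNM (h2.trans inf_le_right)) with h | h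
  · left; rw [← e, h]
  · right; rw [← e, h]

theorem StepPair.map (hf : SemiEquivariant ρ ρ' f) (h : StepPair ρ N M) :
    StepPair ρ' (N.map f) (M.map f) := by
  obtain ⟨hN, hM, hNM, h⟩ := h
  refine ⟨hN.map hf, hM.map hf, Submodule.map_mono hNM, fun K hK h1 h2 => ?_⟩
  have hK' : (M ⊓ K.comap f).map f = K := by
    refine le_antisymm (Submodule.map_le_iff_le_comap.2 inf_le_right) fun v hv => ?_
    obtain ⟨m, hm, rfl⟩ := h2 hv
    exact ⟨m, ⟨hm, hv⟩, rfl⟩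
  rcases h (M ⊓ K.comap f) (hM.inf (hK.comap hf)) (le_inf hNM (Submodule.map_le_iff_le_comap.1 h1))
    inf_le_left with h | h
  · left; rw [← hK', h]
  · right; rw [← hK', h]

theorem StepPair.comap (hf : SemiEquivariant ρ ρ' f) (hW : Stable ρ W) (h : StepPair ρ' N' M')
    (hM' : M' ≤ W.map f) : StepPair ρ (W ⊓ N'.comap f) (W ⊓ M'.comap f) := by
  obtain ⟨hN, hM, hNM, h⟩ := h
  refine ⟨hW.inf (hN.comap hf), hW.inf (hM.comap hf),
    inf_le_inf_left _ (Submodule.comap_mono hNM), fun K hK h1 h2 => ?_⟩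
  have key : K = W ⊓ (K.map f).comap f := by
    refine le_antisymm (le_inf (h2.trans inf_le_left) (Submodule.le_comap_map f K)) ?_
    rintro v ⟨hvW, a, ha, hav⟩
    have : v - a ∈ K := h1 ⟨W.sub_mem hvW (h2 ha).1, by simp [hav]⟩
    simpa using K.add_mem this ha
  have hNK : N' ≤ K.map f := by
    intro v hv
    obtain ⟨w, hw, rfl⟩ := hM' (hNM hv)
    exact ⟨w, h1 ⟨hw, hv⟩, rfl⟩
  rcases h (K.map f) (hK.map hf) hNK (Submodule.map_le_iff_le_comap.2
    (h2.trans inf_le_right)) with h | h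
  · left; rw [key, h]
  · right; rw [key, h]

theorem powSub_ker : powSub ι (LinearMap.ker f) = LinearMap.ker (f.compLeft ι) := by
  ext v
  simp [mem_powSub, funext_iff]

variable [Fintype ι] {c : G → Matrix ι ι F}

theorem NiceOn.mono (h : NiceOn c ρ W) (hMW : M ≤ W) : NiceOn c ρ M :=
  fun N M' hs hM' => h N M' hs (hM'.trans hMW)

/-- The property `NiceOn` passes to extensions: a simple subquotient of `W` is a subquotient either of
the image of `W` under `f` or of the kernel of `f` on `W`. -/
theorem NiceOn.extension (hf : SemiEquivariant ρ ρ' f)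
    (hW' : NiceOn c ρ' W') (hfW : W ≤ W'.comap f) (hK : NiceOn c ρ (LinearMap.ker f ⊓ W)) :
    NiceOn c ρ W := by
  intro N M hNM hMW
  have hker := Stable.ker hf
  obtain ⟨hN, hM, hle, h⟩ := id hNM
  rcases h (N ⊔ LinearMap.ker f ⊓ M) (hN.sup (hker.inf hM)) le_sup_left (sup_le hle inf_le_right)
    with h | h
  · have h1 : LinearMap.ker f ⊓ M ≤ N := by rw [← h]; exact le_sup_right
    have := hW' _ _ (hNM.map hf) (Submodule.map_le_iff_le_comap.2 (hMW.trans hfW))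
    rw [powSub_map, powSub_map] at this
    refine RelCompl.of_map (hf.powMap c) (hM.powSub c) ?_ (powSub_mono hle) this
    rw [← powSub_ker, ← powSub_inf, inf_comm]
    exact powSub_mono h1
  · have := hK _ _ (hNM.inf hker) (inf_le_inf_left _ hMW)
    rw [powSub_inf, powSub_inf] at this
    refine RelCompl.of_inf ?_ (hN.powSub c) (hker.powSub c) this
    rw [← powSub_inf, ← powSub_sup, h]

/-- The property `NiceOn` passes to quotients. -/
theorem NiceOn.map (hf : SemiEquivariant ρ ρ' f) (hWs : Stable ρ W)
    (hW : NiceOn c ρ W) (hfW : W' ≤ W.map f) : NiceOn c ρ' W' := by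
  intro N M hNM hMW
  have h1 := hNM.comap hf hWs (hMW.trans hfW)
  have h2 := hW _ _ h1 inf_le_left
  have key : ∀ {K : Submodule F V'}, K ≤ W' → K = (W ⊓ K.comap f).map f := by
    intro K hK
    refine le_antisymm (fun v hv => ?_) (Submodule.map_le_iff_le_comap.2 inf_le_right)
    obtain ⟨m, hm, rfl⟩ := hfW (hK hv)
    exact ⟨m, ⟨hm, hv⟩, rfl⟩
  have h3 := h2.map (hf.powMap c) (h1.2.1.powSub c) (powSub_mono h1.2.2.1)
  rwa [← powSub_map, ← powSub_map, ← key (hNM.2.2.1.trans hMW), ← key hMW] at h3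

theorem NiceOn.of_semisimple (h : RelCompl (powRep c ρ) ⊥ (powSub ι W)) : NiceOn c ρ W :=
  fun _ _ hNM hMW => h.of_bot (hNM.1.powSub c) (hNM.2.1.powSub c) (powSub_mono hMW)

omit [Fintype ι] in
/-- A finite-dimensional space is semisimple if its vectors are separated by maps to simple
spaces. -/
theorem relCompl_of_separated [FiniteDimensional F W] (hW : Stable ρ W)
    (h : ∀ w ∈ W, w ≠ 0 → ∃ (f : V →ₗ[F] V') (W' : Submodule F V'), SemiEquivariant ρ ρ' f ∧
      IrrOn ρ' W' ∧ W ≤ W'.comap f ∧ f w ≠ 0) : RelCompl ρ ⊥ W := by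
  intro K hK _ hKW
  -- a minimal stable `L` with `K ⊔ L = W`
  have hex : ∃ n, ∃ L, Stable ρ L ∧ K ⊔ L = W ∧ Module.finrank F L = n :=
    ⟨_, W, hW, sup_eq_right.2 hKW, rfl⟩
  classical
  obtain ⟨L, hL, hKL, hn⟩ := Nat.find_spec hex
  refine ⟨L, hL, ?_, hKL⟩
  rw [eq_bot_iff]
  intro w hw
  rw [Submodule.mem_bot]
  by_contra hw0
  have hLW : L ≤ W := hKL ▸ le_sup_right
  obtain ⟨f, W', hf, hirr, hfW, hfw⟩ := h w (hLW hw.2) hw0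
  have h1 : (K ⊓ L).map f = W' := by
    refine (hirr _ ((hK.inf hL).map hf) (Submodule.map_le_iff_le_comap.2
      ((inf_le_right.trans hLW).trans hfW))).resolve_left fun h0 => hfw ?_
    have : f w ∈ (K ⊓ L).map f := ⟨w, hw, rfl⟩
    rwa [h0, Submodule.mem_bot] at this
  have h2 : K ⊔ L ⊓ LinearMap.ker f = W := by
    refine le_antisymm (sup_le hKW (inf_le_left.trans hLW)) ?_
    rw [← hKL]
    refine sup_le le_sup_left fun l hl => ?_
    have : f l ∈ (K ⊓ L).map f := by rw [h1]; exact hfW (hLW hl)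
    obtain ⟨a, ha, hal⟩ := this
    rw [Submodule.mem_sup]
    exact ⟨a, ha.1, l - a, ⟨L.sub_mem hl ha.2, by simp [hal]⟩, by abel⟩
  have hfin : FiniteDimensional F L := Submodule.finiteDimensional_of_le hLW
  have h3 : Module.finrank F ↥(L ⊓ LinearMap.ker f) < Module.finrank F L := by
    refine Submodule.finrank_lt_finrank_of_lt (lt_of_le_of_ne inf_le_left fun he => hfw ?_)
    have : w ∈ L ⊓ LinearMap.ker f := by rw [he]; exact hw.2
    exact this.2
  exact Nat.find_min hex (hn ▸ h3) ⟨_, hL.inf (Stable.ker hf), h2, rfl⟩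

omit [Fintype ι] in
/-- A map to a semisimple space kills the radical. -/
theorem apply_mem_of_relCompl [FiniteDimensional F M'] {U : Submodule F V}
    (hf : SemiEquivariant ρ ρ' f) (hfU : U ≤ M'.comap f) (hN' : Stable ρ' N')
    (hU : Stable ρ U) (h : RelCompl ρ' N' M') (hNM : N' ≤ M') {u : V}
    (hrad : ∀ E, StepPair ρ E U → u ∈ E) : f u ∈ N' := by
  by_contra hfu
  -- a maximal stable `L` above `N'` avoiding `f u`
  have hex : ∃ n, ∃ L, Stable ρ' L ∧ N' ≤ L ∧ L ≤ M' ∧ f u ∉ L ∧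
      Module.finrank F M' - Module.finrank F L = n := ⟨_, N', hN', le_rfl, hNM, hfu, rfl⟩
  classical
  obtain ⟨L, hL, hNL, hLM, huL, hn⟩ := Nat.find_spec hex
  have hmax : ∀ L₁, Stable ρ' L₁ → L < L₁ → L₁ ≤ M' → f u ∈ L₁ := by
    intro L₁ hL₁ hlt hle
    by_contra hu₁
    have hfin : FiniteDimensional F L₁ := Submodule.finiteDimensional_of_le hle
    have h1 := Submodule.finrank_lt_finrank_of_lt hlt
    have h2 := Submodule.finrank_mono hle
    exact Nat.find_min hex (m := Module.finrank F M' - Module.finrank F L₁) (by omega)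
      ⟨L₁, hL₁, hNL.trans hlt.le, hle, hu₁, rfl⟩
  refine huL (hrad (U ⊓ L.comap f) ⟨hU.inf (hL.comap hf), hU, inf_le_left, ?_⟩).2
  intro E hE h1 h2
  by_cases hcase : E.map f ≤ L
  · exact Or.inl (le_antisymm (le_inf h2 (Submodule.map_le_iff_le_comap.1 hcase)) h1)
  right
  have hEM : E.map f ≤ M' := Submodule.map_le_iff_le_comap.2 (h2.trans hfU)
  obtain ⟨L₂, hL₂, h3, h4⟩ := h (L ⊔ E.map f) (hL.sup (hE.map hf)) (hNL.trans le_sup_left)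
    (sup_le hLM hEM)
  have hlt : L < L ⊔ E.map f := lt_of_le_of_ne le_sup_left fun h0 => hcase (by
    rw [h0]; exact le_sup_right)
  have hu1 := hmax _ (hL.sup (hE.map hf)) hlt (sup_le hLM hEM)
  -- the relative complement of `L ⊔ f E` is contained in `L`, so that `L ⊔ f E = M'`
  have h5 : L₂ ≤ L := by
    by_contra h5
    have hlt2 : L < L ⊔ L₂ := lt_of_le_of_ne le_sup_left fun h0 => h5 (by
      rw [h0]; exact le_sup_right)
    have hu2 := hmax _ (hL.sup hL₂) hlt2 (sup_le hLM (h4 ▸ le_sup_right))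
    have : (L ⊔ E.map f) ⊓ (L ⊔ L₂) = L := by
      rw [inf_comm, sup_inf_assoc_of_le _ le_sup_left, inf_comm, h3, sup_eq_left.2 hNL]
    exact huL (this ▸ ⟨hu1, hu2⟩)
  have h6 : L ⊔ E.map f = M' := le_antisymm (sup_le hLM hEM)
    (h4 ▸ sup_le le_rfl (h5.trans le_sup_left))
  refine le_antisymm h2 fun x hx => ?_
  have hx' : f x ∈ L ⊔ E.map f := by rw [h6]; exact hfU hx
  obtain ⟨l, hl, _, ⟨e, he, rfl⟩, hle⟩ := Submodule.mem_sup.1 hx'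
  have : x - e ∈ E := h1 ⟨U.sub_mem hx (h2 he), by
    change f (x - e) ∈ L
    rw [map_sub, ← hle]; simpa using hl⟩
  simpa using E.add_mem this he

end Stable

/-! ### Digit functions on a finite field -/

section Digits

variable (p : ℕ) [Fact p.Prime] {k F : Type*} [Field k] [Field F]

/-- The function `x ↦ ∏_τ τ(x)^{b_τ}` on `k`. -/
def digitFun [Fintype (k →+* F)] (b : (k →+* F) → ℕ) (x : k) : F := ∏ τ, τ x ^ b τ

theorem card_embeddings_le [CharP k p] [CharP F p] [Finite k] [Finite F]
    [Algebra (ZMod p) k] [Algebra (ZMod p) F] :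
    Nat.card (k →+* F) ≤ Module.finrank (ZMod p) k := by
  have hcomm : ∀ (τ : k →+* F) (r : ZMod p), τ (algebraMap _ _ r) = algebraMap _ _ r := by
    intro τ r
    rw [← RingHom.comp_apply]
    exact DFunLike.congr_fun (Subsingleton.elim _ _) r
  have hinj : Function.Injective
      (fun τ : k →+* F => ({ τ with commutes' := hcomm τ } : k →ₐ[ZMod p] F)) := by
    intro τ τ' h
    ext x
    exact DFunLike.congr_fun h x
  have : Finite (k →ₐ[ZMod p] F) := Finite.of_injective (fun τ => (τ : k → F)) DFunLike.coe_injective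
  have : FiniteDimensional (ZMod p) k := Module.Finite.of_finite
  have : FiniteDimensional (ZMod p) F := Module.Finite.of_finite
  refine (Nat.card_le_card_of_injective _ hinj).trans ?_
  classical
  have := Fintype.ofFinite (k →ₐ[ZMod p] F)
  rw [Nat.card_eq_fintype_card, Fintype.card_eq_nat_card]
  exact card_algHom_le_finrank (ZMod p) k F

variable [CharP k p] [CharP F p] [Fintype (k →+* F)]

/-- Since `τ(x)^p = (τ ∘ Frob)(x)`, a monomial function in the `τ(x)` equals one with all exponents
less than `p`. -/
theorem exists_digitFun_eq (b : (k →+* F) → ℕ) :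
    ∃ b' : (k →+* F) → Fin p, ∀ x : k, digitFun b x = digitFun (fun τ => (b' τ : ℕ)) x := by
  classical
  have hp : 1 < p := (Fact.out : p.Prime).one_lt
  induction hn : ∑ τ, b τ using Nat.strong_induction_on generalizing b with
  | _ n ih =>
    by_cases hb : ∀ τ, b τ < p
    · exact ⟨fun τ => ⟨b τ, hb τ⟩, fun x => rfl⟩
    push Not at hb
    obtain ⟨τ, hτ⟩ := hb
    obtain ⟨c, rfl⟩ : ∃ c : (k →+* F) → ℕ, b = c + Pi.single τ p :=
      ⟨b - Pi.single τ p, by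
        funext τ'
        by_cases h : τ' = τ
        · subst h; simp; omega
        · simp [h]⟩
    simp only [Pi.add_apply, Finset.sum_add_distrib, Finset.sum_pi_single', Finset.mem_univ,
      if_true] at hn
    obtain ⟨b', hb'⟩ := ih (∑ τ', (c + Pi.single (τ.comp (frobenius k p)) 1 : (k →+* F) → ℕ) τ') (by
      simp only [Pi.add_apply, Finset.sum_add_distrib, Finset.sum_pi_single', Finset.mem_univ,
        if_true]
      omega) _ rfl
    refine ⟨b', fun x => ?_⟩
    rw [← hb']
    simp only [digitFun, Pi.add_apply, pow_add, Finset.prod_mul_distrib]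
    congr 1
    rw [Finset.prod_eq_single τ (by intro i _ hi; simp [hi]) (by simp),
      Finset.prod_eq_single (τ.comp (frobenius k p)) (by intro i _ hi; simp [hi]) (by simp)]
    simp [frobenius_def]

/-- Every function on `k` is a combination of monomials in the `τ(x)` with exponents less than `p`:
by Lagrange interpolation it is a polynomial in one `τ(x)`. -/
theorem span_digitFun [Finite k] [Nonempty (k →+* F)] :
    Submodule.span F (Set.range fun b : (k →+* F) → Fin p =>
      (digitFun (fun τ => (b τ : ℕ)) : k → F)) = ⊤ := by
  classical
  have := Fintype.ofFinite k
  obtain ⟨τ⟩ := (inferInstance : Nonempty (k →+* F))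
  rw [eq_top_iff]
  rintro f -
  set P := Lagrange.interpolate Finset.univ (fun x : k => τ x) f
  have hP : f = ∑ i ∈ P.support, P.coeff i • fun x => τ x ^ i := by
    funext x
    have := Lagrange.eval_interpolate_at_node (s := Finset.univ) (v := fun x : k => τ x) f
      τ.injective.injOn (Finset.mem_univ x)
    rw [← this, Polynomial.eval_eq_sum, Polynomial.sum_def]
    simp [P]
  rw [hP]
  refine Submodule.sum_mem _ fun i _ => Submodule.smul_mem _ _ ?_
  obtain ⟨b, hb⟩ := exists_digitFun_eq p (k := k) (Pi.single τ i : (k →+* F) → ℕ)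
  refine Submodule.subset_span ⟨b, ?_⟩
  funext x
  change digitFun _ x = _
  rw [← hb, digitFun, Finset.prod_eq_single τ (by intro i _ hi; simp [hi]) (by simp)]
  simp

variable [Finite k] [Finite F] [Nonempty (k →+* F)]

/-- The degree of `k` is the number of its embeddings, and the digit monomials are linearly
independent. Both follow by counting, as these monomials span the space of functions on `k`, while
the number of embeddings is at most the degree. -/
theorem finrank_eq_card_embeddings [Algebra (ZMod p) k] :
    Module.finrank (ZMod p) k = Fintype.card (k →+* F) ∧ LinearIndependent F
      (fun b : (k →+* F) → Fin p => (digitFun (fun τ => (b τ : ℕ)) : k → F)) := by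
  classical
  have := Fintype.ofFinite k
  let _ : Algebra (ZMod p) F := ZMod.algebra F p
  have : FiniteDimensional (ZMod p) k := Module.Finite.of_finite
  have hp : 1 < p := (Fact.out : p.Prime).one_lt
  have h1 := card_embeddings_le p (k := k) (F := F)
  rw [Nat.card_eq_fintype_card] at h1
  have h2 : Fintype.card k = p ^ Module.finrank (ZMod p) k := by
    rw [Module.card_eq_pow_finrank (K := ZMod p), ZMod.card]
  have h3 : Fintype.card k ≤ Fintype.card ((k →+* F) → Fin p) := by
    have := finrank_range_le_card (R := F) (fun b : (k →+* F) → Fin p =>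
      (digitFun (fun τ => (b τ : ℕ)) : k → F))
    rw [Set.finrank, span_digitFun p, finrank_top, Module.finrank_fintype_fun_eq_card] at this
    exact this
  have h4 : Fintype.card ((k →+* F) → Fin p) = p ^ Fintype.card (k →+* F) := by simp
  have h5 : Module.finrank (ZMod p) k = Fintype.card (k →+* F) := by
    refine le_antisymm ?_ h1
    rw [h2, h4] at h3
    exact (Nat.pow_le_pow_iff_right hp).1 h3
  refine ⟨h5, linearIndependent_of_top_le_span_of_card_eq_finrank (span_digitFun p).ge ?_⟩
  rw [h4, Module.finrank_fintype_fun_eq_card, h2, h5]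

/-- Coefficients extracting a given digit monomial from a linear combination. -/
theorem exists_extraction [Fintype k] (b₀ : (k →+* F) → ℕ) (hb₀ : ∀ τ, b₀ τ < p) :
    ∃ c : k → F, c ≠ 0 ∧ ∀ b : (k →+* F) → ℕ, (∀ τ, b τ < p) →
      ∑ x, c x * digitFun b x = if b = b₀ then 1 else 0 := by
  classical
  let _ : Algebra (ZMod p) k := ZMod.algebra k p
  have hli := (finrank_eq_card_embeddings p (k := k) (F := F)).2
  let B := Module.Basis.mk hli (span_digitFun p).ge
  let b₁ : (k →+* F) → Fin p := fun τ => ⟨b₀ τ, hb₀ τ⟩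
  have key : ∀ b : (k →+* F) → ℕ, (∀ τ, b τ < p) →
      ∑ x, B.coord b₁ (Pi.single x 1) * digitFun b x = if b = b₀ then 1 else 0 := by
    intro b hb
    have h1 : (digitFun b : k → F) = B fun τ => ⟨b τ, hb τ⟩ := by
      rw [Module.Basis.mk_apply]
    have h2 : (digitFun b : k → F) = ∑ x, (digitFun b x : F) • (Pi.single x 1 : k → F) := by
      funext y; simp [Finset.sum_apply, Pi.single_apply]
    have h3 := congrArg (B.coord b₁) h2
    rw [map_sum, h1, Module.Basis.coord_apply, Module.Basis.repr_self, Finsupp.single_apply] at h3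
    simp only [map_smul, smul_eq_mul] at h3
    rw [show (if b = b₀ then (1 : F) else 0) = if (fun τ => (⟨b τ, hb τ⟩ : Fin p)) = b₁ then 1 else 0
      from ?_, h3]
    · exact Finset.sum_congr rfl fun x _ => by rw [mul_comm, ← h1]
    · congr 1
      simp only [b₁, funext_iff, Fin.mk.injEq]
  refine ⟨fun x => B.coord b₁ (Pi.single x 1), fun h0 => ?_, key⟩
  have := key b₀ hb₀
  simp [funext_iff] at h0
  simp [h0] at this

omit [Finite F] in
/-- The indicator function of `0` as a combination of digit monomials. -/
theorem exists_digitFun_eq_indicator [DecidableEq k] [Fintype ((k →+* F) → Fin p)] : ∃ C : ((k →+* F) → Fin p) → F, ∀ x : k,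
    ∑ b, C b * digitFun (fun τ => (b τ : ℕ)) x = if x = 0 then 1 else 0 := by
  classical
  have h : (Pi.single 0 1 : k → F) ∈ Submodule.span F (Set.range fun b : (k →+* F) → Fin p =>
      (digitFun (fun τ => (b τ : ℕ)) : k → F)) := by rw [span_digitFun p]; trivial
  obtain ⟨C, hC⟩ := (Submodule.mem_span_range_iff_exists_fun F).1 h
  refine ⟨C, fun x => ?_⟩
  have := congrFun hC x
  rw [Pi.single_apply] at this
  rw [← this]
  simp [Finset.sum_apply]

end Digits

/-! ### Polynomials in pairs of variables -/

section Poly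

open MvPolynomial

variable (k F : Type*) [Field k] [Field F]

/-- The polynomial ring in variables `x_{τ,s,j}`, for embeddings `τ : k → F`, slots `s` and
`j = 0, 1`. For fixed `τ` and `s`, the group `GL₂(k)` acts on the pair `x_{τ,s,0}, x_{τ,s,1}` as on
the standard representation, through `τ`. Slot `0` holds the main pair. Slot `1` is used to realise
projective covers, slot `2` for Frobenius twists, and slot `3` for tensor products with the adjoint
representation, which is `Sym²` up to a twist. -/
abbrev PairRing : Type _ := MvPolynomial ((k →+* F) × Fin 4 × Fin 2) F

variable {k F}

/-- The action of `GL₂(k)` on the polynomial ring by substitutions. -/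
def act (g : GL (Fin 2) k) : PairRing k F →ₐ[F] PairRing k F :=
  aeval fun i => ∑ j, C (i.1 (g j i.2.2)) * X (i.1, i.2.1, j)

/-- The action of `GL₂(k)` by linear maps. -/
def actEnd (g : GL (Fin 2) k) : Module.End F (PairRing k F) := (act g).toLinearMap

theorem act_X (g : GL (Fin 2) k) (τ : k →+* F) (s : Fin 4) (j : Fin 2) :
    act g (X (τ, s, j)) = C (τ (g 0 j)) * X (τ, s, 0) + C (τ (g 1 j)) * X (τ, s, 1) := by
  simp [act, Fin.sum_univ_two]

theorem act_C (g : GL (Fin 2) k) (r : F) : act g (C r : PairRing k F) = C r := by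
  simp [act, algebraMap_eq]

theorem act_mul (g h : GL (Fin 2) k) : act (F := F) (g * h) = (act g).comp (act h) := by
  ext ⟨τ, s, j⟩ : 1
  simp only [AlgHom.comp_apply, act_X, map_add, map_mul, act_C, Units.val_mul, Matrix.mul_apply,
    Fin.sum_univ_two]
  ring

theorem act_one : act (F := F) (1 : GL (Fin 2) k) = AlgHom.id F _ := by
  ext ⟨τ, s, j⟩ : 1
  rw [act_X]
  fin_cases j <;> simp

theorem act_mul_apply (g h : GL (Fin 2) k) (f : PairRing k F) : act (g * h) f = act g (act h f) := by
  rw [act_mul]; rfl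

theorem act_act_inv (g : GL (Fin 2) k) (f : PairRing k F) : act g (act g⁻¹ f) = f := by
  rw [← act_mul_apply, mul_inv_cancel, act_one]; rfl

/-- The multidegree: one grading for each pair of variables. -/
def pairDeg (i : (k →+* F) × Fin 4 × Fin 2) : (k →+* F) × Fin 4 → ℕ :=
  letI := Classical.decEq ((k →+* F) × Fin 4); Pi.single (i.1, i.2.1) 1

/-- Multihomogeneous polynomials. -/
abbrev Homog (d : (k →+* F) × Fin 4 → ℕ) : Submodule F (PairRing k F) :=
  weightedHomogeneousSubmodule F pairDeg d

theorem pderiv_comm (i j : (k →+* F) × Fin 4 × Fin 2) (f : PairRing k F) :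
    pderiv i (pderiv j f) = pderiv j (pderiv i f) := by
  classical
  have : ⁅(pderiv i : Derivation F (PairRing k F) (PairRing k F)),
      (pderiv j : Derivation F (PairRing k F) (PairRing k F))⁆ = 0 := by
    apply MvPolynomial.derivation_ext
    intro l
    simp [Derivation.commutator_apply, pderiv_X, Pi.single_apply, apply_ite]
  have h := congrArg (fun D => D f) this
  simpa [Derivation.commutator_apply, sub_eq_zero] using h

theorem pderiv_algHom {φ : PairRing k F →ₐ[F] PairRing k F} {i : (k →+* F) × Fin 4 × Fin 2}
    (hφ : ∀ j, pderiv i (φ (X j)) = φ (pderiv i (X j))) (f : PairRing k F) :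
    pderiv i (φ f) = φ (pderiv i f) := by
  induction f using MvPolynomial.induction_on with
  | C a => rw [← algebraMap_eq, AlgHom.commutes, algebraMap_eq, pderiv_C, map_zero]
  | add f g hf hg => simp only [map_add, hf, hg]
  | mul_X f j hf => simp only [map_mul, pderiv_mul, hf, hφ, map_add]

theorem pderiv_act (g : GL (Fin 2) k) (τ : k →+* F) (s : Fin 4) (i : Fin 2) (f : PairRing k F) :
    pderiv (τ, s, i) (act g f)
      = C (τ (g i 0)) * act g (pderiv (τ, s, 0) f) + C (τ (g i 1)) * act g (pderiv (τ, s, 1) f) := by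
  classical
  induction f using MvPolynomial.induction_on with
  | C a => simp
  | add f g hf hg => simp only [map_add, hf, hg]; ring
  | mul_X f j hf =>
    obtain ⟨τ', s', j⟩ := j
    have hX : pderiv (τ, s, i) (act g (X (τ', s', j) : PairRing k F))
        = C (τ (g i 0)) * act g (pderiv (τ, s, 0) (X (τ', s', j)))
          + C (τ (g i 1)) * act g (pderiv (τ, s, 1) (X (τ', s', j))) := by
      rw [act_X]
      by_cases hts : τ' = τ ∧ s' = s
      · obtain ⟨rfl, rfl⟩ := hts
        fin_cases i <;> fin_cases j <;>
          simp [pderiv_X]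
      · have h1 : ∀ a b : Fin 2, ((τ', s', a) : (k →+* F) × Fin 4 × Fin 2) ≠ (τ, s, b) := by
          intro a b h
          simp only [Prod.mk.injEq] at h
          exact hts ⟨h.1, h.2.1⟩
        simp [pderiv_X_of_ne (h1 _ _)]
    simp only [map_mul, pderiv_mul, hf, hX, map_add]
    ring

variable [Fintype (k →+* F)] {d d' : (k →+* F) × Fin 4 → ℕ} {f h : PairRing k F}

theorem weight_pairDeg (e : (k →+* F) × Fin 4 × Fin 2 →₀ ℕ) (τ : k →+* F) (s : Fin 4) :
    Finsupp.weight pairDeg e (τ, s) = e (τ, s, 0) + e (τ, s, 1) := by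
  classical
  rw [Finsupp.weight_apply, Finsupp.sum_fintype _ _ (by simp), Finset.sum_apply]
  rw [Fintype.sum_prod_type, Finset.sum_eq_single τ, Fintype.sum_prod_type, Finset.sum_eq_single s,
    Fin.sum_univ_two]
  · simp [pairDeg]
  · intro s' _ hs
    simp [pairDeg, Ne.symm hs]
  · simp
  · intro τ' _ hτ
    refine Finset.sum_eq_zero fun i _ => ?_
    simp [pairDeg, Ne.symm hτ]
  · simp

/-- Induction on multihomogeneous polynomials. -/
theorem Homog.induction {motive : PairRing k F → Prop} (hf : f ∈ Homog d) (zero : motive 0)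
    (add : ∀ f g, motive f → motive g → motive (f + g))
    (mono : ∀ (e : (k →+* F) × Fin 4 × Fin 2 →₀ ℕ) (r : F),
      (∀ τ s, e (τ, s, 0) + e (τ, s, 1) = d (τ, s)) → motive (monomial e r)) : motive f := by
  refine IsWeightedHomogeneous.induction_on (motive := fun p _ => motive p) zero
    (fun p q _ _ => add p q) (fun e r he => mono e r fun τ s => ?_) hf
  rw [← he, weight_pairDeg]

/-- The effect of an algebra homomorphism which is homogeneous on the variables. -/
theorem map_mem_homog {φ : PairRing k F →ₐ[F] PairRing k F}
    (u : (k →+* F) × Fin 4 → (k →+* F) × Fin 4 → ℕ)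
    (hφ : ∀ i, φ (X i) ∈ Homog (u (i.1, i.2.1))) (hf : f ∈ Homog d) :
    φ f ∈ Homog (∑ t, d t • u t) := by
  classical
  refine Homog.induction (motive := fun f => φ f ∈ Homog (∑ t, d t • u t)) hf (by simp)
    (fun f g hf hg => by rw [map_add]; exact add_mem hf hg)
    fun e r he => ?_
  rw [monomial_eq, map_mul, ← algebraMap_eq, AlgHom.commutes, algebraMap_eq,
    Finsupp.prod_fintype _ _ (by simp), map_prod]
  refine IsWeightedHomogeneous.C_mul ?_ r
  have := IsWeightedHomogeneous.prod (R := F) (w := pairDeg) Finset.univ (fun i => φ (X i) ^ e i)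
    (fun i => e i • u (i.1, i.2.1)) (fun i _ => IsWeightedHomogeneous.pow (hφ i) _)
  simp only [map_pow]
  convert this using 1
  rw [Fintype.sum_prod_type, Fintype.sum_prod_type]
  refine Finset.sum_congr rfl fun τ _ => ?_
  rw [Fintype.sum_prod_type]
  refine Finset.sum_congr rfl fun s _ => ?_
  rw [Fin.sum_univ_two, ← add_smul, he]

theorem sum_smul_single [DecidableEq ((k →+* F) × Fin 4)] :
    ∑ t, d t • (Pi.single t 1 : (k →+* F) × Fin 4 → ℕ) = d := by
  funext t
  simp [Finset.sum_apply, Pi.single_apply]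

theorem X_mem_homog [DecidableEq ((k →+* F) × Fin 4)] (τ : k →+* F) (s : Fin 4) (j : Fin 2) :
    (X (τ, s, j) : PairRing k F) ∈ Homog (Pi.single (τ, s) 1) := by
  have := isWeightedHomogeneous_X F (pairDeg (k := k) (F := F)) (τ, s, j)
  have h : pairDeg (τ, s, j) = Pi.single (τ, s) 1 := by
    rw [pairDeg]; congr; exact Subsingleton.elim _ _
  rwa [h] at this

theorem act_mem_homog (g : GL (Fin 2) k) (hf : f ∈ Homog d) : act g f ∈ Homog d := by
  classical
  have := map_mem_homog (φ := act g) (fun t => Pi.single t 1) (fun i => by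
    obtain ⟨τ, s, j⟩ := i
    rw [act_X]
    exact add_mem (IsWeightedHomogeneous.C_mul (X_mem_homog τ s 0) _)
      (IsWeightedHomogeneous.C_mul (X_mem_homog τ s 1) _)) hf
  rwa [sum_smul_single] at this

theorem stable_homog : Stable actEnd (Homog d) := fun g _ hv => act_mem_homog g hv

instance : FiniteDimensional F (Homog d) := by
  classical
  set S := {e : (k →+* F) × Fin 4 × Fin 2 →₀ ℕ |
    ∀ τ s, e (τ, s, 0) + e (τ, s, 1) = d (τ, s)} with hS
  have hfin : S.Finite := by
    refine (Set.finite_Iic (Finsupp.equivFunOnFinite.symm fun i => d (i.1, i.2.1) :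
      (k →+* F) × Fin 4 × Fin 2 →₀ ℕ)).subset ?_
    rintro e he ⟨τ, s, j⟩
    have h1 := he τ s
    have h2 : e (τ, s, j) ≤ d (τ, s) := by
      fin_cases j
      · simp; omega
      · simp; omega
    simpa using h2
  have := FiniteDimensional.span_of_finite F (hfin.image fun e => (monomial e 1 : PairRing k F))
  refine Submodule.finiteDimensional_of_le (S₂ := Submodule.span F
    ((fun e => (monomial e 1 : PairRing k F)) '' S)) fun f hf => ?_
  refine Homog.induction (motive := fun f => f ∈ Submodule.span F
    ((fun e => (monomial e 1 : PairRing k F)) '' S)) hf (zero_mem _) (fun _ _ => add_mem)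
    fun e r he => ?_
  rw [← mul_one r, ← smul_eq_mul, ← smul_monomial]
  exact Submodule.smul_mem _ _ (Submodule.subset_span ⟨e, he, rfl⟩)

theorem algHom_apply_eq_pow_mul {φ ψ : PairRing k F →ₐ[F] PairRing k F} {τ : k →+* F} {s : Fin 4}
    {y : PairRing k F} (h1 : ∀ j, φ (X (τ, s, j)) = y * ψ (X (τ, s, j)))
    (h2 : ∀ i, (i.1, i.2.1) ≠ (τ, s) → φ (X i) = ψ (X i)) (hf : f ∈ Homog d) :
    φ f = y ^ d (τ, s) * ψ f := by
  classical
  refine Homog.induction (motive := fun f => φ f = y ^ d (τ, s) * ψ f) hf (by simp)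
    (fun f g hf hg => by rw [map_add, map_add, hf, hg]; ring)
    fun e r he => ?_
  have key : ∀ i : (k →+* F) × Fin 4 × Fin 2,
      φ (X i) ^ e i = (if (i.1, i.2.1) = (τ, s) then y ^ e i else 1) * ψ (X i) ^ e i := by
    rintro ⟨τ', s', j⟩
    split_ifs with h
    · simp only [Prod.mk.injEq] at h
      obtain ⟨rfl, rfl⟩ := h
      rw [h1, mul_pow]
    · rw [h2 _ h, one_mul]
  rw [monomial_eq, map_mul, map_mul, ← algebraMap_eq, AlgHom.commutes, AlgHom.commutes,
    Finsupp.prod_fintype _ _ (by simp), map_prod, map_prod]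
  simp only [map_pow, key, Finset.prod_mul_distrib]
  have : ∏ i : (k →+* F) × Fin 4 × Fin 2, (if (i.1, i.2.1) = (τ, s) then y ^ e i else 1)
      = y ^ d (τ, s) := by
    rw [Fintype.prod_prod_type, Finset.prod_eq_single τ, Fintype.prod_prod_type,
      Finset.prod_eq_single s, Fin.prod_univ_two]
    · simp [← pow_add, he]
    · intro s' _ hs
      simp [hs]
    · simp
    · intro τ' _ hτ
      simp [hτ]
    · simp
  rw [this]; ring

theorem algHom_apply_eq_self {φ : PairRing k F →ₐ[F] PairRing k F} {t : (k →+* F) × Fin 4}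
    (h2 : ∀ i, (i.1, i.2.1) ≠ t → φ (X i) = X i) (ht : d t = 0) (hf : f ∈ Homog d) :
    φ f = f := by
  classical
  refine Homog.induction (motive := fun f => φ f = f) hf (by simp)
    (fun f g hf hg => by rw [map_add, hf, hg]) fun e r he => ?_
  rw [monomial_eq, map_mul, ← algebraMap_eq, AlgHom.commutes, Finsupp.prod_fintype _ _ (by simp),
    map_prod]
  congr 1
  refine Finset.prod_congr rfl fun i _ => ?_
  rw [map_pow]
  by_cases h : (i.1, i.2.1) = t
  · have h3 := he i.1 i.2.1
    rw [h, ht] at h3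
    have : e i = 0 := by
      obtain ⟨τ, s, j⟩ := i
      fin_cases j
      · simp at h3 ⊢; omega
      · simp at h3 ⊢; omega
    rw [this, pow_zero, pow_zero]
  · rw [h2 i h]

/-- Euler's identity. -/
theorem euler (hf : f ∈ Homog d) (τ : k →+* F) (s : Fin 4) :
    X (τ, s, 0) * pderiv (τ, s, 0) f + X (τ, s, 1) * pderiv (τ, s, 1) f = (d (τ, s) : F) • f := by
  refine Homog.induction (motive := fun f => X (τ, s, 0) * pderiv (τ, s, 0) f
    + X (τ, s, 1) * pderiv (τ, s, 1) f = (d (τ, s) : F) • f) hf (by simp) (fun f g hf hg => by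
    rw [smul_add, ← hf, ← hg, map_add, map_add]; ring) fun e r he => ?_
  rw [X_mul_pderiv_monomial, X_mul_pderiv_monomial, ← add_smul, he, Nat.cast_smul_eq_nsmul]

end Poly

/-! ### The invariant `Δ`, Cayley's operator and polarisation -/

section Operators

open MvPolynomial

variable {k F : Type*} [Field k] [Field F]

/-- The determinant `Δ` of the main pair of variables and the pair in slot `s`. -/
def cross (τ : k →+* F) (s : Fin 4) : PairRing k F :=
  X (τ, 0, 0) * X (τ, s, 1) - X (τ, 0, 1) * X (τ, s, 0)

/-- Cayley's operator, the determinant of the partial derivatives with respect to the main pair and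
to the pair in slot `s`. -/
def cayley (τ : k →+* F) (s : Fin 4) : Module.End F (PairRing k F) :=
  (pderiv (τ, 0, 0)).toLinearMap ∘ₗ (pderiv (τ, s, 1)).toLinearMap
    - (pderiv (τ, 0, 1)).toLinearMap ∘ₗ (pderiv (τ, s, 0)).toLinearMap

theorem cayley_apply (τ : k →+* F) (s : Fin 4) (f : PairRing k F) :
    cayley τ s f = pderiv (τ, 0, 0) (pderiv (τ, s, 1) f) - pderiv (τ, 0, 1) (pderiv (τ, s, 0) f) :=
  rfl

theorem act_cross (g : GL (Fin 2) k) (τ : k →+* F) (s : Fin 4) :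
    act g (cross τ s) = C (τ (Matrix.det (g : Matrix (Fin 2) (Fin 2) k))) * cross τ s := by
  simp only [cross, map_sub, map_mul, act_X, Matrix.det_fin_two]
  ring

theorem cayley_act (g : GL (Fin 2) k) (τ : k →+* F) (s : Fin 4) (f : PairRing k F) :
    cayley τ s (act g f) = τ (Matrix.det (g : Matrix (Fin 2) (Fin 2) k)) • act g (cayley τ s f) := by
  have h : pderiv (τ, 0, 1) (pderiv (τ, s, 0) f) = pderiv (τ, s, 0) (pderiv (τ, 0, 1) f) :=
    pderiv_comm _ _ _
  simp only [cayley_apply, pderiv_act, pderiv_C_mul, map_add, smul_eq_C_mul, map_sub,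
    Matrix.det_fin_two, map_mul]
  ring

theorem det_ne_zero (g : GL (Fin 2) k) (τ : k →+* F) :
    τ (Matrix.det (g : Matrix (Fin 2) (Fin 2) k)) ≠ 0 := by
  rw [Ne, map_eq_zero]
  exact (Matrix.isUnit_iff_isUnit_det _).1 g.isUnit |>.ne_zero

theorem semiEquivariant_cayley (τ : k →+* F) (s : Fin 4) :
    SemiEquivariant (V := PairRing k F) actEnd actEnd (cayley τ s) :=
  ⟨fun g => τ (Matrix.det (g : Matrix (Fin 2) (Fin 2) k)), fun g => det_ne_zero g τ,
    fun g f => cayley_act g τ s f⟩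

/-- Multiplication by `Δ`. -/
def mulCross (τ : k →+* F) (s : Fin 4) : Module.End F (PairRing k F) :=
  LinearMap.mulLeft F (cross τ s)

theorem mulCross_pow_apply (τ : k →+* F) (s : Fin 4) (n : ℕ) (f : PairRing k F) :
    (mulCross τ s ^ n) f = cross τ s ^ n * f := by
  rw [mulCross, LinearMap.pow_mulLeft, LinearMap.mulLeft_apply]

theorem semiEquivariant_mulCross (τ : k →+* F) (s : Fin 4) :
    SemiEquivariant (V := PairRing k F) actEnd actEnd (mulCross τ s) := by
  refine ⟨fun g => (τ (Matrix.det (g : Matrix (Fin 2) (Fin 2) k)))⁻¹,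
    fun g => inv_ne_zero (det_ne_zero g τ), fun g f => ?_⟩
  change cross τ s * act g f = _ • act g (cross τ s * f)
  rw [map_mul, act_cross, ← smul_eq_C_mul, smul_mul_assoc, smul_smul,
    inv_mul_cancel₀ (det_ne_zero g τ), one_smul]

section Merge

variable [DecidableEq (k →+* F)]

/-- Substitution of one pair of variables for another. -/
def slotMap (t t' : (k →+* F) × Fin 4) : PairRing k F →ₐ[F] PairRing k F :=
  aeval fun i => if (i.1, i.2.1) = t then X (t'.1, t'.2, i.2.2) else X i

/-- Specialisation of the pair in slot `s` to the main pair. -/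
def merge (τ : k →+* F) (s : Fin 4) : PairRing k F →ₐ[F] PairRing k F :=
  slotMap (τ, s) (τ, 0)

theorem merge_X (τ : k →+* F) (s : Fin 4) (j : Fin 2) :
    merge τ s (X (τ, s, j) : PairRing k F) = X (τ, 0, j) := by simp [merge, slotMap]

theorem merge_X_of_ne {τ : k →+* F} {s : Fin 4} {i : (k →+* F) × Fin 4 × Fin 2}
    (h : (i.1, i.2.1) ≠ (τ, s)) : merge τ s (X i : PairRing k F) = X i := by
  simp only [merge, slotMap, aeval_X, if_neg h]

theorem merge_act (g : GL (Fin 2) k) (τ : k →+* F) (s : Fin 4) (f : PairRing k F) :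
    merge τ s (act g f) = act g (merge τ s f) := by
  have key : (merge τ s).comp (act g) = (act g).comp (merge τ s : PairRing k F →ₐ[F] _) := by
    refine algHom_ext fun i => ?_
    obtain ⟨τ', s', j⟩ := i
    rw [AlgHom.comp_apply, AlgHom.comp_apply, act_X, map_add, map_mul, map_mul, algHom_C, algHom_C,
      algebraMap_eq]
    by_cases h : (τ', s') = (τ, s)
    · simp only [Prod.mk.injEq] at h
      obtain ⟨rfl, rfl⟩ := h
      rw [merge_X, merge_X, merge_X, act_X]
    · rw [merge_X_of_ne (i := (τ', s', _)) h, merge_X_of_ne (i := (τ', s', _)) h,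
        merge_X_of_ne (i := (τ', s', _)) h, act_X]
  exact DFunLike.congr_fun key f

theorem semiEquivariant_merge (τ : k →+* F) (s : Fin 4) :
    SemiEquivariant (V := PairRing k F) actEnd actEnd (merge τ s).toLinearMap :=
  ⟨fun _ => 1, fun _ => one_ne_zero, fun g f => by rw [one_smul]; exact merge_act g τ s f⟩

/-- Merging kills `Δ`; by `cross_dvd_of_merge_eq_zero` its kernel is generated by `Δ`. -/
theorem merge_cross (τ : k →+* F) {s : Fin 4} (hs : s ≠ 0) :
    merge τ s (cross τ s : PairRing k F) = 0 := by
  have h : ∀ j : Fin 2, merge τ s (X (τ, 0, j) : PairRing k F) = X (τ, 0, j) := fun j =>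
    merge_X_of_ne (by simp [hs.symm])
  rw [cross, map_sub, map_mul, map_mul, merge_X, merge_X, h, h]
  ring

end Merge

theorem X_ne {i j : (k →+* F) × Fin 4 × Fin 2} (h : i ≠ j) :
    pderiv i (X j : PairRing k F) = 0 := pderiv_X_of_ne h.symm

theorem pderiv_cross (τ : k →+* F) {s : Fin 4} (hs : s ≠ 0) :
    pderiv (τ, 0, 0) (cross τ s : PairRing k F) = X (τ, s, 1) ∧
    pderiv (τ, 0, 1) (cross τ s : PairRing k F) = -X (τ, s, 0) ∧
    pderiv (τ, s, 0) (cross τ s : PairRing k F) = -X (τ, 0, 1) ∧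
    pderiv (τ, s, 1) (cross τ s : PairRing k F) = X (τ, 0, 0) := by
  have h : ∀ a b : Fin 2, pderiv (τ, 0, a) (X (τ, s, b) : PairRing k F) = 0 := fun a b =>
    X_ne (by simp [hs.symm])
  have h' : ∀ a b : Fin 2, pderiv (τ, s, a) (X (τ, 0, b) : PairRing k F) = 0 := fun a b =>
    X_ne (by simp [hs])
  have h1 : ∀ (s : Fin 4), pderiv (τ, s, 0) (X (τ, s, 1) : PairRing k F) = 0 := fun s =>
    X_ne (by simp)
  have h2 : ∀ (s : Fin 4), pderiv (τ, s, 1) (X (τ, s, 0) : PairRing k F) = 0 := fun s =>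
    X_ne (by simp)
  refine ⟨?_, ?_, ?_, ?_⟩ <;>
    simp only [cross, map_sub, pderiv_mul, h, h', h1, h2, pderiv_X_self] <;> ring

theorem cross_ne_zero (τ : k →+* F) {s : Fin 4} (hs : s ≠ 0) : (cross τ s : PairRing k F) ≠ 0 := by
  intro h
  have := (pderiv_cross τ hs).1
  rw [h, map_zero] at this
  exact X_ne_zero _ this.symm

variable [Fintype (k →+* F)] [DecidableEq (k →+* F)] {c d : (k →+* F) × Fin 4 → ℕ}
  {f h : PairRing k F} {τ : k →+* F} {s : Fin 4} {t : (k →+* F) × Fin 4} {a b n : ℕ}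

theorem X_mul_mem (hf : f ∈ Homog (Function.update c t a)) (j : Fin 2) :
    X (t.1, t.2, j) * f ∈ Homog (Function.update c t (a + 1)) := by
  have := IsWeightedHomogeneous.mul (X_mem_homog (F := F) t.1 t.2 j) hf
  have e : Function.update c t (a + 1) = Pi.single (t.1, t.2) 1 + Function.update c t a := by
    funext t'
    by_cases h : t' = t
    · subst h; simp [add_comm]
    · simp [h]
  rw [e]
  exact this

theorem pderiv_mem (hf : f ∈ Homog (Function.update c t (a + 1))) (j : Fin 2) :
    pderiv (t.1, t.2, j) f ∈ Homog (Function.update c t a) := by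
  refine IsWeightedHomogeneous.pderiv hf ?_
  have h : pairDeg (t.1, t.2, j) = Pi.single t 1 := by
    rw [pairDeg]; congr; exact Subsingleton.elim _ _
  rw [h]
  funext t'
  by_cases h : t' = t
  · subst h; simp
  · simp [h]

theorem pderiv_eq_zero (hf : f ∈ Homog d) (ht : d t = 0) (j : Fin 2) :
    pderiv (t.1, t.2, j) f = 0 := by
  refine Homog.induction (motive := fun f => pderiv (t.1, t.2, j) f = 0) hf (map_zero _)
    (fun f g hf hg => by rw [map_add, hf, hg, add_zero]) fun e r he => ?_
  have h := he t.1 t.2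
  rw [Prod.mk.eta, ht] at h
  have : e (t.1, t.2, j) = 0 := by
    fin_cases j
    · simp at h ⊢; omega
    · simp at h ⊢; omega
  rw [pderiv_monomial, this]
  simp

/-- The multidegree `c`, modified to be `a` and `b` on the main pair and the pair `s` at `τ`. -/
def wt (c : (k →+* F) × Fin 4 → ℕ) (τ : k →+* F) (s : Fin 4) (a b : ℕ) : (k →+* F) × Fin 4 → ℕ :=
  Function.update (Function.update c (τ, 0) a) (τ, s) b

theorem wt_zero (hs : s ≠ 0) : wt c τ s a b (τ, 0) = a := by
  simp [wt, hs.symm]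

theorem wt_self : wt c τ s a b (τ, s) = b := by
  simp [wt]

theorem wt_other (h : t ≠ (τ, 0)) (h' : t ≠ (τ, s)) : wt c τ s a b t = c t := by
  simp [wt, h, h']

theorem wt_eta (c : (k →+* F) × Fin 4 → ℕ) (τ : k →+* F) (s : Fin 4) :
    wt c τ s (c (τ, 0)) (c (τ, s)) = c := by
  simp [wt]

theorem wt_eq (hs : s ≠ 0) : wt c τ s a b = Function.update (Function.update c (τ, s) b) (τ, 0) a :=
  Function.update_comm (by simp [hs.symm]) _ _ _

theorem X0_mul_mem (hs : s ≠ 0) (hf : f ∈ Homog (wt c τ s a b)) (j : Fin 2) :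
    X (τ, 0, j) * f ∈ Homog (wt c τ s (a + 1) b) := by
  rw [wt_eq hs] at hf ⊢
  exact X_mul_mem hf j

theorem Xs_mul_mem (hf : f ∈ Homog (wt c τ s a b)) (j : Fin 2) :
    X (τ, s, j) * f ∈ Homog (wt c τ s a (b + 1)) := X_mul_mem hf j

theorem pderiv0_mem (hs : s ≠ 0) (hf : f ∈ Homog (wt c τ s (a + 1) b)) (j : Fin 2) :
    pderiv (τ, 0, j) f ∈ Homog (wt c τ s a b) := by
  rw [wt_eq hs] at hf ⊢
  exact pderiv_mem hf j

theorem pderivs_mem (hf : f ∈ Homog (wt c τ s a (b + 1))) (j : Fin 2) :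
    pderiv (τ, s, j) f ∈ Homog (wt c τ s a b) := pderiv_mem hf j

theorem cross_mul_mem (hs : s ≠ 0) (hf : f ∈ Homog (wt c τ s a b)) :
    cross τ s * f ∈ Homog (wt c τ s (a + 1) (b + 1)) := by
  rw [cross, sub_mul, mul_assoc, mul_assoc]
  exact sub_mem (X0_mul_mem hs (Xs_mul_mem hf _) _) (X0_mul_mem hs (Xs_mul_mem hf _) _)

theorem cross_pow_mul_mem (hs : s ≠ 0) (hf : f ∈ Homog (wt c τ s a b)) :
    cross τ s ^ n * f ∈ Homog (wt c τ s (a + n) (b + n)) := by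
  induction n with
  | zero => simpa using hf
  | succ n ih => rw [pow_succ', mul_assoc]; exact cross_mul_mem hs ih

theorem cayley_mem (hs : s ≠ 0) (hf : f ∈ Homog (wt c τ s (a + 1) (b + 1))) :
    cayley τ s f ∈ Homog (wt c τ s a b) :=
  sub_mem (pderiv0_mem hs (pderivs_mem hf _) _) (pderiv0_mem hs (pderivs_mem hf _) _)

theorem cayley_eq_zero (hf : f ∈ Homog (wt c τ s a 0)) : cayley τ s f = 0 := by
  rw [cayley_apply, pderiv_eq_zero (t := (τ, s)) hf wt_self, pderiv_eq_zero (t := (τ, s)) hf wt_self,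
    map_zero, map_zero, sub_zero]

theorem cayley_pow_mem (hs : s ≠ 0) (hf : f ∈ Homog (wt c τ s (a + n) (b + n))) :
    (cayley τ s ^ n) f ∈ Homog (wt c τ s a b) := by
  induction n generalizing f with
  | zero => simpa using hf
  | succ n ih => rw [pow_succ]; exact ih (cayley_mem hs hf)

/-- The commutation relation of `Δ` and Cayley's operator on forms of bidegree `(a, b)`. -/
theorem cayley_cross_mul (hs : s ≠ 0) (hf : f ∈ Homog (wt c τ s a b)) :
    cayley τ s (cross τ s * f) = cross τ s * cayley τ s f + ((a + b + 2 : ℕ) : F) • f := by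
  obtain ⟨h1, h2, h3, h4⟩ := pderiv_cross (F := F) τ hs
  have e1 := euler hf τ 0
  have e2 := euler hf τ s
  rw [wt_zero hs] at e1
  rw [wt_self] at e2
  have h : ∀ a b : Fin 2, pderiv (τ, 0, a) (X (τ, s, b) : PairRing k F) = 0 := fun a b =>
    X_ne (by simp [hs.symm])
  have h' : ∀ a b : Fin 2, pderiv (τ, s, a) (X (τ, 0, b) : PairRing k F) = 0 := fun a b =>
    X_ne (by simp [hs])
  simp only [cayley_apply, pderiv_mul, h1, h2, h3, h4, map_add, pderiv_X_self, map_neg]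
  rw [smul_eq_C_mul] at e1 e2 ⊢
  push_cast
  simp only [map_add, map_natCast] at e1 e2 ⊢
  have e3 : (C 2 : PairRing k F) = 2 := map_ofNat _ _
  linear_combination e1 + e2 - f * e3

theorem cayley_cross_pow_mul (hs : s ≠ 0) (hf : f ∈ Homog (wt c τ s a b)) :
    cayley τ s (cross τ s ^ (n + 1) * f) = cross τ s ^ (n + 1) * cayley τ s f
      + (((n + 1) * (a + b + n + 2) : ℕ) : F) • (cross τ s ^ n * f) := by
  induction n with
  | zero => simp [cayley_cross_mul hs hf]
  | succ n ih =>
    rw [pow_succ', mul_assoc, cayley_cross_mul hs (cross_pow_mul_mem hs hf), ih, mul_add,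
      mul_smul_comm, ← mul_assoc, ← pow_succ', ← mul_assoc, ← pow_succ', add_assoc, ← add_smul]
    congr 2
    push_cast
    ring

/-! ### Divisibility by `Δ` -/

/-- A homogeneous multiple of a homogeneous polynomial is a multiple by a homogeneous one. -/
theorem exists_homog_mul {y : PairRing k F} {d' : (k →+* F) × Fin 4 → ℕ} (hy : y ∈ Homog d')
    (hf : f ∈ Homog (d' + d)) (hyf : y ∣ f) : ∃ g ∈ Homog d, f = y * g := by
  classical
  obtain ⟨q, rfl⟩ := hyf
  refine ⟨_, weightedHomogeneousComponent_mem pairDeg q d, ?_⟩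
  let _ := weightedGradedAlgebra F (pairDeg (k := k) (F := F))
  have h := DirectSum.coe_decompose_mul_add_of_left_mem
    (weightedHomogeneousSubmodule F (pairDeg (k := k) (F := F))) (b := q) (j := d) hy
  have h2 := DirectSum.decompose_of_mem_same
    (weightedHomogeneousSubmodule F (pairDeg (k := k) (F := F))) hf
  rw [h2] at h
  rw [h]
  congr 1
  exact decompose'_apply _ _ _ _

theorem X_not_dvd_cross (hs : s ≠ 0) : ¬ (X (τ, 0, 0) : PairRing k F) ∣ cross τ s := by
  intro h
  have h1 : (X (τ, 0, 0) : PairRing k F) ∣ X (τ, 0, 1) * X (τ, s, 0) := by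
    have := dvd_sub (Dvd.intro (X (τ, s, 1)) rfl : (X (τ, 0, 0) : PairRing k F) ∣ _) h
    simpa [cross] using this
  rw [X_dvd_mul_iff, X_dvd_X, X_dvd_X] at h1
  simp [hs.symm] at h1

theorem cross_dvd_of_dvd_X_pow_mul (hs : s ≠ 0) (h : cross τ s ∣ X (τ, 0, 0) ^ n * f) :
    cross τ s ∣ f := by
  induction n with
  | zero => simpa using h
  | succ n ih =>
    apply ih
    rw [pow_succ', mul_assoc] at h
    obtain ⟨q, hq⟩ := h
    have h1 : (X (τ, 0, 0) : PairRing k F) ∣ cross τ s * q := ⟨_, hq.symm⟩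
    rw [X_dvd_mul_iff] at h1
    obtain ⟨q', rfl⟩ := h1.resolve_left (X_not_dvd_cross hs)
    refine ⟨q', mul_left_cancel₀ (X_ne_zero (τ, (0 : Fin 4), (0 : Fin 2))) (hq.trans ?_)⟩
    ring

/-- Modulo `Δ`, the pairs `X` and `Z` are proportional, so that `X₀ⁿ f(X, Z) ≡ Z₀ⁿ f(X, X)` if `f` has degree `n`
in `Z`. -/
theorem cross_dvd_of_merge_eq_zero (hs : s ≠ 0) (hf : f ∈ Homog d) (h : merge τ s f = 0) :
    cross τ s ∣ f := by
  let φ₁ : PairRing k F →ₐ[F] PairRing k F :=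
    aeval fun i => if (i.1, i.2.1) = (τ, s) then X (τ, 0, 0) * X i else X i
  let φ₂ : PairRing k F →ₐ[F] PairRing k F :=
    aeval fun i => if (i.1, i.2.1) = (τ, s) then X (τ, s, 0) * X (τ, 0, i.2.2) else X i
  have h1 : φ₁ f = X (τ, 0, 0) ^ d (τ, s) * (AlgHom.id F _) f :=
    algHom_apply_eq_pow_mul (fun j => by simp [φ₁]) (fun i hi => by
      simp only [φ₁, aeval_X, if_neg hi, AlgHom.id_apply]) hf
  have h2 : φ₂ f = X (τ, s, 0) ^ d (τ, s) * merge τ s f :=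
    algHom_apply_eq_pow_mul (fun j => by rw [merge_X]; simp [φ₂]) (fun i hi => by
      rw [merge_X_of_ne hi]; simp only [φ₂, aeval_X, if_neg hi]) hf
  have h3 : (Ideal.Quotient.mkₐ F (Ideal.span {(cross τ s : PairRing k F)})).comp φ₁
      = (Ideal.Quotient.mkₐ F (Ideal.span {cross τ s})).comp φ₂ := by
    ext i : 1
    obtain ⟨τ', s', j⟩ := i
    simp only [AlgHom.comp_apply, φ₁, φ₂, aeval_X, Ideal.Quotient.mkₐ_eq_mk]
    split_ifs with hi
    · simp only [Prod.mk.injEq] at hi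
      obtain ⟨rfl, rfl⟩ := hi
      rw [Ideal.Quotient.eq, Ideal.mem_span_singleton]
      fin_cases j
      · simp [mul_comm]
      · rw [cross, Fin.mk_one, mul_comm (X (τ', 0, 1))]
    · rfl
  have h4 := DFunLike.congr_fun h3 f
  rw [AlgHom.comp_apply, AlgHom.comp_apply, h1, h2, h, mul_zero, map_zero,
    Ideal.Quotient.mkₐ_eq_mk, Ideal.Quotient.eq_zero_iff_mem, Ideal.mem_span_singleton] at h4
  exact cross_dvd_of_dvd_X_pow_mul hs h4

theorem cross_mem (hs : s ≠ 0) : (cross τ s : PairRing k F) ∈ Homog (wt 0 τ s 1 1) := by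
  have : (1 : PairRing k F) ∈ Homog (wt 0 τ s 0 0) := by
    have h : wt (0 : (k →+* F) × Fin 4 → ℕ) τ s 0 0 = 0 := by
      have := wt_eta (0 : (k →+* F) × Fin 4 → ℕ) τ s
      simpa using this
    rw [h]
    exact isWeightedHomogeneous_one F _
  simpa using cross_mul_mem hs this

theorem wt_add (hs : s ≠ 0) : wt 0 τ s 1 1 + wt c τ s a b = wt c τ s (a + 1) (b + 1) := by
  funext t
  by_cases h : t = (τ, 0)
  · subst h; simp [wt_zero hs, add_comm]
  by_cases h' : t = (τ, s)
  · subst h'; simp [wt_self, add_comm]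
  simp [wt_other h h']

/-- The leading term of a nonzero polynomial with respect to `Δ`. -/
theorem exists_cross_pow_mul (hs : s ≠ 0) (hf : f ∈ Homog (wt c τ s a b)) (hf0 : f ≠ 0) :
    ∃ n a' b' h, a = a' + n ∧ b = b' + n ∧ h ∈ Homog (wt c τ s a' b') ∧ f = cross τ s ^ n * h ∧
      merge τ s h ≠ 0 := by
  induction b generalizing a f with
  | zero =>
    refine ⟨0, a, 0, f, rfl, rfl, hf, by simp, ?_⟩
    rwa [algHom_apply_eq_self (t := (τ, s)) (fun i hi => merge_X_of_ne hi) wt_self hf]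
  | succ b ih =>
    by_cases h : merge τ s f = 0
    · have hdvd := cross_dvd_of_merge_eq_zero hs hf h
      cases a with
      | zero =>
        exfalso
        let φ : PairRing k F →ₐ[F] PairRing k F :=
          aeval fun i => if (i.1, i.2.1) = (τ, 0) then 0 else X i
        have h1 : φ f = f := algHom_apply_eq_self (t := (τ, 0)) (fun i hi => by
          simp only [φ, aeval_X, if_neg hi]) (wt_zero hs) hf
        obtain ⟨q, rfl⟩ := hdvd
        apply hf0
        rw [← h1, map_mul]
        simp [cross, φ]
      | succ a =>
        rw [← wt_add hs] at hf
        obtain ⟨g, hg, rfl⟩ := exists_homog_mul (cross_mem hs) hf hdvd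
        obtain ⟨n, a', b', h', rfl, rfl, hh, rfl, hm⟩ := ih hg (right_ne_zero_of_mul hf0)
        exact ⟨n + 1, a', b', h', rfl, rfl, hh, by ring, hm⟩
    · exact ⟨0, a, b + 1, f, rfl, rfl, hf, by simp, h⟩

theorem slotMap_mem {t t' : (k →+* F) × Fin 4} (ht : t ≠ t') (hf : f ∈ Homog d) :
    slotMap t t' f ∈ Homog (Function.update (Function.update d t' (d t' + d t)) t 0) := by
  have := map_mem_homog (φ := slotMap t t') (fun t₁ => if t₁ = t then Pi.single t' 1
    else Pi.single t₁ 1) (fun i => by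
      by_cases h : (i.1, i.2.1) = t
      · simp only [slotMap, aeval_X, if_pos h]
        exact X_mem_homog _ _ _
      · simp only [slotMap, aeval_X, if_neg h]
        exact X_mem_homog _ _ _) hf
  refine Eq.subst (motive := fun d => slotMap t t' f ∈ Homog d) (funext fun t₁ => ?_) this
  rw [Finset.sum_apply]
  by_cases h : t₁ = t'
  · subst h
    rw [← Finset.sum_subset (Finset.subset_univ {t₁, t}), Finset.sum_pair ht.symm]
    · simp [ht.symm]
    · intro t₂ _ ht₂
      simp only [Finset.mem_insert, Finset.mem_singleton, not_or] at ht₂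
      simp [ht₂.2, Ne.symm ht₂.1]
  by_cases h' : t₁ = t
  · subst h'
    rw [Function.update_self, Finset.sum_eq_zero]
    intro t₂ _
    split_ifs with h'
    · simp [ht]
    · simp [Ne.symm h']
  rw [Finset.sum_eq_single t₁]
  · simp [h, h']
  · intro t₂ _ ht₂
    split_ifs with h''
    · simp [h]
    · simp [Ne.symm ht₂]
  · simp

theorem merge_mem (hs : s ≠ 0) (hf : f ∈ Homog (wt c τ s a b)) :
    merge τ s f ∈ Homog (wt c τ s (a + b) 0) := by
  have := slotMap_mem (t := (τ, s)) (t' := (τ, 0)) (by simp [hs]) hf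
  rw [wt_zero hs, wt_self] at this
  refine Eq.subst (motive := fun d => merge τ s f ∈ Homog d) ?_ this
  funext t
  simp only [wt, Function.update_apply]
  split_ifs <;> rfl

end Operators

/-! ### Simplicity of restricted symmetric powers -/

section Irreducible

open MvPolynomial

variable {k F : Type*} [Field k] [Field F]

/-- The upper triangular unipotent matrix with entry `x`. -/
def unip (x : k) : GL (Fin 2) k where
  val := !![1, x; 0, 1]
  inv := !![1, -x; 0, 1]
  val_inv := by simp [Matrix.one_fin_two]
  inv_val := by simp [Matrix.one_fin_two]

/-- The permutation matrix exchanging the two coordinates. -/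
def weyl : GL (Fin 2) k where
  val := !![0, 1; 1, 0]
  inv := !![0, 1; 1, 0]
  val_inv := by simp [Matrix.one_fin_two]
  inv_val := by simp [Matrix.one_fin_two]

theorem act_unip_X0 (x : k) (τ : k →+* F) (s : Fin 4) :
    act (unip x) (X (τ, s, 0)) = X (τ, s, 0) := by
  simp [act_X, unip]

theorem act_unip_X1 (x : k) (τ : k →+* F) (s : Fin 4) :
    act (unip x) (X (τ, s, 1)) = C (τ x) * X (τ, s, 0) + X (τ, s, 1) := by
  simp [act_X, unip]

theorem act_weyl_X0 (τ : k →+* F) (s : Fin 4) :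
    act (weyl : GL (Fin 2) k) (X (τ, s, 0)) = X (τ, s, 1) := by
  simp [act_X, weyl]

theorem act_weyl_X1 (τ : k →+* F) (s : Fin 4) :
    act (weyl : GL (Fin 2) k) (X (τ, s, 1)) = X (τ, s, 0) := by
  simp [act_X, weyl]

/-- The multidegree `n` in the main variables. -/
def mainDeg (n : (k →+* F) → ℕ) (t : (k →+* F) × Fin 4) : ℕ := if t.2 = 0 then n t.1 else 0

variable [Fintype (k →+* F)]

/-- The monomial of degree `n` in the main variables, of degree `b` in the second ones. -/
def mon (n b : (k →+* F) → ℕ) : PairRing k F :=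
  ∏ τ, (X (τ, 0, 0) ^ (n τ - b τ) * X (τ, 0, 1) ^ b τ)

variable {n b b₀ : (k →+* F) → ℕ} {f : PairRing k F}

theorem mon_ne_zero : (mon n b : PairRing k F) ≠ 0 :=
  Finset.prod_ne_zero_iff.2 fun _ _ => mul_ne_zero (pow_ne_zero _ (X_ne_zero _))
    (pow_ne_zero _ (X_ne_zero _))

theorem act_weyl_mon (hb : b ≤ n) : act weyl (mon n b : PairRing k F) = mon n (n - b) := by
  simp only [mon, map_prod, map_mul, map_pow, act_weyl_X0, act_weyl_X1]
  refine Finset.prod_congr rfl fun τ _ => ?_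
  rw [Pi.sub_apply, Nat.sub_sub_self (hb τ), mul_comm]

/-- The monomials are parametrised by a finite set. -/
abbrev boxBelow [DecidableEq (k →+* F)] (n : (k →+* F) → ℕ) : Finset ((k →+* F) → ℕ) :=
  Fintype.piFinset fun τ => Finset.range (n τ + 1)

theorem mem_boxBelow [DecidableEq (k →+* F)] : b ∈ boxBelow n ↔ b ≤ n := by
  simp [boxBelow, Fintype.mem_piFinset, Pi.le_def]

theorem exists_eq_sum_mon [DecidableEq (k →+* F)] (hf : f ∈ Homog (mainDeg n)) :
    ∃ c : ((k →+* F) → ℕ) → F, f = ∑ b ∈ boxBelow n, c b • mon n b := by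
  refine Homog.induction (motive := fun f => ∃ c : ((k →+* F) → ℕ) → F,
    f = ∑ b ∈ boxBelow n, c b • mon n b) hf ⟨0, by simp⟩ ?_ ?_
  · rintro _ _ ⟨c, rfl⟩ ⟨c', rfl⟩
    exact ⟨c + c', by simp [add_smul, Finset.sum_add_distrib]⟩
  · intro e r he
    have he0 : ∀ τ, e (τ, 0, 0) + e (τ, 0, 1) = n τ := fun τ => by rw [he]; simp [mainDeg]
    have hes : ∀ τ s, s ≠ 0 → e (τ, s, 0) = 0 ∧ e (τ, s, 1) = 0 := fun τ s hs => by
      have := he τ s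
      simp only [mainDeg, if_neg hs] at this
      omega
    refine ⟨Pi.single (fun τ => e (τ, 0, 1)) r, ?_⟩
    rw [Finset.sum_eq_single (fun τ => e (τ, 0, 1))]
    · rw [Pi.single_eq_same, smul_eq_C_mul, monomial_eq, mon]
      congr 1
      rw [Finsupp.prod_fintype _ _ (by simp), Fintype.prod_prod_type]
      refine Finset.prod_congr rfl fun τ _ => ?_
      rw [Fintype.prod_prod_type, Finset.prod_eq_single 0]
      · rw [Fin.prod_univ_two, ← he0, Nat.add_sub_cancel]
      · intro s _ hs
        rw [Fin.prod_univ_two, (hes τ s hs).1, (hes τ s hs).2, pow_zero, pow_zero, one_mul]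
      · simp
    · intro b _ hb
      rw [Pi.single_eq_of_ne hb, zero_smul]
    · intro h
      refine absurd (mem_boxBelow.2 fun τ => ?_) h
      have := he0 τ
      change e (τ, 0, 1) ≤ n τ
      omega

theorem act_unip_mon [DecidableEq (k →+* F)] (hb : b ≤ n) (x : k) : act (unip x) (mon n b) =
    ∑ i ∈ boxBelow b, (digitFun i x * ∏ τ, ((b τ).choose (i τ) : F)) • mon n (b - i) := by
  simp only [mon, map_prod, map_mul, map_pow, act_unip_X0, act_unip_X1, add_pow, Finset.mul_sum]
  rw [Finset.prod_univ_sum]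
  refine Finset.sum_congr rfl fun i hi => ?_
  rw [mem_boxBelow] at hi
  rw [smul_eq_C_mul, digitFun, map_mul, map_prod, map_prod, ← Finset.prod_mul_distrib,
    ← Finset.prod_mul_distrib]
  refine Finset.prod_congr rfl fun τ _ => ?_
  have h1 : i τ ≤ b τ := hi τ
  have h2 : b τ ≤ n τ := hb τ
  rw [Pi.sub_apply, show n τ - (b τ - i τ) = n τ - b τ + i τ by omega, pow_add, mul_pow,
    map_pow, map_natCast]
  ring

variable (p : ℕ) [Fact p.Prime] [CharP k p] [CharP F p] [Fintype k] [Finite F]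
  [Nonempty (k →+* F)]

theorem extract_mon [DecidableEq (k →+* F)] {c : k → F}
    (hc : ∀ b : (k →+* F) → ℕ, (∀ τ, b τ < p) → ∑ x, c x * digitFun b x = if b = b₀ then 1 else 0)
    (hn : ∀ τ, n τ < p) (hb : b ≤ n) : ∑ x, c x • act (unip x) (mon n b) =
      if ∀ τ, b₀ τ ≤ b τ then (∏ τ, ((b τ).choose (b₀ τ) : F)) • mon n (b - b₀) else 0 := by
  simp only [act_unip_mon hb, Finset.smul_sum]
  rw [Finset.sum_comm]
  have : ∀ i ∈ boxBelow b, ∑ x, c x • (digitFun i x * ∏ τ, ((b τ).choose (i τ) : F)) • mon n (b - i)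
      = if i = b₀ then (∏ τ, ((b τ).choose (b₀ τ) : F)) • mon n (b - b₀) else 0 := by
    intro i hi
    rw [mem_boxBelow] at hi
    have h := hc i fun τ => ((hi τ).trans (hb τ)).trans_lt (hn τ)
    simp only [smul_smul, ← mul_assoc]
    rw [← Finset.sum_smul, ← Finset.sum_mul, h]
    split_ifs with h'
    · rw [h', one_mul]
    · simp
  rw [Finset.sum_congr rfl this, Finset.sum_ite_eq']
  simp only [mem_boxBelow, Pi.le_def]

/-- A suitable element of the group algebra of the unipotent group maps a nonzero polynomial to a
nonzero multiple of the highest weight vector. -/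
theorem exists_extract_eq (hn : ∀ τ, n τ < p) (hf : f ∈ Homog (mainDeg n)) (hf0 : f ≠ 0) :
    ∃ b₀ ≤ n, ∃ r : F, r ≠ 0 ∧ (b₀ = 0 → f = r • mon n 0) ∧ ∀ c : k → F,
      (∀ b : (k →+* F) → ℕ, (∀ τ, b τ < p) → ∑ x, c x * digitFun b x = if b = b₀ then 1 else 0) →
      ∑ x, c x • act (unip x) f = r • mon n 0 := by
  classical
  obtain ⟨C, rfl⟩ := exists_eq_sum_mon hf
  have hne : ((boxBelow n).filter fun b => C b ≠ 0).Nonempty := by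
    rw [Finset.nonempty_iff_ne_empty]
    intro h
    apply hf0
    refine Finset.sum_eq_zero fun b hb => ?_
    have := Finset.filter_eq_empty_iff.1 h hb
    rw [not_not.1 this, zero_smul]
  obtain ⟨b₀, hb₀, hmax⟩ := Finset.exists_max_image _ (fun b : (k →+* F) → ℕ => ∑ τ, b τ) hne
  rw [Finset.mem_filter, mem_boxBelow] at hb₀
  have huniq : ∀ b ∈ boxBelow n, b ≠ b₀ → b₀ ≤ b → C b = 0 := by
    intro b hb hne hle
    by_contra h0
    have h1 := hmax b (Finset.mem_filter.2 ⟨hb, h0⟩)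
    obtain ⟨τ, hτ⟩ : ∃ τ, b₀ τ < b τ := by
      by_contra! h
      exact hne (le_antisymm h hle)
    exact absurd h1 (not_le.2 (Finset.sum_lt_sum (fun τ _ => hle τ) ⟨τ, Finset.mem_univ _, hτ⟩))
  refine ⟨b₀, hb₀.1, C b₀, hb₀.2, ?_, ?_⟩
  · rintro rfl
    refine Finset.sum_eq_single_of_mem (0 : (k →+* F) → ℕ) (mem_boxBelow.2 hb₀.1) fun b hb hb0 => ?_
    rw [huniq b hb hb0 (fun τ => Nat.zero_le _), zero_smul]
  · intro c hc
    simp only [map_sum, map_smul, Finset.smul_sum]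
    rw [Finset.sum_comm]
    simp only [smul_comm (c _) (C _)]
    simp only [← Finset.smul_sum]
    rw [Finset.sum_eq_single_of_mem b₀ (mem_boxBelow.2 hb₀.1)]
    · rw [extract_mon p hc hn hb₀.1, if_pos fun _ => le_rfl]
      simp
    · intro b hb hne
      by_cases h : ∀ τ, b₀ τ ≤ b τ
      · rw [huniq b hb hne h, zero_smul]
      · rw [extract_mon p hc hn (mem_boxBelow.1 hb), if_neg h, smul_zero]

theorem eq_smul_mon_of_unip (hn : ∀ τ, n τ < p) (hf : f ∈ Homog (mainDeg n))
    (h : ∀ x : k, act (unip x) f = f) : ∃ r : F, f = r • mon n 0 := by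
  classical
  by_cases hf0 : f = 0
  · exact ⟨0, by simp [hf0]⟩
  obtain ⟨b₀, hb₀, r, hr, h0, hc⟩ := exists_extract_eq p hn hf hf0
  by_cases hb : b₀ = 0
  · exact ⟨r, h0 hb⟩
  exfalso
  obtain ⟨c, -, hc'⟩ := exists_extraction p (k := k) b₀ fun τ => (hb₀ τ).trans_lt (hn τ)
  have h1 := hc c hc'
  simp only [h] at h1
  have h2 := hc' 0 fun τ => (Fact.out : p.Prime).pos
  rw [if_neg (Ne.symm hb)] at h2
  simp only [digitFun, Pi.zero_apply, pow_zero, Finset.prod_const_one, mul_one] at h2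
  rw [← Finset.sum_smul, h2, zero_smul] at h1
  exact smul_ne_zero hr mon_ne_zero h1.symm

/-- The space of polynomials of degree `n` in the main variables is simple if all degrees are less
than `p`. -/
theorem irrOn_mainDeg (hn : ∀ τ, n τ < p) :
    IrrOn (V := PairRing k F) actEnd (Homog (mainDeg n)) := by
  classical
  intro K hK hKn
  rw [or_iff_not_imp_left]
  intro hne
  obtain ⟨f, hfK, hf0⟩ := Submodule.exists_mem_ne_zero_of_ne_bot hne
  have hex : ∀ (c : k → F), ∀ g ∈ K, ∑ x, c x • act (unip x) g ∈ K := fun c g hg =>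
    K.sum_mem fun x _ => K.smul_mem _ (hK (unip x) g hg)
  have h1 : (mon n 0 : PairRing k F) ∈ K := by
    obtain ⟨b₀, hb₀, r, hr, -, hc⟩ := exists_extract_eq p hn (hKn hfK) hf0
    obtain ⟨c, -, hc'⟩ := exists_extraction p (k := k) b₀ fun τ => (hb₀ τ).trans_lt (hn τ)
    have := hex c f hfK
    rw [hc c hc'] at this
    exact (K.smul_mem_iff hr).1 this
  have h2 : (mon n n : PairRing k F) ∈ K := by
    have := hK weyl _ h1
    change act weyl (mon n 0) ∈ K at this
    rwa [act_weyl_mon (b := 0) (fun _ => Nat.zero_le _), tsub_zero] at this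
  have h3 : ∀ b ≤ n, (mon n b : PairRing k F) ∈ K := by
    intro b hb
    obtain ⟨c, -, hc⟩ := exists_extraction p (k := k) (F := F) (n - b)
      fun τ => (Nat.sub_le _ _).trans_lt (hn τ)
    have h5 : ∀ τ, (n - b) τ ≤ n τ := fun τ => Nat.sub_le _ _
    have := hex c _ h2
    rw [extract_mon p hc hn le_rfl, if_pos h5] at this
    have h4 : n - (n - b) = b := by
      funext τ
      exact Nat.sub_sub_self (hb τ)
    rw [h4, K.smul_mem_iff] at this
    · exact this
    · refine Finset.prod_ne_zero_iff.2 fun τ _ => ?_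
      rw [Ne, CharP.cast_eq_zero_iff F p, Pi.sub_apply, Nat.choose_symm (hb τ)]
      exact fun hdvd => absurd ((Fact.out : p.Prime).dvd_factorial.1 (hdvd.trans (by
          rw [← Nat.choose_mul_factorial_mul_factorial (hb τ), mul_assoc]
          exact Dvd.intro _ rfl))) (not_le.2 (hn τ))
  refine le_antisymm hKn fun g hg => ?_
  obtain ⟨c, rfl⟩ := exists_eq_sum_mon hg
  exact K.sum_mem fun b hb => K.smul_mem _ (h3 b (mem_boxBelow.1 hb))

end Irreducible

/-! ### Separation by maps to simple representations -/

section Separation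

open MvPolynomial

variable {k F : Type*} [Field k] [Field F] [Fintype (k →+* F)] [DecidableEq (k →+* F)]
  {c d : (k →+* F) × Fin 4 → ℕ} {f h : PairRing k F} {τ : k →+* F} {s : Fin 4} {a b n m : ℕ}

theorem exists_cayley_mem (hs : s ≠ 0) (hf : f ∈ Homog (wt c τ s a b)) :
    ∃ a' b', cayley τ s f ∈ Homog (wt c τ s a' b') := by
  cases b with
  | zero => exact ⟨0, 0, by rw [cayley_eq_zero hf]; exact zero_mem _⟩
  | succ b =>
    cases a with
    | zero =>
      refine ⟨0, 0, ?_⟩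
      rw [cayley_apply, pderiv_comm (τ, 0, 0), pderiv_comm (τ, 0, 1),
        pderiv_eq_zero (t := (τ, 0)) hf (wt_zero hs), pderiv_eq_zero (t := (τ, 0)) hf (wt_zero hs)]
      simp
    | succ a => exact ⟨a, b, cayley_mem hs hf⟩

theorem merge_cayley_pow_eq_zero (hs : s ≠ 0) (hf : f ∈ Homog (wt c τ s a b)) (hnm : n < m) :
    merge τ s ((cayley τ s ^ n) (cross τ s ^ m * f)) = 0 := by
  induction n generalizing m a b f with
  | zero =>
    rw [pow_zero, Module.End.one_apply, map_mul, map_pow, merge_cross τ hs, zero_pow (by omega),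
      zero_mul]
  | succ n ih =>
    obtain ⟨m, rfl⟩ : ∃ m', m = m' + 1 := ⟨m - 1, by omega⟩
    rw [pow_succ, Module.End.mul_apply, cayley_cross_pow_mul hs hf, map_add, map_add, map_smul,
      map_smul, ih hf (by omega)]
    obtain ⟨a', b', h⟩ := exists_cayley_mem hs hf
    rw [ih h (by omega), smul_zero, add_zero]

/-- On multiples of `Δ^n` the operator `∂^n` recovers the leading coefficient modulo `Δ`, up to a
product of integers which are nonzero in `F` by the bound on the degrees. -/
theorem merge_cayley_pow_cross_pow_mul (p : ℕ) [Fact p.Prime] [CharP F p] (hs : s ≠ 0)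
    (hf : f ∈ Homog (wt c τ s a b)) (hn : n = 0 ∨ a + b + n + 1 < p) :
    ∃ r : F, r ≠ 0 ∧ merge τ s ((cayley τ s ^ n) (cross τ s ^ n * f)) = r • merge τ s f := by
  induction n with
  | zero => exact ⟨1, one_ne_zero, by simp⟩
  | succ n ih =>
    obtain ⟨r, hr, h⟩ := ih (by omega)
    refine ⟨(((n + 1) * (a + b + n + 2) : ℕ) : F) * r, mul_ne_zero ?_ hr, ?_⟩
    · rw [Ne, CharP.cast_eq_zero_iff F p, (Fact.out : p.Prime).dvd_mul]
      rintro (h | h)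
      · have := Nat.le_of_dvd (by omega) h; omega
      · have := Nat.le_of_dvd (by omega) h; omega
    · rw [pow_succ, Module.End.mul_apply, cayley_cross_pow_mul hs hf, map_add, map_add, map_smul,
        map_smul, h, smul_smul]
      obtain ⟨a', b', h'⟩ := exists_cayley_mem hs hf
      rw [merge_cayley_pow_eq_zero hs h' (Nat.lt_succ_self n), zero_add]

variable (p : ℕ) [Fact p.Prime] [CharP F p]

/-- A nonzero form of bidegree `(a, b)` with `a + b < p` has nonzero image in one of the components
`Sym^(a + b - 2 n)` of `Sym^a ⊗ Sym^b`: divide out the largest power `Δ^n` by means of `∂^n` and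
merge the two pairs of variables. -/
theorem exists_clear_slot (hs : s ≠ 0) (hab : a + b < p) (hf : f ∈ Homog (wt c τ s a b))
    (hf0 : f ≠ 0) : ∃ (T : Module.End F (PairRing k F)) (a' : ℕ), a' ≤ a + b ∧
      SemiEquivariant actEnd actEnd T ∧
      Homog (wt c τ s a b) ≤ (Homog (wt c τ s a' 0)).comap T ∧ T f ≠ 0 := by
  obtain ⟨n, a', b', h, rfl, rfl, hh, rfl, hm⟩ := exists_cross_pow_mul hs hf hf0
  refine ⟨(merge τ s).toLinearMap ∘ₗ (cayley τ s ^ n), a' + b', by omega,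
    (semiEquivariant_merge τ s).comp ((semiEquivariant_cayley τ s).pow n),
    fun g hg => merge_mem hs (cayley_pow_mem hs hg), ?_⟩
  obtain ⟨r, hr, h'⟩ := merge_cayley_pow_cross_pow_mul p hs hh (n := n) (by omega)
  change merge τ s ((cayley τ s ^ n) (cross τ s ^ n * h)) ≠ 0
  rw [h']
  exact smul_ne_zero hr hm

/-- Clebsch–Gordan in the semisimple range: if the total degree at each `τ` is less than `p`, then
the nonzero vectors are separated by maps to simple representations. -/
theorem exists_separating (hd : ∀ τ, ∑ s, d (τ, s) < p) (hf : f ∈ Homog d) (hf0 : f ≠ 0) :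
    ∃ (T : Module.End F (PairRing k F)) (n : (k →+* F) → ℕ), (∀ τ, n τ < p) ∧
      SemiEquivariant actEnd actEnd T ∧ Homog d ≤ (Homog (mainDeg n)).comap T ∧ T f ≠ 0 := by
  -- clear the slots other than the main ones one after the other; `S` is the set of pairs `(τ, s)`
  -- which are still to be cleared
  suffices ∀ (S : Finset ((k →+* F) × Fin 4)) (d : (k →+* F) × Fin 4 → ℕ) (f : PairRing k F),
      (∀ τ, ∑ s, d (τ, s) < p) → f ∈ Homog d → f ≠ 0 → (∀ t, t ∉ S → t.2 ≠ 0 → d t = 0) →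
      ∃ (T : Module.End F (PairRing k F)) (n : (k →+* F) → ℕ), (∀ τ, n τ < p) ∧
        SemiEquivariant actEnd actEnd T ∧ Homog d ≤ (Homog (mainDeg n)).comap T ∧ T f ≠ 0 from
    this Finset.univ d f hd hf hf0 fun t ht => absurd (Finset.mem_univ t) ht
  intro S
  induction S using Finset.induction_on with
  | empty =>
    intro d f hd hf hf0 h
    have hd' : d = mainDeg fun τ => d (τ, 0) := by
      funext t
      simp only [mainDeg]
      split_ifs with ht
      · rw [← ht]
      · exact h t (by simp) ht
    refine ⟨LinearMap.id, fun τ => d (τ, 0), fun τ => ?_, ⟨fun _ => 1, fun _ => one_ne_zero,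
      fun g v => by simp⟩, by rw [← hd']; exact le_rfl, hf0⟩
    exact (Finset.single_le_sum (f := fun s => d (τ, s)) (fun _ _ => Nat.zero_le _)
      (Finset.mem_univ 0)).trans_lt (hd τ)
  | insert t S _ ih =>
    intro d f hd hf hf0 h
    by_cases ht : t.2 = 0
    · refine ih d f hd hf hf0 fun t' ht' hne => h t' ?_ hne
      rw [Finset.mem_insert, not_or]
      exact ⟨fun h => hne (h ▸ ht), ht'⟩
    obtain ⟨τ, s⟩ := t
    have hab : d (τ, 0) + d (τ, s) ≤ ∑ s, d (τ, s) := by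
      rw [← Finset.sum_pair (f := fun s => d (τ, s)) (Ne.symm ht)]
      exact Finset.sum_le_sum_of_subset (Finset.subset_univ _)
    have hf' := hf
    rw [← wt_eta d τ s] at hf'
    obtain ⟨T, a', ha', hT, hle, hTf⟩ := exists_clear_slot p ht (hab.trans_lt (hd τ)) hf' hf0
    obtain ⟨T', n, hn, hT', hle', hTf'⟩ := ih (wt d τ s a' 0) (T f) (fun τ' => by
      refine lt_of_le_of_lt ?_ (hd τ')
      by_cases hτ : τ' = τ
      · subst hτ
        have h0 : ∀ d' : (k →+* F) × Fin 4 → ℕ, ∑ s', d' (τ', s')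
            = d' (τ', 0) + d' (τ', s) + ∑ s' ∈ Finset.univ \ {0, s}, d' (τ', s') := by
          intro d'
          rw [← Finset.sum_pair (f := fun s => d' (τ', s)) (Ne.symm ht), add_comm,
            Finset.sum_sdiff (Finset.subset_univ _)]
        rw [h0, h0 d, wt_zero ht, wt_self, add_zero]
        refine add_le_add ha' (Finset.sum_le_sum fun s' hs' => ?_)
        simp only [Finset.mem_sdiff, Finset.mem_insert, Finset.mem_singleton, not_or] at hs'
        rw [wt_other (by simp [hs'.2.1]) (by simp [hs'.2.2])]
      · refine Finset.sum_le_sum fun s' _ => ?_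
        rw [wt_other (by simp [hτ]) (by simp [hτ])])
      (hle hf') hTf (fun t' ht' hne => by
        by_cases ht'' : t' = (τ, s)
        · subst ht''; exact wt_self
        rw [wt_other (fun h0 => hne (by rw [h0])) ht'']
        exact h t' (by simp [ht'', ht']) hne)
    refine ⟨T' ∘ₗ T, n, hn, hT'.comp hT, fun g hg => hle' (hle ?_), hTf'⟩
    rwa [wt_eta]

end Separation

/-! ### Further identities for Cayley's operator -/

section CayleyIdentities

open MvPolynomial

variable {k F : Type*} [Field k] [Field F] [Fintype (k →+* F)] [DecidableEq (k →+* F)]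
  {c d : (k →+* F) × Fin 4 → ℕ} {f g h : PairRing k F} {τ τ' : k →+* F} {s : Fin 4}
  {t : (k →+* F) × Fin 4} {a b n m i j : ℕ}

theorem X_pow_mul_mem (hf : f ∈ Homog (Function.update c t a)) (j : Fin 2) :
    X (t.1, t.2, j) ^ n * f ∈ Homog (Function.update c t (a + n)) := by
  induction n with
  | zero => simpa using hf
  | succ n ih => rw [pow_succ', mul_assoc]; exact X_mul_mem ih j

theorem X_pow_mem (j : Fin 2) :
    (X (t.1, t.2, j) ^ n : PairRing k F) ∈ Homog (Function.update 0 t n) := by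
  have h : (1 : PairRing k F) ∈ Homog (Function.update 0 t 0) := by
    rw [show Function.update (0 : (k →+* F) × Fin 4 → ℕ) t 0 = 0 from
      Function.update_eq_self_iff.2 rfl]
    exact isWeightedHomogeneous_one F _
  simpa using X_pow_mul_mem (n := n) h j

/-- The quotient of a form by a power of a variable can be chosen to be a form. -/
theorem exists_of_X_pow_dvd (hf : f ∈ Homog (Function.update c t (a + n))) (j : Fin 2)
    (h : X (t.1, t.2, j) ^ n ∣ f) :
    ∃ g ∈ Homog (Function.update c t a), f = X (t.1, t.2, j) ^ n * g := by
  refine exists_homog_mul (X_pow_mem j) ?_ h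
  have e : Function.update (0 : (k →+* F) × Fin 4 → ℕ) t n + Function.update c t a = Function.update c t (a + n) := by
    funext t'
    by_cases h : t' = t
    · subst h; simp [add_comm]
    · simp [h]
  rwa [e]

theorem eq_zero_of_X_pow_dvd (hf : f ∈ Homog d) (j : Fin 2) (hn : d t < n)
    (h : X (t.1, t.2, j) ^ n ∣ f) : f = 0 := by
  classical
  obtain ⟨q, rfl⟩ := h
  let _ := weightedGradedAlgebra F (pairDeg (k := k) (F := F))
  have h1 := DirectSum.coe_decompose_mul_of_left_mem_of_not_le
    (weightedHomogeneousSubmodule F (pairDeg (k := k) (F := F))) (b := q) (n := d)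
    (X_pow_mem (n := n) (t := t) j) (fun hle => by
      have := hle t
      simp only [Function.update_self] at this
      omega)
  rwa [DirectSum.decompose_of_mem_same _ hf] at h1

/-- A polynomial of degree `i + j + 1` in a pair of variables lies in the ideal generated by the
powers of degrees `j + 1` and `i + 1` of the two variables. -/
theorem exists_eq_X_pow_add (hf : f ∈ Homog (Function.update c t (i + j + 1))) :
    ∃ g ∈ Homog (Function.update c t j), ∃ h ∈ Homog (Function.update c t i),
      f = X (t.1, t.2, 1) ^ (i + 1) * g + X (t.1, t.2, 0) ^ (j + 1) * h := by
  refine Homog.induction (motive := fun f => ∃ g ∈ Homog (Function.update c t j),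
    ∃ h ∈ Homog (Function.update c t i),
      f = X (t.1, t.2, 1) ^ (i + 1) * g + X (t.1, t.2, 0) ^ (j + 1) * h) hf
    ⟨0, zero_mem _, 0, zero_mem _, by simp⟩ ?_ ?_
  · rintro _ _ ⟨g, hg, h, hh, rfl⟩ ⟨g', hg', h', hh', rfl⟩
    exact ⟨g + g', add_mem hg hg', h + h', add_mem hh hh', by ring⟩
  · intro e r he
    have hmem : (monomial e r : PairRing k F) ∈ Homog (Function.update c t (i + j + 1)) := by
      refine isWeightedHomogeneous_monomial _ _ _ (funext fun t' => ?_)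
      rw [← he t'.1 t'.2, ← weight_pairDeg]
    have hdvd : ∀ (l : Fin 2) (n : ℕ), n ≤ e (t.1, t.2, l) →
        (X (t.1, t.2, l) ^ n : PairRing k F) ∣ monomial e r := by
      intro l n hn
      rw [X_pow_eq_monomial]
      refine ⟨monomial (e - Finsupp.single (t.1, t.2, l) n) r, ?_⟩
      rw [monomial_mul, one_mul, add_tsub_cancel_of_le]
      rwa [Finsupp.single_le_iff]
    have h1 := he t.1 t.2
    simp only [Prod.mk.eta, Function.update_self] at h1
    rcases le_or_gt (i + 1) (e (t.1, t.2, 1)) with h | h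
    · rw [show i + j + 1 = j + (i + 1) by ring] at hmem
      obtain ⟨g, hg, hg'⟩ := exists_of_X_pow_dvd hmem 1 (hdvd 1 _ h)
      exact ⟨g, hg, 0, zero_mem _, by rw [hg']; ring⟩
    · rw [show i + j + 1 = i + (j + 1) by ring] at hmem
      obtain ⟨g, hg, hg'⟩ := exists_of_X_pow_dvd hmem 0 (hdvd 0 (j + 1) (by omega))
      exact ⟨0, zero_mem _, g, hg, by rw [hg']; ring⟩

theorem cayley_pow_succ_cross_mul (hs : s ≠ 0) (hf : f ∈ Homog (wt c τ s (a + n) (b + n))) :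
    (cayley τ s ^ (n + 1)) (cross τ s * f) = cross τ s * (cayley τ s ^ (n + 1)) f
      + (((n + 1) * (a + b + n + 2) : ℕ) : F) • (cayley τ s ^ n) f := by
  induction n generalizing f with
  | zero => simpa using cayley_cross_mul hs hf
  | succ n ih =>
    rw [pow_succ, Module.End.mul_apply, cayley_cross_mul hs hf, map_add, map_smul,
      ih (cayley_mem hs hf), ← Module.End.mul_apply, ← pow_succ, ← Module.End.mul_apply,
      ← pow_succ, add_assoc, ← add_smul]
    congr 2
    push_cast
    ring

theorem pderiv_iterate_mem (hf : f ∈ Homog (Function.update c t (a + n))) (j : Fin 2) :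
    (pderiv (t.1, t.2, j))^[n] f ∈ Homog (Function.update c t a) := by
  induction n generalizing f with
  | zero => simpa using hf
  | succ n ih => exact ih (pderiv_mem hf j)

theorem pderiv_iterate_eq_zero (hf : f ∈ Homog (Function.update c t n)) (j : Fin 2) :
    (pderiv (t.1, t.2, j))^[n + 1] f = 0 := by
  rw [Function.iterate_succ_apply']
  refine pderiv_eq_zero (t := t) (pderiv_iterate_mem (a := 0) (by simpa using hf) j) (by simp) j

theorem pderiv_iterate_mul_of_eq_zero {i : (k →+* F) × Fin 4 × Fin 2} (h : pderiv i g = 0) :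
    (pderiv i)^[n] (g * f) = g * (pderiv i)^[n] f := by
  induction n generalizing f with
  | zero => rfl
  | succ n ih =>
    rw [Function.iterate_succ_apply, Function.iterate_succ_apply, pderiv_mul, h, zero_mul, zero_add,
      ih]

theorem pderiv_iterate_X_pow_mul {i : (k →+* F) × Fin 4 × Fin 2} (h : pderiv i g = 0) :
    (pderiv i)^[n] (X i ^ n * g) = (n.factorial : F) • g := by
  induction n with
  | zero => simp
  | succ n ih =>
    have e : pderiv i (X i ^ (n + 1) * g) = C ((n + 1 : ℕ) : F) * (X i ^ n * g) := by
      rw [pderiv_mul, h, pderiv_pow, pderiv_X_self, map_natCast]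
      simp only [Nat.add_sub_cancel]
      ring
    rw [Function.iterate_succ_apply, e, pderiv_iterate_mul_of_eq_zero (pderiv_C), ih,
      Nat.factorial_succ, Nat.cast_mul, mul_smul, ← smul_eq_C_mul]

theorem cayley_pow_eq (h : pderiv (τ, 0, 1) f = 0 ∨ pderiv (τ, s, 0) f = 0) :
    (cayley τ s ^ n) f = (pderiv (τ, 0, 0))^[n] ((pderiv (τ, s, 1))^[n] f) := by
  have hcomm : ∀ (i j : (k →+* F) × Fin 4 × Fin 2) n (f : PairRing k F),
      pderiv i ((pderiv j)^[n] f) = (pderiv j)^[n] (pderiv i f) := fun i j n f =>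
    (Function.Commute.iterate_right (f := pderiv i) (g := pderiv j) (fun f => pderiv_comm i j f) n) f
  induction n generalizing f with
  | zero => rfl
  | succ n ih =>
    have e : cayley τ s f = pderiv (τ, 0, 0) (pderiv (τ, s, 1) f) := by
      rw [cayley_apply]
      rcases h with h | h
      · rw [pderiv_comm (τ, 0, 1), h, map_zero, sub_zero]
      · rw [h, map_zero, sub_zero]
    rw [pow_succ, Module.End.mul_apply, e, ih, Function.iterate_succ_apply,
      Function.iterate_succ_apply, hcomm]
    rcases h with h | h
    · left
      rw [pderiv_comm (τ, 0, 1), pderiv_comm (τ, 0, 1), h, map_zero, map_zero]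
    · right
      rw [pderiv_comm (τ, s, 0), pderiv_comm (τ, s, 0), h, map_zero, map_zero]

/-- In degrees less than the characteristic, polynomials killed by `(d/dx)^m` have `x`-degree less
than `m`. -/
theorem X_pow_dvd_of_pderiv_iterate_eq_zero (p : ℕ) [Fact p.Prime] [CharP F p]
    (hn : n < p) (hf : f ∈ Homog (Function.update c t n))
    (h : (pderiv (t.1, t.2, 0))^[m] f = 0) : X (t.1, t.2, 1) ^ (n + 1 - m) ∣ f := by
  induction n generalizing m f with
  | zero =>
    cases m with
    | zero => rw [show f = 0 from h]; exact dvd_zero _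
    | succ m => simp
  | succ n ih =>
    cases m with
    | zero => rw [show f = 0 from h]; exact dvd_zero _
    | succ m =>
      have h0 := ih (by omega) (pderiv_mem hf 0) (m := m) h
      have h1 := ih (by omega) (pderiv_mem hf 1) (m := m + 1) (by
        have := (Function.Commute.iterate_right (f := pderiv (t.1, t.2, 1))
          (g := pderiv (t.1, t.2, 0)) (fun f : PairRing k F => pderiv_comm _ _ f) (m + 1)) f
        rw [← this, h, map_zero])
      have e := euler hf t.1 t.2
      rw [Prod.mk.eta, Function.update_self] at e
      have hn0 : ((n + 1 : ℕ) : F) ≠ 0 := by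
        rw [Ne, CharP.cast_eq_zero_iff F p]
        exact fun hd => absurd (Nat.le_of_dvd (by omega) hd) (by omega)
      have h2 : X (t.1, t.2, 1) ^ (n + 1 + 1 - (m + 1)) ∣ ((n + 1 : ℕ) : F) • f := by
        rw [← e]
        refine dvd_add (Dvd.dvd.mul_left (by simpa using h0) _) ?_
        rcases le_or_gt (m + 1) (n + 1) with hm | hm
        · rw [show n + 1 + 1 - (m + 1) = (n + 1 - (m + 1)) + 1 by omega, pow_succ']
          exact mul_dvd_mul_left _ h1
        · rw [show n + 1 + 1 - (m + 1) = 0 by omega]; simp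
      obtain ⟨q, hq⟩ := h2
      refine ⟨(((n + 1 : ℕ) : F)⁻¹) • q, ?_⟩
      rw [mul_smul_comm, ← hq, smul_smul, inv_mul_cancel₀ hn0, one_smul]

end CayleyIdentities

/-! ### The operators `Δ ∂` -/

section Theta

open MvPolynomial

variable {k F : Type*} [Field k] [Field F]

theorem pderiv_algHom' {φ : PairRing k F →ₐ[F] PairRing k F} {i : (k →+* F) × Fin 4 × Fin 2}
    (hφ : ∀ j, φ (X j) = X j ∨ (j ≠ i ∧ pderiv i (φ (X j)) = 0)) (f : PairRing k F) :
    pderiv i (φ f) = φ (pderiv i f) := by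
  refine pderiv_algHom (fun j => ?_) f
  rcases hφ j with h | ⟨h, h'⟩
  · rw [h]
    by_cases hij : i = j
    · subst hij; rw [pderiv_X_self, map_one]
    · rw [X_ne hij, map_zero]
  · rw [h', X_ne (Ne.symm h), map_zero]

/-- The operator `Δ ∂` for the first two pairs of variables. -/
def theta (τ : k →+* F) : Module.End F (PairRing k F) := mulCross τ 1 * cayley τ 1

theorem theta_apply (τ : k →+* F) (f : PairRing k F) :
    theta τ f = cross τ 1 * cayley τ 1 f := rfl

theorem semiEquivariant_theta (τ : k →+* F) :
    SemiEquivariant (V := PairRing k F) actEnd actEnd (theta τ) :=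
  (semiEquivariant_mulCross τ 1).comp (semiEquivariant_cayley τ 1)

theorem theta_algHom {φ : PairRing k F →ₐ[F] PairRing k F} {τ : k →+* F}
    (h : ∀ l : Fin 2, φ (X (τ, 0, l)) = X (τ, 0, l) ∧ φ (X (τ, 1, l)) = X (τ, 1, l))
    (hφ : ∀ (s : Fin 4) (l : Fin 2), s = 0 ∨ s = 1 →
      ∀ j, φ (X j) = X j ∨ (j ≠ (τ, s, l) ∧ pderiv (τ, s, l) (φ (X j)) = 0)) (f : PairRing k F) :
    theta τ (φ f) = φ (theta τ f) := by
  simp only [theta_apply, cayley_apply, map_mul, map_sub, cross, (h _).1, (h _).2,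
    pderiv_algHom' (hφ 0 _ (Or.inl rfl)), pderiv_algHom' (hφ 1 _ (Or.inr rfl))]

theorem pderiv_cross_of_ne {τ τ' : k →+* F} (h : τ ≠ τ') (s s' : Fin 4) (l : Fin 2) :
    pderiv (τ, s, l) (cross τ' s' : PairRing k F) = 0 := by
  have h' : ∀ s' l', pderiv (τ, s, l) (X (τ', s', l') : PairRing k F) = 0 := fun s' l' =>
    X_ne (by simp [h])
  simp [cross, h']

theorem commute_cayley_mulCross {τ τ' : k →+* F} (h : τ ≠ τ') (s s' : Fin 4) :
    Commute (cayley τ s : Module.End F (PairRing k F)) (mulCross τ' s') := by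
  refine LinearMap.ext fun f => ?_
  change cayley τ s (cross τ' s' * f) = cross τ' s' * cayley τ s f
  simp only [cayley_apply, pderiv_mul, pderiv_cross_of_ne h, zero_mul, zero_add]
  ring

theorem commute_cayley_cayley (τ τ' : k →+* F) (s s' : Fin 4) :
    Commute (cayley τ s : Module.End F (PairRing k F)) (cayley τ' s') := by
  have hc : ∀ i j : (k →+* F) × Fin 4 × Fin 2,
      Commute ((pderiv i).toLinearMap : Module.End F (PairRing k F)) (pderiv j).toLinearMap :=
    fun i j => LinearMap.ext fun f => pderiv_comm i j f
  have h : ∀ τ s, (cayley τ s : Module.End F (PairRing k F)) =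
    (pderiv (τ, 0, 0)).toLinearMap * (pderiv (τ, s, 1)).toLinearMap
    - (pderiv (τ, 0, 1)).toLinearMap * (pderiv (τ, s, 0)).toLinearMap := fun _ _ => rfl
  rw [h, h]
  refine Commute.sub_left (Commute.sub_right ?_ ?_) (Commute.sub_right ?_ ?_) <;>
    exact ((hc _ _).mul_right (hc _ _)).mul_left ((hc _ _).mul_right (hc _ _))

theorem commute_theta_cayley {τ τ' : k →+* F} (h : τ ≠ τ') (s : Fin 4) :
    Commute (theta τ : Module.End F (PairRing k F)) (cayley τ' s) :=
  (commute_cayley_mulCross h.symm _ _).symm.mul_left (commute_cayley_cayley _ _ _ _)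

theorem commute_theta_mulCross {τ τ' : k →+* F} (h : τ ≠ τ') (s : Fin 4) :
    Commute (theta τ : Module.End F (PairRing k F)) (mulCross τ' s) := by
  refine Commute.mul_left (LinearMap.ext fun f => ?_) (commute_cayley_mulCross h _ _)
  change cross τ 1 * (cross τ' s * f) = cross τ' s * (cross τ 1 * f)
  ring

section Frobenius

variable [DecidableEq (k →+* F)]

theorem theta_merge {τ τ' : k →+* F} (h : τ ≠ τ') (s : Fin 4) (f : PairRing k F) :
    theta τ (merge τ' s f) = merge τ' s (theta τ f) := by
  refine theta_algHom (fun l => ⟨merge_X_of_ne (by simp [h]), merge_X_of_ne (by simp [h])⟩)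
    (fun s₁ l _ j => ?_) f
  by_cases hj : (j.1, j.2.1) = (τ', s)
  · obtain ⟨τ'', s'', j⟩ := j
    simp only [Prod.mk.injEq] at hj
    obtain ⟨rfl, rfl⟩ := hj
    right
    exact ⟨by simp [h.symm], by rw [merge_X]; exact X_ne (by simp [h])⟩
  · exact Or.inl (merge_X_of_ne hj)

variable (p : ℕ) [Fact p.Prime] [CharP k p] [CharP F p]

/-- The substitution of the `p`-th powers of the main pair at `τ` for the pair in slot `2` at
`τ ∘ Frob`. -/
def frobMap (τ : k →+* F) : PairRing k F →ₐ[F] PairRing k F :=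
  aeval fun i => if (i.1, i.2.1) = (τ.comp (frobenius k p), 2) then X (τ, 0, i.2.2) ^ p else X i

theorem frobMap_X (τ : k →+* F) (j : Fin 2) :
    frobMap p τ (X (τ.comp (frobenius k p), 2, j) : PairRing k F) = X (τ, 0, j) ^ p := by
  simp [frobMap]

theorem frobMap_X_of_ne {τ : k →+* F} {i : (k →+* F) × Fin 4 × Fin 2}
    (h : (i.1, i.2.1) ≠ (τ.comp (frobenius k p), 2)) :
    frobMap p τ (X i : PairRing k F) = X i := by
  simp only [frobMap, aeval_X, if_neg h]

theorem frobMap_act (g : GL (Fin 2) k) (τ : k →+* F) (f : PairRing k F) :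
    frobMap p τ (act g f) = act g (frobMap p τ f) := by
  have key : (frobMap p τ).comp (act g) = (act g).comp (frobMap p τ : PairRing k F →ₐ[F] _) := by
    refine algHom_ext fun i => ?_
    obtain ⟨τ', s', j⟩ := i
    rw [AlgHom.comp_apply, AlgHom.comp_apply, act_X, map_add, map_mul, map_mul, algHom_C, algHom_C,
      algebraMap_eq]
    by_cases h : (τ', s') = (τ.comp (frobenius k p), 2)
    · simp only [Prod.mk.injEq] at h
      obtain ⟨rfl, rfl⟩ := h
      have : CharP (PairRing k F) p := inferInstance
      rw [frobMap_X, frobMap_X, frobMap_X, map_pow, act_X, add_pow_char, mul_pow, mul_pow,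
        RingHom.comp_apply, RingHom.comp_apply, frobenius_def, frobenius_def, map_pow, map_pow,
        map_pow, map_pow]
    · rw [frobMap_X_of_ne (i := (τ', s', _)) p h, frobMap_X_of_ne (i := (τ', s', _)) p h,
        frobMap_X_of_ne (i := (τ', s', _)) p h, act_X]
  exact DFunLike.congr_fun key f

theorem semiEquivariant_frobMap (τ : k →+* F) :
    SemiEquivariant (V := PairRing k F) actEnd actEnd (frobMap p τ).toLinearMap :=
  ⟨fun _ => 1, fun _ => one_ne_zero, fun g f => by rw [one_smul]; exact frobMap_act p g τ f⟩

theorem theta_frobMap (τ τ' : k →+* F) (f : PairRing k F) :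
    theta τ (frobMap p τ' f) = frobMap p τ' (theta τ f) := by
  refine theta_algHom (fun l => ⟨frobMap_X_of_ne p (by simp), frobMap_X_of_ne p (by simp)⟩)
    (fun s₁ l hs j => ?_) f
  by_cases hj : (j.1, j.2.1) = (τ'.comp (frobenius k p), 2)
  · obtain ⟨τ'', s'', j⟩ := j
    simp only [Prod.mk.injEq] at hj
    obtain ⟨rfl, rfl⟩ := hj
    right
    refine ⟨fun h => ?_, by rw [frobMap_X, pderiv_pow]; simp⟩
    simp only [Prod.mk.injEq] at h
    rcases hs with rfl | rfl <;> simp at h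
  · exact Or.inl (frobMap_X_of_ne p hj)

end Frobenius

variable [Fintype (k →+* F)]

/-- The subspace of the polynomials of multidegree `d` killed by the squares of the operators
`Δ ∂` at all `τ ∈ T`. -/
def thetaSub (d : (k →+* F) × Fin 4 → ℕ) (T : Finset (k →+* F)) : Submodule F (PairRing k F) :=
  Homog d ⊓ ⨅ τ ∈ T, LinearMap.ker (theta τ ^ 2)

theorem mem_thetaSub {d : (k →+* F) × Fin 4 → ℕ} {T : Finset (k →+* F)} {f : PairRing k F} :
    f ∈ thetaSub d T ↔ f ∈ Homog d ∧ ∀ τ ∈ T, (theta τ ^ 2) f = 0 := by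
  simp [thetaSub]

theorem stable_thetaSub (d : (k →+* F) × Fin 4 → ℕ) (T : Finset (k →+* F)) :
    Stable (V := PairRing k F) actEnd (thetaSub d T) :=
  stable_homog.inf (Stable.iInf fun τ => Stable.iInf fun _ =>
    Stable.ker ((semiEquivariant_theta τ).pow 2))

theorem thetaSub_le_comap {d d' : (k →+* F) × Fin 4 → ℕ} {T T' : Finset (k →+* F)}
    {φ : Module.End F (PairRing k F)} (hT : T' ⊆ T) (hd : Homog d ≤ (Homog d').comap φ)
    (hφ : ∀ τ ∈ T', Commute (theta τ) φ) : thetaSub d T ≤ (thetaSub d' T').comap φ := by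
  intro f hf
  rw [Submodule.mem_comap, mem_thetaSub]
  rw [mem_thetaSub] at hf
  refine ⟨hd hf.1, fun τ hτ => ?_⟩
  rw [← Module.End.mul_apply, ((hφ τ hτ).pow_left 2).eq, Module.End.mul_apply, hf.2 τ (hT hτ),
    map_zero]

end Theta

/-! ### Filtration of the constrained polynomial spaces -/

section Step

open MvPolynomial

variable {k F : Type*} [Field k] [Field F] [Fintype (k →+* F)] [DecidableEq (k →+* F)]
  (p : ℕ) [Fact p.Prime] [CharP k p] [CharP F p]
  {d : (k →+* F) × Fin 4 → ℕ} {f : PairRing k F} {τ : k →+* F} {r m a b : ℕ}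

theorem merge_eq_self {s : Fin 4} (hf : f ∈ Homog (wt d τ s a 0)) : merge τ s f = f :=
  algHom_apply_eq_self (t := (τ, s)) (fun _ hi => merge_X_of_ne hi) wt_self hf

/-- A form of bidegree `(p - 1, m + 1)` killed by `∂^(m + 1)` becomes, upon merging the two pairs
of variables, a combination of `p`-th powers of the variables. -/
theorem merge_eq_of_cayley_pow_eq_zero (hp : p = r + m + 2)
    (hf : f ∈ Homog (wt d τ 1 (r + m + 1) (m + 1))) (h0 : (cayley τ 1 ^ (m + 1)) f = 0) :
    ∃ A ∈ Homog (wt d τ 1 m 0), ∃ B ∈ Homog (wt d τ 1 m 0),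
      merge τ 1 f = X (τ, 0, 0) ^ p * A + X (τ, 0, 1) ^ p * B := by
  have hs : (1 : Fin 4) ≠ 0 := by decide
  have hG := merge_mem hs hf
  rw [wt_eq hs, show r + m + 1 + (m + 1) = m + (r + m + 1) + 1 by ring] at hG
  obtain ⟨g, hg, h, hh, hGe⟩ := exists_eq_X_pow_add hG
  rw [← wt_eq hs] at hg hh
  -- the lift `Z₁^(m+1) g(X) + X₀^(p-1) Z₀ h(Z)` of the merged polynomial
  set h' := slotMap (τ, 0) (τ, 1) h with hh'
  have hh'mem : h' ∈ Homog (wt d τ 1 0 m) := by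
    have := slotMap_mem (t := (τ, 0)) (t' := (τ, 1)) (by simp) hh
    rw [wt_zero hs, wt_self] at this
    refine Eq.subst (motive := fun d => h' ∈ Homog d) ?_ this
    funext t
    simp only [wt, Function.update_apply]
    split_ifs <;> simp_all
  have hmerge : merge τ 1 h' = h := by
    rw [hh', ← AlgHom.comp_apply]
    refine algHom_apply_eq_self (t := (τ, 1)) (fun i hi => ?_) wt_self hh
    rw [AlgHom.comp_apply]
    by_cases h : (i.1, i.2.1) = (τ, 0)
    · obtain ⟨τ', s', j⟩ := i
      simp only [Prod.mk.injEq] at h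
      obtain ⟨rfl, rfl⟩ := h
      rw [show slotMap (τ', 0) (τ', 1) (X (τ', 0, j) : PairRing k F) = X (τ', 1, j) by
        simp [slotMap], merge_X]
    · rw [show slotMap (τ, 0) (τ, 1) (X i : PairRing k F) = X i by
        simp only [slotMap, aeval_X, if_neg h], merge_X_of_ne hi]
  set f' := X (τ, 1, 1) ^ (m + 1) * g + X (τ, 0, 0) ^ (r + m + 1) * (X (τ, 1, 0) * h') with hf'
  have hX0 : ∀ j : Fin 2, merge τ 1 (X (τ, 0, j) : PairRing k F) = X (τ, 0, j) := fun j =>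
    merge_X_of_ne (by simp)
  have hf'mem : f' ∈ Homog (wt d τ 1 (r + m + 1) (m + 1)) := by
    refine add_mem ?_ ?_
    · simpa [wt] using X_pow_mul_mem (t := (τ, 1)) (n := m + 1) hg 1
    · have h1 := Xs_mul_mem hh'mem 0
      rw [wt_eq hs] at h1 ⊢
      simpa using X_pow_mul_mem (t := (τ, 0)) (n := r + m + 1) h1 0
  have hmf : merge τ 1 (f - f') = 0 := by
    rw [map_sub, hGe, hf', map_add, map_mul, map_mul, map_mul, map_pow, map_pow, merge_X, merge_X,
      hX0, hmerge, merge_eq_self hg]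
    ring
  obtain ⟨u, hu, hu'⟩ := exists_homog_mul (cross_mem hs)
    (by rw [wt_add hs]; exact sub_mem hf hf'mem) (cross_dvd_of_merge_eq_zero hs
      (sub_mem hf hf'mem) hmf)
  -- `∂^(m+1)` kills `Δ u` since its eigenvalue is a multiple of `p`
  have h1 : (cayley τ 1 ^ (m + 1)) (cross τ 1 * u) = 0 := by
    have hu2 : u ∈ Homog (wt d τ 1 (r + m) (0 + m)) := by rwa [zero_add]
    rw [cayley_pow_succ_cross_mul hs hu2, pow_succ', Module.End.mul_apply,
      cayley_eq_zero (cayley_pow_mem hs hu2), mul_zero, zero_add,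
      show (m + 1) * (r + 0 + m + 2) = (m + 1) * p by rw [hp]; ring]
    simp
  have hD0 : pderiv (τ, 1, 0) g = 0 := pderiv_eq_zero (t := (τ, 1)) hg wt_self 0
  have hD1 : pderiv (τ, 1, 1) g = 0 := pderiv_eq_zero (t := (τ, 1)) hg wt_self 1
  have hE1 : pderiv (τ, 0, 1) h' = 0 := pderiv_eq_zero (t := (τ, 0)) hh'mem (wt_zero hs) 1
  have h2 : (cayley τ 1 ^ (m + 1)) (X (τ, 0, 0) ^ (r + m + 1) * (X (τ, 1, 0) * h')) = 0 := by
    rw [cayley_pow_eq, pderiv_iterate_mul_of_eq_zero,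
      pderiv_iterate_mul_of_eq_zero (g := X (τ, 1, 0)),
      show (pderiv (τ, 1, 1))^[m + 1] h' = 0 from pderiv_iterate_eq_zero (t := (τ, 1)) hh'mem 1,
      mul_zero, mul_zero, iterate_map_zero]
    · exact X_ne (by simp)
    · rw [pderiv_pow, X_ne (by simp), mul_zero]
    · left
      rw [pderiv_mul, pderiv_mul, hE1, pderiv_pow, X_ne (by simp), X_ne (by simp)]
      simp
  have h3 : (cayley τ 1 ^ (m + 1)) (X (τ, 1, 1) ^ (m + 1) * g)
      = ((m + 1).factorial : F) • (pderiv (τ, 0, 0))^[m + 1] g := by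
    rw [cayley_pow_eq, pderiv_iterate_X_pow_mul hD1]
    · rw [smul_eq_C_mul, pderiv_iterate_mul_of_eq_zero pderiv_C, ← smul_eq_C_mul]
    · right
      rw [pderiv_mul, hD0, pderiv_pow, X_ne (by simp)]
      simp
  have h4 : (pderiv (τ, 0, 0))^[m + 1] g = 0 := by
    have : f = X (τ, 1, 1) ^ (m + 1) * g + X (τ, 0, 0) ^ (r + m + 1) * (X (τ, 1, 0) * h')
        + cross τ 1 * u := by rw [← hu', hf']; ring
    rw [this, map_add, map_add, h1, h2, h3, add_zero, add_zero] at h0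
    refine (smul_eq_zero.1 h0).resolve_left ?_
    rw [CharP.cast_eq_zero_iff F p, (Fact.out : p.Prime).dvd_factorial]
    omega
  rw [wt_eq hs] at hg
  have h5 := X_pow_dvd_of_pderiv_iterate_eq_zero (t := (τ, 0)) p (by omega) hg h4
  rw [show r + m + 1 + 1 - (m + 1) = r + 1 by omega] at h5
  rw [show r + m + 1 = m + (r + 1) by ring] at hg
  obtain ⟨B, hB, rfl⟩ := exists_of_X_pow_dvd hg 1 h5
  rw [← wt_eq hs] at hB
  refine ⟨h, hh, B, hB, ?_⟩
  rw [hGe, hp]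
  ring

/-- A form of bidegree `(p - 1, m)` in the generalised kernel of `Δ ∂` which vanishes upon
merging is a multiple of `Δ^m`, since `Δ ∂` acts on the leading term `Δ^j h` by the scalar
`j (m - j)`. -/
theorem exists_eq_cross_pow_mul (hp : p = r + m + 1) (hf : f ∈ Homog (wt d τ 1 (r + m) m))
    (h0 : (theta τ ^ 2) f = 0) (hm : merge τ 1 f = 0) :
    ∃ h ∈ Homog (wt d τ 1 r 0), f = cross τ 1 ^ m * h := by
  have hs : (1 : Fin 4) ≠ 0 := by decide
  by_cases hf0 : f = 0
  · exact ⟨0, zero_mem _, by simp [hf0]⟩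
  obtain ⟨n, a', b', h, ha, hb, hh, rfl, hmh⟩ := exists_cross_pow_mul hs hf hf0
  cases n with
  | zero => rw [pow_zero, one_mul] at hm; exact absurd hm hmh
  | succ n =>
    have key : ∀ {a b n} {h : PairRing k F}, h ∈ Homog (wt d τ 1 a b) →
        theta τ (cross τ 1 ^ (n + 1) * h) = cross τ 1 ^ (n + 2) * cayley τ 1 h
          + (((n + 1) * (a + b + n + 2) : ℕ) : F) • (cross τ 1 ^ (n + 1) * h) := by
      intro a b n h hh
      rw [theta_apply, cayley_cross_pow_mul hs hh, mul_add, mul_smul_comm]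
      congr 1
      · ring
      · congr 1; ring
    obtain ⟨a₁, b₁, hh₁⟩ := exists_cayley_mem hs hh
    set e : F := (((n + 1) * (a' + b' + n + 2) : ℕ) : F) with he
    rw [pow_two, Module.End.mul_apply, key hh, map_add, map_smul, key hh, key hh₁, ← he] at h0
    have h1 : cross τ 1 ^ (n + 1) * (cross τ 1 * (cross τ 1 * cayley τ 1 (cayley τ 1 h)
        + (((n + 1 + 1) * (a₁ + b₁ + (n + 1) + 2) : ℕ) : F) • cayley τ 1 h + e • cayley τ 1 h)
        + (e * e) • h) = 0 := by
      rw [← h0]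
      simp only [smul_eq_C_mul, map_mul]
      ring
    have h2 := congrArg (merge τ 1) ((mul_eq_zero.1 h1).resolve_left
      (pow_ne_zero _ (cross_ne_zero τ hs)))
    rw [map_add, map_mul, merge_cross τ hs, zero_mul, zero_add, map_smul, map_zero, smul_eq_zero,
      mul_self_eq_zero] at h2
    have h3 := h2.resolve_right hmh
    rw [he, CharP.cast_eq_zero_iff F p, (Fact.out : p.Prime).dvd_mul] at h3
    have hb' : b' = 0 := by
      rcases h3 with h3 | h3
      · exact absurd (Nat.le_of_dvd (by omega) h3) (by omega)
      · rw [show a' + b' + n + 2 = p + b' by omega, Nat.dvd_add_right (dvd_refl p)] at h3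
        by_contra hne
        exact absurd (Nat.le_of_dvd (by omega) h3) (by omega)
    obtain rfl : m = n + 1 := by omega
    obtain rfl : r = a' := by omega
    subst hb'
    exact ⟨h, hh, rfl⟩

variable {G ι : Type*} [Fintype ι] {c : GL (Fin 2) k → Matrix ι ι F} {T : Finset (k →+* F)}

theorem theta_mem_homog (hf : f ∈ Homog d) : theta τ f ∈ Homog d := by
  have hs : (1 : Fin 4) ≠ 0 := by decide
  rw [← wt_eta d τ 1] at hf ⊢
  rw [theta_apply]
  generalize d (τ, 1) = b at *
  generalize d (τ, 0) = a at *
  cases b with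
  | zero => rw [cayley_eq_zero hf, mul_zero]; exact zero_mem _
  | succ b =>
    cases a with
    | zero =>
      rw [cayley_apply, pderiv_comm (τ, 0, 0), pderiv_comm (τ, 0, 1),
        pderiv_eq_zero (t := (τ, 0)) hf (wt_zero hs), pderiv_eq_zero (t := (τ, 0)) hf (wt_zero hs)]
      simp
    | succ a => exact cross_mul_mem hs (cayley_mem hs hf)

theorem frobMap_eq_self (hf : f ∈ Homog d) (h : d (τ.comp (frobenius k p), 2) = 0) :
    frobMap p τ f = f :=
  algHom_apply_eq_self (t := (τ.comp (frobenius k p), 2)) (fun _ hi => frobMap_X_of_ne p hi) h hf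

/-- The substitution of `p`-th powers is injective on forms of degree less than `p` in the main pair
and linear in the pair of slot `2`, as `A X₀^p + B X₁^p = 0` forces `A = B = 0`. -/
theorem frobMap_injOn (hd : d (τ, 0) < p) (hd2 : d (τ.comp (frobenius k p), 2) = 1)
    (hf : f ∈ Homog d) (h0 : frobMap p τ f = 0) : f = 0 := by
  set τ' := τ.comp (frobenius k p) with hτ'
  have e := euler hf τ' 2
  rw [hd2, Nat.cast_one, one_smul] at e
  have hd' : d = Function.update d (τ', 2) (0 + 1) := by
    rw [zero_add, ← hd2, Function.update_eq_self]
  have hmem : ∀ j, pderiv (τ', 2, j) f ∈ Homog (Function.update d (τ', 2) 0) := fun j =>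
    pderiv_mem (t := (τ', 2)) (by rwa [← hd']) j
  have hfix : ∀ j, frobMap p τ (pderiv (τ', 2, j) f) = pderiv (τ', 2, j) f := fun j =>
    frobMap_eq_self p (hmem j) (by rw [← hτ', Function.update_self])
  have hlt : Function.update d (τ', 2) 0 (τ, 0) < p := by
    rw [Function.update_of_ne (by simp)]; exact hd
  rw [← e, map_add, map_mul, map_mul, frobMap_X, frobMap_X, hfix, hfix] at h0
  have hcop : ¬ (X (τ, 0, 0) : PairRing k F) ∣ X (τ, 0, 1) ^ p := by
    intro h
    have := X_prime.dvd_of_dvd_pow h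
    rw [X_dvd_X] at this
    simp at this
  have hB : pderiv (τ', 2, 1) f = 0 := by
    refine eq_zero_of_X_pow_dvd (t := (τ, 0)) (hmem 1) 0 hlt ?_
    refine (X_prime (R := F) (i := (τ, 0, 0))).pow_dvd_of_dvd_mul_left p hcop ?_
    exact ⟨-pderiv (τ', 2, 0) f, by linear_combination h0⟩
  rw [hB, mul_zero, add_zero] at h0
  rw [← e, hB, (mul_eq_zero.1 h0).resolve_left (pow_ne_zero _ (X_ne_zero _))]
  simp

/-- Reduction at one embedding. The space `thetaSub d T` has a filtration with three graded pieces: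
the image of `∂^(m + 1)`, made of forms of degree `r`; the image under merging of the kernel of
`∂^(m + 1)`, made of combinations of `p`-th powers, which is `Sym^m` tensored with a Frobenius twist
of the standard representation; and the multiples of `Δ^(m + 1)` by forms of degree `r`. -/
theorem niceOn_step (hp : p = r + m + 2) (hτ : τ ∈ T) (h0 : d (τ, 0) = r + m + 1)
    (h1 : d (τ, 1) = m + 1) (h2 : d (τ.comp (frobenius k p), 2) = 0)
    (hN1 : NiceOn c (actEnd (F := F)) (thetaSub (wt d τ 1 r 0) (T.erase τ)))
    (hN2 : NiceOn c (actEnd (F := F)) (thetaSub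
      (Function.update (wt d τ 1 m 0) (τ.comp (frobenius k p), 2) 1) (T.erase τ))) :
    NiceOn c (actEnd (F := F)) (thetaSub d T) := by
  have hs : (1 : Fin 4) ≠ 0 := by decide
  have hd : d = wt d τ 1 (r + m + 1) (m + 1) := by rw [← h0, ← h1, wt_eta]
  have hne : ∀ τ' ∈ T.erase τ, τ' ≠ τ := fun τ' h => Finset.ne_of_mem_erase h
  set τF := τ.comp (frobenius k p) with hτF
  set d2 := Function.update (wt d τ 1 m 0) (τF, 2) 1 with hd2
  -- the quotient given by the values of `∂^(m + 1)`
  refine NiceOn.extension ((semiEquivariant_cayley τ 1).pow (m + 1)) hN1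
    (thetaSub_le_comap (Finset.erase_subset _ _) (fun f hf => ?_) fun τ' h =>
      (commute_theta_cayley (hne τ' h) 1).pow_right _) ?_
  · rw [hd] at hf
    exact cayley_pow_mem hs (b := 0) (by simpa [add_assoc] using hf)
  have hW : Stable (V := PairRing k F) actEnd (thetaSub d2 (T.erase τ)) := stable_thetaSub _ _
  -- the next quotient, given by merging the two pairs; it lies in the image of `frobMap`
  refine NiceOn.extension (semiEquivariant_merge τ 1)
    (NiceOn.map (semiEquivariant_frobMap p τ) hW hN2 le_rfl) ?_ ?_
  · rintro f ⟨hf0, hf⟩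
    rw [SetLike.mem_coe, mem_thetaSub] at hf
    have hf1 := hf.1
    rw [hd] at hf1
    obtain ⟨A, hA, B, hB, hAB⟩ := merge_eq_of_cayley_pow_eq_zero p hp hf1 hf0
    have hz : wt d τ 1 m 0 (τF, 2) = 0 := by
      rw [wt_other (by simp) (by simp [Fin.ext_iff]), h2]
    have hd2' : d2 = Function.update (wt d τ 1 m 0) (τF, 2) (0 + 1) := rfl
    have hupd : wt d τ 1 m 0 = Function.update (wt d τ 1 m 0) (τF, 2) 0 := by
      exact (Function.update_eq_self_iff.2 hz.symm).symm
    have hu : X (τF, 2, 0) * A + X (τF, 2, 1) * B ∈ Homog d2 := by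
      rw [hupd] at hA hB
      exact add_mem (X_mul_mem (t := (τF, 2)) hA 0) (X_mul_mem (t := (τF, 2)) hB 1)
    have hΦ : frobMap p τ (X (τF, 2, 0) * A + X (τF, 2, 1) * B) = merge τ 1 f := by
      rw [map_add, map_mul, map_mul, frobMap_X, frobMap_X, frobMap_eq_self p hA hz,
        frobMap_eq_self p hB hz, hAB]
    refine ⟨X (τF, 2, 0) * A + X (τF, 2, 1) * B, mem_thetaSub.2 ⟨hu, fun τ' hτ' => ?_⟩, hΦ⟩
    refine frobMap_injOn p (d := d2) (τ := τ) ?_ ?_ ?_ ?_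
    · rw [hd2, Function.update_of_ne (by simp), wt_zero hs]; omega
    · rw [hd2, Function.update_self]
    · rw [pow_two, Module.End.mul_apply]
      exact theta_mem_homog (theta_mem_homog hu)
    · rw [pow_two, Module.End.mul_apply, ← theta_frobMap, ← theta_frobMap, hΦ,
        theta_merge (hne τ' hτ'), theta_merge (hne τ' hτ'), ← Module.End.mul_apply, ← pow_two,
        hf.2 τ' (Finset.mem_of_mem_erase hτ'), map_zero]
  · -- what remains are multiples of `Δ^(m + 1)`
    refine NiceOn.mono (NiceOn.map ((semiEquivariant_mulCross τ 1).pow (m + 1))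
      (stable_thetaSub _ _) hN1 le_rfl) ?_
    rintro f ⟨hf0, -, hf⟩
    rw [SetLike.mem_coe, mem_thetaSub] at hf
    have hf1 := hf.1
    rw [hd] at hf1
    obtain ⟨h, hh, rfl⟩ := exists_eq_cross_pow_mul p (r := r) (m := m + 1) (by omega) hf1
      (hf.2 τ hτ) hf0
    refine ⟨h, mem_thetaSub.2 ⟨hh, fun τ' hτ' => ?_⟩, mulCross_pow_apply _ _ _ _⟩
    have h3 := hf.2 τ' (Finset.mem_of_mem_erase hτ')
    rw [← mulCross_pow_apply, ← Module.End.mul_apply,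
      (((commute_theta_mulCross (hne τ' hτ') 1).pow_right (m + 1)).pow_left 2).eq,
      Module.End.mul_apply, mulCross_pow_apply] at h3
    exact (mul_eq_zero.1 h3).resolve_left (pow_ne_zero _ (cross_ne_zero τ hs))

end Step

/-! ### Semisimplicity of `Hom(sl₂, -)` on simple subquotients -/

section Base

open MvPolynomial

variable {k F : Type*} [Field k] [Field F]

/-- The matrix of `Ad(g⁻¹)` in the basis `e, h, f` of `sl₂`, through `τ`. -/
def adMat (τ : k →+* F) (g : GL (Fin 2) k) : Matrix (Fin 3) (Fin 3) F :=
  (τ (Matrix.det (g : Matrix (Fin 2) (Fin 2) k)))⁻¹ •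
    !![τ (g 1 1) ^ 2, τ (g 1 0) * τ (g 1 1), -τ (g 1 0) ^ 2;
       2 * τ (g 0 1) * τ (g 1 1), τ (g 0 0) * τ (g 1 1) + τ (g 0 1) * τ (g 1 0),
        -2 * τ (g 0 0) * τ (g 1 0);
       -τ (g 0 1) ^ 2, -τ (g 0 0) * τ (g 0 1), τ (g 0 0) ^ 2]

/-- The map from `Hom(sl₂, V)` to polynomials provided by `Hom(sl₂, V) ≅ V ⊗ Sym²`, up to a twist,
where `Sym²` is realised on the pair of variables in slot `3`. -/
def symEmbed (τ : k →+* F) : (Fin 3 → PairRing k F) →ₗ[F] PairRing k F :=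
  LinearMap.mulLeft F (X (τ, 3, 1) ^ 2) ∘ₗ (LinearMap.proj 0 : (Fin 3 → PairRing k F) →ₗ[F] PairRing k F)
    + LinearMap.mulLeft F (X (τ, 3, 0) * X (τ, 3, 1)) ∘ₗ (LinearMap.proj 1 : (Fin 3 → PairRing k F) →ₗ[F] PairRing k F)
    - LinearMap.mulLeft F (X (τ, 3, 0) ^ 2) ∘ₗ (LinearMap.proj 2 : (Fin 3 → PairRing k F) →ₗ[F] PairRing k F)

theorem symEmbed_apply (τ : k →+* F) (w : Fin 3 → PairRing k F) : symEmbed τ w =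
    X (τ, 3, 1) ^ 2 * w 0 + X (τ, 3, 0) * X (τ, 3, 1) * w 1 - X (τ, 3, 0) ^ 2 * w 2 := rfl

theorem symEmbed_powRep (τ : k →+* F) (g : GL (Fin 2) k) (w : Fin 3 → PairRing k F) :
    symEmbed τ (powRep (adMat τ) actEnd g w)
      = (τ (Matrix.det (g : Matrix (Fin 2) (Fin 2) k)))⁻¹ • act g (symEmbed τ w) := by
  have h : ∀ i, powRep (adMat τ) actEnd g w i = ∑ j, adMat τ g i j • act g (w j) :=
    fun i => powRep_apply _ _ _ _ _
  simp only [symEmbed_apply, h, Fin.sum_univ_three, adMat, Matrix.smul_apply, smul_eq_mul]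
  simp only [map_sub, map_add, map_mul, map_pow, act_X, smul_eq_C_mul]
  have hc : C (2 : F) = (2 : PairRing k F) := map_ofNat _ _
  simp [hc]
  ring

theorem semiEquivariant_symEmbed (τ : k →+* F) :
    SemiEquivariant (V := Fin 3 → PairRing k F) (powRep (adMat τ) actEnd) actEnd (symEmbed τ) :=
  ⟨_, fun g => inv_ne_zero (det_ne_zero g τ), symEmbed_powRep τ⟩

variable [Fintype (k →+* F)] [DecidableEq (k →+* F)] {d : (k →+* F) × Fin 4 → ℕ} {τ : k →+* F}
  {w : Fin 3 → PairRing k F}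

theorem symEmbed_mem (hd : d (τ, 3) = 0) (hw : ∀ i, w i ∈ Homog d) :
    symEmbed τ w ∈ Homog (Function.update d (τ, 3) 2) := by
  have hw' : ∀ i, w i ∈ Homog (Function.update d (τ, 3) 0) := fun i => by
    rw [← hd, Function.update_eq_self]; exact hw i
  rw [symEmbed_apply, pow_two, pow_two, mul_assoc, mul_assoc, mul_assoc]
  exact sub_mem (add_mem (X_mul_mem (t := (τ, 3)) (X_mul_mem (t := (τ, 3)) (hw' 0) 1) 1)
    (X_mul_mem (t := (τ, 3)) (X_mul_mem (t := (τ, 3)) (hw' 1) 1) 0))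
    (X_mul_mem (t := (τ, 3)) (X_mul_mem (t := (τ, 3)) (hw' 2) 0) 0)

theorem symEmbed_injOn (h2 : (2 : F) ≠ 0) (hd : d (τ, 3) = 0) (hw : ∀ i, w i ∈ Homog d)
    (h0 : symEmbed τ w = 0) : w = 0 := by
  have hD : ∀ i j, pderiv (τ, 3, j) (w i) = 0 := fun i j =>
    pderiv_eq_zero (t := (τ, 3)) (hw i) hd j
  have h01 : pderiv (τ, 3, 0) (X (τ, 3, 1) : PairRing k F) = 0 := X_ne (by simp)
  have h10 : pderiv (τ, 3, 1) (X (τ, 3, 0) : PairRing k F) = 0 := X_ne (by simp)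
  rw [symEmbed_apply] at h0
  have hc : C (2 : F) = (2 : PairRing k F) := map_ofNat _ _
  have hC : (2 : PairRing k F) ≠ 0 := by
    rw [← hc]; exact (map_ne_zero_iff _ (C_injective _ _)).2 h2
  have e1 := congrArg (fun f => pderiv (τ, 3, 1) (pderiv (τ, 3, 1) f)) h0
  have e2 := congrArg (fun f => pderiv (τ, 3, 0) (pderiv (τ, 3, 1) f)) h0
  have e3 := congrArg (fun f => pderiv (τ, 3, 0) (pderiv (τ, 3, 0) f)) h0
  simp only [map_sub, map_add, pderiv_mul, pow_two, hD, h01, h10, pderiv_X_self, map_zero,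
    mul_zero, add_zero, zero_mul, zero_add, one_mul, mul_one, sub_zero, zero_sub] at e1 e2 e3
  funext i
  fin_cases i
  · exact (mul_eq_zero.1 (show (2 : PairRing k F) * w 0 = 0 by linear_combination e1)).resolve_left hC
  · exact e2
  · exact (mul_eq_zero.1 (show (2 : PairRing k F) * w 2 = 0 by linear_combination -e3)).resolve_left hC

variable (p : ℕ) [Fact p.Prime] [CharP k p] [CharP F p] [Fintype k] [Finite F]

/-- The Clebsch–Gordan range: `Hom(𝔰𝔩₂, V) ≅ V ⊗ Sym²` has total degree less than `p` at each
embedding, so that it is semisimple, and so are all its subquotients. -/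
theorem niceOn_base (hp2 : p ≠ 2) (hd : ∀ τ, ∑ s, d (τ, s) + 2 < p) (hd3 : d (τ, 3) = 0) :
    NiceOn (V := PairRing k F) (adMat τ) actEnd (Homog d) := by
  have : Nonempty (k →+* F) := ⟨τ⟩
  have hfin : FiniteDimensional F (powSub (Fin 3) (Homog (F := F) d)) := by
    let φ : powSub (Fin 3) (Homog (F := F) d) →ₗ[F] (Fin 3 → Homog (F := F) d) :=
      LinearMap.pi fun i => LinearMap.codRestrict _ (LinearMap.proj i ∘ₗ Submodule.subtype _)
        fun w => mem_powSub.1 w.2 i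
    refine Module.Finite.of_injective φ fun w w' h => ?_
    ext i : 2
    exact congrArg Subtype.val (congrFun h i)
  refine NiceOn.of_semisimple (relCompl_of_separated (ρ' := actEnd) (V' := PairRing k F)
    (stable_homog.powSub _) fun w hw hw0 => ?_)
  rw [mem_powSub] at hw
  have h2 : (2 : F) ≠ 0 := by
    have := (CharP.cast_eq_zero_iff F p 2).not.2 fun h =>
      hp2 ((Nat.prime_dvd_prime_iff_eq Fact.out Nat.prime_two).1 h)
    exact_mod_cast this
  obtain ⟨S, n, hn, hS, hle, hSw⟩ := exists_separating p (d := Function.update d (τ, 3) 2)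
    (f := symEmbed τ w) (fun τ' => by
      refine lt_of_le_of_lt ?_ (hd τ')
      rw [Fin.sum_univ_four, Fin.sum_univ_four]
      by_cases h : τ' = τ
      · subst h; simp [Fin.ext_iff]
      · simp [h]) (symEmbed_mem hd3 hw) fun h => hw0 (symEmbed_injOn h2 hd3 hw h)
  refine ⟨S ∘ₗ symEmbed τ, Homog (mainDeg n), hS.comp (semiEquivariant_symEmbed τ),
    irrOn_mainDeg p hn, fun v hv => ?_, hSw⟩
  exact hle (symEmbed_mem hd3 (mem_powSub.1 hv))

/-- For each simple subquotient `S` of the polynomial space that maps onto the projective cover of a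
Serre weight, `Hom(𝔰𝔩₂, S)` is semisimple. The embeddings in `T` are treated one by one with
`niceOn_step`; the pieces that remain are tensor products of `Sym^r` or `Sym^(p - 2 - r)` with at
most one copy of a standard representation at every embedding, to which `niceOn_base` applies. -/
theorem niceOn_thetaSub {r : (k →+* F) → ℕ} (hr : ∀ τ, 2 ≤ r τ ∧ r τ + 4 ≤ p) (τ₀ : k →+* F)
    (T : Finset (k →+* F)) (hT : ∀ τ ∈ T, d (τ, 0) = p - 1 ∧ d (τ, 1) = p - 1 - r τ ∧
      d (τ.comp (frobenius k p), 2) = 0)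
    (hT' : ∀ τ ∉ T, (d (τ, 0) = r τ ∨ d (τ, 0) = p - 2 - r τ) ∧ d (τ, 1) = 0)
    (h2 : ∀ τ, d (τ, 2) ≤ 1) (h3 : ∀ τ, d (τ, 3) = 0) :
    NiceOn (V := PairRing k F) (adMat τ₀) actEnd (thetaSub d T) := by
  have hs : (1 : Fin 4) ≠ 0 := by decide
  have hfrob : ∀ τ τ' : k →+* F, τ'.comp (frobenius k p) = τ.comp (frobenius k p) → τ' = τ := by
    intro τ τ' h
    ext x
    obtain ⟨y, rfl⟩ : ∃ y, frobenius k p y = x :=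
      (Finite.injective_iff_surjective.1 (frobenius_inj k p)) x
    exact DFunLike.congr_fun h y
  induction hn : T.card generalizing T d with
  | zero =>
    rw [Finset.card_eq_zero] at hn
    subst hn
    have : thetaSub (F := F) d ∅ = Homog d := by simp [thetaSub]
    rw [this]
    refine niceOn_base p (by have := hr τ₀; omega) (fun τ => ?_) (h3 τ₀)
    have e1 := hT' τ (by simp)
    have e2 := hr τ
    have e3 := h2 τ
    have e4 := h3 τ
    rw [Fin.sum_univ_four]
    omega
  | succ n ih =>
    obtain ⟨τ, hτ⟩ : T.Nonempty := by
      rw [← Finset.card_pos]; omega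
    have e1 := hT τ hτ
    have e2 := hr τ
    have hcard : (T.erase τ).card = n := by rw [Finset.card_erase_of_mem hτ, hn]; rfl
    obtain ⟨m, hm⟩ : ∃ m, p = r τ + m + 2 := ⟨p - r τ - 2, by omega⟩
    refine niceOn_step p hm hτ (by omega) (by omega) e1.2.2 ?_ ?_
    · refine ih _ (fun τ' hτ' => ?_) (fun τ' hτ' => ?_) (fun τ' => ?_) (fun τ' => ?_) hcard
      · have hne := Finset.ne_of_mem_erase hτ'
        have := hT τ' (Finset.mem_of_mem_erase hτ')
        rw [wt_other (by simp [hne]) (by simp [hne]), wt_other (by simp [hne]) (by simp [hne]),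
          wt_other (by simp) (by simp [Fin.ext_iff])]
        exact this
      · by_cases h : τ' = τ
        · subst h
          rw [wt_zero hs, wt_self]
          exact ⟨Or.inl rfl, rfl⟩
        · rw [wt_other (by simp [h]) (by simp [h]), wt_other (by simp [h]) (by simp [h])]
          exact hT' τ' fun h' => hτ' (Finset.mem_erase.2 ⟨h, h'⟩)
      · rw [wt_other (by simp) (by simp [Fin.ext_iff])]; exact h2 τ'
      · rw [wt_other (by simp) (by simp [Fin.ext_iff])]; exact h3 τ'
    · refine ih _ (fun τ' hτ' => ?_) (fun τ' hτ' => ?_) (fun τ' => ?_) (fun τ' => ?_) hcard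
      · have hne := Finset.ne_of_mem_erase hτ'
        have := hT τ' (Finset.mem_of_mem_erase hτ')
        rw [Function.update_of_ne (by simp), Function.update_of_ne (by simp [Fin.ext_iff]),
          Function.update_of_ne (fun h => hne (hfrob _ _ (by simpa using h))),
          wt_other (by simp [hne]) (by simp [hne]), wt_other (by simp [hne]) (by simp [hne]),
          wt_other (by simp) (by simp [Fin.ext_iff])]
        exact this
      · rw [Function.update_of_ne (by simp), Function.update_of_ne (by simp [Fin.ext_iff])]
        by_cases h : τ' = τ
        · subst h
          rw [wt_zero hs, wt_self]
          exact ⟨Or.inr (by omega), rfl⟩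
        · rw [wt_other (by simp [h]) (by simp [h]), wt_other (by simp [h]) (by simp [h])]
          exact hT' τ' fun h' => hτ' (Finset.mem_erase.2 ⟨h, h'⟩)
      · rw [Function.update_apply]
        split_ifs
        · exact le_rfl
        · rw [wt_other (by simp) (by simp [Fin.ext_iff])]; exact h2 τ'
      · rw [Function.update_of_ne (by simp [Fin.ext_iff]), wt_other (by simp) (by simp [Fin.ext_iff])]
        exact h3 τ'

end Base

/-! ### The map from the polynomial model to the restricted symmetric powers -/

section Descent

open MvPolynomial

variable {k F : Type*} [Field k] [Field F] [Fintype (k →+* F)] [DecidableEq (k →+* F)]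
  (p : ℕ) [Fact p.Prime] [CharP F p]
  {d : (k →+* F) × Fin 4 → ℕ} {f g : PairRing k F} {τ : k →+* F} {r m a b n : ℕ}

theorem commute_theta_theta (τ τ' : k →+* F) :
    Commute (theta τ : Module.End F (PairRing k F)) (theta τ') := by
  by_cases h : τ = τ'
  · rw [h]
  · exact (commute_theta_mulCross h 1).mul_right (commute_theta_cayley h 1)

theorem aeval_theta_mem (P : Polynomial F) (hf : f ∈ Homog d) :
    (Polynomial.aeval (theta τ) P) f ∈ Homog d := by
  induction P using Polynomial.induction_on' with
  | add P Q hP hQ => rw [map_add, LinearMap.add_apply]; exact add_mem hP hQ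
  | monomial n a =>
    rw [Polynomial.aeval_monomial, Module.End.mul_apply, Module.algebraMap_end_apply]
    refine Submodule.smul_mem _ _ ?_
    induction n with
    | zero => simpa using hf
    | succ n ih => rw [pow_succ', Module.End.mul_apply]; exact theta_mem_homog ih

/-- On the multiples of `Δ^j` modulo those of `Δ^(j + 1)`, the operator `Δ ∂` acts by the scalar
`j (r + 2 m + 1 - j)`. -/
theorem aeval_theta_prod (hf : f ∈ Homog (wt d τ 1 (r + m) m)) (hn : n ≤ m + 1) :
    (Polynomial.aeval (theta τ) (∏ j ∈ Finset.range n,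
      (Polynomial.X - Polynomial.C ((j : F) * ((r + m + m + 1 : ℕ) - j))))) f
      = cross τ 1 ^ n * (cayley τ 1 ^ n) f := by
  have hs : (1 : Fin 4) ≠ 0 := by decide
  induction n with
  | zero => simp
  | succ n ih =>
    obtain ⟨b, rfl⟩ : ∃ b, m = b + n := ⟨m - n, by omega⟩
    have h1 : (cayley τ 1 ^ n) f ∈ Homog (wt d τ 1 (r + b) b) :=
      cayley_pow_mem hs (by rwa [add_assoc])
    have h2 : theta τ (cross τ 1 ^ n * (cayley τ 1 ^ n) f)
        = cross τ 1 ^ (n + 1) * (cayley τ 1 ^ (n + 1)) f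
          + ((n : F) * ((r + (b + n) + (b + n) + 1 : ℕ) - n)) • (cross τ 1 ^ n * (cayley τ 1 ^ n) f) := by
      rw [theta_apply]
      cases n with
      | zero => simp
      | succ n =>
        rw [cayley_cross_pow_mul hs h1, mul_add, mul_smul_comm, ← mul_assoc, ← mul_assoc,
          ← pow_succ', ← pow_succ', ← Module.End.mul_apply, ← pow_succ']
        congr 2
        push_cast
        ring
    rw [Finset.prod_range_succ, mul_comm, map_mul, Module.End.mul_apply, ih (by omega), map_sub,
      LinearMap.sub_apply, Polynomial.aeval_X, Polynomial.aeval_C, Module.algebraMap_end_apply, h2]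
    abel

/-- The top power `∂^m` kills the values of `Δ ∂`, the factor `r + m + 1` being `p`. -/
theorem cayley_pow_theta (hp : p = r + m + 1) (hf : f ∈ Homog (wt d τ 1 (r + m) m)) :
    (cayley τ 1 ^ m) (theta τ f) = 0 := by
  have hs : (1 : Fin 4) ≠ 0 := by decide
  rw [theta_apply]
  cases m with
  | zero => rw [cayley_eq_zero hf]; simp
  | succ m =>
    have h1 : cayley τ 1 f ∈ Homog (wt d τ 1 (r + m) (0 + m)) := by
      rw [zero_add]; exact cayley_mem hs hf
    rw [cayley_pow_succ_cross_mul hs h1, pow_succ', Module.End.mul_apply,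
      cayley_eq_zero (cayley_pow_mem hs h1), mul_zero, zero_add,
      show (m + 1) * (r + 0 + m + 2) = (m + 1) * p by rw [hp]; ring]
    simp

/-- A polynomial in `Δ ∂` with nonzero constant term whose values are in the generalised kernel. As
`p = r + m + 1`, the eigenvalues `j (m - j)` of `Δ ∂` vanish only for `j = 0` and `j = m`; the
polynomial is the product of the factors for the other `j`. -/
theorem exists_theta_projector (hp : p = r + m + 1) (hm : m ≠ 0) :
    ∃ P : Polynomial F, P.coeff 0 ≠ 0 ∧ ∀ d, ∀ f ∈ Homog (wt d τ 1 (r + m) m),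
      (theta τ ^ 2) ((Polynomial.aeval (theta τ) P) f) = 0 := by
  obtain ⟨m, rfl⟩ := Nat.exists_eq_succ_of_ne_zero hm
  have hp0 : (p : F) = 0 := CharP.cast_eq_zero F p
  have hcast : ((r + (m + 1) + (m + 1) + 1 : ℕ) : F) = m + 1 := by
    rw [show r + (m + 1) + (m + 1) + 1 = p + (m + 1) by omega]
    push_cast
    rw [hp0, zero_add]
  refine ⟨∏ j ∈ Finset.range m, (Polynomial.X -
    Polynomial.C (((j + 1 : ℕ) : F) * ((r + (m + 1) + (m + 1) + 1 : ℕ) - ((j + 1 : ℕ) : F)))), ?_, ?_⟩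
  · rw [Polynomial.coeff_zero_eq_eval_zero, Polynomial.eval_prod, Finset.prod_ne_zero_iff]
    intro j hj
    rw [Finset.mem_range] at hj
    rw [Polynomial.eval_sub, Polynomial.eval_X, Polynomial.eval_C, zero_sub, neg_ne_zero, hcast]
    have h1 : ((m + 1 : F) - ((j + 1 : ℕ) : F)) = ((m - j : ℕ) : F) := by
      rw [Nat.cast_sub (by omega)]; push_cast; ring
    rw [h1]
    refine mul_ne_zero ?_ ?_ <;>
    · rw [Ne, CharP.cast_eq_zero_iff F p]
      exact fun h => absurd (Nat.le_of_dvd (by omega) h) (by omega)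
  · intro d f hf
    have hs : (1 : Fin 4) ≠ 0 := by decide
    have h := aeval_theta_prod hf le_rfl
    have h0 : (cayley τ 1 ^ (m + 1 + 1)) f = 0 := by
      rw [pow_succ', Module.End.mul_apply]
      exact cayley_eq_zero (cayley_pow_mem hs (b := 0) (by simpa using hf))
    rw [h0, mul_zero, Finset.prod_range_succ, Finset.prod_range_succ'] at h
    simp only [Nat.cast_zero, zero_mul, map_zero, sub_zero] at h
    rw [hcast] at h ⊢
    rw [show ((m.succ : ℕ) : F) = m + 1 by push_cast; ring, sub_self, mul_zero, map_zero, sub_zero,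
      mul_assoc, mul_comm, map_mul, map_mul, Polynomial.aeval_X] at h
    rw [pow_two]
    exact h

/-- The multidegree of the polynomial model: degrees `q` and `m` on the first two pairs, replaced by
`r` and `0` at the embeddings in `S`. In the application `q = p - 1`. -/
def modelDeg (q : ℕ) (r m : (k →+* F) → ℕ) (S : Finset (k →+* F)) (t : (k →+* F) × Fin 4) : ℕ :=
  if t.2 = 0 then (if t.1 ∈ S then r t.1 else q) else
    if t.2 = 1 then (if t.1 ∈ S then 0 else m t.1) else 0

/-- A monomial of multidegree `modelDeg q r m S` which is not killed by the powers of Cayley's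
operator. -/
def modelVec (q : ℕ) (r m : (k →+* F) → ℕ) (S : Finset (k →+* F)) : PairRing k F :=
  ∏ τ, (X (τ, 0, 0) ^ (if τ ∈ S then r τ else q) * X (τ, 1, 1) ^ (if τ ∈ S then 0 else m τ))

theorem modelVec_mem (q : ℕ) (r m : (k →+* F) → ℕ) (S : Finset (k →+* F)) :
    modelVec q r m S ∈ Homog (modelDeg q r m S) := by
  have := IsWeightedHomogeneous.prod (R := F) (w := pairDeg (k := k) (F := F)) Finset.univ
    (fun τ => X (τ, 0, 0) ^ (if τ ∈ S then r τ else q) * X (τ, 1, 1) ^ (if τ ∈ S then 0 else m τ))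
    _ (fun τ _ => (IsWeightedHomogeneous.pow (X_mem_homog τ 0 0) _).mul
      (IsWeightedHomogeneous.pow (X_mem_homog τ 1 1) _))
  refine Eq.subst (motive := fun d => modelVec q r m S ∈ Homog d) (funext fun t => ?_) this
  obtain ⟨τ, s⟩ := t
  rw [Finset.sum_apply, Finset.sum_eq_single τ]
  · simp only [Pi.add_apply, Pi.smul_apply, Pi.single_apply, Prod.mk.injEq, true_and, modelDeg,
      smul_eq_mul]
    by_cases h0 : s = 0
    · subst h0; simp
    · by_cases h1 : s = 1
      · subst h1; simp
      · simp [h0, h1]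
  · intro τ' _ h
    have h1 : ∀ s', (Pi.single (τ', s') 1 : (k →+* F) × Fin 4 → ℕ) (τ, s) = 0 := fun s' =>
      Pi.single_eq_of_ne (by simp [Ne.symm h]) _
    simp only [Pi.add_apply, Pi.smul_apply, h1, smul_zero, add_zero]
  · simp

theorem pderiv_iterate_X_pow_mul' {i : (k →+* F) × Fin 4 × Fin 2} (h : pderiv i g = 0)
    (hn : a + n < p) :
    ∃ c : F, c ≠ 0 ∧ (pderiv i)^[n] (X i ^ (a + n) * g) = c • (X i ^ a * g) := by
  induction n with
  | zero => exact ⟨1, one_ne_zero, by simp⟩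
  | succ n ih =>
    obtain ⟨c, hc, h'⟩ := ih (by omega)
    refine ⟨(a + n + 1 : ℕ) * c, mul_ne_zero ?_ hc, ?_⟩
    · rw [Ne, CharP.cast_eq_zero_iff F p]
      exact fun h => absurd (Nat.le_of_dvd (by omega) h) (by omega)
    · have e : pderiv i (X i ^ (a + (n + 1)) * g) = C ((a + n + 1 : ℕ) : F) * (X i ^ (a + n) * g) := by
        rw [pderiv_mul, h, pderiv_pow, pderiv_X_self, map_natCast, ← add_assoc]
        simp only [Nat.add_sub_cancel]
        ring
      rw [Function.iterate_succ_apply, e, pderiv_iterate_mul_of_eq_zero pderiv_C, h',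
        ← smul_eq_C_mul, smul_smul]

variable {r m : (k →+* F) → ℕ}

theorem modelVec_ne_zero (q : ℕ) (S : Finset (k →+* F)) : modelVec q r m S ≠ 0 :=
  Finset.prod_ne_zero_iff.2 fun _ _ => mul_ne_zero (pow_ne_zero _ (X_ne_zero _))
    (pow_ne_zero _ (X_ne_zero _))

theorem modelDeg_insert {q : ℕ} {S : Finset (k →+* F)} (hτ : τ ∉ S) :
    modelDeg q r m S = wt (modelDeg q r m S) τ 1 q (m τ) ∧
    modelDeg q r m (insert τ S) = wt (modelDeg q r m S) τ 1 (r τ) 0 := by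
  have hs : (1 : Fin 4) ≠ 0 := by decide
  constructor
  · conv_lhs => rw [← wt_eta (modelDeg q r m S) τ 1]
    congr 1 <;> simp [modelDeg, hτ]
  · funext ⟨τ', s⟩
    by_cases h : τ' = τ
    · subst h
      by_cases h0 : s = 0
      · subst h0; rw [wt_zero hs]; simp [modelDeg]
      · by_cases h1 : s = 1
        · subst h1; rw [wt_self]; simp [modelDeg]
        · rw [wt_other (by simp [h0]) (by simp [h1])]; simp [modelDeg, h0, h1]
    · rw [wt_other (by simp [h]) (by simp [h])]
      simp [modelDeg, Finset.mem_insert, h]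

theorem cayley_pow_modelVec {S : Finset (k →+* F)} (hp : p = r τ + m τ + 1) (hτ : τ ∉ S) :
    ∃ c : F, c ≠ 0 ∧ (cayley τ 1 ^ m τ) (modelVec (p - 1) r m S)
      = c • modelVec (p - 1) r m (insert τ S) := by
  have e1 : p - 1 = r τ + m τ := by omega
  set R : PairRing k F := ∏ τ' ∈ Finset.univ.erase τ, (X (τ', 0, 0) ^ (if τ' ∈ S then r τ' else p - 1)
    * X (τ', 1, 1) ^ (if τ' ∈ S then 0 else m τ')) with hR
  have h1 : modelVec (p - 1) r m S = X (τ, 1, 1) ^ (0 + m τ) * (X (τ, 0, 0) ^ (r τ + m τ) * R) := by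
    rw [modelVec, ← Finset.mul_prod_erase _ _ (Finset.mem_univ τ), if_neg hτ, if_neg hτ, ← hR, e1]
    ring
  have h2 : modelVec (p - 1) r m (insert τ S) = X (τ, 0, 0) ^ r τ * R := by
    rw [modelVec, ← Finset.mul_prod_erase _ _ (Finset.mem_univ τ),
      if_pos (Finset.mem_insert_self _ _), if_pos (Finset.mem_insert_self _ _), hR, pow_zero, mul_one]
    congr 1
    refine Finset.prod_congr rfl fun τ' h' => ?_
    simp [Finset.mem_insert, Finset.ne_of_mem_erase h']
  have hD : ∀ s j, pderiv (τ, s, j) R = 0 := by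
    intro s j
    refine Finset.prod_induction _ (fun g => pderiv (τ, s, j) g = 0) ?_ (by simp) ?_
    · intro a b ha hb
      rw [pderiv_mul, ha, hb]; simp
    · intro τ' h'
      have hne := Finset.ne_of_mem_erase h'
      rw [pderiv_mul, pderiv_pow, pderiv_pow, X_ne (by simp [hne.symm]), X_ne (by simp [hne.symm])]
      simp
  obtain ⟨c₁, hc₁, e₁⟩ := pderiv_iterate_X_pow_mul' (F := F) p (i := (τ, 1, 1)) (a := 0) (n := m τ)
    (g := X (τ, 0, 0) ^ (r τ + m τ) * R) (by
      rw [pderiv_mul, hD, pderiv_pow, X_ne (by simp)]; simp) (by omega)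
  obtain ⟨c₂, hc₂, e₂⟩ := pderiv_iterate_X_pow_mul' (F := F) p (i := (τ, 0, 0)) (a := r τ)
    (n := m τ) (hD 0 0) (by omega)
  refine ⟨c₁ * c₂, mul_ne_zero hc₁ hc₂, ?_⟩
  rw [h1, h2, cayley_pow_eq, e₁, pow_zero, one_mul, smul_eq_C_mul,
    pderiv_iterate_mul_of_eq_zero pderiv_C, e₂, ← smul_eq_C_mul, smul_smul]
  left
  rw [pderiv_mul, pderiv_mul, hD, pderiv_pow, pderiv_pow, X_ne (by simp), X_ne (by simp)]
  simp

/-- The product of powers of Cayley's operators maps the polynomial model to a restricted symmetric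
power. -/
theorem exists_descent (hp : ∀ τ, p = r τ + m τ + 1) (S : Finset (k →+* F)) :
    ∃ q : Module.End F (PairRing k F),
      (∀ g f, q (act g f) = (∏ τ ∈ S, τ (Matrix.det (g : Matrix (Fin 2) (Fin 2) k)) ^ m τ) •
        act g (q f)) ∧
      Homog (modelDeg (p - 1) r m ∅) ≤ (Homog (modelDeg (p - 1) r m S)).comap q ∧
      (∀ τ ∉ S, Commute (theta τ) q) ∧
      (∀ τ ∈ S, ∀ f ∈ Homog (modelDeg (p - 1) r m ∅), q (theta τ f) = 0) ∧
      ∃ c : F, c ≠ 0 ∧ q (modelVec (p - 1) r m ∅) = c • modelVec (p - 1) r m S := by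
  induction S using Finset.induction_on with
  | empty =>
    exact ⟨1, by simp, le_rfl, fun _ _ => Commute.one_right _, by simp, 1, one_ne_zero, by simp⟩
  | insert τ S hτ ih =>
    obtain ⟨q, h1, h2, h3, h4, c, hc, h5⟩ := ih
    have hs : (1 : Fin 4) ≠ 0 := by decide
    obtain ⟨hd, hd'⟩ := modelDeg_insert (q := p - 1) (r := r) (m := m) hτ
    have e1 : p - 1 = r τ + m τ := by have := hp τ; omega
    have hq : ∀ f ∈ Homog (modelDeg (p - 1) r m ∅),
        q f ∈ Homog (wt (modelDeg (p - 1) r m S) τ 1 (r τ + m τ) (m τ)) := by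
      intro f hf
      rw [← e1, ← hd]
      exact h2 hf
    refine ⟨cayley τ 1 ^ m τ * q, ?_, ?_, ?_, ?_, ?_⟩
    · intro g f
      have hpow : ∀ n (f : PairRing k F), (cayley τ 1 ^ n) (act g f)
          = τ (Matrix.det (g : Matrix (Fin 2) (Fin 2) k)) ^ n • act g ((cayley τ 1 ^ n) f) := by
        intro n
        induction n with
        | zero => intro f; simp
        | succ n ih =>
          intro f
          rw [pow_succ, Module.End.mul_apply, cayley_act, map_smul, ih, smul_smul,
            Module.End.mul_apply, pow_succ']
      rw [Module.End.mul_apply, h1, map_smul, hpow, smul_smul, Finset.prod_insert hτ, mul_comm,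
        Module.End.mul_apply]
    · intro f hf
      rw [hd']
      exact cayley_pow_mem hs (b := 0) (by simpa using hq f hf)
    · intro τ' hτ'
      rw [Finset.mem_insert, not_or] at hτ'
      exact ((commute_theta_cayley hτ'.1 1).pow_right _).mul_right (h3 τ' hτ'.2)
    · intro τ' hτ' f hf
      rw [Module.End.mul_apply]
      rcases Finset.mem_insert.1 hτ' with rfl | h
      · have e := LinearMap.congr_fun (h3 _ hτ).eq f
        rw [Module.End.mul_apply, Module.End.mul_apply] at e
        rw [← e]
        exact cayley_pow_theta p (hp _) (hq f hf)
      · rw [h4 τ' h f hf, map_zero]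
    · obtain ⟨c', hc', h6⟩ := cayley_pow_modelVec p (hp τ) hτ
      exact ⟨c * c', mul_ne_zero hc hc', by
        rw [Module.End.mul_apply, h5, map_smul, h6, smul_smul]⟩

/-- A map that kills the values of the operators `Δ ∂` but not the whole polynomial space does not
vanish on the generalised kernel of these operators either: apply the polynomials of
`exists_theta_projector`, which act by their nonzero constant terms after composition with the map.
-/
theorem exists_mem_thetaSub_of_descent (hp : ∀ τ, p = r τ + m τ + 1) (hm : ∀ τ, m τ ≠ 0)
    {q : Module.End F (PairRing k F)}
    (hq : ∀ τ, ∀ f ∈ Homog (modelDeg (p - 1) r m ∅), q (theta τ f) = 0)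
    (hq0 : q (modelVec (p - 1) r m ∅) ≠ 0) (T : Finset (k →+* F)) :
    ∃ v ∈ thetaSub (modelDeg (p - 1) r m ∅) T, q v ≠ 0 := by
  induction T using Finset.induction_on with
  | empty => exact ⟨_, mem_thetaSub.2 ⟨modelVec_mem _ _ _ _, by simp⟩, hq0⟩
  | insert τ T _ ih =>
    obtain ⟨v, hv, hqv⟩ := ih
    rw [mem_thetaSub] at hv
    obtain ⟨P, hP0, hP⟩ := exists_theta_projector (F := F) (τ := τ) p (hp τ) (hm τ)
    have e1 : p - 1 = r τ + m τ := by have := hp τ; omega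
    obtain ⟨hd, -⟩ := modelDeg_insert (q := p - 1) (r := r) (m := m) (Finset.notMem_empty τ)
    refine ⟨(Polynomial.aeval (theta τ) P) v, mem_thetaSub.2 ⟨aeval_theta_mem P hv.1, ?_⟩, ?_⟩
    · intro τ' hτ'
      rcases Finset.mem_insert.1 hτ' with rfl | h
      · refine hP (modelDeg (p - 1) r m ∅) v ?_
        rw [← e1, ← hd]
        exact hv.1
      · have hc : Commute (theta τ' ^ 2) (Polynomial.aeval (theta τ : Module.End F (PairRing k F)) P) := by
          refine Commute.pow_left ?_ 2
          rw [Polynomial.aeval_eq_sum_range]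
          exact Commute.sum_right _ _ _ fun i _ =>
            ((commute_theta_theta τ' τ).pow_right i).smul_right _
        rw [← Module.End.mul_apply, hc.eq, Module.End.mul_apply, hv.2 τ' h, map_zero]
    · rw [← Polynomial.X_mul_divX_add P, map_add, LinearMap.add_apply, map_mul, Polynomial.aeval_X,
        Module.End.mul_apply, map_add, hq τ _ (aeval_theta_mem _ hv.1), zero_add,
        Polynomial.aeval_C, Module.algebraMap_end_apply, map_smul]
      exact smul_ne_zero hP0 hqv

end Descent

/-! ### Relative projectivity of the Steinberg representation -/

section Steinberg

open MvPolynomial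

variable {k F : Type*} [Field k] [Field F] [Fintype (k →+* F)] [DecidableEq (k →+* F)]
  {d : (k →+* F) × Fin 4 → ℕ} {f g : PairRing k F}

theorem unip_neg_inv (x : k) : (unip x)⁻¹ = unip (-x) := by
  ext i j
  simp [unip]

/-- Evaluation of the main variables at `(1, 0)`. -/
def evalMain : PairRing k F →ₐ[F] PairRing k F :=
  aeval fun i => if i.2.1 = 0 then (if i.2.2 = 0 then 1 else 0) else X i

/-- A monomial is the product of its part in the main variables and of a form in the others, which
is fixed by the substitutions that involve the main variables only. -/
theorem monomial_eq_mon_mul {n : (k →+* F) → ℕ} {e : (k →+* F) × Fin 4 × Fin 2 →₀ ℕ} (c : F)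
    (he : ∀ τ s, e (τ, s, 0) + e (τ, s, 1) = d (τ, s)) (hd : ∀ τ, d (τ, 0) = n τ) :
    ∃ R ∈ Homog (fun t => if t.2 = 0 then 0 else d t), (∀ φ : PairRing k F →ₐ[F] PairRing k F,
        (∀ τ s j, s ≠ 0 → φ (X (τ, s, j)) = X (τ, s, j)) → φ R = R) ∧
      monomial e c = mon n (fun τ => e (τ, 0, 1)) * R := by
  refine ⟨C c * ∏ τ, ∏ s ∈ Finset.univ.erase (0 : Fin 4), ∏ j, X (τ, s, j) ^ e (τ, s, j),
    ?_, fun φ hφ => ?_, ?_⟩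
  · refine IsWeightedHomogeneous.C_mul ?_ c
    have := IsWeightedHomogeneous.prod (R := F) (w := pairDeg (k := k) (F := F)) Finset.univ
      (fun τ => ∏ s ∈ Finset.univ.erase (0 : Fin 4), ∏ j, X (τ, s, j) ^ e (τ, s, j)) _
      (fun τ _ => IsWeightedHomogeneous.prod _ _ _ fun s _ => IsWeightedHomogeneous.prod _ _ _
        fun j _ => IsWeightedHomogeneous.pow (X_mem_homog τ s j) _)
    refine Eq.subst (motive := fun d => _ ∈ Homog d) (funext fun t => ?_) this
    obtain ⟨τ, s⟩ := t
    rw [Finset.sum_apply, Finset.sum_eq_single τ, Finset.sum_apply]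
    · by_cases h : s = 0
      · subst h
        rw [if_pos rfl]
        refine Finset.sum_eq_zero fun s hs => ?_
        have := Finset.ne_of_mem_erase hs
        simp [Ne.symm this]
      · rw [Finset.sum_eq_single_of_mem s (by simp [h])]
        · simp [Fin.sum_univ_two, h, he]
        · intro s' _ hs'
          simp [Ne.symm hs']
    · intro τ' _ h
      simp [Ne.symm h]
    · simp
  · have h1 : φ (C c) = C c := by rw [← algebraMap_eq, AlgHom.commutes]
    rw [map_mul, h1]
    simp only [map_prod, map_pow]
    refine congrArg (C c * ·) ?_
    exact Finset.prod_congr rfl fun τ _ => Finset.prod_congr rfl fun s hs =>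
      Finset.prod_congr rfl fun j _ => by rw [hφ τ s j (Finset.ne_of_mem_erase hs)]
  · have h1 : ∀ τ : k →+* F, ∏ t : Fin 4 × Fin 2, (X (τ, t) : PairRing k F) ^ e (τ, t)
        = X (τ, 0, 0) ^ (n τ - e (τ, 0, 1)) * X (τ, 0, 1) ^ e (τ, 0, 1) *
          ∏ s ∈ Finset.univ.erase (0 : Fin 4), ∏ j, X (τ, s, j) ^ e (τ, s, j) := by
      intro τ
      rw [Fintype.prod_prod_type, ← Finset.mul_prod_erase _ _ (Finset.mem_univ (0 : Fin 4)),
        Fin.prod_univ_two, ← hd, ← he, Nat.add_sub_cancel]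
    rw [monomial_eq, Finsupp.prod_fintype _ _ (by simp), Fintype.prod_prod_type,
      Finset.prod_congr rfl fun τ _ => h1 τ, Finset.prod_mul_distrib, mon]
    ring

theorem algHom_mon_eq {n b : (k →+* F) → ℕ} {φ : PairRing k F →ₐ[F] PairRing k F} {x : k}
    (h0 : ∀ τ, φ (X (τ, 0, 0)) = 1) (h1 : ∀ τ, φ (X (τ, 0, 1)) = C (τ x)) :
    φ (mon n b) = C (digitFun b x) := by
  simp [mon, digitFun, map_prod, h0, h1]

variable (p : ℕ) [Fact p.Prime] [CharP k p] [CharP F p] [Fintype k] [Finite F] [Nonempty (k →+* F)]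

/-- A form in the main variables of degrees less than `p` is determined by its values at the points
`(1, τ(x))`, because the digit monomials are linearly independent. -/
theorem coeff_eq_zero_of_digit {n : (k →+* F) → ℕ} (hn : ∀ τ, n τ < p) {c : ((k →+* F) → ℕ) → F}
    (h : ∀ x : k, evalMain (act (unip x) (∑ b ∈ boxBelow n, c b • mon n b)) = 0) :
    ∀ b ∈ boxBelow n, c b = 0 := by
  have h1 : ∀ x : k, ∑ b ∈ boxBelow n, c b * digitFun b x = 0 := by
    intro x
    have h2 := h x
    simp only [map_sum, map_smul] at h2
    have h3 : ∀ b : (k →+* F) → ℕ, evalMain (act (unip x) (mon n b : PairRing k F))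
        = C (digitFun b x) := fun b => by
      rw [← AlgHom.comp_apply]
      exact algHom_mon_eq (fun τ => by rw [AlgHom.comp_apply, act_unip_X0]; simp [evalMain])
        (fun τ => by rw [AlgHom.comp_apply, act_unip_X1]; simp [evalMain, algHom_C])
    simp only [h3, smul_eq_C_mul] at h2
    rw [← (C_injective _ F).eq_iff, map_zero, ← h2, map_sum]
    simp only [map_mul]
  intro b₀ hb₀
  rw [mem_boxBelow] at hb₀
  obtain ⟨e, -, he⟩ := exists_extraction p (k := k) b₀ fun τ => (hb₀ τ).trans_lt (hn τ)
  have h4 : ∑ x, e x * ∑ b ∈ boxBelow n, c b * digitFun b x = c b₀ := by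
    simp only [Finset.mul_sum]
    rw [Finset.sum_comm, Finset.sum_eq_single_of_mem b₀ (mem_boxBelow.2 hb₀)]
    · simp only [mul_left_comm (e _)]
      rw [← Finset.mul_sum, he _ fun τ => (hb₀ τ).trans_lt (hn τ), if_pos rfl, mul_one]
    · intro b hb hne
      simp only [mul_left_comm (e _)]
      rw [← Finset.mul_sum, he _ fun τ => (mem_boxBelow.1 hb τ).trans_lt (hn τ), if_neg hne, mul_zero]
  simp only [h1, mul_zero, Finset.sum_const_zero] at h4
  exact h4.symm

theorem eq_zero_of_digit {n : (k →+* F) → ℕ} (hn : ∀ τ, n τ < p) (hf : f ∈ Homog (mainDeg n))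
    (h : ∀ x : k, evalMain (act (unip x) f) = 0) : f = 0 := by
  obtain ⟨c, rfl⟩ := exists_eq_sum_mon hf
  exact Finset.sum_eq_zero fun b hb => by rw [coeff_eq_zero_of_digit p hn h b hb, zero_smul]

omit [Fintype k] [Finite F] [Nonempty (k →+* F)] in
theorem mon_mem_homog {n b : (k →+* F) → ℕ} (hb : b ≤ n) :
    (mon n b : PairRing k F) ∈ Homog (mainDeg n) := by
  have := IsWeightedHomogeneous.prod (R := F) (w := pairDeg (k := k) (F := F)) Finset.univ
    (fun τ => X (τ, 0, 0) ^ (n τ - b τ) * X (τ, 0, 1) ^ b τ)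
    _ (fun τ _ => (IsWeightedHomogeneous.pow (X_mem_homog τ 0 0) _).mul
      (IsWeightedHomogeneous.pow (X_mem_homog τ 0 1) _))
  refine Eq.subst (motive := fun d => mon n b ∈ Homog d) (funext fun t => ?_) this
  obtain ⟨τ, s⟩ := t
  rw [Finset.sum_apply, Finset.sum_eq_single τ]
  · simp only [Pi.add_apply, Pi.smul_apply, Pi.single_apply, Prod.mk.injEq, true_and, mainDeg,
      smul_eq_mul]
    have : b τ ≤ n τ := hb τ
    split_ifs <;> omega
  · intro τ' _ h
    have h1 : ∀ s', (Pi.single (τ', s') 1 : (k →+* F) × Fin 4 → ℕ) (τ, s) = 0 := fun s' =>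
      Pi.single_eq_of_ne (by simp [Ne.symm h]) _
    simp only [Pi.add_apply, Pi.smul_apply, h1, smul_zero, add_zero]
  · simp

theorem evalMain_mem (w : PairRing k F) (hw : w ∈ Homog (mainDeg fun _ => p - 1))
    (hd : ∀ τ, d (τ, 0) = p - 1) (hf : f ∈ Homog d) : evalMain f * w ∈ Homog d := by
  refine Homog.induction (motive := fun f => evalMain f * w ∈ Homog d) hf (by simp)
    (fun f g hf hg => by rw [map_add, add_mul]; exact add_mem hf hg) fun e c he => ?_
  obtain ⟨R, hR, hφ, h⟩ := monomial_eq_mon_mul c he hd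
  have h1 : evalMain (mon (fun _ => p - 1) (fun τ => e (τ, 0, 1)) : PairRing k F)
      = C (digitFun (fun τ : k →+* F => e (τ, 0, 1)) (0 : k)) :=
    algHom_mon_eq (fun τ => by simp [evalMain]) (fun τ => by simp [evalMain])
  rw [h, map_mul, h1, hφ _ fun τ s j hs => by simp [evalMain, hs], mul_assoc]
  refine IsWeightedHomogeneous.C_mul ?_ _
  have := IsWeightedHomogeneous.mul hR hw
  refine Eq.subst (motive := fun d => R * w ∈ Homog d) (funext fun t => ?_) this
  by_cases ht : t.2 = 0
  · obtain ⟨τ, s⟩ := t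
    simp only at ht
    subst ht
    simp [mainDeg, hd]
  · simp [mainDeg, ht]

/-- The Steinberg representation is relatively projective for the unipotent group: on functions on
`k`, the translates of the multiplication by the indicator function of `0` add up to the identity. -/
theorem exists_sum_unip_conj : ∃ w ∈ Homog (F := F) (mainDeg (k := k) fun _ => p - 1),
    ∀ d : (k →+* F) × Fin 4 → ℕ, (∀ τ, d (τ, 0) = p - 1) → ∀ f ∈ Homog d,
      ∑ x : k, act (unip x) (evalMain (act (unip x)⁻¹ f) * w) = f := by
  classical
  have hp := (Fact.out : p.Prime).pos
  set n : (k →+* F) → ℕ := fun _ => p - 1 with hn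
  obtain ⟨c, hc⟩ := exists_digitFun_eq_indicator p (k := k) (F := F)
  have hmon : ∀ b ≤ n, (mon n b : PairRing k F) ∈ Homog (mainDeg n) := fun b hb => mon_mem_homog hb
  have hle : ∀ b : (k →+* F) → Fin p, (fun τ => (b τ : ℕ)) ≤ n := fun b τ => by
    have := (b τ).2
    change (b τ : ℕ) ≤ p - 1
    omega
  set w : PairRing k F := ∑ b : (k →+* F) → Fin p, c b • mon n (fun τ => (b τ : ℕ)) with hw
  have hwmem : w ∈ Homog (mainDeg n) := sum_mem fun b _ => Submodule.smul_mem _ _ (hmon _ (hle b))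
  have hev : ∀ (b : (k →+* F) → ℕ) (x : k), evalMain (act (unip x) (mon n b : PairRing k F))
      = C (digitFun b x) := fun b x => by
    rw [← AlgHom.comp_apply]
    exact algHom_mon_eq (fun τ => by rw [AlgHom.comp_apply, act_unip_X0]; simp [evalMain])
      (fun τ => by rw [AlgHom.comp_apply, act_unip_X1]; simp [evalMain, algHom_C])
  have hevw : ∀ x : k, evalMain (act (unip x) w) = C (if x = 0 then 1 else 0) := by
    intro x
    rw [hw, ← hc, map_sum, map_sum, map_sum]
    refine Finset.sum_congr rfl fun b _ => ?_
    rw [map_smul, map_smul, hev, smul_eq_C_mul, ← map_mul]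
  have hadd : ∀ (x y : k) (f : PairRing k F), act (unip y) (act (unip x) f) = act (unip (y + x)) f := by
    intro x y f
    rw [← act_mul_apply]
    congr 2
    ext i j
    fin_cases i <;> fin_cases j <;> simp [unip, Matrix.mul_apply, Fin.sum_univ_two, add_comm]
  have hkey : ∀ b ≤ n, ∑ x : k, digitFun b (-x) • act (unip x) w = mon n b := by
    intro b hb
    rw [← sub_eq_zero]
    refine eq_zero_of_digit p (n := n) (fun τ => by change p - 1 < p; omega)
      (sub_mem (sum_mem fun x _ => Submodule.smul_mem _ _ (act_mem_homog _ hwmem)) (hmon b hb))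
      fun y => ?_
    rw [map_sub, map_sub, hev, map_sum, map_sum, Finset.sum_eq_single (-y)]
    · rw [map_smul, map_smul, hadd, hevw, neg_neg, add_neg_cancel, if_pos rfl, smul_eq_C_mul,
        ← map_mul, mul_one, sub_self]
    · intro x _ hx
      rw [map_smul, map_smul, hadd, hevw, if_neg, map_zero, smul_zero]
      intro h
      exact hx (eq_neg_of_add_eq_zero_right h)
    · simp
  refine ⟨w, hwmem, fun d hd f hf => ?_⟩
  refine Homog.induction (motive := fun f =>
    ∑ x : k, act (unip x) (evalMain (act (unip x)⁻¹ f) * w) = f) hf (by simp)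
    (fun f g hf hg => by
      simp only [map_add, add_mul, Finset.sum_add_distrib]
      rw [hf, hg]) fun e r he => ?_
  obtain ⟨R, -, hφ, h⟩ := monomial_eq_mon_mul r he hd
  have hb : (fun τ => e (τ, 0, 1)) ≤ n := fun τ => by
    have := he τ 0
    rw [hd] at this
    change e (τ, 0, 1) ≤ p - 1
    omega
  rw [h]
  conv_rhs => rw [← hkey _ hb, Finset.sum_mul]
  refine Finset.sum_congr rfl fun x _ => ?_
  have h1 : act (unip x) (evalMain (act (unip x)⁻¹
      (mon (fun _ => p - 1) (fun τ => e (τ, 0, 1)) : PairRing k F)))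
      = C (digitFun (fun τ : k →+* F => e (τ, 0, 1)) (-x)) := by
    rw [← AlgHom.comp_apply, ← AlgHom.comp_apply]
    refine algHom_mon_eq (fun τ => ?_) (fun τ => ?_)
    · rw [AlgHom.comp_apply, AlgHom.comp_apply, unip_neg_inv, act_unip_X0]; simp [evalMain]
    · rw [AlgHom.comp_apply, AlgHom.comp_apply, unip_neg_inv, act_unip_X1]
      simp [evalMain, algHom_C]
  have h2 : act (unip x) (evalMain (act (unip x)⁻¹ R)) = R := by
    rw [← AlgHom.comp_apply, ← AlgHom.comp_apply]
    refine hφ _ fun τ s j hs => ?_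
    have : evalMain (act (unip x)⁻¹ (X (τ, s, j) : PairRing k F)) = act (unip x)⁻¹ (X (τ, s, j)) := by
      simp only [act_X, map_add, map_mul, algHom_C]
      simp [evalMain, hs]
    rw [AlgHom.comp_apply, AlgHom.comp_apply, this, act_act_inv]
  rw [map_mul, map_mul, map_mul, map_mul, h1, h2, smul_eq_C_mul]
  ring

end Steinberg

/-! ### Serre weights as spaces of polynomials -/

section Weight

open MvPolynomial

variable {k F : Type*} [Field k] [Field F]

/-- The monomial `X₀^{n-i} X₁^i` for `i ≤ n`. -/
def symMon (F : Type*) [Field F] (n i : ℕ) : SymPow F n :=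
  ⟨X 0 ^ (n - i) * X 1 ^ min i n, by
    rw [mem_homogeneousSubmodule]
    have h := ((isHomogeneous_X F (0 : Fin 2)).pow (n - i)).mul
      ((isHomogeneous_X F (1 : Fin 2)).pow (min i n))
    have e : 1 * (n - i) + 1 * min i n = n := by omega
    rwa [e] at h⟩

theorem exists_eq_sum_symMon {n : ℕ} (P : SymPow F n) :
    ∃ c : ℕ → F, ∑ i ∈ Finset.range (n + 1), c i • symMon F n i = P := by
  rw [← Submodule.mem_span_image_finset_iff_exists_fun']
  have key : P.1 ∈ (Submodule.span F (symMon F n '' (Finset.range (n + 1) : Set ℕ))).map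
      (Submodule.subtype _) := by
    rw [P.1.as_sum]
    refine Submodule.sum_mem _ fun e he => ?_
    have hdeg : e 0 + e 1 = n := by
      have := (mem_homogeneousSubmodule n P.1).1 P.2 (mem_support_iff.1 he)
      rw [Finsupp.weight_apply, Finsupp.sum_fintype _ _ (by simp)] at this
      simpa [Fin.sum_univ_two] using this
    refine ⟨coeff e P.1 • symMon F n (e 1), Submodule.smul_mem _ _
      (Submodule.subset_span ⟨e 1, by simp; omega, rfl⟩), ?_⟩
    have h1 : n - e 1 = e 0 := by omega
    have h2 : min (e 1) n = e 1 := by omega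
    simp only [Submodule.subtype_apply, Submodule.coe_smul, symMon, h1, h2]
    rw [monomial_eq, Finsupp.prod_fintype _ _ (by simp), Fin.prod_univ_two, MvPolynomial.smul_eq_C_mul]
  obtain ⟨Q, hQ, hQP⟩ := key
  rwa [← Subtype.ext hQP]

/-- The weight `n` of the symmetric power at `τ` in `F(λ)`. -/
def lowWeight (lam : (k →+* F) → ℤ × ℤ) (τ : k →+* F) : ℕ := ((lam τ).1 - (lam τ).2).toNat

/-- The inclusion of `F[X₀, X₁]` as the polynomials in the two variables at `(τ, 0)`. -/
def slotEmbed (τ : k →+* F) : MvPolynomial (Fin 2) F →ₐ[F] PairRing k F := rename fun j => (τ, 0, j)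

theorem slotEmbed_substitution (τ : k →+* F) (g : GL (Fin 2) k) (P : MvPolynomial (Fin 2) F) :
    slotEmbed τ (substitution (Matrix.GeneralLinearGroup.map τ g : GL (Fin 2) F) P)
      = act g (slotEmbed τ P) := by
  rw [← AlgHom.comp_apply, ← AlgHom.comp_apply]
  congr 1
  ext j : 1
  simp [slotEmbed, substitution, act_X, Fin.sum_univ_two, algHom_C]

variable [Fintype (k →+* F)] {lam : (k →+* F) → ℤ × ℤ}

/-- The product of the powers of determinants in `F(λ)`. -/
def weightChar (lam : (k →+* F) → ℤ × ℤ) : GL (Fin 2) k →* Fˣ :=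
  ∏ τ, (zpowGroupHom (lam τ).2).comp
    ((Matrix.GeneralLinearGroup.det).comp (Matrix.GeneralLinearGroup.map τ))

/-- `F(λ)` as the space of polynomials in the variables of slot `0` of multidegree
`lowWeight λ`. -/
def polyEmbed (lam : (k →+* F) → ℤ × ℤ) : SerreWeightSpace lam →ₗ[F] PairRing k F :=
  PiTensorProduct.lift ((MultilinearMap.mkPiAlgebra F (k →+* F) (PairRing k F)).compLinearMap
    fun τ => (slotEmbed τ).toLinearMap ∘ₗ Submodule.subtype _)

theorem polyEmbed_tprod (v : ∀ τ : k →+* F, SymPow F ((lam τ).1 - (lam τ).2).toNat) :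
    polyEmbed lam (PiTensorProduct.tprod F v) = ∏ τ, slotEmbed τ (v τ).1 := by
  simp [polyEmbed]

theorem polyEmbed_serreWeight (g : GL (Fin 2) k) (v : SerreWeightSpace lam) :
    polyEmbed lam (serreWeight lam g v)
      = (weightChar lam g : F) • act g (polyEmbed lam v) := by
  induction v using PiTensorProduct.induction_on with
  | smul_tprod r v =>
    have h : serreWeight lam g (PiTensorProduct.tprod F v) = PiTensorProduct.tprod F
        fun τ => algRep F (lam τ) (Matrix.GeneralLinearGroup.map τ g) (v τ) :=
      PiTensorProduct.map_tprod _ _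
    rw [map_smul, map_smul, map_smul, map_smul, smul_comm, h, polyEmbed_tprod, polyEmbed_tprod,
      map_prod]
    congr 1
    have h2 : (weightChar lam g : F) = ∏ τ,
        ((Matrix.GeneralLinearGroup.det (Matrix.GeneralLinearGroup.map τ g) ^ (lam τ).2 : Fˣ) : F) := by
      simp only [weightChar, MonoidHom.finsetProd_apply, Units.coe_prod]
      rfl
    rw [h2, MvPolynomial.smul_eq_C_mul, map_prod, ← Finset.prod_mul_distrib]
    refine Finset.prod_congr rfl fun τ _ => ?_
    rw [← slotEmbed_substitution, ← MvPolynomial.smul_eq_C_mul, ← map_smul]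
    rfl
  | add v w hv hw => rw [map_add, map_add, hv, hw, map_add, map_add, smul_add]

/-- The basis vectors of `F(λ)` corresponding to monomials. -/
def weightVec (lam : (k →+* F) → ℤ × ℤ) (b : (k →+* F) → ℕ) : SerreWeightSpace lam :=
  PiTensorProduct.tprod F fun τ => symMon F _ (b τ)

theorem polyEmbed_weightVec {b : (k →+* F) → ℕ} (hb : b ≤ lowWeight lam) :
    polyEmbed lam (weightVec lam b) = mon (lowWeight lam) b := by
  rw [weightVec, polyEmbed_tprod, mon]
  refine Finset.prod_congr rfl fun τ _ => ?_
  have h : min (b τ) (lowWeight lam τ) = b τ := min_eq_left (hb τ)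
  simp only [lowWeight] at h ⊢
  simp [symMon, slotEmbed, h]

variable [DecidableEq (k →+* F)]

theorem exists_eq_sum_weightVec (v : SerreWeightSpace lam) : ∃ c : ((k →+* F) → ℕ) → F,
    ∑ b ∈ boxBelow (lowWeight lam), c b • weightVec lam b = v := by
  rw [← Submodule.mem_span_image_finset_iff_exists_fun']
  have htop : (⊤ : Submodule F (SerreWeightSpace lam)) ≤
      Submodule.span F (weightVec lam '' (boxBelow (lowWeight lam) : Set _)) := by
    rw [← PiTensorProduct.span_tprod_eq_top, Submodule.span_le]
    rintro _ ⟨w, rfl⟩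
    choose c hc using fun τ => exists_eq_sum_symMon (w τ)
    have hw : w = fun τ => ∑ i ∈ Finset.range (lowWeight lam τ + 1), c τ i • symMon F _ i :=
      funext fun τ => (hc τ).symm
    rw [hw, MultilinearMap.map_sum_finset]
    refine Submodule.sum_mem _ fun b hb => ?_
    rw [MultilinearMap.map_smul_univ]
    exact Submodule.smul_mem _ _ (Submodule.subset_span ⟨b, hb, rfl⟩)
  exact htop trivial

theorem polyEmbed_mem (v : SerreWeightSpace lam) :
    polyEmbed lam v ∈ Homog (mainDeg (lowWeight lam)) := by
  obtain ⟨c, rfl⟩ := exists_eq_sum_weightVec v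
  rw [map_sum]
  refine Submodule.sum_mem _ fun b hb => ?_
  rw [map_smul, polyEmbed_weightVec (mem_boxBelow.1 hb)]
  exact Submodule.smul_mem _ _ (mon_mem_homog (mem_boxBelow.1 hb))

theorem range_polyEmbed : LinearMap.range (polyEmbed lam) = Homog (mainDeg (lowWeight lam)) := by
  refine le_antisymm ?_ fun f hf => ?_
  · rintro _ ⟨v, rfl⟩
    exact polyEmbed_mem v
  · obtain ⟨c, rfl⟩ := exists_eq_sum_mon hf
    refine ⟨∑ b ∈ boxBelow (lowWeight lam), c b • weightVec lam b, ?_⟩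
    rw [map_sum]
    exact Finset.sum_congr rfl fun b hb => by
      rw [map_smul, polyEmbed_weightVec (mem_boxBelow.1 hb)]

theorem semiEquivariant_polyEmbed :
    SemiEquivariant (V := SerreWeightSpace lam) (serreWeight lam) actEnd (polyEmbed lam) :=
  ⟨fun g => weightChar lam g, fun _ => Units.ne_zero _, polyEmbed_serreWeight⟩

variable (p : ℕ) [Fact p.Prime] [CharP k p] [CharP F p] [Fintype k] [Finite F] [Nonempty (k →+* F)]

theorem polyEmbed_injective (h : ∀ τ, lowWeight lam τ < p) :
    Function.Injective (polyEmbed lam) := by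
  refine (injective_iff_map_eq_zero _).2 fun v hv => ?_
  obtain ⟨c, rfl⟩ := exists_eq_sum_weightVec v
  have hv' : ∑ b ∈ boxBelow (lowWeight lam), c b • (mon (lowWeight lam) b : PairRing k F) = 0 := by
    rw [← hv, map_sum]
    exact Finset.sum_congr rfl fun b hb => by
      rw [map_smul, polyEmbed_weightVec (mem_boxBelow.1 hb)]
  refine Finset.sum_eq_zero fun b hb => ?_
  rw [coeff_eq_zero_of_digit p h (c := c) (fun x => by rw [hv', map_zero, map_zero]) b hb, zero_smul]

theorem irrOn_serreWeight (h : ∀ τ, lowWeight lam τ < p) :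
    IrrOn (V := SerreWeightSpace lam) (serreWeight lam) ⊤ := by
  intro K hK _
  have hinj := polyEmbed_injective p h
  rcases irrOn_mainDeg p h _ (hK.map semiEquivariant_polyEmbed)
    (by rw [← range_polyEmbed]; exact LinearMap.map_le_range) with h0 | h0
  · left
    exact Submodule.map_injective_of_injective hinj (by rw [h0, Submodule.map_bot])
  · right
    rw [← range_polyEmbed, LinearMap.range_eq_map] at h0
    exact Submodule.map_injective_of_injective hinj h0

end Weight

/-! ### The projective cover as a quotient of a space of polynomials -/

section Cover

open MvPolynomial

variable {k F : Type*} [Field k] [Field F]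

theorem unip_mul (x y : k) : unip x * unip y = unip (x + y) := by
  ext i j
  fin_cases i <;> fin_cases j <;> simp [unip, Matrix.mul_apply, Fin.sum_univ_two, add_comm]

theorem unip_injective : Function.Injective (unip : k → GL (Fin 2) k) := by
  intro x y h
  have := congrArg (fun g : GL (Fin 2) k => g 0 1) h
  simpa [unip] using this

/-- The subgroup of upper unipotent matrices. -/
def unipSubgroup (k : Type*) [Field k] : Subgroup (GL (Fin 2) k) where
  carrier := Set.range unip
  mul_mem' := by
    rintro _ _ ⟨x, rfl⟩ ⟨y, rfl⟩
    exact ⟨x + y, (unip_mul x y).symm⟩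
  one_mem' := ⟨0, by ext i j; fin_cases i <;> fin_cases j <;> simp [unip]⟩
  inv_mem' := by
    rintro _ ⟨x, rfl⟩
    exact ⟨-x, (unip_neg_inv x).symm⟩

/-- The upper unipotent matrices form a Sylow `p`-subgroup, of index `1` modulo `p`. -/
theorem card_quotient_unipSubgroup (p : ℕ) [CharP k p] [CharP F p] [Fact p.Prime] [Fintype k] :
    (Nat.card (GL (Fin 2) k ⧸ unipSubgroup k) : F) = 1 := by
  set q := Fintype.card k with hq
  have h1 := Subgroup.card_eq_card_quotient_mul_card_subgroup (unipSubgroup k)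
  have h2 : Nat.card (unipSubgroup k) = q := by
    rw [hq, ← Nat.card_eq_fintype_card]
    exact Nat.card_range_of_injective unip_injective
  have h3 : 1 < q := Fintype.one_lt_card
  rw [h2, Matrix.card_GL_field, Fin.prod_univ_two, ← hq] at h1
  have h4 : (q ^ 2 - q ^ ((0 : Fin 2) : ℕ)) * (q ^ 2 - q ^ ((1 : Fin 2) : ℕ))
      = ((q ^ 2 - 1) * (q - 1)) * q := by
    have : q ^ 2 - q = (q - 1) * q := by rw [Nat.sub_mul, one_mul, sq]
    simp only [Fin.val_zero, Fin.val_one, pow_zero, pow_one, this]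
    ring
  rw [h4] at h1
  have h5 := Nat.eq_of_mul_eq_mul_right (by omega) h1
  have hq0 : (q : F) = 0 := by
    rw [CharP.cast_eq_zero_iff F p, ← CharP.cast_eq_zero_iff k p, hq]
    exact FiniteField.cast_card_eq_zero k
  rw [← h5, Nat.cast_mul, Nat.cast_sub (Nat.one_le_pow _ _ (by omega)), Nat.cast_sub h3.le,
    Nat.cast_pow, hq0]
  norm_num

variable [Fintype (k →+* F)] [DecidableEq (k →+* F)]

/-- If the conjugates of `Θ` by the unipotent matrices add up to the identity, then the sum of the
conjugates by all of `GL₂(k)` is the number of cosets of the unipotent group. -/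
theorem sum_conj_eq [Fintype k] [Fintype (GL (Fin 2) k)] {d : (k →+* F) × Fin 4 → ℕ}
    (Θ : Module.End F (PairRing k F))
    (hΘ : ∀ f ∈ Homog d, ∑ x : k, act (unip x) (Θ (act (unip x)⁻¹ f)) = f)
    {f : PairRing k F} (hf : f ∈ Homog d) :
    ∑ g, act g (Θ (act g⁻¹ f)) = (Nat.card (GL (Fin 2) k ⧸ unipSubgroup k) : F) • f := by
  classical
  rw [← Finset.sum_fiberwise Finset.univ
    (fun g : GL (Fin 2) k => (g : GL (Fin 2) k ⧸ unipSubgroup k)), Nat.card_eq_fintype_card,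
    ← Finset.card_univ, Nat.cast_smul_eq_nsmul, ← Finset.sum_const]
  refine Finset.sum_congr rfl fun c _ => ?_
  have h1 : ∑ g ∈ Finset.univ.filter (fun g : GL (Fin 2) k =>
      (g : GL (Fin 2) k ⧸ unipSubgroup k) = c), act g (Θ (act g⁻¹ f))
      = ∑ x : k, act (c.out * unip x) (Θ (act (c.out * unip x)⁻¹ f)) := by
    symm
    refine Finset.sum_bij (fun x _ => c.out * unip x) (fun x _ => ?_) (fun x _ y _ h => ?_)
      (fun g hg => ?_) fun _ _ => rfl
    · simp only [Finset.mem_filter, Finset.mem_univ, true_and]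
      conv_rhs => rw [← QuotientGroup.out_eq' c]
      exact QuotientGroup.mk_mul_of_mem _ ⟨x, rfl⟩
    · exact unip_injective (mul_left_cancel h)
    · simp only [Finset.mem_filter, Finset.mem_univ, true_and] at hg
      have h2 : (c.out)⁻¹ * g ∈ unipSubgroup k := by
        rw [← QuotientGroup.eq, QuotientGroup.out_eq', hg]
      obtain ⟨x, hx⟩ := h2
      exact ⟨x, Finset.mem_univ _, by rw [hx]; group⟩
  rw [h1]
  have h2 := congrArg (act c.out) (hΘ _ (act_mem_homog (c.out)⁻¹ hf))
  rw [act_act_inv, map_sum] at h2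
  refine Eq.trans (Finset.sum_congr rfl fun x _ => ?_) h2
  rw [mul_inv_rev, act_mul_apply, act_mul_apply]

variable (p : ℕ) [Fact p.Prime] [CharP k p] [CharP F p] [Fintype k] [Finite F] [Nonempty (k →+* F)]

/-- Polynomials of degree `p - 1` in every pair of variables of slot `0` form a projective
representation. -/
theorem exists_lift_of_surjective {V W : Type*} [AddCommGroup V] [Module F V] [AddCommGroup W]
    [Module F W] {ρ : Representation F (GL (Fin 2) k) V} {σ : Representation F (GL (Fin 2) k) W}
    (π : Representation.IntertwiningMap ρ σ) (hπ : Function.Surjective π)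
    {d : (k →+* F) × Fin 4 → ℕ} (hd : ∀ τ, d (τ, 0) = p - 1) (ξ : GL (Fin 2) k →* Fˣ)
    (j : PairRing k F →ₗ[F] W)
    (hj : ∀ g, ∀ f ∈ Homog d, j (act g f) = (ξ g : F) • σ g (j f)) :
    ∃ L : PairRing k F →ₗ[F] V, (∀ g f, L (act g f) = (ξ g : F) • ρ g (L f)) ∧
      ∀ f ∈ Homog d, π (L f) = j f := by
  classical
  have := Fintype.ofFinite (GL (Fin 2) k)
  obtain ⟨w, hw, hsum⟩ := exists_sum_unip_conj (k := k) (F := F) p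
  obtain ⟨s, hs⟩ := π.toLinearMap.exists_rightInverse_of_surjective
    (LinearMap.range_eq_top.2 hπ)
  have hs' : ∀ y, π (s y) = y := fun y => DFunLike.congr_fun hs y
  obtain ⟨Θ, hΘ⟩ : ∃ Θ : Module.End F (PairRing k F), ∀ f, Θ f = evalMain f * w :=
    ⟨LinearMap.mulRight F w ∘ₗ evalMain.toLinearMap, fun _ => rfl⟩
  have hΘmem : ∀ f ∈ Homog d, Θ f ∈ Homog d := fun f hf => by
    rw [hΘ]; exact evalMain_mem p w hw hd hf
  have hΘsum : ∀ f ∈ Homog d, ∑ x : k, act (unip x) (Θ (act (unip x)⁻¹ f)) = f := fun f hf => by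
    simp only [hΘ]; exact hsum d hd f hf
  -- average a linear lift of `j`, cut off by `Θ`, over the group
  obtain ⟨L, hL⟩ : ∃ L : PairRing k F →ₗ[F] V,
      ∀ f, L f = ∑ g, (ξ g : F) • ρ g (s (j (Θ (act g⁻¹ f)))) :=
    ⟨∑ g, (ξ g : F) • ((ρ g) ∘ₗ s ∘ₗ j ∘ₗ Θ ∘ₗ actEnd g⁻¹), fun f => by
      simp only [LinearMap.sum_apply, LinearMap.smul_apply, LinearMap.comp_apply]; rfl⟩
  refine ⟨L, fun g f => ?_, fun f hf => ?_⟩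
  · rw [hL, hL, ← Equiv.sum_comp (Equiv.mulLeft g), map_sum, Finset.smul_sum]
    refine Finset.sum_congr rfl fun h _ => ?_
    have e : (g * h)⁻¹ * g = h⁻¹ := by group
    rw [Equiv.coe_mulLeft, ← act_mul_apply, e, map_mul, map_mul, Module.End.mul_apply,
      Units.val_mul, map_smul, smul_smul]
  · have e : ∀ g, π ((ξ g : F) • ρ g (s (j (Θ (act g⁻¹ f))))) = j (act g (Θ (act g⁻¹ f))) := by
      intro g
      rw [map_smul, π.isIntertwining, hs', hj g _ (hΘmem _ (act_mem_homog _ hf))]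
    rw [hL, map_sum, Finset.sum_congr rfl fun g _ => e g, ← map_sum, sum_conj_eq Θ hΘsum hf,
      card_quotient_unipSubgroup p, one_smul]

theorem modelDeg_univ {q : ℕ} {r m : (k →+* F) → ℕ} :
    modelDeg q r m Finset.univ = mainDeg r := by
  funext t
  simp [modelDeg, mainDeg]

variable {lam : (k →+* F) → ℤ × ℤ}

theorem IsDeep.lowWeight (h : IsDeep p 2 lam) (τ : k →+* F) :
    2 ≤ lowWeight lam τ ∧ lowWeight lam τ + 4 ≤ p := by
  have := h τ
  unfold LatticeGL2.lowWeight
  push_cast at this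
  omega

omit [Fintype (k →+* F)] [DecidableEq (k →+* F)] in
theorem exists_leftInverse_serreWeight {V : Type*} [AddCommGroup V] [Module F V]
    {f : SerreWeightSpace lam →ₗ[F] V} (hf : Function.Injective f) :
    ∃ J : V →ₗ[F] SerreWeightSpace lam, ∀ v, J (f v) = v := by
  obtain ⟨J, hJ⟩ := LinearMap.exists_leftInverse_of_injective (V := SerreWeightSpace lam) f
    (LinearMap.ker_eq_bot.2 hf)
  exact ⟨J, fun v => DFunLike.congr_fun hJ v⟩

omit [DecidableEq (k →+* F)] [Fintype k] in
theorem exists_polyEmbed_leftInverse (h : ∀ τ, lowWeight lam τ < p) [Finite k] :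
    ∃ J : PairRing k F →ₗ[F] SerreWeightSpace lam, (∀ v, J (polyEmbed lam v) = v) ∧
      ∀ g, ∀ f ∈ Homog (mainDeg (lowWeight lam)),
        J (act g f) = (((weightChar lam)⁻¹ g : Fˣ) : F) • serreWeight lam g (J f) := by
  classical
  have := Fintype.ofFinite k
  obtain ⟨J, hJ'⟩ := exists_leftInverse_serreWeight (polyEmbed_injective p h)
  refine ⟨J, hJ', fun g f hf => ?_⟩
  rw [← range_polyEmbed] at hf
  obtain ⟨v, rfl⟩ := hf
  have e : act g (polyEmbed lam v)
      = (((weightChar lam)⁻¹ g : Fˣ) : F) • polyEmbed lam (serreWeight lam g v) := by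
    rw [polyEmbed_serreWeight g v, smul_smul, MonoidHom.inv_apply, Units.inv_mul, one_smul]
  rw [e, map_smul, hJ', hJ']

omit [DecidableEq (k →+* F)] in
theorem exists_detChar (m : (k →+* F) → ℕ) : ∃ D : GL (Fin 2) k →* Fˣ,
    ∀ g, (D g : F) = ∏ τ, τ (Matrix.det (g : Matrix (Fin 2) (Fin 2) k)) ^ m τ := by
  refine ⟨∏ τ, (powMonoidHom (m τ)).comp
    ((Matrix.GeneralLinearGroup.det).comp (Matrix.GeneralLinearGroup.map τ)), fun g => ?_⟩
  simp only [MonoidHom.finsetProd_apply, Units.coe_prod]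
  refine Finset.prod_congr rfl fun τ _ => ?_
  simp [Matrix.GeneralLinearGroup.map_det]

/-- The projective cover of a deep Serre weight is a quotient of the generalised kernel of the
operators `Δ ∂` on polynomials of degrees `p - 1` and `p - 1 - r` in two pairs of variables: the
product of the operators `∂^(p - 1 - r)` maps these polynomials to the Serre weight, and this map
lifts to the projective cover. -/
theorem exists_surjection (hlam : IsDeep p 2 lam) {V : Type*} [AddCommGroup V] [Module F V]
    {ρ : Representation F (GL (Fin 2) k) V}
    (π : Representation.IntertwiningMap ρ (serreWeight lam)) (hπ : IsProjectiveCover π) :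
    ∃ L : PairRing k F →ₗ[F] V, SemiEquivariant (V := PairRing k F) (V' := V) actEnd ρ L ∧
      (thetaSub (modelDeg (p - 1) (lowWeight lam) (fun τ => p - 1 - lowWeight lam τ) ∅)
        Finset.univ).map L = ⊤ := by
  have hr := hlam.lowWeight p
  have hrp : ∀ τ, lowWeight lam τ < p := fun τ => by have := hr τ; omega
  generalize hm : (fun τ => p - 1 - lowWeight lam τ) = m
  have hpm : ∀ τ, p = lowWeight lam τ + m τ + 1 := fun τ => by
    have := hr τ; simp only [← hm]; omega
  have hm0 : ∀ τ, m τ ≠ 0 := fun τ => by have := hr τ; simp only [← hm]; omega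
  obtain ⟨q, hqact, hqmem, -, hqθ, c, hc, hqv⟩ := exists_descent p hpm Finset.univ
  rw [modelDeg_univ] at hqmem
  obtain ⟨J, hJ, hJact⟩ := exists_polyEmbed_leftInverse p hrp
  obtain ⟨D, hD⟩ := exists_detChar (F := F) m
  obtain ⟨L, hLact, hL⟩ := exists_lift_of_surjective p (W := SerreWeightSpace lam) π
    hπ.surjective
    (d := modelDeg (p - 1) (lowWeight lam) m ∅) (fun τ => by simp [modelDeg])
    (D * (weightChar lam)⁻¹) (J ∘ₗ q) (fun g f hf => by
      rw [LinearMap.comp_apply, hqact, map_smul, hJact g _ (hqmem hf), MonoidHom.mul_apply,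
        Units.val_mul, hD, smul_smul, LinearMap.comp_apply])
  have hLs : SemiEquivariant (V := PairRing k F) (V' := V) actEnd ρ L :=
    ⟨fun g => ((D * (weightChar lam)⁻¹) g : Fˣ), fun _ => Units.ne_zero _, hLact⟩
  refine ⟨L, hLs, ?_⟩
  obtain ⟨v, hv, hv0⟩ := exists_mem_thetaSub_of_descent p hpm hm0
    (fun τ => hqθ τ (Finset.mem_univ τ))
    (by rw [hqv]; exact smul_ne_zero hc (modelVec_ne_zero _ _)) Finset.univ
  have hv' := (mem_thetaSub.1 hv).1
  have hWs : Stable (actEnd (F := F))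
      (thetaSub (modelDeg (p - 1) (lowWeight lam) m ∅) Finset.univ) := stable_thetaSub _ _
  generalize thetaSub (modelDeg (p - 1) (lowWeight lam) m ∅) Finset.univ = W at hv hWs ⊢
  have hπs : SemiEquivariant (V := V) (V' := SerreWeightSpace lam) ρ (serreWeight lam)
      π.toLinearMap :=
    ⟨fun _ => 1, fun _ => one_ne_zero, fun g v =>
      (DFunLike.congr_fun (π.isIntertwining' g) v).trans (one_smul F _).symm⟩
  -- `F(λ)` is simple, so a nonzero map to it is surjective, and the kernel of `π` is superfluous
  have htop : (W.map L).map π.toLinearMap = ⊤ := by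
    refine (irrOn_serreWeight p hrp _ ((hWs.map hLs).map hπs) le_top).resolve_left fun h0 => ?_
    have h1 : π (L v) = 0 := by
      rw [← Submodule.mem_bot F, ← h0]
      exact ⟨_, ⟨v, hv, rfl⟩, rfl⟩
    rw [hL v hv'] at h1
    have h2 := hqmem hv'
    rw [Submodule.mem_comap, ← range_polyEmbed] at h2
    obtain ⟨w, hw⟩ := h2
    rw [LinearMap.comp_apply, ← hw, hJ] at h1
    rw [h1, map_zero] at hw
    exact hv0 hw.symm
  have hN := hπ.superfluous ⟨W.map L, fun g v hv => hWs.map hLs g v hv⟩ (by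
    refine SetLike.ext fun v => ⟨fun _ => trivial, fun _ => ?_⟩
    have : π v ∈ (W.map L).map π.toLinearMap := by rw [htop]; trivial
    obtain ⟨n, hn, hnv⟩ := this
    refine Submodule.mem_sup.2 ⟨n, hn, v - n, ?_, by abel⟩
    change π (v - n) = 0
    rw [map_sub, sub_eq_zero]
    exact hnv.symm)
  exact congrArg Subrepresentation.toSubmodule hN

/-- In the projective cover of a deep Serre weight, the product of any simple subquotient with
the adjoint representation is semisimple. -/
theorem niceOn_projectiveCover (hlam : IsDeep p 2 lam) {V : Type*} [AddCommGroup V] [Module F V]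
    {ρ : Representation F (GL (Fin 2) k) V}
    (π : Representation.IntertwiningMap ρ (serreWeight lam)) (hπ : IsProjectiveCover π)
    (τ₀ : k →+* F) : NiceOn (V := V) (adMat τ₀) ρ ⊤ := by
  obtain ⟨L, hLs, hmap⟩ := exists_surjection p hlam π hπ
  refine NiceOn.map hLs (stable_thetaSub _ _) (niceOn_thetaSub p (hlam.lowWeight p) τ₀ _
    (fun τ _ => ?_) (by simp) (fun τ => ?_) fun τ => ?_) hmap.ge
  · simp [modelDeg]
  · simp [modelDeg]
  · simp [modelDeg]

end Cover

/-! ### Equivariant maps from the adjoint representation to endomorphisms -/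

section AdTriple

open MvPolynomial

variable {k F : Type*} [Field k] [Field F]

/-- Three operators on `V` form an equivariant map `Y ↦ A_Y` from `𝔰𝔩₂`, on which `GL₂(k)` acts
through `τ`, to `End V`; the three operators are the images of the standard basis `e`, `h`, `f`. -/
def IsAdTriple {V : Type*} [AddCommGroup V] [Module F V] (τ : k →+* F)
    (ρ : GL (Fin 2) k → Module.End F V) (A : Fin 3 → Module.End F V) : Prop :=
  ∀ i g v, A i (ρ g v) = ∑ j, adMat τ g i j • ρ g (A j v)

/-- The natural action of `𝔰𝔩₂` at the embedding `τ` by derivations in the variables of slot `0`. -/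
def lieOp (τ : k →+* F) : Fin 3 → Module.End F (PairRing k F) :=
  ![LinearMap.mulLeft F (X (τ, 0, 0)) ∘ₗ (pderiv (τ, 0, 1)).toLinearMap,
    LinearMap.mulLeft F (X (τ, 0, 0)) ∘ₗ (pderiv (τ, 0, 0)).toLinearMap
      - LinearMap.mulLeft F (X (τ, 0, 1)) ∘ₗ (pderiv (τ, 0, 1)).toLinearMap,
    LinearMap.mulLeft F (X (τ, 0, 1)) ∘ₗ (pderiv (τ, 0, 0)).toLinearMap]

variable (τ : k →+* F) (f : PairRing k F)

theorem lieOp_zero : lieOp τ 0 f = X (τ, 0, 0) * pderiv (τ, 0, 1) f := rfl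

theorem lieOp_one :
    lieOp τ 1 f = X (τ, 0, 0) * pderiv (τ, 0, 0) f - X (τ, 0, 1) * pderiv (τ, 0, 1) f := rfl

theorem lieOp_two : lieOp τ 2 f = X (τ, 0, 1) * pderiv (τ, 0, 0) f := rfl

theorem isAdTriple_lieOp : IsAdTriple (V := PairRing k F) τ actEnd (lieOp τ) := by
  have key : ∀ (g : GL (Fin 2) k) (a : F) (x y : PairRing k F), a ≠ 0 → C a * x = y →
      x = a⁻¹ • y := by
    intro g a x y ha h
    rw [← h, ← smul_eq_C_mul, smul_smul, inv_mul_cancel₀ ha, one_smul]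
  intro i g f
  have hdet : τ (Matrix.det (g : Matrix (Fin 2) (Fin 2) k))
      = τ (g 0 0) * τ (g 1 1) - τ (g 0 1) * τ (g 1 0) := by
    rw [Matrix.det_fin_two, map_sub, map_mul, map_mul]
  simp only [adMat, Matrix.smul_apply, smul_eq_mul, mul_smul, ← Finset.smul_sum]
  refine key g _ _ _ (det_ne_zero g τ) ?_
  change C _ * lieOp τ i (act g f) = ∑ j, _ • act g (lieOp τ j f)
  rw [hdet, Fin.sum_univ_three, lieOp_zero, lieOp_one, lieOp_two]
  simp only [map_mul, map_sub, act_X]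
  fin_cases i <;> simp only [Fin.zero_eta, Fin.mk_one, Fin.reduceFinMk]
  · rw [lieOp_zero, pderiv_act]
    simp [smul_eq_C_mul]
    ring
  · have h2 : (C (2 : F) : PairRing k F) = 2 := map_ofNat C 2
    rw [lieOp_one, pderiv_act, pderiv_act]
    simp [smul_eq_C_mul, h2]
    ring
  · rw [lieOp_two, pderiv_act]
    simp [smul_eq_C_mul]
    ring

theorem lieOp_comm : lieOp τ 0 (lieOp τ 2 f) - lieOp τ 2 (lieOp τ 0 f) = lieOp τ 1 f ∧
    lieOp τ 1 (lieOp τ 0 f) - lieOp τ 0 (lieOp τ 1 f) = (2 : F) • lieOp τ 0 f ∧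
    lieOp τ 1 (lieOp τ 2 f) - lieOp τ 2 (lieOp τ 1 f) = (-2 : F) • lieOp τ 2 f := by
  have h01 : pderiv (τ, 0, 0) (X (τ, 0, 1) : PairRing k F) = 0 := X_ne (by simp)
  have h10 : pderiv (τ, 0, 1) (X (τ, 0, 0) : PairRing k F) = 0 := X_ne (by simp)
  have hc := pderiv_comm (τ, 0, 1) (τ, 0, 0) f
  simp only [lieOp_zero, lieOp_one, lieOp_two, Derivation.leibniz, smul_eq_mul, map_sub,
    pderiv_X_self, h01, h10, hc, smul_eq_C_mul, C_neg, map_ofNat]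
  refine ⟨?_, ?_, ?_⟩ <;> ring

/-- Twice the Casimir operator acts on forms of degree `r` by `r (r + 2)`. -/
theorem lieOp_casimir [Fintype (k →+* F)] {d : (k →+* F) × Fin 4 → ℕ} (hf : f ∈ Homog d) :
    lieOp τ 1 (lieOp τ 1 f) + (2 : F) • lieOp τ 0 (lieOp τ 2 f) + (2 : F) • lieOp τ 2 (lieOp τ 0 f)
      = ((d (τ, 0) * (d (τ, 0) + 2) : ℕ) : F) • f := by
  classical
  have h01 : pderiv (τ, 0, 0) (X (τ, 0, 1) : PairRing k F) = 0 := X_ne (by simp)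
  have h10 : pderiv (τ, 0, 1) (X (τ, 0, 0) : PairRing k F) = 0 := X_ne (by simp)
  have hc := pderiv_comm (τ, 0, 1) (τ, 0, 0) f
  have he := euler hf τ 0
  have he0 := congrArg (pderiv (τ, 0, 0)) he
  have he1 := congrArg (pderiv (τ, 0, 1)) he
  simp only [map_add, Derivation.leibniz, smul_eq_mul, pderiv_X_self, h01, h10, hc, Derivation.map_natCast,
    smul_eq_C_mul, map_natCast] at he he0 he1
  simp only [lieOp_zero, lieOp_one, lieOp_two, Derivation.leibniz, smul_eq_mul, map_sub,
    pderiv_X_self, h01, h10, hc, smul_eq_C_mul, map_ofNat, map_natCast, Nat.cast_mul, Nat.cast_add,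
    Nat.cast_ofNat, map_mul, map_add]
  linear_combination X (τ, 0, 0) * he0 + X (τ, 0, 1) * he1 + ((d (τ, 0) : PairRing k F) + 2) * he

end AdTriple

section Unique

open MvPolynomial

variable {k F : Type*} [Field k] [Field F] [Fintype (k →+* F)] [DecidableEq (k →+* F)]
  {lam : (k →+* F) → ℤ × ℤ} {τ : k →+* F}

/-- The diagonal matrix with entries `a`, `1`. -/
def torus (a : kˣ) : GL (Fin 2) k where
  val := !![(a : k), 0; 0, 1]
  inv := !![((a⁻¹ : kˣ) : k), 0; 0, 1]
  val_inv := by simp [Matrix.one_fin_two]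
  inv_val := by simp [Matrix.one_fin_two]

theorem det_torus (a : kˣ) : Matrix.det (torus a : Matrix (Fin 2) (Fin 2) k) = a := by
  simp [torus, Matrix.det_fin_two]

theorem det_unip (x : k) : Matrix.det (unip x : Matrix (Fin 2) (Fin 2) k) = 1 := by
  simp [unip, Matrix.det_fin_two]

theorem act_torus_mon (a : kˣ) (n : (k →+* F) → ℕ) :
    act (torus a) (mon n 0 : PairRing k F) = (∏ σ : k →+* F, σ a ^ n σ) • mon n 0 := by
  simp [mon, map_prod, act_X, torus, mul_pow, Finset.prod_mul_distrib, smul_eq_C_mul]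

theorem act_unip_mon_zero (x : k) (n : (k →+* F) → ℕ) :
    act (unip x) (mon n 0 : PairRing k F) = mon n 0 := by
  simp [mon, map_prod, act_unip_X0]

theorem weightChar_unip (x : k) : weightChar lam (unip x) = 1 := by
  rw [weightChar, MonoidHom.finsetProd_apply]
  refine Finset.prod_eq_one fun τ _ => ?_
  have : Matrix.GeneralLinearGroup.det (Matrix.GeneralLinearGroup.map τ (unip x)) = 1 := by
    ext
    simp [Matrix.GeneralLinearGroup.map_det, det_unip]
  simp only [MonoidHom.comp_apply, this, map_one]

/-- The component of degree `r + 2 - 2 j` in the decomposition of `𝔰𝔩₂ ⊗ Sym^r`. -/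
def component (τ : k →+* F) (j : ℕ) : Module.End F (PairRing k F) :=
  (merge τ 3).toLinearMap ∘ₗ cayley τ 3 ^ j

theorem component_act (j : ℕ) (g : GL (Fin 2) k) (f : PairRing k F) :
    component τ j (act g f)
      = τ (Matrix.det (g : Matrix (Fin 2) (Fin 2) k)) ^ j • act g (component τ j f) := by
  have h : (cayley τ 3 ^ j) (act g f)
      = τ (Matrix.det (g : Matrix (Fin 2) (Fin 2) k)) ^ j • act g ((cayley τ 3 ^ j) f) := by
    induction j with
    | zero => simp
    | succ j ih =>
      rw [pow_succ', Module.End.mul_apply, ih, map_smul, cayley_act, smul_smul, ← pow_succ,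
        Module.End.mul_apply]
  change merge τ 3 ((cayley τ 3 ^ j) (act g f)) = _
  rw [h, map_smul, merge_act]
  rfl

theorem component_mem {n : (k →+* F) → ℕ} {j : ℕ} (hj : j ≤ 2) (hn : 2 ≤ n τ) {f : PairRing k F}
    (hf : f ∈ Homog (Function.update (mainDeg n) (τ, 3) 2)) :
    component τ j f ∈ Homog (mainDeg (Function.update n τ (n τ + 2 - 2 * j))) := by
  have e : Function.update (mainDeg n) (τ, 3) 2 = wt (mainDeg n) τ 3 (n τ - j + j) (2 - j + j) := by
    rw [wt, Nat.sub_add_cancel hj, Nat.sub_add_cancel (hj.trans hn)]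
    congr 1
    symm
    rw [Function.update_eq_self_iff]
    simp [mainDeg]
  rw [e] at hf
  have h := merge_mem (by decide) (cayley_pow_mem (by decide) hf)
  change merge τ 3 ((cayley τ 3 ^ j) f) ∈ _
  convert h using 2
  funext t
  obtain ⟨σ, s⟩ := t
  by_cases h1 : (σ, s) = (τ, 3)
  · rw [h1, wt_self]; simp [mainDeg]
  by_cases h2 : (σ, s) = (τ, 0)
  · rw [h2, wt_zero (by decide)]
    simp only [mainDeg, if_true, Function.update_self]
    omega
  · rw [wt_other h2 h1]
    by_cases h3 : s = 0
    · subst h3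
      have h4 : σ ≠ τ := fun h => h2 (by rw [h])
      simp [mainDeg, Function.update_of_ne h4]
    · simp [mainDeg, h3]

variable (p : ℕ) [Fact p.Prime] [CharP k p] [CharP F p] [Fintype k] [Finite F] [Nonempty (k →+* F)]

theorem eq_zero_of_component {n : (k →+* F) → ℕ} (hn : n τ + 3 < p) {f : PairRing k F}
    (hf : f ∈ Homog (Function.update (mainDeg n) (τ, 3) 2))
    (h : ∀ j ≤ 2, component τ j f = 0) : f = 0 := by
  by_contra hf0
  have e : Function.update (mainDeg n) (τ, 3) 2 = wt (mainDeg n) τ 3 (n τ) 2 := by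
    rw [wt]
    congr 1
    symm
    rw [Function.update_eq_self_iff]
    simp [mainDeg]
  rw [e] at hf
  obtain ⟨j, a', b', g, ha, hb, hg, rfl, hg0⟩ := exists_cross_pow_mul (by decide) hf hf0
  obtain ⟨r, hr, hr'⟩ := merge_cayley_pow_cross_pow_mul p (by decide) hg (n := j)
    (Or.inr (by omega))
  have := h j (by omega)
  change merge τ 3 ((cayley τ 3 ^ j) (cross τ 3 ^ j * g)) = 0 at this
  rw [hr'] at this
  exact smul_ne_zero hr hg0 this

/-- A map from `F(λ)` to polynomials, equivariant up to a character that is trivial on unipotents,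
maps the highest weight vector to a multiple of a monomial. -/
theorem exists_apply_weightVec {n : (k →+* F) → ℕ} (hn : ∀ τ, n τ < p)
    {φ : SerreWeightSpace lam →ₗ[F] PairRing k F} {χ : GL (Fin 2) k → F}
    (hφ : ∀ g v, φ (serreWeight lam g v) = χ g • act g (φ v)) (hχ : ∀ x, χ (unip x) = 1)
    (hinv : ∀ x, serreWeight lam (unip x) (weightVec lam 0) = weightVec lam 0)
    (hmem : φ (weightVec lam 0) ∈ Homog (mainDeg n)) : ∃ c : F, φ (weightVec lam 0) = c • mon n 0 :=
  eq_smul_mon_of_unip p hn hmem fun x => by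
    have := hφ (unip x) (weightVec lam 0)
    rw [hinv, hχ, one_smul] at this
    exact this.symm

theorem serreWeight_weightVec_zero (hr : ∀ τ, lowWeight lam τ < p) {g : GL (Fin 2) k} {c : F}
    (hg : act g (mon (lowWeight lam) 0 : PairRing k F) = c • mon (lowWeight lam) 0) :
    serreWeight lam g (weightVec lam 0) = ((weightChar lam g : F) * c) • weightVec lam 0 := by
  refine polyEmbed_injective p hr ?_
  rw [polyEmbed_serreWeight, map_smul, polyEmbed_weightVec (b := 0) (fun _ => Nat.zero_le _), hg, smul_smul]

/-- A semi-equivariant map from `F(λ)` vanishing on the highest weight vector is zero. -/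
theorem eq_zero_of_apply_weightVec (hr : ∀ τ, lowWeight lam τ < p) {V : Type*} [AddCommGroup V]
    [Module F V] {ρ : GL (Fin 2) k → Module.End F V} {φ : SerreWeightSpace lam →ₗ[F] V}
    (hφ : SemiEquivariant (V := SerreWeightSpace lam) (serreWeight lam) ρ φ)
    (h : φ (weightVec lam 0) = 0) (v : SerreWeightSpace lam) : φ v = 0 := by
  rcases irrOn_serreWeight p hr _ (Stable.ker hφ) le_top with h0 | h0
  · exfalso
    have h1 : weightVec lam 0 ∈ LinearMap.ker φ := h
    rw [h0, Submodule.mem_bot] at h1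
    have h2 := polyEmbed_weightVec (lam := lam) (b := 0) fun _ => Nat.zero_le _
    rw [h1, map_zero] at h2
    exact mon_ne_zero h2.symm
  · have : v ∈ LinearMap.ker φ := by rw [h0]; trivial
    exact this

/-- The polynomial encoding the three vectors `B_i v`. -/
def tripleEmbed (τ : k →+* F) (B : Fin 3 → Module.End F (SerreWeightSpace lam)) :
    SerreWeightSpace lam →ₗ[F] PairRing k F :=
  symEmbed τ ∘ₗ LinearMap.pi fun i => polyEmbed lam ∘ₗ B i

theorem tripleEmbed_serreWeight {B : Fin 3 → Module.End F (SerreWeightSpace lam)}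
    (hB : IsAdTriple (V := SerreWeightSpace lam) τ (serreWeight lam) B) (g : GL (Fin 2) k)
    (v : SerreWeightSpace lam) : tripleEmbed τ B (serreWeight lam g v)
      = ((weightChar lam g : F) * (τ (Matrix.det (g : Matrix (Fin 2) (Fin 2) k)))⁻¹) •
        act g (tripleEmbed τ B v) := by
  have h : (LinearMap.pi fun i => polyEmbed lam ∘ₗ B i) (serreWeight lam g v)
      = (weightChar lam g : F) • powRep (adMat τ) actEnd g
        ((LinearMap.pi fun i => polyEmbed lam ∘ₗ B i) v) := by
    funext i
    rw [Pi.smul_apply, powRep_apply]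
    simp only [LinearMap.pi_apply, LinearMap.comp_apply]
    rw [hB i g v, map_sum, Finset.smul_sum]
    refine Finset.sum_congr rfl fun j _ => ?_
    rw [map_smul, polyEmbed_serreWeight, smul_comm]
    rfl
  change symEmbed τ _ = _
  rw [h, map_smul, symEmbed_powRep, smul_smul]
  rfl

theorem tripleEmbed_mem (B : Fin 3 → Module.End F (SerreWeightSpace lam))
    (v : SerreWeightSpace lam) :
    tripleEmbed τ B v ∈ Homog (Function.update (mainDeg (lowWeight lam)) (τ, 3) 2) :=
  symEmbed_mem (by simp [mainDeg]) fun _ => polyEmbed_mem _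

/-- Of the three components of an equivariant triple, only the middle one is nonzero, and it is a
multiple of the standard embedding. The two others are excluded by the torus. -/
theorem exists_component_tripleEmbed (hlam : IsDeep p 2 lam)
    {B : Fin 3 → Module.End F (SerreWeightSpace lam)}
    (hB : IsAdTriple (V := SerreWeightSpace lam) τ (serreWeight lam) B) :
    ∃ c : F, (∀ v, component τ 1 (tripleEmbed τ B v) = c • polyEmbed lam v) ∧
      ∀ j ≤ 2, j ≠ 1 → ∀ v, component τ j (tripleEmbed τ B v) = 0 := by
  have hr := hlam.lowWeight p
  have hrp : ∀ τ, lowWeight lam τ < p := fun τ => by have := hr τ; omega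
  have hinv : ∀ x, serreWeight lam (unip x) (weightVec lam 0) = weightVec lam 0 := fun x => by
    rw [serreWeight_weightVec_zero p hrp (c := 1) (by rw [act_unip_mon_zero, one_smul]),
      weightChar_unip]
    simp
  have hact : ∀ j g v, (component τ j ∘ₗ tripleEmbed τ B) (serreWeight lam g v)
      = ((weightChar lam g : F) * (τ (Matrix.det (g : Matrix (Fin 2) (Fin 2) k)))⁻¹ *
        τ (Matrix.det (g : Matrix (Fin 2) (Fin 2) k)) ^ j) •
          act g ((component τ j ∘ₗ tripleEmbed τ B) v) := fun j g v => by
    rw [LinearMap.comp_apply, tripleEmbed_serreWeight hB, map_smul, component_act, smul_smul]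
    rfl
  have hsemi : ∀ j, SemiEquivariant (V := SerreWeightSpace lam) (serreWeight lam) actEnd
      (component τ j ∘ₗ tripleEmbed τ B) := fun j =>
    ⟨_, fun g => mul_ne_zero (mul_ne_zero (Units.ne_zero _) (inv_ne_zero (det_ne_zero g τ)))
      (pow_ne_zero _ (det_ne_zero g τ)), hact j⟩
  have hvec : ∀ j ≤ 2, ∃ c : F, (component τ j ∘ₗ tripleEmbed τ B) (weightVec lam 0)
      = c • mon (Function.update (lowWeight lam) τ (lowWeight lam τ + 2 - 2 * j)) 0 := fun j hj => by
    refine exists_apply_weightVec p (fun σ => ?_) (hact j) (fun x => ?_) hinv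
      (component_mem hj (hr τ).1 (tripleEmbed_mem B _))
    · by_cases h : σ = τ
      · subst h
        rw [Function.update_self]
        have := hr σ
        omega
      · rw [Function.update_of_ne h]
        exact hrp σ
    · rw [weightChar_unip, det_unip]
      simp
  have hzero : ∀ j ≤ 2, j ≠ 1 → ∀ v, component τ j (tripleEmbed τ B v) = 0 := by
    intro j hj hj1
    refine eq_zero_of_apply_weightVec p hrp (hsemi j) ?_
    obtain ⟨c, hc⟩ := hvec j hj
    -- the field `k` has more than two elements as `p > 2`
    obtain ⟨a, ha⟩ : ∃ a : kˣ, a ≠ 1 := by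
      by_contra! h
      have h1 : Fintype.card k ≤ 2 := by
        classical
        rw [Fintype.card_eq_card_units_add_one, Fintype.card_le_one_iff_subsingleton.2
          ⟨fun x y => (h x).trans (h y).symm⟩ |>.antisymm Fintype.card_pos]
      have h2 : (p : ℕ) ∣ Fintype.card k :=
        (CharP.cast_eq_zero_iff k p _).1 (FiniteField.cast_card_eq_zero k)
      have h3 := Nat.le_of_dvd Fintype.card_pos h2
      have := hr τ
      omega
    have hτa : τ a ≠ 1 := fun h => ha (Units.ext (τ.injective (by rw [h]; simp)))
    have hτ0 : τ a ≠ 0 := by simp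
    -- on highest weight vectors the two sides of the equivariance under `diag(a, 1)` differ by the
    -- factor `τ(a)^(±1)`
    have h1 := hact j (torus a) (weightVec lam 0)
    rw [serreWeight_weightVec_zero p hrp (act_torus_mon a _), map_smul, hc, map_smul,
      act_torus_mon, det_torus, smul_smul, smul_smul, smul_smul] at h1
    set n := Function.update (lowWeight lam) τ (lowWeight lam τ + 2 - 2 * j) with hn
    have hP : ∀ r : (k →+* F) → ℕ, ∏ σ : k →+* F, σ (a : k) ^ r σ
        = τ (a : k) ^ r τ * ∏ σ ∈ Finset.univ.erase τ, σ (a : k) ^ r σ := fun r =>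
      (Finset.mul_prod_erase _ _ (Finset.mem_univ τ)).symm
    have hQ : ∏ σ ∈ Finset.univ.erase τ, σ (a : k) ^ n σ
        = ∏ σ ∈ Finset.univ.erase τ, σ (a : k) ^ lowWeight lam σ :=
      Finset.prod_congr rfl fun σ hσ => by
        rw [hn, Function.update_of_ne (Finset.ne_of_mem_erase hσ)]
    have hQ0 : ∏ σ ∈ Finset.univ.erase τ, σ (a : k) ^ lowWeight lam σ ≠ 0 :=
      Finset.prod_ne_zero_iff.2 fun σ _ => pow_ne_zero _ (by simp)
    have hnτ : n τ = lowWeight lam τ + 2 - 2 * j := by rw [hn, Function.update_self]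
    rw [hP, hP n, hQ, hnτ] at h1
    have h2 := sub_eq_zero.2 h1
    rw [← sub_smul] at h2
    have h3 := (smul_eq_zero.1 h2).resolve_right mon_ne_zero
    change (component τ j ∘ₗ tripleEmbed τ B) (weightVec lam 0) = 0
    rw [hc]
    have hχ : (weightChar lam (torus a) : F) ≠ 0 := Units.ne_zero _
    suffices c = 0 by rw [this, zero_smul]
    generalize (∏ σ ∈ Finset.univ.erase τ, σ (a : k) ^ lowWeight lam σ) = Q at h3 hQ0
    generalize (weightChar lam (torus a) : F) = χ at h3 hχ
    have hrτ := (hr τ).1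
    generalize lowWeight lam τ = s at h3 hrτ
    have hs0 : τ (a : k) ^ s ≠ 0 := pow_ne_zero _ hτ0
    have hne : τ (a : k) - 1 ≠ 0 := sub_ne_zero.2 hτa
    have h4 : c * (χ * Q * τ (a : k) ^ s * (τ (a : k) - 1)) = 0 := by
      obtain rfl | rfl : j = 0 ∨ j = 2 := by omega
      · rw [mul_zero, Nat.sub_zero, pow_add] at h3
        field_simp at h3
        linear_combination -h3
      · obtain ⟨s', rfl⟩ : ∃ s', s = s' + 2 := ⟨s - 2, by omega⟩
        have e : s' + 2 + 2 - 2 * 2 = s' := by omega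
        rw [e, pow_add] at h3
        field_simp at h3
        linear_combination τ (a : k) * h3
    exact (mul_eq_zero.1 h4).resolve_right
      (mul_ne_zero (mul_ne_zero (mul_ne_zero hχ hQ0) hs0) hne)
  obtain ⟨c, hc⟩ := hvec 1 (by norm_num)
  refine ⟨c, fun v => ?_, hzero⟩
  have e : Function.update (lowWeight lam) τ (lowWeight lam τ + 2 - 2 * 1) = lowWeight lam := by
    simp
  rw [e] at hc
  refine sub_eq_zero.1 (eq_zero_of_apply_weightVec p hrp (lam := lam) (V := PairRing k F)
    (ρ := actEnd) (φ := component τ 1 ∘ₗ tripleEmbed τ B - c • polyEmbed lam)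
    ⟨fun g => weightChar lam g, fun _ => Units.ne_zero _, fun g v => ?_⟩ ?_ v)
  · rw [LinearMap.sub_apply, hact, LinearMap.smul_apply, polyEmbed_serreWeight, pow_one, mul_assoc,
      inv_mul_cancel₀ (det_ne_zero g τ), mul_one, LinearMap.sub_apply, map_sub, smul_sub,
      LinearMap.smul_apply, map_smul, smul_comm c]
    rfl
  · rw [LinearMap.sub_apply, hc, LinearMap.smul_apply, polyEmbed_weightVec (b := 0) fun _ => Nat.zero_le _]
    exact sub_self _

/-- Equivariant maps from the adjoint representation to the endomorphisms of a deep Serre weight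
are unique up to scalars. -/
theorem IsAdTriple.exists_eq_smul (hlam : IsDeep p 2 lam)
    {B N : Fin 3 → Module.End F (SerreWeightSpace lam)}
    (hB : IsAdTriple (V := SerreWeightSpace lam) τ (serreWeight lam) B)
    (hN : IsAdTriple (V := SerreWeightSpace lam) τ (serreWeight lam) N) (hN0 : N ≠ 0) :
    ∃ c : F, B = c • N := by
  have hr := hlam.lowWeight p
  have hrp : ∀ τ, lowWeight lam τ < p := fun τ => by have := hr τ; omega
  have h2 : (2 : F) ≠ 0 := by
    intro h
    have h3 : ((2 : ℕ) : F) = 0 := by exact_mod_cast h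
    have := Nat.le_of_dvd two_pos ((CharP.cast_eq_zero_iff F p 2).1 h3)
    have := hr τ
    omega
  have hinj : ∀ A A' : Fin 3 → Module.End F (SerreWeightSpace lam), (∀ j ≤ 2, ∀ v,
      component τ j (tripleEmbed τ A v) = component τ j (tripleEmbed τ A' v)) → A = A' := by
    intro A A' hA
    funext i
    refine LinearMap.ext fun v => polyEmbed_injective p hrp (sub_eq_zero.1 ?_)
    have h0 := eq_zero_of_component p (n := lowWeight lam) (τ := τ) (by have := hr τ; omega)
      (sub_mem (tripleEmbed_mem A v) (tripleEmbed_mem A' v)) fun j hj => by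
        rw [map_sub, hA j hj, sub_self]
    rw [tripleEmbed, tripleEmbed, LinearMap.comp_apply, LinearMap.comp_apply, ← map_sub] at h0
    exact congrFun (symEmbed_injOn (d := mainDeg (lowWeight lam)) h2 (by simp [mainDeg])
      (fun i => sub_mem (polyEmbed_mem (A i v)) (polyEmbed_mem (A' i v))) h0) i
  obtain ⟨b, hb, hb'⟩ := exists_component_tripleEmbed p hlam hB
  obtain ⟨n, hn, hn'⟩ := exists_component_tripleEmbed p hlam hN
  have hn0 : n ≠ 0 := by
    rintro rfl
    refine hN0 (hinj N 0 fun j hj v => ?_)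
    have e : tripleEmbed τ (0 : Fin 3 → Module.End F (SerreWeightSpace lam)) v = 0 := by
      simp [tripleEmbed, symEmbed_apply]
    rw [e, map_zero]
    by_cases hj1 : j = 1
    · rw [hj1, hn, zero_smul]
    · exact hn' j hj hj1 v
  refine ⟨b / n, hinj _ _ fun j hj v => ?_⟩
  have e : tripleEmbed τ ((b / n) • N) v = (b / n) • tripleEmbed τ N v := by
    rw [tripleEmbed, tripleEmbed, LinearMap.comp_apply, LinearMap.comp_apply, ← map_smul]
    congr 1
    funext i
    simp
  rw [e, map_smul]
  by_cases hj1 : j = 1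
  · rw [hj1, hb, hn, smul_smul, div_mul_cancel₀ _ hn0]
  · rw [hb' j hj hj1, hn' j hj hj1, smul_zero]

theorem lieOp_mem {n : (k →+* F) → ℕ} (hn : n τ ≠ 0) {f : PairRing k F}
    (hf : f ∈ Homog (mainDeg n)) (i : Fin 3) : lieOp τ i f ∈ Homog (mainDeg n) := by
  have e : mainDeg n = Function.update (mainDeg n) (τ, 0) (n τ - 1 + 1) := by
    symm
    rw [Function.update_eq_self_iff, Nat.sub_add_cancel (Nat.one_le_iff_ne_zero.2 hn)]
    simp [mainDeg]
  have h : ∀ j l : Fin 2, X (τ, 0, j) * pderiv (τ, 0, l) f ∈ Homog (mainDeg n) := fun j l => by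
    rw [e] at hf ⊢
    exact X_mul_mem (pderiv_mem hf l) j
  fin_cases i
  · exact h 0 1
  · exact sub_mem (h 0 0) (h 1 1)
  · exact h 1 0

/-- The natural action of `𝔰𝔩₂` on `F(λ)` through the embedding `τ`. -/
theorem exists_natural_adTriple (hlam : IsDeep p 2 lam) (τ : k →+* F) :
    ∃ N : Fin 3 → Module.End F (SerreWeightSpace lam),
      IsAdTriple (V := SerreWeightSpace lam) τ (serreWeight lam) N ∧ N ≠ 0 ∧
      (∀ v, N 0 (N 2 v) = N 2 (N 0 v) + N 1 v) ∧
      (∀ v, N 1 (N 0 v) = N 0 (N 1 v) + (2 : F) • N 0 v) ∧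
      (∀ v, N 1 (N 2 v) = N 2 (N 1 v) + (-2 : F) • N 2 v) ∧
      ∃ c : F, c ≠ 0 ∧
        ∀ v, N 1 (N 1 v) + (2 : F) • N 0 (N 2 v) + (2 : F) • N 2 (N 0 v) = c • v := by
  have hr := hlam.lowWeight p
  have hrp : ∀ τ, lowWeight lam τ < p := fun τ => by have := hr τ; omega
  obtain ⟨J, hJ, hJact⟩ := exists_polyEmbed_leftInverse p hrp
  obtain ⟨N, hN⟩ : ∃ N : Fin 3 → Module.End F (SerreWeightSpace lam),
      ∀ i v, N i v = J (lieOp τ i (polyEmbed lam v)) :=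
    ⟨fun i => J ∘ₗ lieOp τ i ∘ₗ polyEmbed lam, fun _ _ => rfl⟩
  have hmem : ∀ i v, lieOp τ i (polyEmbed lam v) ∈ Homog (mainDeg (lowWeight lam)) := fun i v =>
    lieOp_mem (by have := hr τ; omega) (polyEmbed_mem v) i
  have hJ' : ∀ f ∈ Homog (mainDeg (lowWeight lam)), polyEmbed lam (J f) = f := by
    intro f hf
    rw [← range_polyEmbed] at hf
    obtain ⟨v, rfl⟩ := hf
    rw [hJ]
  have hpN : ∀ i v, polyEmbed lam (N i v) = lieOp τ i (polyEmbed lam v) := fun i v => by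
    rw [hN, hJ' _ (hmem i v)]
  have hcas : ∀ v, N 1 (N 1 v) + (2 : F) • N 0 (N 2 v) + (2 : F) • N 2 (N 0 v)
      = ((lowWeight lam τ * (lowWeight lam τ + 2) : ℕ) : F) • v := fun v => by
    refine polyEmbed_injective p hrp ?_
    have := lieOp_casimir τ _ (polyEmbed_mem v)
    simp only [mainDeg, if_true] at this
    simp only [map_add, map_smul, hpN, this]
  have hc0 : ((lowWeight lam τ * (lowWeight lam τ + 2) : ℕ) : F) ≠ 0 := by
    rw [Ne, CharP.cast_eq_zero_iff F p, (Fact.out : p.Prime).dvd_mul]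
    rintro (h | h)
    · have := Nat.le_of_dvd (by have := hr τ; omega) h
      have := hr τ
      omega
    · have := Nat.le_of_dvd (by omega) h
      have := hr τ
      omega
  refine ⟨N, fun i g v => ?_, fun h => ?_, ?_, ?_, ?_, _, hc0, hcas⟩
  · refine polyEmbed_injective p hrp ?_
    rw [hpN, polyEmbed_serreWeight, map_smul, map_sum]
    refine (congrArg _ (isAdTriple_lieOp τ i g _)).trans ?_
    rw [Finset.smul_sum]
    refine Finset.sum_congr rfl fun j _ => ?_
    rw [map_smul, polyEmbed_serreWeight, hpN, smul_comm]
    rfl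
  · rw [h] at hcas
    have h1 := hcas (weightVec lam 0)
    simp only [Pi.zero_apply, smul_zero, add_zero, LinearMap.zero_apply] at h1
    have h2 := polyEmbed_weightVec (lam := lam) (b := 0) fun _ => Nat.zero_le _
    have h3 := congrArg (polyEmbed lam) h1
    rw [map_zero, map_smul, h2] at h3
    exact smul_ne_zero hc0 mon_ne_zero h3.symm
  all_goals
    refine fun v => polyEmbed_injective p hrp ?_
    have := lieOp_comm τ (polyEmbed lam v)
    simp only [map_add, map_smul, hpN]
  · rw [← this.1, add_sub_cancel]
  · rw [← this.2.1, add_sub_cancel]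
  · rw [← this.2.2, add_sub_cancel]

end Unique

/-! ### The radical filtration -/

section Radical

variable {F G V ι : Type*} [Field F] [AddCommGroup V] [Module F V] [Fintype ι]
  {ρ : G → Module.End F V} {c : G → Matrix ι ι F} {U U' : Submodule F V}

/-- The radical of a stable subspace: the intersection of its maximal stable subspaces. -/
def radSub (ρ : G → Module.End F V) (U : Submodule F V) : Submodule F V :=
  ⨅ E : {E // StepPair ρ E U}, E.1

theorem mem_radSub {v : V} : v ∈ radSub ρ U ↔ ∀ E, StepPair ρ E U → v ∈ E := by
  simp [radSub, Submodule.mem_iInf]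

theorem stable_radSub : Stable ρ (radSub ρ U) := Stable.iInf fun E => E.2.1

/-- A maximal proper stable subspace exists by finite dimension. -/
theorem radSub_lt [FiniteDimensional F V] (hU : Stable ρ U) (h0 : U ≠ ⊥) : radSub ρ U < U := by
  -- a stable proper subspace of maximal dimension
  have hex : ∃ n, ∃ E, Stable ρ E ∧ E < U ∧ Module.finrank F U - Module.finrank F E = n :=
    ⟨_, ⊥, Stable.bot, bot_lt_iff_ne_bot.2 h0, rfl⟩
  classical
  obtain ⟨E, hE, hEU, hn⟩ := Nat.find_spec hex
  have hstep : StepPair ρ E U := by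
    refine ⟨hE, hU, hEU.le, fun K hK h1 h2 => ?_⟩
    by_contra! h
    have hlt : E < K := lt_of_le_of_ne h1 (Ne.symm h.1)
    have h3 := Submodule.finrank_lt_finrank_of_lt hlt
    have h4 := Submodule.finrank_mono h2
    exact Nat.find_min hex (m := Module.finrank F U - Module.finrank F K) (by omega)
      ⟨K, hK, lt_of_le_of_ne h2 h.2, rfl⟩
  exact lt_of_le_of_lt (fun v hv => mem_radSub.1 hv E hstep) hEU

/-- An equivariant family of operators that maps `U` to `U'` also maps `rad U` to `rad U'`. -/
theorem map_radSub [FiniteDimensional F V] (hnice : NiceOn c ρ ⊤) {A : ι → Module.End F V}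
    (hA : ∀ i g v, A i (ρ g v) = ∑ j, c g i j • ρ g (A j v)) (hU : Stable ρ U)
    (h : ∀ i, ∀ v ∈ U, A i v ∈ U') (i : ι) (v : V) (hv : v ∈ radSub ρ U) :
    A i v ∈ radSub ρ U' := by
  refine mem_radSub.2 fun E hE => ?_
  have hf : SemiEquivariant ρ (powRep c ρ) (LinearMap.pi A) := by
    refine ⟨fun _ => 1, fun _ => one_ne_zero, fun g v => ?_⟩
    funext i
    rw [one_smul, powRep_apply, LinearMap.pi_apply, hA]
    rfl
  exact mem_powSub.1 (apply_mem_of_relCompl (M' := powSub ι U') hf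
    (fun v hv => mem_powSub.2 fun i => h i v hv) (hE.1.powSub c) hU (hnice _ _ hE le_top)
    (powSub_mono hE.2.2.1) (mem_radSub.1 hv)) i

/-- The radical filtration. -/
def radFil (ρ : G → Module.End F V) : ℕ → Submodule F V
  | 0 => ⊤
  | n + 1 => radSub ρ (radFil ρ n)

theorem stable_radFil (n : ℕ) : Stable ρ (radFil ρ n) := by
  cases n with
  | zero => exact Stable.top
  | succ n => exact stable_radSub

theorem exists_radFil_eq_bot [FiniteDimensional F V] : ∃ n, radFil ρ n = ⊥ := by
  by_contra! h
  have : ∀ n, Module.finrank F (radFil ρ n) + n ≤ Module.finrank F V := by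
    intro n
    induction n with
    | zero => simpa using Submodule.finrank_le _
    | succ n ih =>
      have := Submodule.finrank_lt_finrank_of_lt (radSub_lt (ρ := ρ) (stable_radFil n) (h n))
      change Module.finrank F (radSub ρ (radFil ρ n)) + (n + 1) ≤ _
      omega
  have := this (Module.finrank F V + 1)
  omega

/-- An equivariant family of operators preserves the radical filtration. -/
theorem map_radFil [FiniteDimensional F V] (hnice : NiceOn c ρ ⊤) {A : ι → Module.End F V}
    (hA : ∀ i g v, A i (ρ g v) = ∑ j, c g i j • ρ g (A j v)) (n : ℕ) :
    ∀ i, ∀ v ∈ radFil ρ n, A i v ∈ radFil ρ n := by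
  induction n with
  | zero => exact fun _ _ _ => trivial
  | succ n ih => exact map_radSub hnice hA (stable_radFil n) ih

/-- An equivariant family of operators with values in the radical shifts the radical filtration. -/
theorem map_radFil_succ [FiniteDimensional F V] (hnice : NiceOn c ρ ⊤) {A : ι → Module.End F V}
    (hA : ∀ i g v, A i (ρ g v) = ∑ j, c g i j • ρ g (A j v))
    (h : ∀ i v, A i v ∈ radFil ρ 1) (n : ℕ) :
    ∀ i, ∀ v ∈ radFil ρ n, A i v ∈ radFil ρ (n + 1) := by
  induction n with
  | zero => exact fun i v _ => h i v
  | succ n ih => exact map_radSub hnice hA (stable_radFil n) ih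

end Radical

/-! ### Commutators of equivariant triples -/

section Commutator

variable {k F V : Type*} [Field k] [Field F] [AddCommGroup V] [Module F V] {τ : k →+* F}
  {ρ : GL (Fin 2) k → Module.End F V} {A : Fin 3 → Module.End F V}

theorem det_ne_zero' (τ : k →+* F) (g : GL (Fin 2) k) :
    τ (g 0 0) * τ (g 1 1) - τ (g 0 1) * τ (g 1 0) ≠ 0 := by
  have := det_ne_zero g τ
  rwa [Matrix.det_fin_two, map_sub, map_mul, map_mul] at this

theorem adMat_eq (τ : k →+* F) (g : GL (Fin 2) k) : adMat τ g =
    (τ (g 0 0) * τ (g 1 1) - τ (g 0 1) * τ (g 1 0))⁻¹ •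
    !![τ (g 1 1) ^ 2, τ (g 1 0) * τ (g 1 1), -τ (g 1 0) ^ 2;
       2 * τ (g 0 1) * τ (g 1 1), τ (g 0 0) * τ (g 1 1) + τ (g 0 1) * τ (g 1 0),
        -2 * τ (g 0 0) * τ (g 1 0);
       -τ (g 0 1) ^ 2, -τ (g 0 0) * τ (g 0 1), τ (g 0 0) ^ 2] := by
  rw [adMat, Matrix.det_fin_two, map_sub, map_mul, map_mul]

theorem IsAdTriple.mul_apply (hA : IsAdTriple τ ρ A) (i j : Fin 3) (g : GL (Fin 2) k) (v : V) :
    A i (A j (ρ g v)) = ∑ a, ∑ b, (adMat τ g j a * adMat τ g i b) • ρ g (A b (A a v)) := by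
  rw [hA, map_sum]
  refine Finset.sum_congr rfl fun a _ => ?_
  rw [map_smul, hA, Finset.smul_sum]
  exact Finset.sum_congr rfl fun b _ => by rw [smul_smul]

/-- The triple `[A_Y, A_Z]` for the bracket relations `e = ½ [h, e]`, `h = [e, f]`,
`f = -½ [h, f]`. -/
def bracketTriple (A : Fin 3 → Module.End F V) : Fin 3 → Module.End F V :=
  ![(2⁻¹ : F) • (A 1 * A 0 - A 0 * A 1), A 0 * A 2 - A 2 * A 0,
    (2⁻¹ : F) • (A 2 * A 1 - A 1 * A 2)]

theorem IsAdTriple.bracket (h2 : (2 : F) ≠ 0) (hA : IsAdTriple τ ρ A) :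
    IsAdTriple τ ρ (bracketTriple A) := by
  intro i g v
  have h0 := det_ne_zero' τ g
  rw [Fin.sum_univ_three]
  fin_cases i <;>
  · simp [bracketTriple, hA.mul_apply, Fin.sum_univ_three, adMat_eq]
    match_scalars <;> field_simp <;> ring

/-- Twice the Casimir operator. -/
def casimir (A : Fin 3 → Module.End F V) : Module.End F V :=
  A 1 * A 1 + (2 : F) • (A 0 * A 2) + (2 : F) • (A 2 * A 0)

theorem IsAdTriple.casimir_comm (hA : IsAdTriple τ ρ A) (g : GL (Fin 2) k) (v : V) :
    casimir A (ρ g v) = ρ g (casimir A v) := by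
  have h0 := det_ne_zero' τ g
  simp [casimir, hA.mul_apply, Fin.sum_univ_three, adMat_eq]
  match_scalars <;> field_simp <;> ring

/-- The identities behind the vanishing of triples `b` with `b_Y A_Z = b_Z A_Y`: if the `A_Y` satisfy
the bracket relations up to errors `ε_Y = A'_Y - A_Y`, then `b_Y` composed with the Casimir
operator is expressed through the errors. -/
theorem casimir_identities {T : Type*} [AddCommGroup T] [Module F T] (h2 : (2 : F) ≠ 0)
    {b : Fin 3 → V →ₗ[F] T} (hb : ∀ i j v, b i (A j v) = b j (A i v)) {ε : Fin 3 → Module.End F V}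
    (hε : ∀ i v, bracketTriple A i v = A i v + ε i v) {s : V →ₗ[F] T}
    (hs : ∀ v, s v = b 1 (A 1 v) + (2 : F) • b 0 (A 2 v) + (2 : F) • b 2 (A 0 v)) (v : V) :
    s v = -(b 1 (ε 1 v) + (2 : F) • b 2 (ε 0 v) + (2 : F) • b 0 (ε 2 v)) ∧
    b 1 (casimir A v) = s (A 1 v) + (4 : F) • (b 2 (ε 0 v) - b 0 (ε 2 v)) ∧
    b 0 (casimir A v) = s (A 0 v) + (2 : F) • (b 0 (ε 1 v) - b 1 (ε 0 v)) ∧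
    b 2 (casimir A v) = s (A 2 v) + (2 : F) • (b 1 (ε 2 v) - b 2 (ε 1 v)) := by
  have e0 : ∀ w, A 1 (A 0 w) - A 0 (A 1 w) = (2 : F) • A 0 w + (2 : F) • ε 0 w := fun w => by
    rw [← smul_add, ← hε, bracketTriple]
    simp [smul_smul, mul_inv_cancel₀ h2]
  have e1 : ∀ w, A 0 (A 2 w) - A 2 (A 0 w) = A 1 w + ε 1 w := fun w => by
    rw [← hε]; simp [bracketTriple]
  have e2 : ∀ w, A 2 (A 1 w) - A 1 (A 2 w) = (2 : F) • A 2 w + (2 : F) • ε 2 w := fun w => by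
    rw [← smul_add, ← hε, bracketTriple]
    simp [smul_smul, mul_inv_cancel₀ h2]
  have b0 := fun i => congrArg (b i) (e0 v)
  have b1 := fun i => congrArg (b i) (e1 v)
  have b2 := fun i => congrArg (b i) (e2 v)
  simp only [map_sub, map_add, map_smul] at b0 b1 b2
  have r01 := hb 0 1
  have r02 := hb 0 2
  have r12 := hb 1 2
  simp only [casimir, LinearMap.add_apply, LinearMap.smul_apply, Module.End.mul_apply, map_add,
    map_smul, hs]
  have c02 := b0 2
  have c20 := b2 0
  have c01 := b0 1
  have c10 := b1 0
  have c11 := b1 1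
  have c12 := b1 2
  have c21 := b2 1
  simp only [r01, r02, r12] at c02 c20 c01 c10 c11 c12 c21 ⊢
  refine ⟨?_, ?_, ?_, ?_⟩
  · linear_combination (norm := module) (-1 : F) • c11 + (-1 : F) • c02 + (-1 : F) • c20
  · linear_combination (norm := module) (-2 : F) • c20 + (2 : F) • c02
  · linear_combination (norm := module) (-1 : F) • c01 + (2 : F) • c10
  · linear_combination (norm := module) (1 : F) • c21 + (-2 : F) • c12

end Commutator

/-! ### Equivariant triples on the projective cover -/

section Lift

variable {F G V W₁ W₂ : Type*} [Field F] [Group G] [AddCommGroup V] [Module F V] [AddCommGroup W₁]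
  [Module F W₁] [AddCommMonoid W₂] [Module F W₂] {ρ : Representation F G V}
  {σ₁ : Representation F G W₁} {σ₂ : Representation F G W₂}

theorem exists_lift_of_projective (h : Module.Projective (MonoidAlgebra F G) ρ.asModule)
    (f : Representation.IntertwiningMap σ₁ σ₂) (hf : Function.Surjective f)
    (g : Representation.IntertwiningMap ρ σ₂) :
    ∃ l : Representation.IntertwiningMap ρ σ₁, ∀ v, f (l v) = g v := by
  obtain ⟨l, hl⟩ := Module.projective_lifting_property
    (Representation.IntertwiningMap.equivLinearMapAsModule σ₁ σ₂ f)
    (Representation.IntertwiningMap.equivLinearMapAsModule ρ σ₂ g) hf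
  exact ⟨(Representation.IntertwiningMap.equivLinearMapAsModule ρ σ₁).symm l,
    fun v => DFunLike.congr_fun hl v⟩

end Lift

theorem exists_representation_powRep {k F W : Type*} [Field k] [Field F] [AddCommGroup W]
    [Module F W] (τ : k →+* F) (ρ : Representation F (GL (Fin 2) k) W) :
    ∃ R : Representation F (GL (Fin 2) k) (Fin 3 → W), ∀ g, R g = powRep (adMat τ) ρ g := by
  have hone : adMat τ (1 : GL (Fin 2) k) = 1 := by
    ext i j
    rw [adMat_eq]
    fin_cases i <;> fin_cases j <;> simp
  have hmul : ∀ g h : GL (Fin 2) k, adMat τ (g * h) = adMat τ g * adMat τ h := by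
    intro g h
    have e : τ ((g * h) 0 0) * τ ((g * h) 1 1) - τ ((g * h) 0 1) * τ ((g * h) 1 0)
        = (τ (g 0 0) * τ (g 1 1) - τ (g 0 1) * τ (g 1 0)) *
          (τ (h 0 0) * τ (h 1 1) - τ (h 0 1) * τ (h 1 0)) := by
      simp [Matrix.mul_apply, Fin.sum_univ_two]
      ring
    rw [adMat_eq, adMat_eq, adMat_eq, e, mul_inv, Matrix.smul_mul, Matrix.mul_smul, smul_smul]
    congr 1
    ext i j
    fin_cases i <;> fin_cases j <;>
      simp [Matrix.mul_apply, Fin.sum_univ_two, Fin.sum_univ_three] <;> ring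
  refine ⟨⟨⟨powRep (adMat τ) ρ, ?_⟩, fun g h => ?_⟩, fun _ => rfl⟩
  · refine LinearMap.ext fun v => funext fun i => ?_
    rw [powRep_apply, hone]
    simp [Matrix.one_apply]
  · refine LinearMap.ext fun v => funext fun i => ?_
    rw [Module.End.mul_apply, powRep_apply, powRep_apply, hmul]
    simp only [Matrix.mul_apply, Finset.sum_smul, powRep_apply, map_sum, map_smul, map_mul,
      Module.End.mul_apply, Finset.smul_sum, smul_smul]
    exact Finset.sum_comm

theorem exists_linear_section {F V W : Type*} [Field F] [AddCommGroup V] [Module F V]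
    [AddCommGroup W] [Module F W] {f : V →ₗ[F] W} (hf : Function.Surjective f) :
    ∃ s : W →ₗ[F] V, ∀ w, f (s w) = w := by
  obtain ⟨s, hs⟩ := f.exists_rightInverse_of_surjective (LinearMap.range_eq_top.2 hf)
  exact ⟨s, fun w => DFunLike.congr_fun hs w⟩

section CoverTriple

variable {k F : Type*} [Field k] [Field F] [Fintype (k →+* F)] [DecidableEq (k →+* F)]
  {lam : (k →+* F) → ℤ × ℤ} {τ : k →+* F}
  (p : ℕ) [Fact p.Prime] [CharP k p] [CharP F p] [Fintype k] [Finite F] [Nonempty (k →+* F)]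
  {V : Type*} [AddCommGroup V] [Module F V] {ρ : Representation F (GL (Fin 2) k) V}
  {π : Representation.IntertwiningMap ρ (serreWeight lam)}

theorem IsDeep.two_ne_zero (hlam : IsDeep p 2 lam) : (2 : F) ≠ 0 := by
  obtain ⟨τ⟩ := (inferInstance : Nonempty (k →+* F))
  intro h
  have h3 : ((2 : ℕ) : F) = 0 := by exact_mod_cast h
  have := Nat.le_of_dvd two_pos ((CharP.cast_eq_zero_iff F p 2).1 h3)
  have := hlam.lowWeight p τ
  omega

theorem intertwining_apply (g : GL (Fin 2) k) (v : V) : π (ρ g v) = serreWeight lam g (π v) :=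
  DFunLike.congr_fun (π.isIntertwining' g) v

theorem semiEquivariant_intertwining :
    SemiEquivariant (V := V) (V' := SerreWeightSpace lam) ρ (serreWeight lam) π.toLinearMap :=
  ⟨fun _ => 1, fun _ => one_ne_zero, fun g v =>
    (intertwining_apply g v).trans (one_smul F _).symm⟩

/-- The kernel of a projective cover being superfluous, a stable subspace that surjects onto the
target is everything. -/
theorem IsProjectiveCover.eq_top (hπ : IsProjectiveCover π) {K : Submodule F V} (hK : Stable ρ K)
    (h : ∀ w, ∃ v ∈ K, π v = w) : K = ⊤ := by
  have hN := hπ.superfluous ⟨K, fun g v hv => hK g v hv⟩ (by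
    refine SetLike.ext fun v => ⟨fun _ => trivial, fun _ => ?_⟩
    obtain ⟨n, hn, hnv⟩ := h (π v)
    refine Submodule.mem_sup.2 ⟨n, hn, v - n, ?_, by abel⟩
    change π (v - n) = 0
    rw [map_sub, sub_eq_zero]
    exact hnv.symm)
  exact congrArg Subrepresentation.toSubmodule hN

/-- The radical of the projective cover of a Serre weight is the kernel of the projection. -/
theorem radFil_one (hlam : IsDeep p 2 lam) (hπ : IsProjectiveCover π) :
    radFil ρ 1 = LinearMap.ker π.toLinearMap := by
  have hrp : ∀ τ, lowWeight lam τ < p := fun τ => by have := hlam.lowWeight p τ; omega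
  have hirr : ∀ K, Stable ρ K → (∃ v ∈ K, π v ≠ 0) → K = ⊤ := by
    rintro K hK ⟨v, hv, hv0⟩
    refine hπ.eq_top hK fun w => ?_
    have h1 := (irrOn_serreWeight p hrp _ (hK.map (semiEquivariant_intertwining (π := π)))
      le_top).resolve_left fun h0 => hv0 (by
        rw [← Submodule.mem_bot F, ← h0]
        exact ⟨v, hv, rfl⟩)
    have h2 : w ∈ K.map π.toLinearMap := by rw [h1]; trivial
    obtain ⟨v, hv, hw⟩ := h2
    exact ⟨v, hv, hw⟩
  refine le_antisymm (fun v hv => mem_radSub.1 hv _ ⟨Stable.ker semiEquivariant_intertwining,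
    Stable.top, le_top, fun K hK h1 _ => ?_⟩) fun v hv => mem_radSub.2 fun E hE => ?_
  · by_cases h : K ≤ LinearMap.ker π.toLinearMap
    · exact Or.inl (le_antisymm h h1)
    · obtain ⟨v, hv, hv0⟩ := Set.not_subset.1 h
      exact Or.inr (hirr K hK ⟨v, hv, hv0⟩)
  · rcases hE.2.2.2 (E ⊔ LinearMap.ker π.toLinearMap)
      (hE.1.sup (Stable.ker semiEquivariant_intertwining)) le_sup_left le_top with h | h
    · rw [← h]
      exact Submodule.mem_sup_right hv
    · have : E = ⊤ := hπ.eq_top hE.1 fun w => by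
        obtain ⟨v, rfl⟩ := hπ.surjective w
        have hv : v ∈ E ⊔ LinearMap.ker π.toLinearMap := by rw [h]; trivial
        obtain ⟨e, he, n, hn, rfl⟩ := Submodule.mem_sup.1 hv
        have hn' : π n = 0 := hn
        exact ⟨e, he, by rw [map_add, hn', add_zero]⟩
      rw [this]; trivial

variable [FiniteDimensional F V]

/-- An equivariant triple on the projective cover induces one on the Serre weight. -/
theorem IsAdTriple.exists_induced (hlam : IsDeep p 2 lam) (hπ : IsProjectiveCover π)
    {A : Fin 3 → Module.End F V} (hA : IsAdTriple τ ρ A) :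
    ∃ B : Fin 3 → Module.End F (SerreWeightSpace lam),
      IsAdTriple (V := SerreWeightSpace lam) τ (serreWeight lam) B ∧ ∀ i v, π (A i v) = B i (π v) := by
  obtain ⟨s, hs⟩ := exists_linear_section (W := SerreWeightSpace lam) (f := π.toLinearMap)
    hπ.surjective
  have hs' : ∀ w, π (s w) = w := hs
  have hker : ∀ i v, π v = 0 → π (A i v) = 0 := fun i v hv => by
    have h1 := map_radFil (niceOn_projectiveCover p hlam π hπ τ) hA 1 i v
    rw [radFil_one p hlam hπ] at h1
    exact h1 hv
  have hB : ∀ i v, π (A i v) = π (A i (s (π v))) := fun i v => by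
    have h := hker i (v - s (π v)) (by rw [map_sub, hs', sub_self])
    rwa [map_sub, map_sub, sub_eq_zero] at h
  refine ⟨fun i => π.toLinearMap ∘ₗ A i ∘ₗ s, fun i g w => ?_, hB⟩
  obtain ⟨v, rfl⟩ := hπ.surjective w
  change π (A i (s (serreWeight lam g (π v)))) = ∑ j, _ • serreWeight lam g (π (A j (s (π v))))
  rw [← intertwining_apply, ← hB, hA, map_sum]
  exact Finset.sum_congr rfl fun j _ => by rw [map_smul, intertwining_apply, ← hB]

theorem casimir_apply (A : Fin 3 → Module.End F V) (v : V) :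
    casimir A v = A 1 (A 1 v) + (2 : F) • A 0 (A 2 v) + (2 : F) • A 2 (A 0 v) := rfl

/-- The Casimir operator of a triple that lifts `N` commutes with the group and is surjective modulo
the radical, hence is surjective, hence bijective by finite dimension. -/
theorem casimir_bijective (hπ : IsProjectiveCover π) {A : Fin 3 → Module.End F V}
    (hA : IsAdTriple τ ρ A) {N : Fin 3 → Module.End F (SerreWeightSpace lam)}
    (hN : ∀ i v, π (A i v) = N i (π v)) {c : F} (hc : c ≠ 0)
    (hcas : ∀ v, N 1 (N 1 v) + (2 : F) • N 0 (N 2 v) + (2 : F) • N 2 (N 0 v) = c • v) :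
    Function.Bijective (casimir A) := by
  have hsurj : Function.Surjective (casimir A) := by
    rw [← LinearMap.range_eq_top]
    refine hπ.eq_top ?_ fun w => ?_
    · rintro g _ ⟨v, rfl⟩
      exact ⟨ρ g v, hA.casimir_comm g v⟩
    · have hcv : ∀ v, π (casimir A v) = c • π v := fun v => by
        rw [casimir_apply, map_add, map_add, map_smul, map_smul, hN, hN, hN, hN, hN, hN, hcas]
      obtain ⟨v, rfl⟩ := hπ.surjective w
      exact ⟨casimir A (c⁻¹ • v), ⟨_, rfl⟩, by
        rw [hcv, map_smul, smul_smul, mul_inv_cancel₀ hc, one_smul]⟩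
  exact ⟨LinearMap.injective_iff_surjective.2 hsurj, hsurj⟩

/-- The natural action of `𝔰𝔩₂` on a deep Serre weight lifts to the projective cover, and the lift
has no common kernel, because its Casimir operator is bijective. -/
theorem exists_adTriple_projectiveCover (hlam : IsDeep p 2 lam) (hπ : IsProjectiveCover π)
    (τ : k →+* F) : ∃ A : Fin 3 → Module.End F V, IsAdTriple τ ρ A ∧
      ∀ v, (∀ i, A i v = 0) → v = 0 := by
  obtain ⟨N, hNt, -, -, -, -, c, hc, hcas⟩ := exists_natural_adTriple p hlam τ
  obtain ⟨R, hR⟩ := exists_representation_powRep τ ρ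
  obtain ⟨S, hS⟩ := exists_representation_powRep τ (W := SerreWeightSpace lam) (serreWeight lam)
  obtain ⟨f, hf⟩ : ∃ f : Representation.IntertwiningMap R S, ∀ v i, f v i = π (v i) :=
    ⟨⟨π.toLinearMap.compLeft (Fin 3), fun g => LinearMap.ext fun v => funext fun i => by
      simp only [LinearMap.comp_apply, hR, hS, LinearMap.compLeft_apply, Function.comp_apply,
        powRep_apply, map_sum, map_smul]
      exact Finset.sum_congr rfl fun j _ => congrArg _ (intertwining_apply g _)⟩, fun _ _ => rfl⟩
  obtain ⟨g, hg⟩ : ∃ g : Representation.IntertwiningMap ρ S, ∀ v i, g v i = N i (π v) :=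
    ⟨⟨LinearMap.pi fun i => N i ∘ₗ π.toLinearMap, fun g => LinearMap.ext fun v => funext fun i => by
      simp only [LinearMap.comp_apply, hS, LinearMap.pi_apply, powRep_apply]
      exact (congrArg (N i) (intertwining_apply g v)).trans (hNt i g (π v))⟩, fun _ _ => rfl⟩
  obtain ⟨l, hl⟩ := exists_lift_of_projective hπ.projective f (fun w => by
    choose v hv using fun i => hπ.surjective (w i)
    exact ⟨v, funext fun i => (hf v i).trans (hv i)⟩) g
  have hA : IsAdTriple τ ρ fun i => LinearMap.proj i ∘ₗ l.toLinearMap := fun i g v => by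
    have h1 : l (ρ g v) = R g (l v) := DFunLike.congr_fun (l.isIntertwining' g) v
    change l (ρ g v) i = _
    rw [h1, hR, powRep_apply]
    rfl
  refine ⟨_, hA, fun v hv => ?_⟩
  refine (casimir_bijective hπ hA (N := N) (fun i v => ?_) hc hcas).1 ?_
  · have h1 := congrFun (hl v) i
    rwa [hf, hg] at h1
  · rw [casimir_apply, hv, hv, hv]
    simp

/-- A triple without common kernel induces a nonzero multiple of the natural action. -/
theorem IsAdTriple.exists_ne_zero (hlam : IsDeep p 2 lam) (hπ : IsProjectiveCover π) [Nontrivial V]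
    {A : Fin 3 → Module.End F V} (hA : IsAdTriple τ ρ A) (hinj : ∀ v, (∀ i, A i v = 0) → v = 0)
    {N : Fin 3 → Module.End F (SerreWeightSpace lam)}
    (hN : IsAdTriple (V := SerreWeightSpace lam) τ (serreWeight lam) N) (hN0 : N ≠ 0) :
    ∃ c : F, c ≠ 0 ∧ ∀ i v, π (A i v) = c • N i (π v) := by
  obtain ⟨B, hB, hAB⟩ := hA.exists_induced p hlam hπ
  obtain ⟨c, rfl⟩ := hB.exists_eq_smul p hlam hN hN0
  refine ⟨c, ?_, hAB⟩
  rintro rfl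
  have hnice := niceOn_projectiveCover p hlam π hπ τ
  have h1 : ∀ i v, A i v ∈ radFil ρ 1 := fun i v => by
    rw [radFil_one p hlam hπ]
    have := hAB i v
    rw [zero_smul] at this
    exact this
  -- the last nonzero step of the filtration is killed by all `A i`
  classical
  have hex := exists_radFil_eq_bot (ρ := ρ)
  have hn := Nat.find_spec hex
  obtain ⟨n, hn'⟩ : ∃ n, Nat.find hex = n + 1 := Nat.exists_eq_succ_of_ne_zero fun h0 => by
    rw [h0] at hn
    exact top_ne_bot hn
  refine Nat.find_min hex (m := n) (by omega) (eq_bot_iff.2 fun v hv => ?_)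
  refine (Submodule.mem_bot F).2 (hinj v fun i => ?_)
  have := map_radFil_succ hnice hA h1 n i v hv
  rwa [← hn', hn] at this

/-- Linear maps `b_Y` with `b_Y A_Z = b_Z A_Y` for all `Y`, `Z` vanish, for a triple `A` without
common kernel. If `A` satisfied the bracket relations, then `b_Y` composed with the Casimir operator
would be zero by `casimir_identities`, and the Casimir operator is invertible. In general the
relations hold up to operators `ε` that shift the radical filtration, and `b` is shown to vanish on
its steps by descending induction. -/
theorem eq_zero_of_symmetric (hlam : IsDeep p 2 lam) (hπ : IsProjectiveCover π)
    {A : Fin 3 → Module.End F V} (hA : IsAdTriple τ ρ A) (hinj : ∀ v, (∀ i, A i v = 0) → v = 0)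
    {T : Type*} [AddCommGroup T] [Module F T] {b : Fin 3 → V →ₗ[F] T}
    (hb : ∀ i j v, b i (A j v) = b j (A i v)) (i : Fin 3) (v : V) : b i v = 0 := by
  rcases subsingleton_or_nontrivial V with _ | _
  · rw [Subsingleton.elim v 0, map_zero]
  have h2 : (2 : F) ≠ 0 := hlam.two_ne_zero p
  have hnice := niceOn_projectiveCover p hlam π hπ τ
  obtain ⟨N, hN, hN0, hc1, hc0, hc2, r, hr, hcas⟩ := exists_natural_adTriple p hlam τ
  obtain ⟨c, hc, hAN⟩ := hA.exists_ne_zero p hlam hπ hinj hN hN0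
  -- rescale so that `A` induces the natural action
  obtain ⟨A', hA'⟩ : ∃ A' : Fin 3 → Module.End F V, ∀ i v, A' i v = c⁻¹ • A i v :=
    ⟨fun i => c⁻¹ • A i, fun _ _ => rfl⟩
  have hAt : IsAdTriple τ ρ A' := fun i g v => by
    rw [hA', hA, Finset.smul_sum]
    exact Finset.sum_congr rfl fun j _ => by rw [hA', map_smul, smul_comm]
  have hAN' : ∀ i v, π (A' i v) = N i (π v) := fun i v => by
    rw [hA', map_smul, hAN, smul_smul, inv_mul_cancel₀ hc, one_smul]
  have hb' : ∀ i j v, b i (A' j v) = b j (A' i v) := fun i j v => by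
    rw [hA', hA', map_smul, map_smul, hb]
  -- the failure `ε` of the bracket relations; it has values in the radical, because the relations
  -- hold on the Serre weight
  obtain ⟨ε, hε⟩ : ∃ ε : Fin 3 → Module.End F V, ∀ i v, ε i v = bracketTriple A' i v - A' i v :=
    ⟨fun i => bracketTriple A' i - A' i, fun _ _ => rfl⟩
  have hεt : IsAdTriple τ ρ ε := fun i g v => by
    rw [hε, hAt.bracket h2, hAt, ← Finset.sum_sub_distrib]
    exact Finset.sum_congr rfl fun j _ => by rw [hε, map_sub, smul_sub]
  have hε1 : ∀ i v, ε i v ∈ radFil ρ 1 := fun i v => by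
    rw [radFil_one p hlam hπ]
    have hk : ∀ x y : V, π x = π y → x - y ∈ LinearMap.ker π.toLinearMap := fun x y h => by
      change π (x - y) = 0
      rw [map_sub, h, sub_self]
    fin_cases i
    · have h3 := hk (A' 1 (A' 0 v)) (A' 0 (A' 1 v) + (2 : F) • A' 0 v) (by
        rw [map_add, map_smul, hAN', hAN', hAN', hAN', hc0])
      have e : ε 0 v = (2⁻¹ : F) • (A' 1 (A' 0 v) - (A' 0 (A' 1 v) + (2 : F) • A' 0 v)) := by
        rw [hε, smul_sub, smul_add, smul_smul, inv_mul_cancel₀ h2, one_smul, ← sub_sub, ← smul_sub]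
        rfl
      exact e ▸ Submodule.smul_mem _ _ h3
    · have h3 := hk (A' 0 (A' 2 v)) (A' 2 (A' 0 v) + A' 1 v) (by
        rw [map_add, hAN', hAN', hAN', hAN', hAN', hc1])
      rw [← sub_sub] at h3
      exact (hε 1 v).symm ▸ h3
    · have h3 := hk (A' 1 (A' 2 v)) (A' 2 (A' 1 v) + (-2 : F) • A' 2 v) (by
        rw [map_add, map_smul, hAN', hAN', hAN', hAN', hc2])
      have e : ε 2 v = (-2⁻¹ : F) • (A' 1 (A' 2 v) - (A' 2 (A' 1 v) + (-2 : F) • A' 2 v)) := by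
        have h4 : ε 2 v = (2⁻¹ : F) • (A' 2 (A' 1 v) - A' 1 (A' 2 v)) - A' 2 v := hε 2 v
        rw [h4]
        match_scalars <;> field_simp
      exact e ▸ Submodule.smul_mem _ _ h3
  have hpres := map_radFil hnice hAt
  have hshift := map_radFil_succ hnice hεt hε1
  have hcasb := casimir_bijective hπ hAt hAN' hr hcas
  -- the Casimir operator is bijective on every step of the filtration
  have hcasr : ∀ n, ∀ v ∈ radFil ρ n, ∃ w ∈ radFil ρ n, casimir A' w = v := by
    intro n
    have h1 : (radFil ρ n).map (casimir A') ≤ radFil ρ n := by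
      rintro _ ⟨v, hv, rfl⟩
      rw [casimir_apply]
      exact add_mem (add_mem (hpres n _ _ (hpres n _ _ hv))
        (Submodule.smul_mem _ _ (hpres n _ _ (hpres n _ _ hv))))
        (Submodule.smul_mem _ _ (hpres n _ _ (hpres n _ _ hv)))
    have h2 := Submodule.eq_of_le_of_finrank_eq h1
      (LinearEquiv.finrank_eq (Submodule.equivMapOfInjective _ hcasb.1 _).symm)
    intro v hv
    rw [← h2] at hv
    exact hv
  obtain ⟨n, hn⟩ := exists_radFil_eq_bot (ρ := ρ)
  -- descending induction along the radical filtration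
  have key : ∀ m ≤ n, ∀ i, ∀ v ∈ radFil ρ (n - m), b i v = 0 := by
    intro m
    induction m with
    | zero =>
      intro _ i v hv
      rw [Nat.sub_zero, hn, Submodule.mem_bot] at hv
      rw [hv, map_zero]
    | succ m ih =>
      intro hm i v hv
      have e : n - m = n - (m + 1) + 1 := by omega
      have ih' := ih (by omega)
      rw [e] at ih'
      generalize n - (m + 1) = l at hv ih'
      have hbε : ∀ i j, ∀ v ∈ radFil ρ l, b i (ε j v) = 0 := fun i j v hv =>
        ih' i _ (hshift l j v hv)
      obtain ⟨s, hs⟩ : ∃ s : V →ₗ[F] T,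
          ∀ v, s v = b 1 (A' 1 v) + (2 : F) • b 0 (A' 2 v) + (2 : F) • b 2 (A' 0 v) :=
        ⟨b 1 ∘ₗ A' 1 + (2 : F) • (b 0 ∘ₗ A' 2) + (2 : F) • (b 2 ∘ₗ A' 0), fun _ => rfl⟩
      have hid := fun v => casimir_identities (A := A') h2 hb' (ε := ε)
        (fun i v => by rw [hε, add_sub_cancel]) hs v
      have hs0 : ∀ v ∈ radFil ρ l, s v = 0 := fun v hv => by
        rw [(hid v).1, hbε _ _ v hv, hbε _ _ v hv, hbε _ _ v hv]
        simp
      obtain ⟨w, hw, rfl⟩ := hcasr l v hv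
      obtain ⟨-, i1, i0, i2⟩ := hid w
      fin_cases i
      · refine i0.trans ?_
        rw [hs0 _ (hpres l _ _ hw), hbε _ _ w hw, hbε _ _ w hw]
        simp
      · refine i1.trans ?_
        rw [hs0 _ (hpres l _ _ hw), hbε _ _ w hw, hbε _ _ w hw]
        simp
      · refine i2.trans ?_
        rw [hs0 _ (hpres l _ _ hw), hbε _ _ w hw, hbε _ _ w hw]
        simp
  refine key n le_rfl i v ?_
  rw [Nat.sub_self]
  trivial

end CoverTriple

/-! ### Reduction modulo `p` -/

section ModP

variable {p : ℕ} [Fact p.Prime] {F : Type*} [Field F] [CharP F p]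

theorem algebraMap_witt (a : WittVector p F) : algebraMap (WittVector p F) F a = a.coeff 0 := rfl

theorem witt_smul_eq (a : WittVector p F) {V : Type*} [AddCommGroup V] [Module F V]
    [Module (WittVector p F) V] [IsScalarTower (WittVector p F) F V] (v : V) :
    a • v = a.coeff 0 • v := by
  rw [← algebraMap_smul F a v, algebraMap_witt]

variable [Finite F] {L : Type*} [AddCommMonoid L] [Module (WittVector p F) L]

theorem coeff_zero_eq_zero_iff (a : WittVector p F) :
    a.coeff 0 = 0 ↔ ∃ b, a = (p : WittVector p F) * b := by
  rw [← WittVector.mem_span_p_iff_coeff_zero_eq_zero, Ideal.mem_span_singleton]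
  rfl

omit [Finite F] in
theorem one_tmul_smul (a : WittVector p F) (l : L) :
    (1 : F) ⊗ₜ[WittVector p F] (a • l) = a.coeff 0 • 1 ⊗ₜ l := by
  rw [TensorProduct.tmul_smul, TensorProduct.smul_tmul', witt_smul_eq, TensorProduct.smul_tmul']

theorem exists_one_tmul (w : F ⊗[WittVector p F] L) : ∃ l : L, w = 1 ⊗ₜ l := by
  induction w with
  | zero => exact ⟨0, by simp⟩
  | tmul a l =>
    obtain ⟨b, rfl⟩ := WittVector.constantCoeff_surjective (R := F) p a
    refine ⟨b • l, ?_⟩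
    rw [TensorProduct.tmul_smul, TensorProduct.smul_tmul', witt_smul_eq]
    simp
  | add x y hx hy =>
    obtain ⟨l, rfl⟩ := hx
    obtain ⟨l', rfl⟩ := hy
    exact ⟨l + l', by rw [TensorProduct.tmul_add]⟩

theorem one_tmul_p_smul (l : L) : (1 : F) ⊗ₜ[WittVector p F] ((p : WittVector p F) • l) = 0 := by
  rw [one_tmul_smul, WittVector.coeff_p_zero, zero_smul]

/-- The kernel of `L → F ⊗ L` is `p L`. -/
theorem one_tmul_eq_zero_iff (l : L) :
    (1 : F) ⊗ₜ[WittVector p F] l = 0 ↔ ∃ l', l = (p : WittVector p F) • l' := by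
  let _ := Module.addCommMonoidToAddCommGroup (WittVector p F) (M := L)
  refine ⟨fun h => ?_, ?_⟩
  · let I : Submodule (WittVector p F) L := LinearMap.range
      (LinearMap.lsmul (WittVector p F) L (p : WittVector p F))
    -- `a ⊗ x ↦ a x` on `F ⊗ L` with values in `L ⧸ p L`
    let f : F →ₗ[WittVector p F] L →ₗ[WittVector p F] L ⧸ I :=
      { toFun := fun a => ((WittVector.constantCoeff_surjective (R := F) p a).choose) • I.mkQ
        map_add' := fun a b => ?_
        map_smul' := fun c a => ?_ }
    · have h1 := congrArg (TensorProduct.lift f) h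
      rw [TensorProduct.lift.tmul, map_zero] at h1
      have hc := (WittVector.constantCoeff_surjective (R := F) p 1).choose_spec
      set c := (WittVector.constantCoeff_surjective (R := F) p (1 : F)).choose
      have h2 : c • I.mkQ l = 0 := h1
      obtain ⟨b, hb⟩ := (coeff_zero_eq_zero_iff (c - 1)).1 (by
        rw [← WittVector.constantCoeff_apply, map_sub, map_one, hc, sub_self])
      rw [← map_smul] at h2
      obtain ⟨m, hm⟩ := (Submodule.Quotient.mk_eq_zero I).1 h2
      refine ⟨m - b • l, ?_⟩
      have hm' : (p : WittVector p F) • m = c • l := hm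
      rw [smul_sub, hm', smul_smul, ← hb, sub_smul, one_smul]
      abel
    all_goals
      have key : ∀ x y : WittVector p F, x.coeff 0 = y.coeff 0 → x • I.mkQ = y • I.mkQ := by
        intro x y hxy
        obtain ⟨b, hb⟩ := (coeff_zero_eq_zero_iff (x - y)).1 (by
          rw [← WittVector.constantCoeff_apply, map_sub, WittVector.constantCoeff_apply,
            WittVector.constantCoeff_apply, hxy, sub_self])
        refine LinearMap.ext fun l => ?_
        rw [← sub_eq_zero, LinearMap.smul_apply, LinearMap.smul_apply, ← sub_smul, hb, ← map_smul]
        exact (Submodule.Quotient.mk_eq_zero I).2 ⟨b • l, by rw [LinearMap.lsmul_apply, smul_smul]⟩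
    · have ha := (WittVector.constantCoeff_surjective (R := F) p a).choose_spec
      have hb := (WittVector.constantCoeff_surjective (R := F) p b).choose_spec
      have hab := (WittVector.constantCoeff_surjective (R := F) p (a + b)).choose_spec
      rw [← add_smul]
      refine key _ _ ?_
      rw [← WittVector.constantCoeff_apply, ← WittVector.constantCoeff_apply, map_add, ha, hb, hab]
    · have ha := (WittVector.constantCoeff_surjective (R := F) p a).choose_spec
      have hca := (WittVector.constantCoeff_surjective (R := F) p (c • a)).choose_spec
      rw [RingHom.id_apply, smul_smul]
      refine key _ _ ?_
      rw [← WittVector.constantCoeff_apply, ← WittVector.constantCoeff_apply, map_mul, ha, hca,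
        witt_smul_eq]
      rfl
  · rintro ⟨l', rfl⟩
    exact one_tmul_p_smul l'

end ModP

/-! ### Coordinates on `𝔰𝔩₂ ⊗ P` -/

section Coordinates

variable {p : ℕ} [Fact p.Prime] {k F : Type*} [Field k] [Field F] [CharP F p]

/-- Coordinates on trace zero matrices with respect to the basis `e`, `h`, `f`. -/
def slCoord (O : Type*) [CommRing O] : sl₂ O ≃ₗ[O] (Fin 3 → O) where
  toFun Z := ![Z.1 0 1, Z.1 0 0, Z.1 1 0]
  map_add' Y Z := by simp
  map_smul' c Z := by simp
  invFun c := ⟨!![c 1, c 0; c 2, -c 1], by simp [LinearMap.mem_ker, Matrix.trace_fin_two]⟩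
  left_inv Z := by
    have h : Z.1 0 0 + Z.1 1 1 = 0 := by
      rw [← Matrix.trace_fin_two]
      exact Z.2
    ext i j
    fin_cases i <;> fin_cases j <;> simp [eq_neg_of_add_eq_zero_right h]
  right_inv c := by
    ext i
    fin_cases i <;> simp

variable {P : Type*} [AddCommGroup P] [Module (WittVector p F) P]

/-- Coordinates on `𝔰𝔩₂ ⊗ P` with respect to the basis `e`, `h`, `f`. -/
def coordO : R₂Space p F P ≃ₗ[WittVector p F] (Fin 3 → P) :=
  TensorProduct.congr (slCoord (WittVector p F)) (LinearEquiv.refl _ P) ≪≫ₗ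
    TensorProduct.comm _ _ _ ≪≫ₗ TensorProduct.piScalarRight _ _ P (Fin 3)

theorem coordO_tmul (Z : sl₂ (WittVector p F)) (x : P) (i : Fin 3) :
    coordO (Z ⊗ₜ[WittVector p F] x) i = slCoord (WittVector p F) Z i • x := by
  simp [coordO]

/-- Coordinates on `(𝔰𝔩₂ ⊗ P) / p` with respect to the basis `e`, `h`, `f`. -/
def coordF : (F ⊗[WittVector p F] R₂Space p F P) ≃ₗ[F] (Fin 3 → F ⊗[WittVector p F] P) :=
  LinearEquiv.baseChange _ F _ _ coordO ≪≫ₗ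
    TensorProduct.piRight (WittVector p F) F F fun _ : Fin 3 => P

theorem coordF_tmul (a : F) (y : R₂Space p F P) (i : Fin 3) :
    coordF (a ⊗ₜ[WittVector p F] y) i = a ⊗ₜ coordO y i := by
  simp [coordF]

end Coordinates

section Equivariance

variable {p : ℕ} [Fact p.Prime] {k F : Type*} [Field k] [Field F] [CharP F p]
  {P : Type*} [AddCommGroup P] [Module (WittVector p F) P]
  (ρ : Representation (WittVector p F) (GL (Fin 2) k) P) (τ : k →+* F)

theorem inv_apply_fin_two (g : GL (Fin 2) F) :
    ((g⁻¹ : GL (Fin 2) F) : Matrix (Fin 2) (Fin 2) F)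
      = (g 0 0 * g 1 1 - g 0 1 * g 1 0)⁻¹ • !![g 1 1, -g 0 1; -g 1 0, g 0 0] := by
  rw [Matrix.coe_units_inv, Matrix.inv_def, Matrix.adjugate_fin_two, Matrix.det_fin_two,
    Ring.inverse_eq_inv]

theorem coeff_zero_map (g : K p k) (i j : Fin 2) :
    ((Matrix.GeneralLinearGroup.map (WittVector.map τ) g : GL (Fin 2) (WittVector p F)) i j).coeff 0
      = τ (reduction p k g i j) := rfl

theorem coeff_zero_map_inv (g : K p k) (i j : Fin 2) :
    (((Matrix.GeneralLinearGroup.map (WittVector.map τ) g)⁻¹ : GL (Fin 2) (WittVector p F)) i j).coeff 0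
      = ((Matrix.GeneralLinearGroup.map τ (reduction p k g))⁻¹ : GL (Fin 2) F) i j := by
  rw [← map_inv, coeff_zero_map, map_inv, ← map_inv]
  rfl

theorem baseChangeRep_tmul {A G V O : Type*} [CommSemiring O] [CommSemiring A]
    [Algebra O A] [Monoid G] [AddCommMonoid V] [Module O V] (σ : Representation O G V) (g : G) (a : A)
    (v : V) : baseChangeRep A σ g (a ⊗ₜ v) = a ⊗ₜ σ g v := rfl

/-- The values at `e`, `h`, `f` of the trace pairing with an element of `𝔰𝔩₂ ⊗ P` modulo `p`. -/
def tracePair : (F ⊗[WittVector p F] R₂Space p F P) →ₗ[F] (Fin 3 → F ⊗[WittVector p F] P) where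
  toFun w := ![coordF w 2, (2 : F) • coordF w 1, coordF w 0]
  map_add' v w := by ext i; fin_cases i <;> simp
  map_smul' c w := by ext i; fin_cases i <;> simp [smul_comm c]

theorem tracePair_apply (w : F ⊗[WittVector p F] R₂Space p F P) :
    tracePair w = ![coordF w 2, (2 : F) • coordF w 1, coordF w 0] := rfl

theorem coeff_zero_add (x y : WittVector p F) : (x + y).coeff 0 = x.coeff 0 + y.coeff 0 :=
  map_add (WittVector.constantCoeff (p := p) (R := F)) x y

theorem coeff_zero_sub (x y : WittVector p F) : (x - y).coeff 0 = x.coeff 0 - y.coeff 0 :=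
  map_sub (WittVector.constantCoeff (p := p) (R := F)) x y

theorem coeff_zero_mul (x y : WittVector p F) : (x * y).coeff 0 = x.coeff 0 * y.coeff 0 :=
  map_mul (WittVector.constantCoeff (p := p) (R := F)) x y

theorem adjointRep_coe (O : Type*) [CommRing O] (g : GL (Fin 2) O) (Z : sl₂ O) :
    (adjointRep O g Z).1 = (g : Matrix (Fin 2) (Fin 2) O) * (Z.1 * (g⁻¹ : GL (Fin 2) O)) := rfl

theorem R₂_tmul (g : K p k) (Z : sl₂ (WittVector p F)) (x : P) :
    R₂ ρ τ g (Z ⊗ₜ[WittVector p F] x)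
      = adjointRep _ (Matrix.GeneralLinearGroup.map (WittVector.map τ) g) Z
        ⊗ₜ[WittVector p F] R₁ ρ g x := rfl

theorem coordF_one_tmul (Z : sl₂ (WittVector p F)) (x : P) :
    coordF ((1 : F) ⊗ₜ[WittVector p F] (Z ⊗ₜ[WittVector p F] x))
      = ![(Z.1 0 1).coeff 0 • 1 ⊗ₜ x, (Z.1 0 0).coeff 0 • 1 ⊗ₜ x, (Z.1 1 0).coeff 0 • 1 ⊗ₜ x] := by
  ext i
  rw [coordF_tmul, coordO_tmul, one_tmul_smul]
  fin_cases i <;> rfl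

/-- The trace pairing is invariant, so that it identifies `𝔰𝔩₂ ⊗ V` with `Hom(𝔰𝔩₂, V)`
equivariantly. -/
theorem tracePair_equivariant [Finite F] (g : K p k) (w : F ⊗[WittVector p F] R₂Space p F P)
    (i : Fin 3) : tracePair (baseChangeRep F (R₂ ρ τ) g w) i
      = ∑ j, adMat τ (reduction p k g) i j • baseChangeRep F (R₁ ρ) g (tracePair w j) := by
  obtain ⟨y, rfl⟩ := exists_one_tmul w
  induction y using TensorProduct.induction_on with
  | zero => simp
  | add y y' hy hy' =>
    simp only [TensorProduct.tmul_add, map_add, Pi.add_apply, hy, hy', smul_add, Finset.sum_add_distrib]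
  | tmul Z x =>
    rw [baseChangeRep_tmul, R₂_tmul]
    set γ := reduction p k g with hγ
    have h0 := det_ne_zero' τ γ
    have hZ : (Z.1 1 1).coeff 0 = -(Z.1 0 0).coeff 0 := by
      have h : Z.1 0 0 + Z.1 1 1 = 0 := by
        rw [← Matrix.trace_fin_two]
        exact Z.2
      rw [eq_neg_iff_add_eq_zero, ← coeff_zero_add, add_comm, h, WittVector.zero_coeff]
    have hinv := inv_apply_fin_two (Matrix.GeneralLinearGroup.map τ γ)
    have hm : ∀ i j, (Matrix.GeneralLinearGroup.map τ γ) i j = τ (γ i j) := fun _ _ => rfl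
    simp only [hm] at hinv
    simp only [tracePair_apply, coordF_one_tmul, adjointRep_coe, Matrix.mul_apply, Fin.sum_univ_two,
      coeff_zero_add, coeff_zero_mul, coeff_zero_map, coeff_zero_map_inv, hinv, adMat_eq, ← hγ, hZ,
      Fin.sum_univ_three]
    fin_cases i <;>
    · simp [baseChangeRep_tmul]
      match_scalars
      field_simp
      ring

theorem tracePair_bijective (h2 : (2 : F) ≠ 0) :
    Function.Bijective (tracePair (p := p) (F := F) (P := P)) := by
  refine ⟨fun w w' h => coordF.injective ?_, fun c => ⟨coordF.symm ![c 2, (2⁻¹ : F) • c 1, c 0], ?_⟩⟩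
  · ext i
    fin_cases i
    · exact congrFun h 2
    · exact smul_right_injective _ h2 (congrFun h 1)
    · exact congrFun h 0
  · ext i
    rw [tracePair_apply, LinearEquiv.apply_symm_apply]
    fin_cases i <;> simp [smul_smul, h2]

theorem reduction_surjective [CharP k p] : Function.Surjective (reduction p k) := by
  intro γ
  choose X hX using fun i j => WittVector.constantCoeff_surjective (R := k) p (γ i j)
  have hdet : ((Matrix.of X).det).coeff 0 = Matrix.det (γ : Matrix (Fin 2) (Fin 2) k) := by
    rw [← WittVector.constantCoeff_apply, RingHom.map_det]
    congr 1
    ext i j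
    exact hX i j
  have hu : IsUnit (Matrix.of X).det := WittVector.isUnit_of_coeff_zero_ne_zero _ (by
    rw [hdet]
    exact (Matrix.GeneralLinearGroup.det γ).ne_zero)
  refine ⟨Matrix.nonsingInvUnit _ hu, ?_⟩
  ext i j
  exact hX i j

end Equivariance

section Gluing

variable {p : ℕ} [Fact p.Prime] {k F : Type*} [Field k] [Field F] [CharP k p] [CharP F p] [Finite F]
  {P : Type*} [AddCommGroup P] [Module (WittVector p F) P]
  {ρ : Representation (WittVector p F) (GL (Fin 2) k) P}

/-- The equivariant triple on `P / p` given by a gluing map `ι_τ`, through the trace pairing. -/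
def gluingTriple (ι : GluingMaps ρ) (τ : k →+* F) (i : Fin 3) :
    Module.End F (F ⊗[WittVector p F] P) :=
  LinearMap.proj i ∘ₗ tracePair ∘ₗ (ι τ).toLinearMap

theorem isAdTriple_gluingTriple (ι : GluingMaps ρ) (τ : k →+* F) :
    IsAdTriple τ (baseChangeRep F ρ) (gluingTriple ι τ) := by
  intro i γ v
  obtain ⟨g, rfl⟩ := reduction_surjective γ
  have h1 : ι τ (baseChangeRep F ρ (reduction p k g) v) = baseChangeRep F (R₂ ρ τ) g (ι τ v) :=
    DFunLike.congr_fun ((ι τ).isIntertwining' g) v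
  change tracePair (ι τ _) i = _
  rw [h1, tracePair_equivariant]
  rfl

theorem gluingTriple_injective (h2 : (2 : F) ≠ 0) {ι : GluingMaps ρ} {τ : k →+* F}
    (hι : Function.Injective (ι τ)) (v : F ⊗[WittVector p F] P) (h : ∀ i, gluingTriple ι τ i v = 0) :
    v = 0 := by
  apply hι
  rw [map_zero]
  apply (tracePair_bijective h2).1
  rw [map_zero]
  exact funext h

/-- An equivariant triple without common kernel gives an injective equivariant map from `P / p` to
`𝔰𝔩₂ ⊗ P / p`, through the trace pairing. -/
theorem IsAdTriple.exists_gluing (h2 : (2 : F) ≠ 0) {τ : k →+* F}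
    {A : Fin 3 → Module.End F (F ⊗[WittVector p F] P)} (hA : IsAdTriple τ (baseChangeRep F ρ) A)
    (hinj : ∀ v, (∀ i, A i v = 0) → v = 0) :
    ∃ ι : Representation.IntertwiningMap (baseChangeRep F (R₁ ρ)) (baseChangeRep F (R₂ ρ τ)),
      Function.Injective ι := by
  let T := LinearEquiv.ofBijective (tracePair (p := p) (F := F) (P := P)) (tracePair_bijective h2)
  have hT : ∀ w, T w = tracePair w := fun _ => rfl
  have hT' : ∀ c, tracePair (T.symm c) = c := fun c => T.apply_symm_apply c
  refine ⟨⟨T.symm.toLinearMap ∘ₗ LinearMap.pi A, fun g => LinearMap.ext fun v => T.injective ?_⟩,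
    fun v w h => ?_⟩
  · ext i
    simp only [LinearMap.comp_apply, hT, LinearEquiv.coe_coe, tracePair_equivariant, hT']
    exact hA i _ v
  · have h1 : LinearMap.pi A v = LinearMap.pi A w := T.symm.injective h
    rw [← sub_eq_zero]
    refine hinj _ fun i => ?_
    rw [map_sub, sub_eq_zero]
    exact congrFun h1 i

theorem exists_gluingMaps [Fintype k] [Nonempty (k →+* F)] {lam : (k →+* F) → ℤ × ℤ}
    (hlam : IsDeep p 2 lam) [Module.Finite (WittVector p F) P]
    {π : Representation.IntertwiningMap (baseChangeRep F ρ) (serreWeight lam)}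
    (hπ : IsProjectiveCover π) : ∃ ι : GluingMaps ρ, ∀ τ, Function.Injective (ι τ) := by
  classical
  have : Finite (k →+* F) := Finite.of_injective (fun f : k →+* F => (f : k → F))
    DFunLike.coe_injective
  have := Fintype.ofFinite (k →+* F)
  have h : ∀ τ : k →+* F, ∃ ι : Representation.IntertwiningMap (baseChangeRep F (R₁ ρ))
      (baseChangeRep F (R₂ ρ τ)), Function.Injective ι := fun τ => by
    obtain ⟨A, hA, hinj⟩ := exists_adTriple_projectiveCover p hlam hπ τ
    exact hA.exists_gluing (hlam.two_ne_zero p) hinj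
  choose ι hι using h
  exact ⟨ι, hι⟩

end Gluing

/-! ### The reduction of the glued lattice -/

section Lattice

variable {p : ℕ} [Fact p.Prime] {k F : Type*} [Field k] [Field F] [CharP k p] [CharP F p] [Finite F]
  {P : Type*} [AddCommGroup P] [Module (WittVector p F) P]
  {ρ : Representation (WittVector p F) (GL (Fin 2) k) P}

/-- The element `1 + p X` of `K_1`. -/
def oneAdd (X : Matrix (Fin 2) (Fin 2) (WittVector p k)) : K p k :=
  Matrix.nonsingInvUnit (1 + (p : WittVector p k) • X) (WittVector.isUnit_of_coeff_zero_ne_zero _ (by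
    rw [← WittVector.constantCoeff_apply, RingHom.map_det]
    have : WittVector.constantCoeff.mapMatrix (1 + (p : WittVector p k) • X) = 1 := by
      rw [map_add, map_one, add_eq_left]
      ext i j
      change ((p : WittVector p k) * X i j).coeff 0 = 0
      rw [mul_comm, WittVector.mul_charP_coeff_zero]
    rw [this, Matrix.det_one]
    exact one_ne_zero))

theorem oneAdd_coe (X : Matrix (Fin 2) (Fin 2) (WittVector p k)) :
    (oneAdd X : Matrix (Fin 2) (Fin 2) (WittVector p k)) = 1 + (p : WittVector p k) • X := rfl

theorem reduction_of_eq {g : K p k} {X : Matrix (Fin 2) (Fin 2) (WittVector p k)}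
    (hg : (g : Matrix (Fin 2) (Fin 2) (WittVector p k)) = 1 + (p : WittVector p k) • X) :
    reduction p k g = 1 := by
  ext i j
  change ((g : Matrix (Fin 2) (Fin 2) (WittVector p k)) i j).coeff 0 = _
  rw [hg, Matrix.add_apply, Matrix.smul_apply, coeff_zero_add, smul_eq_mul, mul_comm,
    WittVector.mul_charP_coeff_zero, add_zero]
  fin_cases i <;> fin_cases j <;> simp

theorem conj_eq_add_smul {R : Type*} [CommRing R] {G : GL (Fin 2) R} {c : R}
    {Y : Matrix (Fin 2) (Fin 2) R} (hG : (G : Matrix (Fin 2) (Fin 2) R) = 1 + c • Y)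
    (Z : Matrix (Fin 2) (Fin 2) R) :
    (G : Matrix (Fin 2) (Fin 2) R) * (Z * (G⁻¹ : GL (Fin 2) R))
      = Z + c • ((Y * Z - Z * Y) * ((G⁻¹ : GL (Fin 2) R) : Matrix (Fin 2) (Fin 2) R)) := by
  have h1 : Z = Z * G * ((G⁻¹ : GL (Fin 2) R) : Matrix (Fin 2) (Fin 2) R) := by
    rw [mul_assoc, G.mul_inv, mul_one]
  have h2 : (G : Matrix (Fin 2) (Fin 2) R) * Z = Z * G + c • (Y * Z - Z * Y) := by
    rw [hG, add_mul, mul_add, one_mul, mul_one, smul_mul_assoc, mul_smul_comm, smul_sub]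
    abel
  rw [← mul_assoc, h2, add_mul, ← h1, smul_mul_assoc]

/-- The coordinates of `[X, w]`, for `w ∈ 𝔰𝔩₂ ⊗ V` with trace pairings `A`, where `X` acts through
its reduction and `τ`. -/
def commCoord {V : Type*} [AddCommGroup V] [Module F V] (τ : k →+* F)
    (X : Matrix (Fin 2) (Fin 2) (WittVector p k)) (A : Fin 3 → V) : Fin 3 → V :=
  ![(τ ((X 0 0).coeff 0) - τ ((X 1 1).coeff 0)) • A 2 - τ ((X 0 1).coeff 0) • A 1,
    τ ((X 0 1).coeff 0) • A 0 - τ ((X 1 0).coeff 0) • A 2,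
    τ ((X 1 0).coeff 0) • A 1 - (τ ((X 0 0).coeff 0) - τ ((X 1 1).coeff 0)) • A 0]

/-- Conjugation by `1 + p X` on `𝔰𝔩₂ ⊗ P` is `1 + p [X, ·]` modulo `p²`. -/
theorem exists_R₂_apply_eq (τ : k →+* F) {g : K p k} {X : Matrix (Fin 2) (Fin 2) (WittVector p k)}
    (hg : (g : Matrix (Fin 2) (Fin 2) (WittVector p k)) = 1 + (p : WittVector p k) • X)
    (y : R₂Space p F P) :
    ∃ D : R₂Space p F P, R₂ ρ τ g y = y + (p : WittVector p F) • D ∧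
      coordF ((1 : F) ⊗ₜ[WittVector p F] D) = commCoord τ X (tracePair ((1 : F) ⊗ₜ y)) := by
  induction y using TensorProduct.induction_on with
  | zero =>
    refine ⟨0, by simp, ?_⟩
    ext i
    fin_cases i <;> simp [commCoord]
  | add y y' hy hy' =>
    obtain ⟨D, hD, hA⟩ := hy
    obtain ⟨D', hD', hA'⟩ := hy'
    refine ⟨D + D', by rw [map_add, hD, hD', smul_add, add_add_add_comm], ?_⟩
    rw [TensorProduct.tmul_add, map_add, hA, hA', TensorProduct.tmul_add, map_add]
    ext i
    fin_cases i <;>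
    · simp [commCoord]
      module
  | tmul Z x =>
    set G : GL (Fin 2) (WittVector p F) := Matrix.GeneralLinearGroup.map (WittVector.map τ) g with hG
    set Y : Matrix (Fin 2) (Fin 2) (WittVector p F) := X.map (WittVector.map τ) with hY
    have hGY : (G : Matrix (Fin 2) (Fin 2) (WittVector p F)) = 1 + (p : WittVector p F) • Y := by
      have h1 := congrArg (WittVector.map (p := p) τ).mapMatrix hg
      rw [map_add, map_one] at h1
      refine h1.trans (congrArg _ ?_)
      ext1 i j
      change WittVector.map τ ((p : WittVector p k) * X i j) = p * WittVector.map τ (X i j)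
      rw [map_mul, map_natCast]
    have hconj := conj_eq_add_smul hGY Z.1
    have htr : ((Y * Z.1 - Z.1 * Y) * (G⁻¹ : GL (Fin 2) (WittVector p F))).trace = 0 := by
      have h1 := congrArg Matrix.trace hconj
      have h2 : Z.1.trace = 0 := Z.2
      rw [← mul_assoc, Matrix.trace_units_conj, Matrix.trace_add, Matrix.trace_smul, h2, zero_add,
        smul_eq_mul] at h1
      exact (mul_eq_zero.1 h1.symm).resolve_left (WittVector.p_nonzero p F)
    refine ⟨(⟨_, htr⟩ : sl₂ (WittVector p F)) ⊗ₜ x, ?_, ?_⟩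
    · rw [R₂_tmul, TensorProduct.smul_tmul', ← TensorProduct.add_tmul]
      congr 1
      · exact Subtype.ext hconj
      · change ρ (reduction p k g) x = x
        rw [reduction_of_eq hg, map_one]
        rfl
    · have hZ : (Z.1 1 1).coeff 0 = -(Z.1 0 0).coeff 0 := by
        have h : Z.1 0 0 + Z.1 1 1 = 0 := by
          rw [← Matrix.trace_fin_two]
          exact Z.2
        rw [eq_neg_iff_add_eq_zero, ← coeff_zero_add, add_comm, h, WittVector.zero_coeff]
      have hinv' : ∀ i j, ((G⁻¹ : GL (Fin 2) (WittVector p F)) i j).coeff 0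
          = (1 : Matrix (Fin 2) (Fin 2) F) i j := by
        intro i j
        rw [hG, coeff_zero_map_inv, reduction_of_eq hg, map_one, inv_one]
        rfl
      have hYc : ∀ i j, (Y i j).coeff 0 = τ ((X i j).coeff 0) := fun _ _ => rfl
      rw [tracePair_apply, coordF_one_tmul, coordF_one_tmul, commCoord]
      simp only [Matrix.mul_apply, Matrix.sub_apply, Fin.sum_univ_two, coeff_zero_add, coeff_zero_sub,
        coeff_zero_mul, hinv', hYc, hZ]
      ext i
      fin_cases i <;>
      · simp
        match_scalars
        ring

variable (ι : GluingMaps ρ)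

/-- The projection `R / p → P / p`. -/
def projFst : (F ⊗[WittVector p F] lattice ι) →ₗ[F] F ⊗[WittVector p F] P :=
  LinearMap.baseChange F (LinearMap.fst _ _ _ ∘ₗ (lattice ι).subtype)

theorem projFst_one_tmul (l : lattice ι) :
    projFst ι ((1 : F) ⊗ₜ[WittVector p F] l) = 1 ⊗ₜ l.1.1 := rfl

/-- The inclusion of `p · ⊕_τ 𝔰𝔩₂ ⊗ P` into the glued lattice. -/
def inclLattice : ((k →+* F) → Fin 3 → P) →ₗ[WittVector p F] lattice ι where
  toFun y := ⟨(0, fun τ => (p : WittVector p F) • coordO.symm (y τ)), fun τ => by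
    rw [one_tmul_p_smul, TensorProduct.tmul_zero, map_zero]⟩
  map_add' y z := by
    ext τ <;> simp
  map_smul' c y := by
    ext τ <;> simp [smul_comm c]

/-- Reduction modulo `p` of a family of triples of copies of `P`, in coordinates. -/
def tensorFamily : (F ⊗[WittVector p F] ((k →+* F) → Fin 3 → P)) →ₗ[F]
    ((k →+* F) → Fin 3 → F ⊗[WittVector p F] P) :=
  LinearMap.pi fun τ => LinearMap.pi fun i =>
    LinearMap.baseChange F (LinearMap.proj i ∘ₗ LinearMap.proj τ)

theorem tensorFamily_bijective :
    Function.Bijective (tensorFamily (p := p) (k := k) (F := F) (P := P)) := by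
  refine ⟨fun v w h => ?_, fun w => ?_⟩
  · rw [← sub_eq_zero] at h ⊢
    rw [← map_sub] at h
    obtain ⟨y, hy⟩ := exists_one_tmul (v - w)
    rw [hy] at h ⊢
    have h1 : ∀ τ i, ∃ z, y τ i = (p : WittVector p F) • z := fun τ i =>
      (one_tmul_eq_zero_iff _).1 (congrFun (congrFun h τ) i)
    choose z hz using h1
    exact (one_tmul_eq_zero_iff _).2 ⟨z, funext fun τ => funext fun i => hz τ i⟩
  · choose y hy using fun τ i => exists_one_tmul (w τ i)
    exact ⟨1 ⊗ₜ y, funext fun τ => funext fun i => (hy τ i).symm⟩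

/-- The image of `p · ⊕_τ 𝔰𝔩₂ ⊗ P` in `R / p`, in coordinates. -/
def inclMod : ((k →+* F) → Fin 3 → F ⊗[WittVector p F] P) →ₗ[F] F ⊗[WittVector p F] lattice ι :=
  LinearMap.baseChange F (inclLattice ι) ∘ₗ
    (LinearEquiv.ofBijective (tensorFamily (p := p) (k := k) (F := F) (P := P))
      tensorFamily_bijective).symm.toLinearMap

theorem inclMod_one_tmul (y : (k →+* F) → Fin 3 → P) :
    inclMod ι (fun τ i => (1 : F) ⊗ₜ[WittVector p F] y τ i) = 1 ⊗ₜ inclLattice ι y := by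
  have h : (LinearEquiv.ofBijective (tensorFamily (p := p) (k := k) (F := F) (P := P))
      tensorFamily_bijective).symm (fun τ i => (1 : F) ⊗ₜ[WittVector p F] y τ i) = 1 ⊗ₜ y := by
    rw [LinearEquiv.symm_apply_eq]
    rfl
  change LinearMap.baseChange F (inclLattice ι) ((LinearEquiv.ofBijective _ _).symm _) = _
  rw [h, LinearMap.baseChange_tmul]

theorem exists_inclMod (w : (k →+* F) → Fin 3 → F ⊗[WittVector p F] P) :
    ∃ y : (k →+* F) → Fin 3 → P, w = (fun τ i => (1 : F) ⊗ₜ[WittVector p F] y τ i) := by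
  choose y hy using fun τ i => exists_one_tmul (w τ i)
  exact ⟨y, funext fun τ => funext fun i => hy τ i⟩

theorem projFst_surjective : Function.Surjective (projFst ι) := by
  intro v
  obtain ⟨x, rfl⟩ := exists_one_tmul v
  choose y hy using fun τ => exists_one_tmul (ι τ (1 ⊗ₜ x))
  exact ⟨1 ⊗ₜ ⟨(x, y), fun τ => (hy τ).symm⟩, rfl⟩

theorem projFst_inclMod (w : (k →+* F) → Fin 3 → F ⊗[WittVector p F] P) :
    projFst ι (inclMod ι w) = 0 := by
  obtain ⟨y, rfl⟩ := exists_inclMod w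
  rw [inclMod_one_tmul, projFst_one_tmul]
  exact TensorProduct.tmul_zero _ _

/-- The kernel of `R / p → P / p` is the image of `p · ⊕_τ 𝔰𝔩₂ ⊗ P`. -/
theorem exists_inclMod_eq {n : F ⊗[WittVector p F] lattice ι} (hn : projFst ι n = 0) :
    ∃ w, inclMod ι w = n := by
  obtain ⟨⟨⟨x, y⟩, hl⟩, rfl⟩ := exists_one_tmul n
  obtain ⟨x', rfl⟩ := (one_tmul_eq_zero_iff x).1 hn
  have hy : ∀ τ, ∃ z, y τ = (p : WittVector p F) • z := fun τ => by
    rw [← one_tmul_eq_zero_iff (F := F)]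
    refine (hl τ).trans ?_
    change ι τ (1 ⊗ₜ ((p : WittVector p F) • x')) = 0
    rw [one_tmul_p_smul, map_zero]
  choose z hz using hy
  choose y' hy' using fun τ => exists_one_tmul (ι τ (1 ⊗ₜ x'))
  -- subtract `p` times the element `(x', y')` of the lattice
  let l' : lattice ι := ⟨(x', y'), fun τ => (hy' τ).symm⟩
  refine ⟨fun τ i => 1 ⊗ₜ coordO (z τ - y' τ) i, ?_⟩
  rw [inclMod_one_tmul, ← add_zero (_ ⊗ₜ _), ← one_tmul_p_smul l', ← TensorProduct.tmul_add]
  congr 1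
  refine Subtype.ext (Prod.ext ?_ (funext fun τ => ?_))
  · exact zero_add _
  · change (p : WittVector p F) • coordO.symm (coordO (z τ - y' τ)) + (p : WittVector p F) • y' τ = y τ
    rw [LinearEquiv.symm_apply_apply, ← smul_add, sub_add_cancel, hz]

theorem inclMod_injective (hP : ∀ x : P, (p : WittVector p F) • x = 0 → x = 0) :
    Function.Injective (inclMod ι) := by
  refine (injective_iff_map_eq_zero _).2 fun w hw => ?_
  obtain ⟨y, rfl⟩ := exists_inclMod w
  rw [inclMod_one_tmul, one_tmul_eq_zero_iff] at hw
  obtain ⟨⟨⟨x, z⟩, hl⟩, h⟩ := hw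
  have hx : x = 0 := hP x (congrArg (fun l : lattice ι => l.1.1) h).symm
  have hz : ∀ τ i, y τ i = coordO (z τ) i := fun τ i => by
    have h1 : (p : WittVector p F) • coordO.symm (y τ) = (p : WittVector p F) • z τ :=
      congrFun (congrArg (fun l : lattice ι => l.1.2) h) τ
    have h2 := congrFun (congrArg coordO h1) i
    rw [map_smul, map_smul, LinearEquiv.apply_symm_apply] at h2
    rw [← sub_eq_zero]
    refine hP _ ?_
    rw [smul_sub, sub_eq_zero]
    exact h2
  funext τ i
  have h1 : (1 : F) ⊗ₜ[WittVector p F] z τ = 0 := by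
    refine (hl τ).trans ?_
    change ι τ (1 ⊗ₜ x) = 0
    rw [hx, TensorProduct.tmul_zero, map_zero]
  rw [hz, ← coordF_tmul, h1, map_zero]
  rfl

theorem projFst_latticeModP (g : K p k) (n : F ⊗[WittVector p F] lattice ι) :
    projFst ι (latticeModP ι g n) = baseChangeRep F ρ (reduction p k g) (projFst ι n) := by
  obtain ⟨l, rfl⟩ := exists_one_tmul n
  rfl

theorem latticeModP_one_tmul (g : K p k) (l : lattice ι) :
    latticeModP ι g ((1 : F) ⊗ₜ[WittVector p F] l) = 1 ⊗ₜ latticeRep ι g l := rfl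

/-- On the glued lattice `R` an element `1 + p X` of `K_1` acts trivially on the first coordinate,
and by `1 + p [X, ·]` modulo `p²` on the others. As `p²` times the sum of the `𝔰𝔩₂ ⊗ P` is contained
in `p R`, only the reductions of the coordinates matter modulo `p R`, and these are given by the
gluing maps. -/
theorem exists_latticeRep_eq {g : K p k} {X : Matrix (Fin 2) (Fin 2) (WittVector p k)}
    (hg : (g : Matrix (Fin 2) (Fin 2) (WittVector p k)) = 1 + (p : WittVector p k) • X)
    (l : lattice ι) : ∃ y, latticeRep ι g l = l + inclLattice ι y ∧
      ∀ τ, (fun i => (1 : F) ⊗ₜ[WittVector p F] y τ i)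
        = commCoord τ X (fun i => gluingTriple ι τ i ((1 : F) ⊗ₜ l.1.1)) := by
  choose D hD hA using fun τ => exists_R₂_apply_eq (ρ := ρ) τ hg (l.1.2 τ)
  refine ⟨fun τ => coordO (D τ), ?_, fun τ => ?_⟩
  · refine Subtype.ext (Prod.ext ?_ (funext fun τ => ?_))
    · change ρ (reduction p k g) l.1.1 = l.1.1 + 0
      rw [reduction_of_eq hg, map_one, add_zero]
      rfl
    · refine (hD τ).trans (congrArg (l.1.2 τ + ·) ?_)
      change _ = (p : WittVector p F) • coordO.symm (coordO (D τ))
      rw [LinearEquiv.symm_apply_apply]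
  · have h1 : (fun i => (1 : F) ⊗ₜ[WittVector p F] coordO (D τ) i)
        = coordF ((1 : F) ⊗ₜ[WittVector p F] D τ) := funext fun i => (coordF_tmul _ _ _).symm
    rw [h1, hA, l.2 τ]
    rfl

/-- The action of `1 + p X` on `R / p`, through the commutators with `X` of the gluing maps. -/
theorem latticeModP_apply_eq {g : K p k} {X : Matrix (Fin 2) (Fin 2) (WittVector p k)}
    (hg : (g : Matrix (Fin 2) (Fin 2) (WittVector p k)) = 1 + (p : WittVector p k) • X)
    (n : F ⊗[WittVector p F] lattice ι) :
    latticeModP ι g n = n + inclMod ι fun τ =>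
      commCoord τ X fun i => gluingTriple ι τ i (projFst ι n) := by
  obtain ⟨l, rfl⟩ := exists_one_tmul n
  obtain ⟨y, h1, h2⟩ := exists_latticeRep_eq ι hg l
  rw [latticeModP_one_tmul, h1, TensorProduct.tmul_add, ← inclMod_one_tmul, projFst_one_tmul]
  exact congrArg _ (congrArg _ (funext h2))

theorem latticeModP_inclMod {g : K p k} {X : Matrix (Fin 2) (Fin 2) (WittVector p k)}
    (hg : (g : Matrix (Fin 2) (Fin 2) (WittVector p k)) = 1 + (p : WittVector p k) • X)
    (w : (k →+* F) → Fin 3 → F ⊗[WittVector p F] P) :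
    latticeModP ι g (inclMod ι w) = inclMod ι w := by
  have h0 : (fun τ : k →+* F => commCoord τ X fun i => gluingTriple ι τ i 0) = 0 := by
    funext τ i
    fin_cases i <;> simp [commCoord]
  rw [latticeModP_apply_eq ι hg, projFst_inclMod, h0, map_zero, add_zero]

end Lattice

/-! ### The cosocle of the reduction of the glued lattice -/

section Cosocle

/-- Distinct embeddings `k → F` are separated by linear combinations of elements of `k`. -/
theorem mem_of_sum_embeddings (p : ℕ) [Fact p.Prime] {k F : Type*} [Field k] [Field F]
    [Fintype (k →+* F)] [DecidableEq (k →+* F)] [CharP k p] [CharP F p] [Fintype k] [Finite F]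
    [Nonempty (k →+* F)] {V : Type*} [AddCommGroup V] [Module F V] {N : Submodule F V}
    {s : (k →+* F) → V} (h : ∀ x : k, ∑ τ, τ x • s τ ∈ N) (τ : k →+* F) : s τ ∈ N := by
  have h1 : ∀ (τ : k →+* F) (x : k), digitFun (Pi.single τ 1) x = τ x := fun τ x => by
    rw [digitFun, Finset.prod_eq_single τ]
    · simp
    · intro σ _ hσ
      simp [hσ]
    · simp
  have hlt : ∀ (τ σ : k →+* F), (Pi.single τ 1 : (k →+* F) → ℕ) σ < p := fun τ σ => by
    by_cases hσ : σ = τ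
    · subst hσ
      simpa using (Fact.out : p.Prime).one_lt
    · simpa [hσ] using (Fact.out : p.Prime).pos
  obtain ⟨c, -, hc⟩ := exists_extraction (k := k) (F := F) p (Pi.single τ 1) (hlt τ)
  have h2 : ∑ x, c x • ∑ σ : k →+* F, σ x • s σ = s τ := by
    simp only [Finset.smul_sum, smul_smul]
    rw [Finset.sum_comm]
    simp only [← Finset.sum_smul]
    rw [Finset.sum_eq_single τ]
    · have := hc (Pi.single τ 1) (hlt τ)
      rw [if_pos rfl] at this
      simp only [h1] at this
      rw [this, one_smul]
    · intro σ _ hσ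
      have := hc (Pi.single σ 1) (hlt σ)
      rw [if_neg] at this
      · simp only [h1] at this
        rw [this, zero_smul]
      · intro he
        have := congrFun he σ
        simp [hσ] at this
    · simp
  rw [← h2]
  exact N.sum_mem fun x _ => N.smul_mem _ (h x)

variable {p : ℕ} [Fact p.Prime] {k F : Type*} [Field k] [Field F] [Fintype (k →+* F)]
  [DecidableEq (k →+* F)] [CharP k p] [CharP F p] [Fintype k] [Finite F] [Nonempty (k →+* F)]
  {P : Type*} [AddCommGroup P] [Module (WittVector p F) P]
  [Module.Finite (WittVector p F) P]
  {ρ : Representation (WittVector p F) (GL (Fin 2) k) P}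
  {lam : (k →+* F) → ℤ × ℤ} {π : Representation.IntertwiningMap (baseChangeRep F ρ) (serreWeight lam)}
  {ι : GluingMaps ρ}

/-- Let `X` depend on `x ∈ k` in such a way that the commutator with `X` is `τ(x)` times a fixed
operator `C` for every `τ`. By `latticeModP_apply_eq`, a stable subspace which surjects onto `P / p`
contains the sum over `τ` of the `τ(x) • C A_τ`, where `A_τ` is the triple of the gluing map, and by
`mem_of_sum_embeddings` it contains every single `C A_τ`. -/
theorem inclMod_mem_of_stable {N : Submodule F (F ⊗[WittVector p F] lattice ι)}
    (hN : ∀ g, N ≤ N.comap (latticeModP ι g)) (hsurj : ∀ v, ∃ n ∈ N, projFst ι n = v)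
    {C : (Fin 3 → F ⊗[WittVector p F] P) →ₗ[F] Fin 3 → F ⊗[WittVector p F] P}
    {X : k → Matrix (Fin 2) (Fin 2) (WittVector p k)}
    (hX : ∀ (τ : k →+* F) x A, commCoord τ (X x) A = τ x • C A) (τ : k →+* F)
    (v : F ⊗[WittVector p F] P) :
    inclMod ι (Pi.single τ (C fun i => gluingTriple ι τ i v)) ∈ N := by
  obtain ⟨n, hn, rfl⟩ := hsurj v
  refine mem_of_sum_embeddings p (s := fun τ => inclMod ι (Pi.single τ
    (C fun i => gluingTriple ι τ i (projFst ι n)))) (fun x => ?_) τ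
  have h1 := hN (oneAdd (X x)) hn
  rw [Submodule.mem_comap, latticeModP_apply_eq ι (oneAdd_coe (X x)), N.add_mem_iff_right hn] at h1
  convert h1 using 1
  simp only [hX, ← map_smul, ← map_sum]
  congr 1
  funext σ
  rw [Finset.sum_apply, Finset.sum_eq_single σ]
  · rw [Pi.smul_apply, Pi.single_eq_same, map_smul]
  · intro τ _ hτ
    rw [Pi.smul_apply, Pi.single_eq_of_ne hτ.symm, smul_zero]
  · simp

/-- A stable subspace of `R / p` which surjects onto `P / p` is everything. In the quotient by the
subspace, the coordinates `b_Y` of the inclusion of the kernel of the projection to `P / p` satisfy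
`b_Y A_Z = b_Z A_Y`, where `A` is the triple of the gluing map, so that they vanish. -/
theorem eq_top_of_projFst (hlam : IsDeep p 2 lam) (hπ : IsProjectiveCover π)
    (hι : ∀ τ, Function.Injective (ι τ)) {N : Submodule F (F ⊗[WittVector p F] lattice ι)}
    (hN : ∀ g, N ≤ N.comap (latticeModP ι g)) (hsurj : ∀ v, ∃ n ∈ N, projFst ι n = v) : N = ⊤ := by
  choose t ht using WittVector.constantCoeff_surjective (R := k) p
  have ht' : ∀ x, (t x).coeff 0 = x := ht
  let b : (k →+* F) → Fin 3 → (F ⊗[WittVector p F] P) →ₗ[F] (F ⊗[WittVector p F] lattice ι) ⧸ N :=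
    fun τ i => N.mkQ ∘ₗ inclMod ι ∘ₗ LinearMap.single F _ τ ∘ₗ LinearMap.single F (fun _ => _) i
  have hb : ∀ τ i v, b τ i v = N.mkQ (inclMod ι (Pi.single τ (Pi.single i v))) := fun _ _ _ => rfl
  have key : ∀ τ i j v, b τ i (gluingTriple ι τ j v) = b τ j (gluingTriple ι τ i v) := by
    have hsum : ∀ τ c, N.mkQ (inclMod ι (Pi.single τ c)) = b τ 0 (c 0) + b τ 1 (c 1) + b τ 2 (c 2) := by
      intro τ c
      have hc : c = Pi.single 0 (c 0) + Pi.single 1 (c 1) + Pi.single 2 (c 2) := by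
        ext i
        fin_cases i <;> simp
      conv_lhs => rw [hc]
      simp only [Pi.single_add, map_add, hb]
    have h0 : ∀ τ (C : (Fin 3 → F ⊗[WittVector p F] P) →ₗ[F] Fin 3 → F ⊗[WittVector p F] P)
        (X : k → Matrix (Fin 2) (Fin 2) (WittVector p k))
        (_ : ∀ (τ : k →+* F) x A, commCoord τ (X x) A = τ x • C A) v,
        b τ 0 (C (fun i => gluingTriple ι τ i v) 0) + b τ 1 (C (fun i => gluingTriple ι τ i v) 1)
          + b τ 2 (C (fun i => gluingTriple ι τ i v) 2) = 0 := fun τ C X hX v => by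
      rw [← hsum]
      exact (Submodule.Quotient.mk_eq_zero N).2 (inclMod_mem_of_stable hN hsurj hX τ v)
    intro τ
    -- the commutators with `e`, `diag(1, 0)` and `f`, multiplied by lifts of elements of `k`
    have he := h0 τ (LinearMap.pi ![-LinearMap.proj 1, LinearMap.proj 0, 0])
      (fun x => !![0, t x; 0, 0]) fun τ x A => by
        funext i
        fin_cases i <;> simp [commCoord, ht']
    have hh := h0 τ (LinearMap.pi ![LinearMap.proj 2, 0, -LinearMap.proj 0])
      (fun x => !![t x, 0; 0, 0]) fun τ x A => by
        funext i
        fin_cases i <;> simp [commCoord, ht']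
    have hf := h0 τ (LinearMap.pi ![0, -LinearMap.proj 2, LinearMap.proj 1])
      (fun x => !![0, 0; t x, 0]) fun τ x A => by
        funext i
        fin_cases i <;> simp [commCoord, ht']
    have he' : ∀ v, b τ 1 (gluingTriple ι τ 0 v) = b τ 0 (gluingTriple ι τ 1 v) := fun v => by
      have := he v
      simp at this
      rwa [neg_add_eq_zero, eq_comm] at this
    have hh' : ∀ v, b τ 0 (gluingTriple ι τ 2 v) = b τ 2 (gluingTriple ι τ 0 v) := fun v => by
      have := hh v
      simp at this
      rwa [add_neg_eq_zero] at this
    have hf' : ∀ v, b τ 2 (gluingTriple ι τ 1 v) = b τ 1 (gluingTriple ι τ 2 v) := fun v => by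
      have := hf v
      simp at this
      rwa [neg_add_eq_zero, eq_comm] at this
    intro i j v
    fin_cases i <;> fin_cases j
    · rfl
    · exact (he' v).symm
    · exact hh' v
    · exact he' v
    · rfl
    · exact (hf' v).symm
    · exact (hh' v).symm
    · exact hf' v
    · rfl
  have hb0 : ∀ τ i v, b τ i v = 0 := fun τ i v =>
    eq_zero_of_symmetric p hlam hπ (isAdTriple_gluingTriple ι τ)
      (gluingTriple_injective (hlam.two_ne_zero p) (hι τ)) (key τ) i v
  have hincl : ∀ w, inclMod ι w ∈ N := fun w => by
    rw [← Submodule.Quotient.mk_eq_zero, ← Submodule.mkQ_apply]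
    have hw : w = ∑ τ, ∑ i, Pi.single τ (Pi.single i (w τ i)) := by
      funext σ j
      rw [Finset.sum_apply, Finset.sum_apply, Finset.sum_eq_single σ]
      · rw [Finset.sum_apply, Finset.sum_apply, Finset.sum_eq_single j]
        · simp
        · intro i _ hi
          simp [hi.symm]
        · simp
      · intro τ _ hτ
        simp [hτ.symm]
      · simp
    rw [hw]
    simp only [map_sum, ← hb, hb0, Finset.sum_const_zero]
  refine eq_top_iff.2 fun m _ => ?_
  obtain ⟨n, hn, hnm⟩ := hsurj (projFst ι m)
  obtain ⟨w, hw⟩ := exists_inclMod_eq ι (n := m - n) (by rw [map_sub, hnm, sub_self])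
  have h1 := N.add_mem (hincl w) hn
  rwa [hw, sub_add_cancel] at h1

/-- A stable subspace of `R / p` which surjects onto the Serre weight is everything. -/
theorem eq_top_of_serreWeight (hlam : IsDeep p 2 lam) (hπ : IsProjectiveCover π)
    (hι : ∀ τ, Function.Injective (ι τ)) {N : Submodule F (F ⊗[WittVector p F] lattice ι)}
    (hN : ∀ g, N ≤ N.comap (latticeModP ι g)) (hsurj : ∀ w, ∃ n ∈ N, π (projFst ι n) = w) :
    N = ⊤ := by
  refine eq_top_of_projFst hlam hπ hι hN ?_
  have h1 : N.map (projFst ι) = ⊤ := by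
    refine hπ.eq_top (K := N.map (projFst ι)) ?_ fun w => ?_
    · rintro γ _ ⟨n, hn, rfl⟩
      obtain ⟨g, rfl⟩ := reduction_surjective γ
      exact ⟨_, hN g hn, projFst_latticeModP ι g n⟩
    · obtain ⟨n, hn, hw⟩ := hsurj w
      exact ⟨_, ⟨n, hn, rfl⟩, hw⟩
  intro v
  have h2 : v ∈ N.map (projFst ι) := by rw [h1]; trivial
  exact h2

/-- The projection of `R / p` onto the Serre weight. -/
def toSerreWeight (π : Representation.IntertwiningMap (baseChangeRep F ρ) (serreWeight lam))
    (ι : GluingMaps ρ) : Representation.IntertwiningMap (latticeModP ι) (serreWeightK p lam) where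
  toLinearMap := π.toLinearMap ∘ₗ projFst ι
  isIntertwining' g := LinearMap.ext fun n => by
    change π (projFst ι (latticeModP ι g n)) = serreWeight lam (reduction p k g) (π (projFst ι n))
    rw [projFst_latticeModP]
    exact intertwining_apply _ _

theorem toSerreWeight_surjective (hπ : IsProjectiveCover π) :
    Function.Surjective (toSerreWeight π ι) :=
  hπ.surjective.comp (projFst_surjective ι)

end Cosocle

section Radical

variable {F G V W : Type*} [Field F] [Group G] [AddCommGroup V] [Module F V] [AddCommGroup W]
  [Module F W] {ρ : Representation F G V} {σ : Representation F G W}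

theorem exists_stable_of_asModule (N : Submodule (MonoidAlgebra F G) ρ.asModule) :
    ∃ N' : Submodule F V, (∀ g, N' ≤ N'.comap (ρ g)) ∧ ∀ v : V, v ∈ N' ↔ ρ.asModuleEquiv.symm v ∈ N := by
  refine ⟨⟨⟨⟨{v : V | ρ.asModuleEquiv.symm v ∈ N}, fun h h' => N.add_mem h h'⟩, N.zero_mem⟩,
    fun c v hv => ?_⟩, fun g v hv => ?_, fun v => Iff.rfl⟩
  · change ρ.asModuleEquiv.symm (c • v) ∈ N
    rw [Representation.asModuleEquiv_symm_map_smul]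
    exact N.smul_mem _ hv
  · change ρ.asModuleEquiv.symm (ρ g v) ∈ N
    rw [Representation.asModuleEquiv_symm_map_rho]
    exact N.smul_mem _ hv

/-- If `σ` is irreducible and only the whole of `ρ` surjects onto `σ`, then the cosocle of `ρ`
is `σ`. -/
theorem nonempty_cosocle_equiv {q : Representation.IntertwiningMap ρ σ} (hq : Function.Surjective q)
    (hirr : ∀ U : Submodule F W, (∀ g, U ≤ U.comap (σ g)) → U = ⊥ ∨ U = ⊤)
    (htop : ∀ N : Submodule F V, (∀ g, N ≤ N.comap (ρ g)) → (∀ w, ∃ n ∈ N, q n = w) → N = ⊤) :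
    Nonempty (Cosocle ρ ≃ₗ[MonoidAlgebra F G] σ.asModule) := by
  set Q := Representation.IntertwiningMap.equivLinearMapAsModule ρ σ q with hQ
  have hQs : Function.Surjective Q := hq
  have hmap : ∀ N : Submodule (MonoidAlgebra F G) ρ.asModule, N ⊔ LinearMap.ker Q = ⊤ → N = ⊤ := by
    intro N hN
    obtain ⟨N', hN', hmem⟩ := exists_stable_of_asModule N
    have h1 : N' = ⊤ := htop N' hN' fun w => by
      obtain ⟨v, rfl⟩ := hq w
      have hv : ρ.asModuleEquiv.symm v ∈ N ⊔ LinearMap.ker Q := by rw [hN]; trivial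
      obtain ⟨n, hn, m, hm, h⟩ := Submodule.mem_sup.1 hv
      refine ⟨ρ.asModuleEquiv n, (hmem _).2 hn, ?_⟩
      have h2 : Q (n + m) = Q n := by rw [map_add, LinearMap.mem_ker.1 hm, add_zero]
      rw [h] at h2
      exact h2.symm
    refine eq_top_iff.2 fun v _ => ?_
    exact (hmem (ρ.asModuleEquiv v)).1 (by rw [h1]; trivial)
  have hrad : radical ρ = LinearMap.ker Q := by
    refine le_antisymm ?_ (le_sInf fun N hN => ?_)
    · by_cases hker : LinearMap.ker Q = ⊤
      · exact hker ▸ le_top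
      refine sInf_le ⟨hker, fun N hN => ?_⟩
      obtain ⟨U, hU, hmem⟩ := exists_stable_of_asModule (N.map Q)
      rcases hirr U hU with h | h
      · refine absurd hN (not_lt_of_ge fun v hv => ?_)
        have h1 : σ.asModuleEquiv (Q v) ∈ U := (hmem _).2 ⟨v, hv, rfl⟩
        rw [h, Submodule.mem_bot] at h1
        exact h1
      · refine hmap N (eq_top_iff.2 fun v _ => ?_)
        have h1 : σ.asModuleEquiv (Q v) ∈ U := by rw [h]; trivial
        obtain ⟨n, hn, hnv⟩ := (hmem _).1 h1
        have h2 : Q n = Q v := hnv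
        exact Submodule.mem_sup.2 ⟨n, hn, v - n, by rw [LinearMap.mem_ker, map_sub, h2, sub_self],
          add_sub_cancel _ _⟩
    · by_contra hle
      refine hN.1 (hmap N (hN.2 _ (lt_of_le_of_ne le_sup_left fun h => hle ?_)))
      rw [h]
      exact le_sup_right
  exact ⟨(Submodule.quotEquivOfEq _ _ hrad).trans (Q.quotKerEquivOfSurjective hQs)⟩

end Radical

section Cosocle

variable {p : ℕ} [Fact p.Prime] {k F : Type*} [Field k] [Field F] [Fintype (k →+* F)]
  [DecidableEq (k →+* F)] [CharP k p] [CharP F p] [Fintype k] [Finite F] [Nonempty (k →+* F)]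
  {P : Type*} [AddCommGroup P] [Module (WittVector p F) P]
  [Module.Finite (WittVector p F) P]
  {ρ : Representation (WittVector p F) (GL (Fin 2) k) P}
  {lam : (k →+* F) → ℤ × ℤ} {π : Representation.IntertwiningMap (baseChangeRep F ρ) (serreWeight lam)}
  {ι : GluingMaps ρ}

theorem nonempty_cosocle_latticeModP_equiv (hlam : IsDeep p 2 lam) (hπ : IsProjectiveCover π)
    (hι : ∀ τ, Function.Injective (ι τ)) :
    Nonempty (Cosocle (latticeModP ι) ≃ₗ[MonoidAlgebra F (K p k)] (serreWeightK p lam).asModule) := by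
  have hr : ∀ τ, lowWeight lam τ < p := fun τ => by have := hlam.lowWeight p τ; omega
  refine nonempty_cosocle_equiv (W := SerreWeightSpace lam) (q := toSerreWeight π ι)
    (toSerreWeight_surjective hπ) (fun U hU => ?_) fun N hN h => eq_top_of_serreWeight hlam hπ hι hN h
  refine irrOn_serreWeight p hr U (fun γ w hw => ?_) le_top
  obtain ⟨g, rfl⟩ := reduction_surjective γ
  exact hU g hw

end Cosocle

/-! ### The first two steps of the filtration of a smooth representation by a normal subgroup -/

section Fixed

variable {F G J : Type*} [Field F] [Group G] [AddCommGroup J] [Module F J]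

/-- The vectors fixed by `H`. -/
def fixedBy (ρ : Representation F G J) (H : Subgroup G) : Submodule F J where
  carrier := {v | ∀ g ∈ H, ρ g v = v}
  add_mem' hv hw g hg := by rw [map_add, hv g hg, hw g hg]
  zero_mem' g _ := map_zero _
  smul_mem' c v hv g hg := by rw [map_smul, hv g hg]

/-- The vectors fixed by `H` modulo the vectors fixed by `H`: the vectors killed by the square of
the augmentation ideal of `H`. -/
def fixedSq (ρ : Representation F G J) (H : Subgroup G) : Submodule F J where
  carrier := {v | ∀ g ∈ H, ρ g v - v ∈ fixedBy ρ H}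
  add_mem' {v w} hv hw g hg := by
    rw [map_add, add_sub_add_comm]
    exact add_mem (hv g hg) (hw g hg)
  zero_mem' g _ := by
    rw [map_zero, sub_zero]
    exact zero_mem _
  smul_mem' c v hv g hg := by
    rw [map_smul, ← smul_sub]
    exact Submodule.smul_mem _ c (hv g hg)

variable {ρ : Representation F G J} {H : Subgroup G}

theorem fixedBy_stable [H.Normal] (g : G) : fixedBy ρ H ≤ (fixedBy ρ H).comap (ρ g) := by
  intro v hv h hh
  have h1 : g⁻¹ * h * g ∈ H := by
    simpa using (inferInstance : H.Normal).conj_mem h hh g⁻¹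
  have h2 : h * g = g * (g⁻¹ * h * g) := by group
  rw [← Module.End.mul_apply, ← map_mul, h2, map_mul, Module.End.mul_apply, hv _ h1]

variable {U : ℕ → Subgroup G} {Z : Subgroup G} {κ : Type*} {s : κ → G}

/-- A vector fixed by elements `s j` which generate `H` topologically modulo `Z` is fixed by `H`. -/
theorem mem_fixedBy_of_generators (hρ : IsSmooth U ρ) (hZ : IsTrivialOn Z ρ)
    (hgen : ∀ Q : Subgroup G, (∀ j, s j ∈ Q) → Z ⊓ H ≤ Q → (∃ n, U n ⊓ H ≤ Q) → H ≤ Q) {v : J}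
    (hv : ∀ j, ρ (s j) v = v) : v ∈ fixedBy ρ H := by
  obtain ⟨n, hn⟩ := hρ v
  let Q : Subgroup G :=
    { carrier := {g | ρ g v = v}
      mul_mem' := fun {a b} ha hb => by
        have ha' : ρ a v = v := ha
        have hb' : ρ b v = v := hb
        change ρ (a * b) v = v
        rw [map_mul, Module.End.mul_apply, hb', ha']
      one_mem' := by
        change ρ 1 v = v
        rw [map_one]
        rfl
      inv_mem' := fun {a} ha => by
        have ha' : ρ a v = v := ha
        change ρ a⁻¹ v = v
        conv_lhs => rw [← ha']
        rw [← Module.End.mul_apply, ← map_mul, inv_mul_cancel, map_one]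
        rfl }
  exact fun g hg => hgen Q hv (fun g hg => hZ g hg.1 v) ⟨n, fun g hg => hn g hg.1⟩ hg

/-- It is enough to test membership in `fixedSq` on topological generators, because `g ↦ g v - v` is
a homomorphism as long as its values are fixed vectors. -/
theorem mem_fixedSq_of_generators (hρ : IsSmooth U ρ) (hZ : IsTrivialOn Z ρ) (hs : ∀ j, s j ∈ H)
    (hgen : ∀ Q : Subgroup G, (∀ j, s j ∈ Q) → Z ⊓ H ≤ Q → (∃ n, U n ⊓ H ≤ Q) → H ≤ Q) {v : J}
    (hv : ∀ j, ρ (s j) v - v ∈ fixedBy ρ H) : v ∈ fixedSq ρ H := by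
  obtain ⟨n, hn⟩ := hρ v
  let Q : Subgroup G :=
    { carrier := {g | g ∈ H ∧ ρ g v - v ∈ fixedBy ρ H}
      mul_mem' := fun {a b} ha hb => by
        refine ⟨H.mul_mem ha.1 hb.1, ?_⟩
        have h1 : ρ (a * b) v - v = (ρ b v - v) + (ρ a v - v) := by
          rw [← hb.2 a ha.1, map_mul, Module.End.mul_apply, map_sub]
          abel
        rw [h1]
        exact add_mem hb.2 ha.2
      one_mem' := ⟨H.one_mem, by
        rw [map_one, Module.End.one_apply, sub_self]
        exact zero_mem _⟩
      inv_mem' := fun {a} ha => by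
        refine ⟨H.inv_mem ha.1, ?_⟩
        have h1 : ρ a⁻¹ v - v = -(ρ a v - v) := by
          rw [← ha.2 a⁻¹ (H.inv_mem ha.1), map_sub, ← Module.End.mul_apply, ← map_mul,
            inv_mul_cancel, map_one, Module.End.one_apply, neg_sub]
        rw [h1]
        exact neg_mem ha.2 }
  have h0 : ∀ g, ρ g v = v → ρ g v - v ∈ fixedBy ρ H := fun g h => by
    rw [h, sub_self]
    exact zero_mem _
  exact fun g hg => (hgen Q (fun j => ⟨hs j, hv j⟩) (fun g hg => ⟨hg.2, h0 g (hZ g hg.1 v)⟩)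
    ⟨n, fun g hg => ⟨hg.2, h0 g (hn g hg.1)⟩⟩ hg).2

/-- A vector `v` killed by the square of the augmentation ideal is determined by a projection of `v`
to the fixed vectors and by the fixed vectors `s_j v - v`, for topological generators `s_j`. -/
theorem finrank_fixedSq_le [Fintype κ] (hρ : IsSmooth U ρ) (hZ : IsTrivialOn Z ρ) (hs : ∀ j, s j ∈ H)
    (hgen : ∀ Q : Subgroup G, (∀ j, s j ∈ Q) → Z ⊓ H ≤ Q → (∃ n, U n ⊓ H ≤ Q) → H ≤ Q)
    [FiniteDimensional F (fixedBy ρ H)] :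
    FiniteDimensional F (fixedSq ρ H) ∧
      Module.finrank F (fixedSq ρ H) ≤ (1 + Fintype.card κ) * Module.finrank F (fixedBy ρ H) := by
  obtain ⟨r, hr⟩ := (fixedBy ρ H).subtype.exists_leftInverse_of_injective
    (LinearMap.ker_eq_bot.2 (fixedBy ρ H).injective_subtype)
  let T : fixedSq ρ H →ₗ[F] fixedBy ρ H × (κ → fixedBy ρ H) :=
    (r ∘ₗ (fixedSq ρ H).subtype).prod (LinearMap.pi fun j =>
      LinearMap.codRestrict (fixedBy ρ H) ((ρ (s j) - 1) ∘ₗ (fixedSq ρ H).subtype)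
        fun v => v.2 (s j) (hs j))
  have hT : Function.Injective T := by
    refine (injective_iff_map_eq_zero _).2 fun v hv => Subtype.ext ?_
    have h2 : (v : J) ∈ fixedBy ρ H := mem_fixedBy_of_generators hρ hZ hgen fun j =>
      sub_eq_zero.1 (congrArg (fun w => ((w.2 j : fixedBy ρ H) : J)) hv)
    have h1 : r v = 0 := congrArg Prod.fst hv
    have h3 := DFunLike.congr_fun hr ⟨v, h2⟩
    have h4 : (⟨(v : J), h2⟩ : fixedBy ρ H) = 0 := h3.symm.trans h1
    exact congrArg (fun w : fixedBy ρ H => (w : J)) h4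
  have hfd := FiniteDimensional.of_injective T hT
  refine ⟨hfd, (LinearMap.finrank_le_finrank_of_injective hT).trans (le_of_eq ?_)⟩
  rw [Module.finrank_prod, Module.finrank_pi_fintype, Finset.sum_const, Finset.card_univ,
    smul_eq_mul]
  ring

end Fixed

/-! ### The square of the augmentation ideal acting on the dual -/

section Augmentation

variable {F G J : Type*} [Field F] [Group G] [AddCommGroup J] [Module F J]
  {U : ℕ → Subgroup G} [∀ n, (U n).Normal] {H : Subgroup G} {ρ : Representation F G J}

theorem lift_one_eq_zero (hU : Antitone U) {ξ : completedGroupAlgebra F (levels U H)}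
    (hξ : ξ ∈ augmentationIdeal (F := F) (levels U H)) (n : ℕ) :
    ((ξ.1 n).coeff.sum fun _ a => a) = 0 := by
  have hle : levels U H n ≤ (levels U H 0).comap (MonoidHom.id H) := fun x hx => hU (Nat.zero_le n) hx
  have h0 : (MonoidAlgebra.lift F F (H ⧸ levels U H 0) 1) (ξ.1 0) = 0 := hξ
  rw [← ξ.2 0 n hle, MonoidAlgebra.lift_apply, MonoidAlgebra.mapDomainAlgHom_apply,
    MonoidAlgebra.mapDomain] at h0
  rw [Finsupp.sum_mapDomain_index (by simp) (by intros; simp)] at h0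
  simpa using h0

/-- An element of the augmentation ideal kills the functionals that are constant on the `H`-orbit of
the vector. -/
theorem dualAction_apply_eq_zero (hU : Antitone U) (hρ : IsSmooth U ρ)
    {ξ : completedGroupAlgebra F (levels U H)} (hξ : ξ ∈ augmentationIdeal (F := F) (levels U H))
    {φ : Module.Dual F J} {v : J} (hv : ∀ h ∈ H, φ (ρ h v - v) = 0) :
    dualAction hU hρ ξ φ v = 0 := by
  obtain ⟨n, hn⟩ := hρ v
  have h1 : dualAction hU hρ ξ φ v = levelSum ρ n (ξ.1 n) φ v := dualActionFun_eq hU hρ ξ φ hn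
  have h2 : levelSum ρ n (ξ.1 n) φ v = (ξ.1 n).coeff.sum fun _ a => a * φ v := by
    refine Finsupp.sum_congr fun x _ => ?_
    have := hv _ (H.inv_mem (Quotient.out x : H).2)
    rw [map_sub, sub_eq_zero] at this
    rw [this]
  rw [h1, h2, ← Finsupp.sum_mul, lift_one_eq_zero hU hξ, zero_mul]

/-- The element `[h] - 1` of the augmentation ideal. -/
theorem exists_augmentation_sub_one (hU : Antitone U) (hρ : IsSmooth U ρ) (h : H) :
    ∃ ξ ∈ augmentationIdeal (F := F) (levels U H), ∀ φ v,
      dualAction hU hρ ξ φ v = φ (ρ (h : G)⁻¹ v) - φ v := by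
  refine ⟨⟨fun n => MonoidAlgebra.single (h : H ⧸ levels U H n) 1 - MonoidAlgebra.single 1 1,
    fun m n hmn => ?_⟩, ?_, fun φ v => ?_⟩
  · rw [map_sub, MonoidAlgebra.mapDomainAlgHom_apply, MonoidAlgebra.mapDomainAlgHom_apply,
      MonoidAlgebra.mapDomain_single, MonoidAlgebra.mapDomain_single, map_one]
    rfl
  · change (MonoidAlgebra.lift F F (H ⧸ levels U H 0) 1) (MonoidAlgebra.single _ 1
      - MonoidAlgebra.single _ 1) = 0
    rw [map_sub, MonoidAlgebra.lift_single, MonoidAlgebra.lift_single]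
    simp
  · obtain ⟨n, hn⟩ := hρ v
    refine (dualActionFun_eq hU hρ _ φ hn).trans ?_
    have h1 : ∀ ξ ξ' : MonoidAlgebra F (H ⧸ levels U H n),
        levelSum ρ n (ξ - ξ') φ v = levelSum ρ n ξ φ v - levelSum ρ n ξ' φ v := fun ξ ξ' =>
      Finsupp.sum_sub_index (f := ξ.coeff) (g := ξ'.coeff) fun _ _ _ => sub_mul _ _ _
    have h2 : ∀ x : H, levelSum ρ n (MonoidAlgebra.single (x : H ⧸ levels U H n) 1) φ v
        = φ (ρ (x : G)⁻¹ v) := fun x => by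
      unfold levelSum
      rw [MonoidAlgebra.coeff_single, Finsupp.sum_single_index (by simp), out_apply hn, one_mul]
    have h3 := h2 1
    rw [OneMemClass.coe_one, inv_one, map_one, Module.End.one_apply] at h3
    exact (h1 _ _).trans (congrArg₂ _ (h2 h) h3)

variable {Z : Subgroup G} {κ : Type*} {s : κ → G}

/-- `𝔪_H² J^∨` is the annihilator of the vectors killed by `𝔪_H²`, for `H` topologically finitely
generated. The annihilator of the intersection of the kernels of finitely many operators is the sum of
the images of their transposes, and the operators `(s_j - 1) (s_i - 1)` cut out these vectors. -/
theorem augmentationMul_augmentationMul_top [Finite κ] (hU : Antitone U) (hρ : IsSmooth U ρ)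
    (hZ : IsTrivialOn Z ρ) (hs : ∀ j, s j ∈ H)
    (hgen : ∀ Q : Subgroup G, (∀ j, s j ∈ Q) → Z ⊓ H ≤ Q → (∃ n, U n ⊓ H ≤ Q) → H ≤ Q) :
    augmentationMul hU H hρ (augmentationMul hU H hρ ⊤) = (fixedSq ρ H).dualAnnihilator := by
  classical
  have := Fintype.ofFinite κ
  refine le_antisymm (Submodule.span_le.2 ?_) fun φ hφ => ?_
  · have h1 : augmentationMul hU H hρ ⊤ ≤ (fixedBy ρ H).dualAnnihilator := by
      refine Submodule.span_le.2 ?_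
      rintro _ ⟨ξ, hξ, φ, -, rfl⟩
      refine (Submodule.mem_dualAnnihilator _).2 fun v hv => ?_
      exact dualAction_apply_eq_zero hU hρ hξ fun h hh => by rw [hv h hh, sub_self, map_zero]
    rintro _ ⟨ξ, hξ, φ, hφ, rfl⟩
    refine (Submodule.mem_dualAnnihilator _).2 fun v hv => ?_
    exact dualAction_apply_eq_zero hU hρ hξ fun h hh =>
      (Submodule.mem_dualAnnihilator _).1 (h1 hφ) _ (hv h hh)
  · -- the operators `(s j - 1) (s i - 1)` cut out `fixedSq`
    let T : J →ₗ[F] (κ × κ → J) := LinearMap.pi fun ij => (ρ (s ij.2) - 1) ∘ₗ (ρ (s ij.1) - 1)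
    have hT : LinearMap.ker T ≤ fixedSq ρ H := fun v hv =>
      mem_fixedSq_of_generators hρ hZ hs hgen fun i =>
        mem_fixedBy_of_generators hρ hZ hgen fun j => sub_eq_zero.1 (congrFun hv (i, j))
    have h1 : φ ∈ (LinearMap.ker T).dualAnnihilator := Submodule.dualAnnihilator_anti hT hφ
    rw [← LinearMap.range_dualMap_eq_dualAnnihilator_ker] at h1
    obtain ⟨Ψ, rfl⟩ := h1
    have h2 : T.dualMap Ψ = ∑ ij : κ × κ,
        ((Ψ ∘ₗ LinearMap.single F _ ij) ∘ₗ (ρ (s ij.2) - 1)) ∘ₗ (ρ (s ij.1) - 1) := by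
      ext v
      rw [LinearMap.dualMap_apply, LinearMap.sum_apply]
      conv_lhs => rw [← Finset.univ_sum_single (T v), map_sum]
      rfl
    have h3 : ∀ (N : Submodule F (Module.Dual F J)) (ψ : Module.Dual F J) j, ψ ∈ N →
        ψ ∘ₗ (ρ (s j) - 1) ∈ augmentationMul hU H hρ N := by
      intro N ψ j hψ
      obtain ⟨ξ, hξ, h⟩ := exists_augmentation_sub_one (F := F) hU hρ (⟨s j, hs j⟩⁻¹ : H)
      refine Submodule.subset_span ⟨ξ, hξ, ψ, hψ, LinearMap.ext fun v => ?_⟩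
      rw [h]
      simp
    rw [h2]
    exact Submodule.sum_mem _ fun ij _ => h3 _ _ _ (h3 _ _ _ Submodule.mem_top)

end Augmentation

/-! ### Topological generators of the first congruence subgroup -/

section Generators

theorem exists_one_add_pow {A : Type*} [Ring A] (a : A) (n : ℕ) :
    ∃ R, (1 + a) ^ n = 1 + n • a + n.choose 2 • a ^ 2 + a ^ 3 * R := by
  induction n with
  | zero => exact ⟨0, by simp⟩
  | succ n ih =>
    obtain ⟨R, hR⟩ := ih
    refine ⟨(n.choose 2 : A) + R * (1 + a), ?_⟩
    have hc : (n + 1).choose 2 = n.choose 2 + n := by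
      rw [Nat.choose_succ_succ' n 1, Nat.choose_one_right, add_comm]
    rw [pow_succ, hR, hc]
    simp only [nsmul_eq_mul, Nat.cast_add, Nat.cast_one]
    have h1 : a ^ 3 * (n.choose 2 : A) = n.choose 2 * a ^ 3 := (Nat.cast_commute _ _).symm
    rw [mul_add (a ^ 3), h1, ← mul_assoc (a ^ 3)]
    noncomm_ring

variable {p : ℕ} [Fact p.Prime] {k : Type*} [Field k] [CharP k p]

theorem mem_congruenceSubgroup {n : ℕ} {g : K p k} : g ∈ congruenceSubgroup p k n ↔
    ∃ X : Matrix (Fin 2) (Fin 2) (WittVector p k),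
      (g : Matrix (Fin 2) (Fin 2) (WittVector p k)) = 1 + (p : WittVector p k) ^ n • X := by
  have key : g ∈ congruenceSubgroup p k n ↔ ∀ i j,
      (g : Matrix (Fin 2) (Fin 2) (WittVector p k)) i j - (1 : Matrix _ _ (WittVector p k)) i j
        ∈ Ideal.span {(p : WittVector p k) ^ n} := by
    rw [congruenceSubgroup, MonoidHom.mem_ker, ← Units.val_inj, ← Matrix.ext_iff]
    refine forall_congr' fun i => forall_congr' fun j => ?_
    rw [← Ideal.Quotient.eq]
    have h1 : Ideal.Quotient.mk (Ideal.span {(p : WittVector p k) ^ n})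
        ((1 : Matrix (Fin 2) (Fin 2) (WittVector p k)) i j)
        = (1 : Matrix (Fin 2) (Fin 2) _) i j := by
      rw [Matrix.one_apply, Matrix.one_apply]
      split_ifs <;> simp
    rw [h1]
    rfl
  rw [key]
  constructor
  · intro h
    choose X hX using fun i j => Ideal.mem_span_singleton.1 (h i j)
    refine ⟨Matrix.of X, ?_⟩
    ext1 i j
    rw [Matrix.add_apply, Matrix.smul_apply, Matrix.of_apply, smul_eq_mul, ← hX]
    ring
  · rintro ⟨X, hX⟩ i j
    rw [hX, Matrix.add_apply, Matrix.smul_apply, add_sub_cancel_left, smul_eq_mul]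
    exact Ideal.mem_span_singleton.2 (dvd_mul_right _ _)

theorem mem_congruenceSubgroup_one_iff_reduction [Finite k] {g : K p k} :
    g ∈ congruenceSubgroup p k 1 ↔ reduction p k g = 1 := by
  constructor
  · intro h
    obtain ⟨X, hX⟩ := mem_congruenceSubgroup.1 h
    rw [pow_one] at hX
    exact reduction_of_eq hX
  · intro h
    have h1 : ∀ i j, ∃ b, (g : Matrix (Fin 2) (Fin 2) (WittVector p k)) i j
        - (1 : Matrix _ _ (WittVector p k)) i j = (p : WittVector p k) * b := fun i j => by
      rw [← coeff_zero_eq_zero_iff, coeff_zero_sub, sub_eq_zero]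
      have h2 : (reduction p k g : Matrix (Fin 2) (Fin 2) k) i j = (1 : Matrix _ _ k) i j := by
        rw [h, Units.val_one]
      refine Eq.trans h2 ?_
      rw [Matrix.one_apply, Matrix.one_apply]
      split_ifs <;> simp
    choose X hX using h1
    refine mem_congruenceSubgroup.2 ⟨Matrix.of X, ?_⟩
    ext1 i j
    rw [Matrix.add_apply, Matrix.smul_apply, Matrix.of_apply, smul_eq_mul, pow_one, ← hX]
    ring

/-- `Q` contains an element congruent to `1 + pᵐ X` modulo `p^(m+1)`. -/
def HasLeading (Q : Subgroup (K p k)) (m : ℕ) (X : Matrix (Fin 2) (Fin 2) (WittVector p k)) : Prop :=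
  ∃ h ∈ Q, ∃ E, (h : Matrix (Fin 2) (Fin 2) (WittVector p k))
    = 1 + (p : WittVector p k) ^ m • (X + (p : WittVector p k) • E)

variable {Q : Subgroup (K p k)}

theorem HasLeading.add_smul {m : ℕ} {X : Matrix (Fin 2) (Fin 2) (WittVector p k)}
    (h : HasLeading Q m X) (E : Matrix (Fin 2) (Fin 2) (WittVector p k)) :
    HasLeading Q m (X + (p : WittVector p k) • E) := by
  obtain ⟨g, hg, E', he⟩ := h
  refine ⟨g, hg, E' - E, ?_⟩
  rw [he, smul_sub, add_assoc, add_sub_cancel]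

theorem HasLeading.zero (m : ℕ) : HasLeading Q m 0 := ⟨1, Q.one_mem, 0, by simp⟩

theorem HasLeading.add {m : ℕ} (hm : 1 ≤ m) {X Y : Matrix (Fin 2) (Fin 2) (WittVector p k)}
    (hX : HasLeading Q m X) (hY : HasLeading Q m Y) : HasLeading Q m (X + Y) := by
  obtain ⟨g, hg, E, he⟩ := hX
  obtain ⟨g', hg', E', he'⟩ := hY
  obtain ⟨n, rfl⟩ : ∃ n, m = n + 1 := ⟨m - 1, by omega⟩
  refine ⟨g * g', Q.mul_mem hg hg', E + E' + (p : WittVector p k) ^ n •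
    ((X + (p : WittVector p k) • E) * (Y + (p : WittVector p k) • E')), ?_⟩
  have h : ∀ (c : WittVector p k) (A B : Matrix (Fin 2) (Fin 2) (WittVector p k)),
      (1 + c • A) * (1 + c • B) = 1 + c • A + c • B + (c * c) • (A * B) := fun c A B => by
    simp only [add_mul, mul_add, one_mul, mul_one, smul_mul_assoc, mul_smul_comm, smul_smul,
      smul_add]
    abel
  rw [Units.val_mul, he, he', h]
  generalize (X + (p : WittVector p k) • E) * (Y + (p : WittVector p k) • E') = W
  match_scalars <;> ring

/-- The `p`-th power map takes `1 + pᵐ X` to `1 + p^(m+1) X` modulo `p^(m+2)`. -/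
theorem HasLeading.succ (hp2 : p ≠ 2) {m : ℕ} (hm : 1 ≤ m)
    {X : Matrix (Fin 2) (Fin 2) (WittVector p k)} (hX : HasLeading Q m X) :
    HasLeading Q (m + 1) X := by
  obtain ⟨g, hg, E, he⟩ := hX
  obtain ⟨n, rfl⟩ : ∃ n, m = n + 1 := ⟨m - 1, by omega⟩
  have hp : p.Prime := Fact.out
  obtain ⟨c, hc⟩ : p ∣ p.choose 2 := hp.dvd_choose_self two_ne_zero
    (lt_of_le_of_ne hp.two_le (Ne.symm hp2))
  set Y := X + (p : WittVector p k) • E with hY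
  obtain ⟨R, hR⟩ := exists_one_add_pow ((p : WittVector p k) ^ (n + 1) • Y) p
  refine ⟨g ^ p, Q.pow_mem hg p, E + (c : WittVector p k) • (p : WittVector p k) ^ n • Y ^ 2
    + (p : WittVector p k) ^ (2 * n) • (Y ^ 3 * R), ?_⟩
  rw [Units.val_pow_eq_pow_val, he, hR, hc, smul_pow, smul_pow, smul_mul_assoc]
  simp only [← Nat.cast_smul_eq_nsmul (WittVector p k), Nat.cast_mul, smul_add, smul_smul, hY]
  match_scalars <;> ring

/-- A subgroup that contains a congruence subgroup and elements `1 + p X + …` for all `X` contains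
elements `1 + p^m X + …` for all `m` and `X`, by taking `p`-th powers; successive approximation then
shows that it contains `K_1`. -/
theorem congruenceSubgroup_le_of_hasLeading (hp2 : p ≠ 2) (h1 : ∀ X, HasLeading Q 1 X)
    {n : ℕ} (hn : congruenceSubgroup p k n ≤ Q) : congruenceSubgroup p k 1 ≤ Q := by
  have hall : ∀ m, ∀ X, HasLeading Q (m + 1) X := fun m => by
    induction m with
    | zero => exact h1
    | succ m ih => exact fun X => (ih X).succ hp2 (Nat.le_add_left 1 m)
  have key : ∀ d m, n ≤ m + 1 + d → congruenceSubgroup p k (m + 1) ≤ Q := by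
    intro d
    induction d with
    | zero => exact fun m hm => (congruenceSubgroup_antitone p k hm).trans hn
    | succ d ih =>
      intro m hm g hg
      obtain ⟨X, hX⟩ := mem_congruenceSubgroup.1 hg
      obtain ⟨h, hh, E, hE⟩ := hall m X
      have h2 : h⁻¹ * g ∈ congruenceSubgroup p k (m + 1 + 1) := by
        refine mem_congruenceSubgroup.2 ⟨-(((h⁻¹ : K p k) : Matrix (Fin 2) (Fin 2) (WittVector p k)) * E), ?_⟩
        have h3 : (g : Matrix (Fin 2) (Fin 2) (WittVector p k))
            = h - (p : WittVector p k) ^ (m + 1 + 1) • E := by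
          rw [hX, hE, smul_add, smul_smul, ← pow_succ]
          abel
        rw [Units.val_mul, h3, mul_sub, h.inv_mul, mul_smul_comm, smul_neg, sub_eq_add_neg]
      have h4 := Q.mul_mem hh (ih (m + 1) (by omega) h2)
      rwa [mul_inv_cancel_left] at h4
  exact key n 0 (by omega)

theorem oneAdd_mem (X : Matrix (Fin 2) (Fin 2) (WittVector p k)) :
    oneAdd X ∈ congruenceSubgroup p k 1 :=
  mem_congruenceSubgroup.2 ⟨X, by rw [oneAdd_coe, pow_one]⟩

theorem HasLeading.of_oneAdd {X : Matrix (Fin 2) (Fin 2) (WittVector p k)} (h : oneAdd X ∈ Q) :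
    HasLeading Q 1 X := ⟨_, h, 0, by rw [oneAdd_coe, pow_one, smul_zero, add_zero]⟩

theorem oneAdd_smul_one_mem (a : WittVector p k) :
    oneAdd (a • (1 : Matrix (Fin 2) (Fin 2) (WittVector p k))) ∈ Z₁ p k := by
  refine ⟨Subgroup.mem_center_iff.2 fun g => Units.ext ?_, oneAdd_mem _⟩
  rw [Units.val_mul, Units.val_mul, oneAdd_coe, mul_add, add_mul, mul_one, one_mul, smul_smul,
    mul_smul_comm, smul_mul_assoc, mul_one, one_mul]

/-- The matrices `e`, `diag(1, 0)` and `f`, which span all matrices modulo the scalar ones. -/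
def baseMat (p : ℕ) [Fact p.Prime] (k : Type*) [Field k] :
    Fin 3 → Matrix (Fin 2) (Fin 2) (WittVector p k) :=
  ![!![0, 1; 0, 0], !![1, 0; 0, 0], !![0, 0; 1, 0]]

/-- `K_1` is topologically generated by `Z_1` and `3 f` elements, namely the `1 + p t Y`, where `Y`
runs through `baseMat` and `t` through lifts of a basis of `k` over `𝔽_p`. -/
theorem exists_generators [Finite k] (hp2 : p ≠ 2) {F : Type*} [Field F] [Finite F] [CharP F p]
    [Fintype (k →+* F)] [Nonempty (k →+* F)] :
    ∃ s : Fin 3 × (k →+* F) → K p k, (∀ j, s j ∈ congruenceSubgroup p k 1) ∧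
      ∀ Q : Subgroup (K p k), (∀ j, s j ∈ Q) → Z₁ p k ⊓ congruenceSubgroup p k 1 ≤ Q →
        (∃ n, congruenceSubgroup p k n ⊓ congruenceSubgroup p k 1 ≤ Q) →
        congruenceSubgroup p k 1 ≤ Q := by
  let _ : Algebra (ZMod p) k := ZMod.algebra k p
  have hfr : Module.finrank (ZMod p) k = Fintype.card (k →+* F) :=
    (finrank_eq_card_embeddings p (k := k) (F := F)).1
  let b := (Module.finBasisOfFinrankEq (ZMod p) k hfr).reindex (Fintype.equivFin (k →+* F)).symm
  choose t ht using WittVector.constantCoeff_surjective (R := k) p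
  refine ⟨fun j => oneAdd (t (b j.2) • baseMat p k j.1), fun j => oneAdd_mem _,
    fun Q hs hZ ⟨n, hn⟩ => ?_⟩
  refine congruenceSubgroup_le_of_hasLeading hp2 (n := max n 1) ?_ fun g hg => hn
    ⟨congruenceSubgroup_antitone p k (le_max_left n 1) hg,
      congruenceSubgroup_antitone p k (le_max_right n 1) hg⟩
  have hbase : ∀ (i : Fin 3) (a : WittVector p k), HasLeading Q 1 (a • baseMat p k i) := by
    intro i a
    let S : AddSubmonoid (WittVector p k) :=
      { carrier := {a | HasLeading Q 1 (a • baseMat p k i)}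
        add_mem' := fun {x y} hx hy => by
          have := HasLeading.add le_rfl hx hy
          rwa [← _root_.add_smul] at this
        zero_mem' := by
          change HasLeading Q 1 _
          rw [zero_smul]
          exact HasLeading.zero 1 }
    have h1 : (∑ j, (b.repr (a.coeff 0) j).val • t (b j)) ∈ S :=
      S.sum_mem fun j _ => S.nsmul_mem (HasLeading.of_oneAdd (hs (i, j))) _
    obtain ⟨c, hc⟩ := (coeff_zero_eq_zero_iff
      (a - ∑ j, (b.repr (a.coeff 0) j).val • t (b j))).1 (by
        rw [coeff_zero_sub, sub_eq_zero, ← WittVector.constantCoeff_apply (∑ j, _), map_sum]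
        conv_lhs => rw [← b.sum_repr (a.coeff 0)]
        refine Finset.sum_congr rfl fun j _ => ?_
        rw [map_nsmul, ht, ← Nat.cast_smul_eq_nsmul (ZMod p), ZMod.natCast_zmod_val])
    have h2 := HasLeading.add_smul h1 (c • baseMat p k i)
    rwa [smul_smul, ← _root_.add_smul, ← hc, add_sub_cancel] at h2
  have hone : ∀ a : WittVector p k, HasLeading Q 1 (a • (1 : Matrix (Fin 2) (Fin 2) (WittVector p k))) := fun a =>
    HasLeading.of_oneAdd (hZ ⟨oneAdd_smul_one_mem a, oneAdd_mem _⟩)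
  intro X
  have hX : X = X 0 1 • baseMat p k 0 + (X 0 0 - X 1 1) • baseMat p k 1 + X 1 0 • baseMat p k 2
      + X 1 1 • (1 : Matrix (Fin 2) (Fin 2) (WittVector p k)) := by
    ext1 i j
    fin_cases i <;> fin_cases j <;> simp [baseMat]
  rw [hX]
  exact (((hbase _ _).add le_rfl (hbase _ _)).add le_rfl (hbase _ _)).add le_rfl (hone _)

end Generators

/-! ### Injective envelopes and projective covers -/

section Envelope

/-- A representation of `G` that is trivial on the kernel of `G → Γ` comes from `Γ`. -/
theorem exists_representation_of_surjective {F G Γ V : Type*} [Field F] [Group G] [Group Γ]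
    [AddCommGroup V] [Module F V] {f : G →* Γ} (hf : Function.Surjective f) (ρ : Representation F G V)
    (hρ : ∀ g, f g = 1 → ρ g = 1) : ∃ ρ' : Representation F Γ V, ∀ g, ρ' (f g) = ρ g := by
  have key : ∀ g h, f g = f h → ρ g = ρ h := fun g h hgh => by
    have h1 := hρ (g * h⁻¹) (by rw [map_mul, map_inv, hgh, mul_inv_cancel])
    rw [← one_mul (ρ h), ← h1, ← map_mul, inv_mul_cancel_right]
  choose t ht using hf
  exact ⟨⟨⟨fun γ => ρ (t γ), by rw [key _ 1 (by rw [ht, map_one]), map_one]⟩, fun γ δ => by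
    change ρ _ = ρ _ * ρ _
    rw [← map_mul]
    exact key _ _ (by rw [ht, map_mul, ht, ht])⟩, fun g => key _ _ (ht _)⟩

/-- The vectors fixed by `ker f` in an essential extension of the inflation of `σ^∨` along
`f : G → Γ` embed into the dual of every projective representation of `Γ` covering `σ`. -/
theorem exists_injective_fixedBy_ker {F G Γ V W J : Type*} [Field F] [Group G] [Group Γ]
    [AddCommGroup V] [Module F V] [AddCommMonoid W] [Module F W] [AddCommGroup J] [Module F J]
    {f : G →* Γ} (hf : Function.Surjective f) {σ : Representation F Γ W} {ρ : Representation F Γ V}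
    (hproj : Module.Projective (MonoidAlgebra F Γ) ρ.asModule)
    {π : Representation.IntertwiningMap ρ σ} (hπ : Function.Surjective π)
    {ρJ : Representation F G J}
    {i : Representation.IntertwiningMap (Representation.dual (σ.comp f : Representation F G W)) ρJ}
    (hi : Function.Injective i)
    (hess : ∀ N : Subrepresentation ρJ, N ⊓ i.range = ⊥ → N = ⊥) {H : Subgroup G} [H.Normal]
    (hH : ∀ g, g ∈ H ↔ f g = 1) :
    ∃ L : fixedBy ρJ H →ₗ[F] Module.Dual F V, Function.Injective L := by
  have hieq : ∀ g ψ, i ((Representation.dual (σ.comp f : Representation F G W)) g ψ) = ρJ g (i ψ) :=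
    fun g ψ => DFunLike.congr_fun (i.isIntertwining' g) ψ
  have hmem : ∀ ψ, i ψ ∈ fixedBy ρJ H := fun ψ g hg => by
    rw [← hieq]
    congr 1
    ext w
    change ψ (σ (f g⁻¹) w) = ψ w
    rw [map_inv, (hH g).1 hg, inv_one, map_one]
    rfl
  -- the fixed vectors form a representation of `Γ` which contains `σ^∨`; its dual maps onto
  -- `σ^∨∨`, and `V → σ^∨∨` lifts to this dual by projectivity
  let i₁ : Module.Dual F W →ₗ[F] fixedBy ρJ H := LinearMap.codRestrict _ i.toLinearMap hmem
  have hi₁ : Function.Injective i₁ := fun a b h => hi (congrArg Subtype.val h)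
  obtain ⟨σ₁, hσ₁⟩ := exists_representation_of_surjective hf
    (ρJ.subrepresentation (fixedBy ρJ H) fixedBy_stable) fun g hg =>
      LinearMap.ext fun x => Subtype.ext (x.2 g ((hH g).2 hg))
  have hσ₁' : ∀ g (x : fixedBy ρJ H), (σ₁ (f g) x : J) = ρJ g x := fun g x => by
    rw [hσ₁]
    rfl
  obtain ⟨r, hr⟩ : ∃ r : Representation.IntertwiningMap σ₁.dual σ.dual.dual,
      ∀ Φ ψ, r Φ ψ = Φ (i₁ ψ) :=
    ⟨⟨i₁.dualMap, fun γ => LinearMap.ext fun Φ => LinearMap.ext fun ψ => by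
      obtain ⟨g, rfl⟩ := hf γ
      change Φ (σ₁ (f g)⁻¹ (i₁ ψ)) = Φ (i₁ (ψ ∘ₗ σ ((f g)⁻¹)⁻¹))
      congr 1
      refine Subtype.ext ?_
      rw [← map_inv, hσ₁']
      refine (hieq g⁻¹ ψ).symm.trans ?_
      change i (ψ ∘ₗ σ (f (g⁻¹)⁻¹)) = i (ψ ∘ₗ σ ((f g⁻¹)⁻¹))
      rw [map_inv]⟩, fun _ _ => rfl⟩
  have hrs : Function.Surjective r := fun Φ => by
    obtain ⟨t, ht⟩ := i₁.exists_leftInverse_of_injective (LinearMap.ker_eq_bot.2 hi₁)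
    refine ⟨Φ ∘ₗ t, LinearMap.ext fun ψ => ?_⟩
    rw [hr]
    exact congrArg Φ (DFunLike.congr_fun ht ψ)
  obtain ⟨q, hq⟩ : ∃ q : Representation.IntertwiningMap ρ σ.dual.dual, ∀ v ψ, q v ψ = ψ (π v) :=
    ⟨⟨Module.Dual.eval F W ∘ₗ π.toLinearMap, fun γ => LinearMap.ext fun v => LinearMap.ext fun ψ => by
      have h1 : π (ρ γ v) = σ γ (π v) := DFunLike.congr_fun (π.isIntertwining' γ) v
      change ψ (π (ρ γ v)) = ψ (σ ((γ⁻¹)⁻¹) (π v))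
      rw [h1, inv_inv]⟩, fun _ _ => rfl⟩
  obtain ⟨l, hl⟩ := exists_lift_of_projective hproj r hrs q
  have hl' : ∀ v ψ, l v (i₁ ψ) = ψ (π v) := fun v ψ => by rw [← hr, hl, hq]
  refine ⟨l.toLinearMap.flip, (injective_iff_map_eq_zero _).2 fun x hx => ?_⟩
  -- the annihilator of the image of `l` is a subrepresentation which avoids the socle
  let N : Subrepresentation ρJ := ⟨(LinearMap.ker l.toLinearMap.flip).map (fixedBy ρJ H).subtype, by
    rintro g _ ⟨x, hx, rfl⟩
    refine ⟨σ₁ (f g) x, LinearMap.ext fun v => ?_, hσ₁' g x⟩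
    have h1 : l (ρ (f g)⁻¹ v) = σ₁.dual (f g)⁻¹ (l v) := DFunLike.congr_fun (l.isIntertwining' _) v
    have h2 : l v (σ₁ ((f g)⁻¹)⁻¹ x) = l (ρ (f g)⁻¹ v) x := (DFunLike.congr_fun h1 x).symm
    rw [inv_inv] at h2
    exact h2.trans (DFunLike.congr_fun (LinearMap.mem_ker.1 hx) _)⟩
  have hN : N = ⊥ := hess N (by
    refine SetLike.ext fun y => ⟨?_, fun hy => ?_⟩
    · rintro ⟨⟨x, hx, rfl⟩, ψ, hψ⟩
      have hxi : x = i₁ ψ := Subtype.ext hψ.symm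
      have h0 : ψ = 0 := LinearMap.ext fun w => by
        obtain ⟨v, rfl⟩ := hπ w
        rw [← hl', ← hxi]
        exact DFunLike.congr_fun (LinearMap.mem_ker.1 hx) v
      rw [h0, map_zero] at hxi
      rw [hxi]
      rfl
    · have hy0 : y = 0 := hy
      rw [hy0]
      exact ⟨Submodule.zero_mem _, 0, map_zero i⟩)
  have hx' : (x : J) ∈ N := ⟨x, hx, rfl⟩
  rw [hN] at hx'
  exact Subtype.ext hx'

/-- Injectivity of an injective envelope with respect to finite-dimensional representations in
arbitrary universes. -/
theorem IsInjectiveEnvelope.extend_finite {F : Type u} [Field F] {G : Type*} [Group G]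
    {U : ℕ → Subgroup G} {Z : Subgroup G} {J : Type u} [AddCommGroup J] [Module F J] {W : Type*}
    [AddCommGroup W] [Module F W] {σ : Representation F G W} {ρJ : Representation F G J}
    {i : Representation.IntertwiningMap σ ρJ} (hi : IsInjectiveEnvelope U Z i) {A B : Type*}
    [AddCommGroup A] [Module F A] [FiniteDimensional F A] [AddCommGroup B] [Module F B]
    [FiniteDimensional F B] {ρA : Representation F G A} {ρB : Representation F G B}
    (hAs : IsSmooth U ρA) (hAt : IsTrivialOn Z ρA) (hBs : IsSmooth U ρB) (hBt : IsTrivialOn Z ρB)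
    {f : Representation.IntertwiningMap ρA ρB} (hf : Function.Injective f)
    (g : Representation.IntertwiningMap ρA ρJ) :
    ∃ h : Representation.IntertwiningMap ρB ρJ, ∀ a, h (f a) = g a := by
  let a := (Module.finBasis F A).equivFun
  let b := (Module.finBasis F B).equivFun
  let ρA' : Representation F G (Fin (Module.finrank F A) → F) :=
    a.conjRingEquiv.toMonoidHom.comp ρA
  let ρB' : Representation F G (Fin (Module.finrank F B) → F) :=
    b.conjRingEquiv.toMonoidHom.comp ρB
  have hA' : ∀ g x, ρA' g x = a (ρA g (a.symm x)) := fun _ _ => rfl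
  have hB' : ∀ g x, ρB' g x = b (ρB g (b.symm x)) := fun _ _ => rfl
  obtain ⟨h, hh⟩ := hi.extend ρA' ρB'
    (fun v => (hAs (a.symm v)).imp fun n hn g hg => by
      rw [hA', hn g hg, LinearEquiv.apply_symm_apply])
    (fun g hg v => by rw [hA', hAt g hg, LinearEquiv.apply_symm_apply])
    (fun v => (hBs (b.symm v)).imp fun n hn g hg => by
      rw [hB', hn g hg, LinearEquiv.apply_symm_apply])
    (fun g hg v => by rw [hB', hBt g hg, LinearEquiv.apply_symm_apply])
    ⟨b.toLinearMap ∘ₗ f.toLinearMap ∘ₗ a.symm.toLinearMap, fun g => LinearMap.ext fun v => by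
      change b (f (a.symm (a (ρA g (a.symm v))))) = b (ρB g (b.symm (b (f (a.symm v)))))
      rw [LinearEquiv.symm_apply_apply, LinearEquiv.symm_apply_apply]
      exact congrArg b (DFunLike.congr_fun (f.isIntertwining' g) _)⟩
    ⟨g.toLinearMap ∘ₗ a.symm.toLinearMap, fun x => LinearMap.ext fun v => by
      change g (a.symm (a (ρA x (a.symm v)))) = ρJ x (g (a.symm v))
      rw [LinearEquiv.symm_apply_apply]
      exact DFunLike.congr_fun (g.isIntertwining' x) _⟩
    (b.injective.comp (hf.comp a.symm.injective))
  refine ⟨⟨h.toLinearMap ∘ₗ b.toLinearMap, fun g => LinearMap.ext fun v => ?_⟩, fun x => ?_⟩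
  · have h1 := DFunLike.congr_fun (h.isIntertwining' g) (b v)
    change h (b (ρB g v)) = ρJ g (h (b v))
    refine Eq.trans ?_ h1
    change h _ = h (b (ρB g (b.symm (b v))))
    rw [LinearEquiv.symm_apply_apply]
  · have h1 := hh (a x)
    change h (b (f (a.symm (a x)))) = g (a.symm (a x)) at h1
    rw [LinearEquiv.symm_apply_apply] at h1
    exact h1

/-- If only the whole of `ρM` surjects onto `σ` through `q`, then a map out of the dual of `ρM` is
injective as soon as it is injective on the dual of `σ`. -/
theorem injective_of_comp_dual {F G M W J : Type*} [Field F] [Group G] [AddCommGroup M] [Module F M]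
    [FiniteDimensional F M] [AddCommGroup W] [Module F W] [AddCommGroup J] [Module F J]
    {ρM : Representation F G M} {ρJ : Representation F G J} {q : M →ₗ[F] W}
    (htop : ∀ N : Submodule F M, (∀ g, N ≤ N.comap (ρM g)) → (∀ w, ∃ n ∈ N, q n = w) → N = ⊤)
    {h : Representation.IntertwiningMap ρM.dual ρJ}
    (hh : ∀ ψ : Module.Dual F W, h (ψ ∘ₗ q) = 0 → ψ = 0) : Function.Injective h := by
  have hker : ∀ g Φ, h Φ = 0 → h (ρM.dual g Φ) = 0 := fun g Φ hΦ => by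
    have h1 : h (ρM.dual g Φ) = ρJ g (h Φ) := DFunLike.congr_fun (h.isIntertwining' g) Φ
    rw [h1, hΦ, map_zero]
  have hN : (LinearMap.ker h.toLinearMap).dualCoannihilator = ⊤ := by
    refine htop _ (fun g m hm => (Submodule.mem_dualCoannihilator _).2 fun Φ hΦ => ?_) ?_
    · have h1 := (Submodule.mem_dualCoannihilator _).1 hm (ρM.dual g⁻¹ Φ) (hker _ _ hΦ)
      change Φ (ρM (g⁻¹)⁻¹ m) = 0 at h1
      rwa [inv_inv] at h1
    · by_contra hw
      have h1 : ((LinearMap.ker h.toLinearMap).dualCoannihilator).map q < ⊤ := by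
        refine lt_top_iff_ne_top.2 fun h2 => hw fun w => ?_
        have h3 : w ∈ ((LinearMap.ker h.toLinearMap).dualCoannihilator).map q := by rw [h2]; trivial
        exact h3
      obtain ⟨ψ, hψ, hle⟩ := Submodule.exists_le_ker_of_lt_top _ h1
      refine hψ (hh ψ ?_)
      have h2 : ψ ∘ₗ q ∈ ((LinearMap.ker h.toLinearMap).dualCoannihilator).dualAnnihilator :=
        (Submodule.mem_dualAnnihilator _).2 fun m hm => hle ⟨m, hm, rfl⟩
      rw [Subspace.dualCoannihilator_dualAnnihilator_eq] at h2
      exact h2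
  refine (injective_iff_map_eq_zero _).2 fun Φ hΦ => LinearMap.ext fun m => ?_
  have hm : m ∈ (LinearMap.ker h.toLinearMap).dualCoannihilator := by rw [hN]; trivial
  exact (Submodule.mem_dualCoannihilator _).1 hm Φ hΦ

/-- If the dual of a finite-dimensional `ρM` is identified with the vectors of `ρJ` killed by
`𝔪_H²`, then `ρM` is `J^∨ / 𝔪_H² J^∨`. -/
theorem nonempty_equiv_dualModSq {F G M J : Type*} [Field F] [Group G] [AddCommGroup M] [Module F M]
    [FiniteDimensional F M] [AddCommGroup J] [Module F J] {U : ℕ → Subgroup G} [∀ n, (U n).Normal]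
    {H : Subgroup G} [H.Normal] {ρM : Representation F G M} {ρJ : Representation F G J}
    (hU : Antitone U) (hρ : IsSmooth U ρJ) {h : Representation.IntertwiningMap ρM.dual ρJ}
    (hinj : Function.Injective h)
    (hann : augmentationMul hU H hρ (augmentationMul hU H hρ ⊤)
      = (LinearMap.range h.toLinearMap).dualAnnihilator) :
    Nonempty (ρM.Equiv (dualModSq hU H hρ)) := by
  have hs : Function.Surjective h.toLinearMap.dualMap :=
    LinearMap.dualMap_surjective_of_injective hinj
  have hker : augmentationMul hU H hρ (augmentationMul hU H hρ ⊤)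
      = LinearMap.ker h.toLinearMap.dualMap := by
    rw [hann, LinearMap.ker_dualMap_eq_dualAnnihilator_range]
  let e := (Submodule.quotEquivOfEq _ _ hker).trans (h.toLinearMap.dualMap.quotKerEquivOfSurjective hs)
  have he : ∀ φ Φ, e (Submodule.Quotient.mk φ) Φ = φ (h Φ) := fun _ _ => rfl
  refine ⟨Representation.Equiv.mk ((Module.evalEquiv F M).trans e.symm) fun g =>
    LinearMap.ext fun m => e.injective (LinearMap.ext fun Φ => ?_)⟩
  change e (e.symm (Module.evalEquiv F M (ρM g m))) Φ
    = e (dualModSq hU H hρ g (e.symm (Module.evalEquiv F M m))) Φ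
  rw [LinearEquiv.apply_symm_apply]
  obtain ⟨φ, hφ⟩ := Submodule.Quotient.mk_surjective _ (e.symm (Module.evalEquiv F M m))
  have h1 : e (Submodule.Quotient.mk φ) = Module.evalEquiv F M m := by
    rw [hφ, LinearEquiv.apply_symm_apply]
  have h2 : h (ρM.dual g⁻¹ Φ) = ρJ g⁻¹ (h Φ) := DFunLike.congr_fun (h.isIntertwining' _) Φ
  rw [← hφ]
  change Φ (ρM g m) = φ (ρJ g⁻¹ (h Φ))
  rw [← h2, ← he, h1]
  change _ = Φ (ρM (g⁻¹)⁻¹ m)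
  rw [inv_inv]

end Envelope

/-! ### Comparison of the lattice with the injective envelope -/

section Comparison

/-- A projective module is contained in a free one, and `W(F)` is torsion free. -/
theorem torsionFree_of_projective {p : ℕ} [Fact p.Prime] {F Γ P : Type*} [Field F] [CharP F p]
    [Group Γ] [AddCommGroup P] [Module (WittVector p F) P] {ρ : Representation (WittVector p F) Γ P}
    (hproj : Module.Projective (MonoidAlgebra (WittVector p F) Γ) ρ.asModule) (x : P)
    (hx : (p : WittVector p F) • x = 0) : x = 0 := by
  obtain ⟨s, hs⟩ := Module.projective_def.1 hproj
  have hx' : p • (ρ.asModuleEquiv.symm x) = 0 := by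
    rw [← map_nsmul, ← Nat.cast_smul_eq_nsmul (WittVector p F), hx, map_zero]
  have h1 : p • s (ρ.asModuleEquiv.symm x) = 0 := by rw [← map_nsmul, hx', map_zero]
  have h2 : s (ρ.asModuleEquiv.symm x) = 0 := by
    refine Finsupp.ext fun y => MonoidAlgebra.coeff_injective (Finsupp.ext fun g => ?_)
    have h3 : p • ((s (ρ.asModuleEquiv.symm x) y).coeff g) = 0 :=
      congrArg (fun f : ρ.asModule →₀ MonoidAlgebra (WittVector p F) Γ => (f y).coeff g) h1
    rw [nsmul_eq_mul] at h3
    exact (mul_eq_zero.1 h3).resolve_left (WittVector.p_nonzero p F)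
  have h4 := hs (ρ.asModuleEquiv.symm x)
  rw [h2, map_zero] at h4
  exact ρ.asModuleEquiv.symm.injective (h4.symm.trans (map_zero _).symm)

section Lattice

variable {p : ℕ} [Fact p.Prime] {k F : Type*} [Field k] [Field F] [CharP k p] [CharP F p] [Finite F]
  {P : Type*} [AddCommGroup P] [Module (WittVector p F) P]
  {ρ : Representation (WittVector p F) (GL (Fin 2) k) P} (ι : GluingMaps ρ)

theorem latticeModP_eq_of_commCoord {g : K p k} {X : Matrix (Fin 2) (Fin 2) (WittVector p k)}
    (hg : (g : Matrix (Fin 2) (Fin 2) (WittVector p k)) = 1 + (p : WittVector p k) • X)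
    (hd : (X 0 0).coeff 0 = (X 1 1).coeff 0) (h01 : (X 0 1).coeff 0 = 0) (h10 : (X 1 0).coeff 0 = 0)
    (n : F ⊗[WittVector p F] lattice ι) : latticeModP ι g n = n := by
  have h0 : (fun τ : k →+* F => commCoord τ X fun i => gluingTriple ι τ i (projFst ι n)) = 0 := by
    funext τ i
    fin_cases i <;> simp [commCoord, hd, h01, h10]
  rw [latticeModP_apply_eq ι hg, h0, map_zero, add_zero]

theorem isSmooth_dual_latticeModP :
    IsSmooth (congruenceSubgroup p k) (latticeModP ι).dual := fun Φ => ⟨2, fun g hg => by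
  obtain ⟨X, hX⟩ := mem_congruenceSubgroup.1 ((congruenceSubgroup p k 2).inv_mem hg)
  refine LinearMap.ext fun n => congrArg Φ ?_
  refine latticeModP_eq_of_commCoord ι (X := (p : WittVector p k) • X) ?_ ?_ ?_ ?_ n
  · rw [hX, smul_smul, sq]
  all_goals
    simp only [Matrix.smul_apply, smul_eq_mul, mul_comm (p : WittVector p k),
      WittVector.mul_charP_coeff_zero]⟩

/-- A central element `1 + p X` has scalar `X`, whose commutators vanish. -/
theorem isTrivialOn_dual_latticeModP : IsTrivialOn (Z₁ p k) (latticeModP ι).dual := by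
  intro g hg Φ
  have hg' := (Z₁ p k).inv_mem hg
  obtain ⟨X, hX⟩ := mem_congruenceSubgroup.1 hg'.2
  rw [pow_one] at hX
  have hcomm := fun (Y : Matrix (Fin 2) (Fin 2) (WittVector p k)) (hY : IsUnit Y.det) =>
    congrArg Units.val (Subgroup.mem_center_iff.1 hg'.1 (Matrix.nonsingInvUnit Y hY))
  have hp0 := WittVector.p_nonzero p k
  have e1 := hcomm !![1, 1; 0, 1] (by simp)
  have e2 := hcomm !![1, 0; 1, 1] (by simp)
  rw [Units.val_mul, Units.val_mul, hX] at e1 e2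
  have e3 := congrFun (congrFun e1 0) 0
  have e4 := congrFun (congrFun e1 0) 1
  have e5 := congrFun (congrFun e2 0) 0
  simp [Matrix.nonsingInvUnit, Matrix.mul_apply, Fin.sum_univ_two, hp0] at e3 e4 e5
  refine LinearMap.ext fun n => congrArg Φ (latticeModP_eq_of_commCoord ι hX ?_ ?_ ?_ n)
  · rw [mul_left_cancel₀ hp0 (show (p : WittVector p k) * X 0 0 = p * X 1 1 by linear_combination -e4)]
  · rw [e5, WittVector.zero_coeff]
  · rw [e3, WittVector.zero_coeff]

/-- The lattice modulo `p` is killed by the square of the augmentation ideal of `K_1`, since `K_1`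
acts trivially on the kernel of `R / p → P / p`. -/
theorem latticeModP_sub_mem {g g' : K p k} (hg : g ∈ congruenceSubgroup p k 1)
    (hg' : g' ∈ congruenceSubgroup p k 1) (n : F ⊗[WittVector p F] lattice ι) :
    latticeModP ι g (latticeModP ι g' n - n) = latticeModP ι g' n - n := by
  obtain ⟨X, hX⟩ := mem_congruenceSubgroup.1 hg
  obtain ⟨X', hX'⟩ := mem_congruenceSubgroup.1 hg'
  rw [pow_one] at hX hX'
  rw [latticeModP_apply_eq ι hX', add_sub_cancel_left, latticeModP_inclMod ι hX]

variable [Module.Finite (WittVector p F) P]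

theorem finiteDimensional_latticeModP [Finite (k →+* F)] :
    FiniteDimensional F (F ⊗[WittVector p F] lattice ι) := by
  obtain ⟨s, hs⟩ := exists_linear_section (projFst_surjective ι)
  refine Module.Finite.of_surjective ((inclMod ι).coprod s) fun n => ?_
  obtain ⟨w, hw⟩ := exists_inclMod_eq ι (n := n - s (projFst ι n)) (by rw [map_sub, hs, sub_self])
  refine ⟨(w, projFst ι n), ?_⟩
  rw [LinearMap.coprod_apply, hw, sub_add_cancel]

/-- The dimension of `R / p`, an extension of `P / p` by `3 f` copies of `P / p`. -/
theorem finrank_latticeModP [Fintype (k →+* F)]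
    (hP : ∀ x : P, (p : WittVector p F) • x = 0 → x = 0) :
    Module.finrank F (F ⊗[WittVector p F] lattice ι)
      = (1 + Fintype.card (Fin 3 × (k →+* F))) * Module.finrank F (F ⊗[WittVector p F] P) := by
  have := finiteDimensional_latticeModP ι
  have hker : LinearMap.ker (projFst ι) = LinearMap.range (inclMod ι) := by
    refine le_antisymm (fun n hn => exists_inclMod_eq ι hn) ?_
    rintro _ ⟨w, rfl⟩
    exact projFst_inclMod ι w
  rw [← LinearMap.finrank_range_add_finrank_ker (projFst ι), hker,
    LinearMap.finrank_range_of_inj (inclMod_injective ι hP),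
    LinearMap.range_eq_top.2 (projFst_surjective ι), finrank_top, Module.finrank_pi_fintype]
  simp only [Module.finrank_pi_fintype, Finset.sum_const, Finset.card_univ, Fintype.card_fin,
    Fintype.card_prod, smul_eq_mul]
  ring

end Lattice

variable {p : ℕ} [Fact p.Prime] {k : Type*} {F : Type u} [Field k] [Field F] [Fintype (k →+* F)]
  [DecidableEq (k →+* F)] [CharP k p] [CharP F p] [Fintype k] [Finite F] [Nonempty (k →+* F)]
  {P : Type*} [AddCommGroup P] [Module (WittVector p F) P]
  [Module.Finite (WittVector p F) P]
  {ρ : Representation (WittVector p F) (GL (Fin 2) k) P}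
  {lam : (k →+* F) → ℤ × ℤ} {π : Representation.IntertwiningMap (baseChangeRep F ρ) (serreWeight lam)}
  {ι : GluingMaps ρ} {J : Type u} [AddCommGroup J] [Module F J] {ρJ : Representation F (K p k) J}
  {i : Representation.IntertwiningMap (serreWeightK p lam).dual ρJ}

/-- The dual of `R / p` embeds into the injective envelope of `σ^∨`: the inclusion of `σ^∨` extends
to it by injectivity, and the extension is injective because the cosocle of `R / p` is `σ`. -/
theorem exists_injective_dual_latticeModP (hlam : IsDeep p 2 lam) (hπ : IsProjectiveCover π)
    (hι : ∀ τ, Function.Injective (ι τ))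
    (hi : IsInjectiveEnvelope (congruenceSubgroup p k) (Z₁ p k) i) :
    ∃ h : Representation.IntertwiningMap (latticeModP ι).dual ρJ, Function.Injective h := by
  have := finiteDimensional_latticeModP ι
  have hq := toSerreWeight_surjective (ι := ι) hπ
  have : FiniteDimensional F (SerreWeightSpace lam) :=
    Module.Finite.of_surjective (toSerreWeight π ι).toLinearMap hq
  have hred : ∀ g ∈ congruenceSubgroup p k 1, ∀ Ψ, (serreWeightK p lam).dual g Ψ = Ψ := by
    intro g hg Ψ
    refine LinearMap.ext fun w => ?_
    change Ψ (serreWeight lam (reduction p k g⁻¹) w) = Ψ w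
    rw [map_inv, mem_congruenceSubgroup_one_iff_reduction.1 hg, inv_one, map_one]
    rfl
  let f : Representation.IntertwiningMap (serreWeightK p lam).dual (latticeModP ι).dual :=
    ⟨(toSerreWeight π ι).toLinearMap.dualMap, fun g => LinearMap.ext fun Ψ => LinearMap.ext fun n => by
      have h1 := DFunLike.congr_fun ((toSerreWeight π ι).isIntertwining' g⁻¹) n
      exact (congrArg Ψ h1).symm⟩
  have hf : Function.Injective f := LinearMap.dualMap_injective_of_surjective hq
  have : FiniteDimensional F (Module.Dual F (SerreWeightSpace lam)) :=
    FiniteDimensional.of_injective f.toLinearMap hf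
  obtain ⟨h, hh⟩ := hi.extend_finite (fun Ψ => ⟨1, fun g hg => hred g hg Ψ⟩)
    (fun g hg Ψ => hred g hg.2 Ψ) (isSmooth_dual_latticeModP ι) (isTrivialOn_dual_latticeModP ι) hf i
  refine ⟨h, injective_of_comp_dual (W := SerreWeightSpace lam) (q := (toSerreWeight π ι).toLinearMap)
    (fun N hN hs => eq_top_of_serreWeight hlam hπ hι hN hs) fun ψ hψ => hi.injective ?_⟩
  rw [map_zero, ← hh]
  exact hψ

/-- The comparison of `R / p` with `J^∨ / 𝔪² J^∨`. The dual of `R / p` embeds into the vectors of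
`J` killed by `𝔪²`, a space of dimension at most `(1 + 3 f) dim J^(K_1)`. Since `dim J^(K_1) ≤ dim P
/ p`, this is at most the dimension of `R / p`, so that the embedding is onto. -/
theorem nonempty_latticeModP_equiv (hlam : IsDeep p 2 lam) (hπ : IsProjectiveCover π)
    (hproj : Module.Projective (MonoidAlgebra (WittVector p F) (GL (Fin 2) k)) ρ.asModule)
    (hι : ∀ τ, Function.Injective (ι τ))
    (hi : IsInjectiveEnvelope (congruenceSubgroup p k) (Z₁ p k) i) :
    Nonempty ((latticeModP ι).Equiv
      (dualModSq (congruenceSubgroup_antitone p k) (congruenceSubgroup p k 1) hi.smooth)) := by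
  have hp2 : p ≠ 2 := fun h => by
    obtain ⟨τ⟩ := (inferInstance : Nonempty (k →+* F))
    have := hlam.lowWeight p τ
    omega
  have := finiteDimensional_latticeModP ι
  obtain ⟨h, hinj⟩ := exists_injective_dual_latticeModP hlam hπ hι hi
  obtain ⟨s, hs, hgen⟩ := exists_generators (p := p) (k := k) hp2 (F := F)
  obtain ⟨L, hL⟩ := exists_injective_fixedBy_ker (H := congruenceSubgroup p k 1) reduction_surjective
    hπ.projective hπ.surjective hi.injective hi.essential
    fun g => mem_congruenceSubgroup_one_iff_reduction
  have := FiniteDimensional.of_injective L hL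
  obtain ⟨hfd, hle⟩ := finrank_fixedSq_le hi.smooth hi.trivialOn hs hgen
  have hL' := LinearMap.finrank_le_finrank_of_injective hL
  rw [Subspace.dual_finrank_eq] at hL'
  have heq : ∀ g Φ, h ((latticeModP ι).dual g Φ) = ρJ g (h Φ) := fun g Φ =>
    DFunLike.congr_fun (h.isIntertwining' g) Φ
  have hrange : LinearMap.range h.toLinearMap ≤ fixedSq ρJ (congruenceSubgroup p k 1) := by
    rintro _ ⟨Φ, rfl⟩ g hg g' hg'
    change ρJ g' (ρJ g (h Φ) - h Φ) = ρJ g (h Φ) - h Φ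
    rw [← heq, ← map_sub, ← heq]
    congr 1
    refine LinearMap.ext fun n => ?_
    have h1 := congrArg Φ (latticeModP_sub_mem ι (inv_mem hg) (inv_mem hg') n)
    rw [map_sub, map_sub, map_sub] at h1
    change Φ (latticeModP ι g⁻¹ (latticeModP ι g'⁻¹ n)) - Φ (latticeModP ι g'⁻¹ n)
      = Φ (latticeModP ι g⁻¹ n) - Φ n
    linear_combination h1
  have hfin : Module.finrank F (LinearMap.range h.toLinearMap)
      = Module.finrank F (F ⊗[WittVector p F] lattice ι) := by
    rw [LinearMap.finrank_range_of_inj hinj, Subspace.dual_finrank_eq]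
  have hrange' : LinearMap.range h.toLinearMap = fixedSq ρJ (congruenceSubgroup p k 1) := by
    refine Submodule.eq_of_le_of_finrank_le hrange ?_
    rw [hfin, finrank_latticeModP ι (torsionFree_of_projective hproj)]
    exact hle.trans (Nat.mul_le_mul_left _ hL')
  refine nonempty_equiv_dualModSq (congruenceSubgroup_antitone p k) hi.smooth hinj ?_
  rw [hrange']
  exact augmentationMul_augmentationMul_top _ hi.smooth hi.trivialOn hs hgen

end Comparison

end

end LatticeGL2

open LatticeGL2 in
theorem mainTheorem11 (p : ℕ) [Fact p.Prime]
    (k : Type*) [Field k] [Finite k] [CharP k p]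
    (F : Type u) [Field F] [Finite F] [CharP F p] (hkF : Nonempty (k →+* F))
    (lam : (k →+* F) → ℤ × ℤ) (hlam : IsDeep p 2 lam)
    {P : Type*} [AddCommGroup P] [Module (WittVector p F) P]
    (ρP : Representation (WittVector p F) (GL (Fin 2) k) P)
    (hfin : Module.Finite (WittVector p F) P)
    (hproj : Module.Projective (MonoidAlgebra (WittVector p F) (GL (Fin 2) k)) ρP.asModule)
    (π : Representation.IntertwiningMap (baseChangeRep F ρP) (serreWeight lam))
    (hπ : IsProjectiveCover π)
    {J : Type u} [AddCommGroup J] [Module F J] (ρJ : Representation F (K p k) J)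
    (i : Representation.IntertwiningMap
      (serreWeightK p lam).dual ρJ)
    (hi : IsInjectiveEnvelope (congruenceSubgroup p k) (Z₁ p k) i) :
    (∃ ι : GluingMaps ρP, ∀ τ, Function.Injective (ι τ)) ∧
    ∀ ι : GluingMaps ρP, (∀ τ, Function.Injective (ι τ)) →
      Nonempty (Cosocle (latticeModP ι) ≃ₗ[MonoidAlgebra F (K p k)]
        (serreWeightK p lam).asModule) ∧
      Nonempty ((latticeModP ι).Equiv
        (dualModSq (congruenceSubgroup_antitone p k) (congruenceSubgroup p k 1) hi.smooth)) := by
  classical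
  have := Fintype.ofFinite k
  have : Finite (k →+* F) := Finite.of_injective (fun f : k →+* F => (f : k → F))
    DFunLike.coe_injective
  have := Fintype.ofFinite (k →+* F)
  exact ⟨exists_gluingMaps hlam hπ, fun ι hι =>
    ⟨nonempty_cosocle_latticeModP_equiv hlam hπ hι, nonempty_latticeModP_equiv hlam hπ hproj hι hi⟩⟩
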